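/- **Setting.** Let $A$ be an integral domain which is a $\mathbb C$-algebra, $S=\operatorname{Spec}A$, let $X\to S$ be a separated smooth family of curves and $\Sigma=(\sigma_i)_{i\in I}$ a finite nonempty family of sections. Let $\mathcal J=\prod_i\ker(\mathcal O_X\to\sigma_{i*}\mathcal O_S)$ and $R=\mathcal O_{\overline\Sigma}(S)=\varprojlim_n\Gamma(\mathcal O_X/\mathcal J^n)$. Assume $\Sigma$ is well covered, and choose a coordinate $t\in R$: for some $a_i\in A$, with $f(x)=\prod_{i\in I}(x-a_i)$, the map $x\mapsto t$ induces isomorphisms $A[x]/(f^n)\simeq\Gamma(\mathcal O_X/\mathcal J^n)$ for all $n$. Put $\varphi=f(t)$ and $K=\mathcal O_{\overline\Sigma^*}(S)=R[\varphi^{-1}]$, with the topology in which the $\varphi^nR$ are a basis of neighbourhoods of $0$; $\partial_t$ is the continuous $A$-linear derivation with $\partial_t t=1$ and $\operatorname{Res}_\Sigma$ is the residue along $\Sigma$, so that $\operatorname{Res}_\Sigma(P(t)\varphi^{-m}dt)$ is the coefficient of $x^{m|I|-1}$ in $P$ if $\deg P<m|I|$, and $\operatorname{Res}_\Sigma$ vanishes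 on $R\,dt$. Let $\mathfrak g$ be a finite dimensional complex Lie algebra and $\kappa$ a symmetric invariant bilinear form on it. Let $\hat{\mathfrak g}_{\Sigma}=(\mathfrak g\otimes_{\mathbb C}K)\oplus A\mathbf 1$ with $\mathbf 1$ central and $[x\otimes k,y\otimes l]=[x,y]\otimes kl+\kappa(x,y)\operatorname{Res}_\Sigma(l\,dk)\mathbf 1$, let $\mathcal U^1$ be the quotient of its enveloping algebra over $A$ by $\mathbf 1-1$, $\mathcal U_n\subset\mathcal U^1$ the left ideal generated by $\mathfrak g\otimes\varphi^nR$, and $\mathcal U=\varprojlim_n\mathcal U^1/\mathcal U_n$. A *field* is a continuous $A$-linear map $K\to\mathcal U$; $R$ and $\partial_t$ act on fields on the right by precomposition. The canonical field of $x\in\mathfrak g$ is $k\mapsto x\otimes k$ and the unit field is $k\mapsto\operatorname{Res}_\Sigma(k\,dt)$. The chiral product $\mu(X\boxtimes Y)$ is the commutator, $k\otimes l\mapsto X(k)Y(l)-Y(l)X(k)$, extended to poles along the diagonal by expanding negative powers of $t\otimes1-1\otimes t$ with the second variable small in the first term and with the first variable small in the second term; and $(X_{(n)}Y)(g)=\mu\big((t\otimes1-1\otimes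 t)^nX\boxtimes Y\big)(1\otimes g)$ for $n\in\mathbb Z$. Let $\mathcal V(0)$ be the $R$-span of the unit field and the canonical fields and $\mathcal V(n+1)=\mathcal V(n)+\mathcal V(n)\partial_t+\langle X_{(-1)}Y: X,Y\in\mathcal V(n)\rangle R$. The chiral algebra $\mathcal V^\kappa_\Sigma(\mathfrak g)(S)$ is $\bigcup_n\mathcal V(n)=\varinjlim\mathcal V(n)$, with the colimit topology (in linearly topologized $A$-modules), where $\mathcal V(n)$ carries the topology with neighbourhoods of $0$ given by $\{X: X(\varphi^{-j}R)\subset W\}$, $j\ge0$, $W$ a neighbourhood of $0$ in $\mathcal U$. Its center $\zeta^\kappa_\Sigma(\mathfrak g)(S)$ consists of the $z$ with $\mu(z\boxtimes y)=0$ on $K\otimes K$ for all $y\in\mathcal V^\kappa_\Sigma(\mathfrak g)(S)$, i.e. $[z(k),y(l)]=0$ for all $k,l\in K$, with the subspace topology. Let $V^\kappa(\mathfrak g)$ be the universal affine vertex algebra of level $\kappa$ and $\zeta^\kappa(\mathfrak g)=\{v: w_{(n)}v=0\ \ \forall w\in V^\kappa(\mathfrak g),\,n\ge0\}$ its center. For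 a complex vector space $V$ with the discrete topology let $V\overleftarrow\otimes R$ be $V\otimes_{\mathbb C}R$ with the linear topology whose open $A$-submodules $Q$ are those such that for every $v\in V$ there is $n$ with $v\otimes\varphi^nR\subset Q$. **Statement.** There is a unique $R$-linear map $\mathcal Y_{\Sigma,t}:V^\kappa(\mathfrak g)\otimes_{\mathbb C}R\to\mathcal V^\kappa_\Sigma(\mathfrak g)(S)$ that sends $|0\rangle\otimes 1$ to the unit field and $x_{(-1)}|0\rangle\otimes 1$ to the canonical field of $x$ for all $x\in\mathfrak g$, and satisfies $\mathcal Y_{\Sigma,t}(v_{(n)}w\otimes 1)=\mathcal Y_{\Sigma,t}(v\otimes 1)_{(n)}\mathcal Y_{\Sigma,t}(w\otimes 1)$ for all $v,w\in V^\kappa(\mathfrak g)$ and $n\in\mathbb Z$. It maps $\zeta^\kappa(\mathfrak g)\otimes_{\mathbb C}R$ into $\zeta^\kappa_\Sigma(\mathfrak g)(S)$, and this restriction $$\mathcal Y_{\Sigma,t}:\ \zeta^\kappa(\mathfrak g)\,\overleftarrow\otimes\,\mathcal O_{\overline\Sigma}(S)\longrightarrow\zeta^\kappa_\Sigma(\mathfrak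 g)(S)$$ is an isomorphism of topological modules (linear, bijective and a homeomorphism). -/

import Mathlib

open scoped TensorProduct Polynomial
universe u v w
namespace ChiralCenter
open Polynomial Filter Topology

section Coordinate
variable {A R : Type u} [CommRing A] [CommRing R] [Algebra A R]

theorem pow_dvd_derivative {f : A[X]} {n : ℕ} {P : A[X]} (hP : f ^ (n + 1) ∣ P) :
    f ^ n ∣ derivative P := by
  obtain ⟨Q, rfl⟩ := hP
  rw [derivative_mul, derivative_pow_succ]
  refine dvd_add ?_ ?_
  · exact ⟨C ((n : A) + 1) * derivative f * Q, by ring⟩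
  · exact ⟨f * derivative Q, by ring⟩

/-- `t` is a coordinate: `R`, with its decreasing family of ideals `I`, is
`lim_n A[x] / (f ^ n)` through `x ↦ t`. -/
structure IsFormalCoordinate (I : ℕ → Ideal R) (t : R) (f : A[X]) : Prop where
  monic : f.Monic
  antitone : Antitone I
  aeval_mem_iff : ∀ n (P : A[X]), aeval t P ∈ I n ↔ f ^ n ∣ P
  exists_sub_mem : ∀ n r, ∃ P : A[X], r - aeval t P ∈ I n
  separated : ∀ r, (∀ n, r ∈ I n) → r = 0
  complete : ∀ s : ℕ → R, (∀ n, s (n + 1) - s n ∈ I n) → ∃ r, ∀ n, r - s n ∈ I n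

namespace IsFormalCoordinate
variable {I : ℕ → Ideal R} {t : R} {f : A[X]} (h : IsFormalCoordinate I t f)

theorem exists_deriv (h : IsFormalCoordinate I t f) (r : R) :
    ∃ d : R, ∀ n (P : A[X]), r - aeval t P ∈ I (n + 1) → d - aeval t (derivative P) ∈ I n := by
  have key : ∀ n (P Q : A[X]), r - aeval t P ∈ I (n + 1) → r - aeval t Q ∈ I (n + 1) →
      aeval t (derivative P) - aeval t (derivative Q) ∈ I n := by
    intro n P Q hP hQ
    have h1 : aeval t (P - Q) ∈ I (n + 1) := by
      have := (I (n + 1)).sub_mem hQ hP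
      simpa using this
    rw [← map_sub, ← derivative_sub]
    exact (h.aeval_mem_iff _ _).2 (pow_dvd_derivative ((h.aeval_mem_iff _ _).1 h1))
  choose p hp using fun n => h.exists_sub_mem n r
  obtain ⟨d, hd⟩ := h.complete (fun n => aeval t (derivative (p (n + 1))))
    (fun n => key n _ _ (h.antitone (Nat.le_succ _) (hp (n + 2))) (hp (n + 1)))
  refine ⟨d, fun n P hP => ?_⟩
  have := (I n).add_mem (hd n) (key n _ P (hp (n + 1)) hP)
  simpa using this

/-- `d r / d t`, computed on polynomial representatives modulo `I (n + 1)`. -/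
noncomputable def derivFun (r : R) : R := (h.exists_deriv r).choose

theorem derivFun_spec (r : R) (n : ℕ) (P : A[X]) (hP : r - aeval t P ∈ I (n + 1)) :
    h.derivFun r - aeval t (derivative P) ∈ I n := (h.exists_deriv r).choose_spec n P hP

theorem derivFun_eq (r d : R)
    (hd : ∀ n, ∃ P : A[X], r - aeval t P ∈ I (n + 1) ∧ d - aeval t (derivative P) ∈ I n) :
    h.derivFun r = d := by
  refine sub_eq_zero.1 (h.separated _ fun n => ?_)
  obtain ⟨P, h1, h2⟩ := hd n
  have := (I n).sub_mem (h.derivFun_spec r n P h1) h2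
  simpa using this

/-- The derivation `∂_t` of `R`. -/
noncomputable def deriv : Derivation A R R where
  toFun := h.derivFun
  map_add' r s := h.derivFun_eq _ _ fun n => by
    obtain ⟨P, hP⟩ := h.exists_sub_mem (n + 1) r
    obtain ⟨Q, hQ⟩ := h.exists_sub_mem (n + 1) s
    refine ⟨P + Q, ?_, ?_⟩
    · convert (I (n + 1)).add_mem hP hQ using 1; simp; ring
    · convert (I n).add_mem (h.derivFun_spec r n P hP) (h.derivFun_spec s n Q hQ) using 1
      simp; ring
  map_smul' a r := h.derivFun_eq _ _ fun n => by
    obtain ⟨P, hP⟩ := h.exists_sub_mem (n + 1) r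
    refine ⟨a • P, ?_, ?_⟩
    · convert (I (n + 1)).mul_mem_left (algebraMap A R a) hP using 1
      simp [Algebra.smul_def, mul_sub]
    · convert (I n).mul_mem_left (algebraMap A R a) (h.derivFun_spec r n P hP) using 1
      simp [Algebra.smul_def, mul_sub]
  map_one_eq_zero' := h.derivFun_eq _ _ fun n => ⟨1, by simp, by simp⟩
  leibniz' r s := h.derivFun_eq _ _ fun n => by
    obtain ⟨P, hP⟩ := h.exists_sub_mem (n + 1) r
    obtain ⟨Q, hQ⟩ := h.exists_sub_mem (n + 1) s
    have hP' := h.derivFun_spec r n P hP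
    have hQ' := h.derivFun_spec s n Q hQ
    have hPn := h.antitone (Nat.le_succ n) hP
    have hQn := h.antitone (Nat.le_succ n) hQ
    refine ⟨P * Q, ?_, ?_⟩
    · have := (I (n + 1)).add_mem ((I (n + 1)).mul_mem_left s hP)
        ((I (n + 1)).mul_mem_left (aeval t P) hQ)
      convert this using 1; simp; ring
    · have := (I n).add_mem
        ((I n).add_mem ((I n).mul_mem_left r hQ') ((I n).mul_mem_left (aeval t (derivative Q)) hPn))
        ((I n).add_mem ((I n).mul_mem_left s hP') ((I n).mul_mem_left (aeval t (derivative P)) hQn))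
      convert this using 1; simp [derivative_mul]; ring

theorem pow_dvd_of_mul (h : IsFormalCoordinate I t f) {m d : ℕ} {P : A[X]} (hP : f ^ (m + d) ∣ f ^ d * P) : f ^ m ∣ P := by
  obtain ⟨Q, hQ⟩ := hP
  refine ⟨Q, ?_⟩
  have : f ^ d * (P - f ^ m * Q) = 0 := by rw [mul_sub, hQ]; ring
  exact sub_eq_zero.1 (((h.monic.pow d).mul_right_eq_zero_iff).1 this)

theorem mul_pow_mem (h : IsFormalCoordinate I t f) {m : ℕ} (d : ℕ) {r : R} (hr : r ∈ I m) : aeval t f ^ d * r ∈ I (m + d) := by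
  obtain ⟨P, hP⟩ := h.exists_sub_mem (m + d) r
  have h1 : aeval t P ∈ I m := by
    have := (I m).sub_mem hr (h.antitone (Nat.le_add_right m d) hP)
    simpa using this
  obtain ⟨Q, rfl⟩ := (h.aeval_mem_iff _ _).1 h1
  have h2 : aeval t (f ^ d * (f ^ m * Q)) ∈ I (m + d) :=
    (h.aeval_mem_iff _ _).2 ⟨Q, by ring⟩
  have := (I (m + d)).add_mem h2 ((I (m + d)).mul_mem_left (aeval t f ^ d) hP)
  convert this using 1; simp; ring

theorem mem_of_mul_pow_mem (h : IsFormalCoordinate I t f) {m d : ℕ} {r : R} (hr : aeval t f ^ d * r ∈ I (m + d)) : r ∈ I m := by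
  obtain ⟨P, hP⟩ := h.exists_sub_mem (m + d) r
  have h1 : aeval t (f ^ d * P) ∈ I (m + d) := by
    have := (I (m + d)).sub_mem hr ((I (m + d)).mul_mem_left (aeval t f ^ d) hP)
    convert this using 1; simp; ring
  have h2 := (h.aeval_mem_iff _ _).2 (h.pow_dvd_of_mul ((h.aeval_mem_iff _ _).1 h1))
  have := (I m).add_mem h2 (h.antitone (Nat.le_add_right m d) hP)
  simpa using this

theorem uniformizer_mem_nonZeroDivisors (h : IsFormalCoordinate I t f) : aeval t f ∈ nonZeroDivisors R := by
  refine mem_nonZeroDivisors_iff_right.2 fun r hr => h.separated _ fun n =>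
    h.mem_of_mul_pow_mem (d := 1) ?_
  rw [pow_one, mul_comm, hr]
  exact zero_mem _

theorem modByMonic_coeff (h : IsFormalCoordinate I t f) (m d : ℕ) (P : A[X]) :
    ((f ^ d * P) %ₘ f ^ (m + d)).coeff ((m + d) * f.natDegree - 1) =
      (P %ₘ f ^ m).coeff (m * f.natDegree - 1) := by
  nontriviality A
  have hm := h.monic.pow m
  have e : (f ^ d * P) %ₘ f ^ (m + d) = f ^ d * (P %ₘ f ^ m) := by
    refine (div_modByMonic_unique (P /ₘ f ^ m) _ (h.monic.pow _) ⟨?_, ?_⟩).2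
    · conv_rhs => rw [← modByMonic_add_div P (f ^ m)]
      ring
    · rw [pow_add, mul_comm (f ^ d), (h.monic.pow d).degree_mul, (h.monic.pow d).degree_mul]
      refine WithBot.add_lt_add_right ?_ (degree_modByMonic_lt _ hm)
      exact degree_ne_bot.2 (h.monic.pow d).ne_zero
  rw [e]
  rcases Nat.eq_zero_or_pos (m * f.natDegree) with h0 | hpos
  · have h1 : f ^ m = 1 := by
      refine eq_one_of_monic_natDegree_zero hm ?_
      rw [h.monic.natDegree_pow, h0]
    simp [h1]
  · have h2 : (P %ₘ f ^ m).natDegree ≤ m * f.natDegree - 1 := by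
      have := natDegree_modByMonic_lt P hm (fun h1 => by
        have := h.monic.natDegree_pow m
        rw [h1, natDegree_one] at this
        omega)
      rw [h.monic.natDegree_pow] at this
      omega
    have h3 : (m + d) * f.natDegree - 1 = d * f.natDegree + (m * f.natDegree - 1) := by
      rw [add_mul]; omega
    rw [h3, coeff_mul_add_eq_of_natDegree_le (h.monic.natDegree_pow d).le h2]
    have := (h.monic.pow d).coeff_natDegree
    rw [h.monic.natDegree_pow] at this
    rw [this, one_mul]

/-- Functions on the punctured formal neighbourhood: the uniformizer `f (t)` is inverted. -/
abbrev Punctured (_ : IsFormalCoordinate I t f) : Type u := Localization.Away (aeval t f)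

theorem algebraMap_injective : Function.Injective (algebraMap R h.Punctured) :=
  IsLocalization.injective _ (Submonoid.powers_le.2 h.uniformizer_mem_nonZeroDivisors)

/-- `c` is the residue of `k dt`: if `f (t) ^ m * k` is congruent to `P (t)` modulo the `m`-th
ideal and `deg P < m * deg f`, then `c` is the coefficient of `x ^ (m * deg f - 1)` in `P`,
that is, the residue at infinity, up to sign, of `P / f ^ m dx`. -/
def IsResidue (k : h.Punctured) (c : A) : Prop :=
  ∃ (m : ℕ) (r : R) (P : A[X]), algebraMap R h.Punctured r =
      algebraMap R h.Punctured (aeval t f) ^ m * k ∧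
    r - aeval t P ∈ I m ∧ c = (P %ₘ f ^ m).coeff (m * f.natDegree - 1)

theorem exists_isResidue (k : h.Punctured) : ∃ c, h.IsResidue k c := by
  obtain ⟨m, r, hr⟩ := IsLocalization.Away.surj (aeval t f) k
  obtain ⟨P, hP⟩ := h.exists_sub_mem m r
  exact ⟨_, m, r, P, by rw [← hr, mul_comm], hP, rfl⟩

theorem isResidue_lift {k : h.Punctured} {m : ℕ} {r : R} {P : A[X]} (d : ℕ)
    (h1 : algebraMap R h.Punctured r = algebraMap R h.Punctured (aeval t f) ^ m * k)
    (h2 : r - aeval t P ∈ I m) :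
    algebraMap R h.Punctured (aeval t f ^ d * r) =
      algebraMap R h.Punctured (aeval t f) ^ (m + d) * k ∧
    aeval t f ^ d * r - aeval t (f ^ d * P) ∈ I (m + d) := by
  refine ⟨by rw [map_mul, h1, map_pow]; ring, ?_⟩
  convert h.mul_pow_mem d h2 using 1
  simp; ring

theorem modByMonic_eq (h : IsFormalCoordinate I t f) {m : ℕ} {P Q : A[X]} (hPQ : aeval t (P - Q) ∈ I m) :
    P %ₘ f ^ m = Q %ₘ f ^ m := by
  rw [h.aeval_mem_iff] at hPQ
  rw [← sub_eq_zero, ← sub_modByMonic, modByMonic_eq_zero_iff_dvd (h.monic.pow m)]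
  exact hPQ

/-- A common denominator for two elements. -/
theorem exists_common {k k' : h.Punctured} {c c' : A} (hk : h.IsResidue k c)
    (hk' : h.IsResidue k' c') : ∃ (m : ℕ) (r r' : R) (P P' : A[X]),
    (algebraMap R h.Punctured r = algebraMap R h.Punctured (aeval t f) ^ m * k ∧
      r - aeval t P ∈ I m ∧ c = (P %ₘ f ^ m).coeff (m * f.natDegree - 1)) ∧
    (algebraMap R h.Punctured r' = algebraMap R h.Punctured (aeval t f) ^ m * k' ∧
      r' - aeval t P' ∈ I m ∧ c' = (P' %ₘ f ^ m).coeff (m * f.natDegree - 1)) := by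
  obtain ⟨m, r, P, h1, h2, rfl⟩ := hk
  obtain ⟨m', r', P', h1', h2', rfl⟩ := hk'
  have a := h.isResidue_lift m' h1 h2
  have b := h.isResidue_lift m h1' h2'
  rw [add_comm m' m] at b
  refine ⟨m + m', _, _, _, _, ⟨a.1, a.2, (h.modByMonic_coeff m m' P).symm⟩, b.1, b.2, ?_⟩
  rw [← h.modByMonic_coeff m' m P', add_comm m' m]

theorem isResidue_unique {k : h.Punctured} {c c' : A} (hk : h.IsResidue k c)
    (hk' : h.IsResidue k c') : c = c' := by
  obtain ⟨m, r, r', P, P', ⟨h1, h2, rfl⟩, h1', h2', rfl⟩ := h.exists_common hk hk'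
  obtain rfl := h.algebraMap_injective (h1.trans h1'.symm)
  rw [h.modByMonic_eq]
  have := (I m).sub_mem h2' h2
  simpa using this

/-- The residue `k ↦ Res (k dt)`. -/
noncomputable def res : h.Punctured →ₗ[A] A where
  toFun k := (h.exists_isResidue k).choose
  map_add' k k' := by
    refine h.isResidue_unique (h.exists_isResidue _).choose_spec ?_
    obtain ⟨m, r, r', P, P', ⟨h1, h2, e⟩, h1', h2', e'⟩ :=
      h.exists_common (h.exists_isResidue k).choose_spec (h.exists_isResidue k').choose_spec
    refine ⟨m, r + r', P + P', by rw [map_add, h1, h1', mul_add], ?_, ?_⟩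
    · convert (I m).add_mem h2 h2' using 1; simp; ring
    · rw [e, e', add_modByMonic, coeff_add]
  map_smul' a k := by
    refine h.isResidue_unique (h.exists_isResidue _).choose_spec ?_
    obtain ⟨m, r, P, h1, h2, e⟩ := (h.exists_isResidue k).choose_spec
    refine ⟨m, a • r, a • P, ?_, ?_, ?_⟩
    · rw [mul_smul_comm, ← h1, Algebra.smul_def, Algebra.smul_def, map_mul,
        IsScalarTower.algebraMap_apply A R h.Punctured]
    · convert (I m).mul_mem_left (algebraMap A R a) h2 using 1
      simp [Algebra.smul_def, mul_sub]
    · rw [smul_modByMonic, coeff_smul, e]; rfl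

theorem res_algebraMap (r : R) : h.res (algebraMap R h.Punctured r) = 0 := by
  refine h.isResidue_unique (h.exists_isResidue _).choose_spec ⟨0, r, 0, by simp, ?_, by simp⟩
  have : (1 : R) ∈ I 0 := by simpa using (h.aeval_mem_iff 0 1).2 (by simp)
  simp [(Ideal.eq_top_iff_one _).2 this]

/-- The image of the uniformizer `f (t)` in `K`. -/
noncomputable abbrev unif : h.Punctured := algebraMap R h.Punctured (aeval t f)

theorem exists_unif_pow_mul (k : h.Punctured) :
    ∃ (n : ℕ) (r : R), h.unif ^ n * k = algebraMap R _ r := by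
  obtain ⟨m, r, hr⟩ := IsLocalization.Away.surj (aeval t f) k
  exact ⟨m, r, by rw [← hr, mul_comm]⟩

/-- The derivation `∂_t` of the punctured ring, extending `∂_t` on `R`. -/
noncomputable def derivK : Derivation A h.Punctured h.Punctured :=
  haveI : Algebra.FormallyEtale R h.Punctured :=
    Algebra.FormallyEtale.of_isLocalization (Submonoid.powers (aeval t f))
  ((TensorProduct.AlgebraTensorModule.rid R h.Punctured h.Punctured).toLinearMap ∘ₗ
    (h.deriv.liftKaehlerDifferential.baseChange h.Punctured) ∘ₗ
    (KaehlerDifferential.tensorKaehlerEquivOfFormallyEtale A R h.Punctured).symm.toLinearMap).compDer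
      (KaehlerDifferential.D A h.Punctured)

theorem derivK_algebraMap (r : R) :
    h.derivK (algebraMap R h.Punctured r) = algebraMap R h.Punctured (h.deriv r) := by
  have : Algebra.FormallyEtale R h.Punctured :=
    Algebra.FormallyEtale.of_isLocalization (Submonoid.powers (aeval t f))
  have : (KaehlerDifferential.tensorKaehlerEquivOfFormallyEtale A R h.Punctured).symm
      (KaehlerDifferential.D A h.Punctured (algebraMap R h.Punctured r)) =
        1 ⊗ₜ KaehlerDifferential.D A R r := by
    rw [LinearEquiv.symm_apply_eq]
    simp
  simp [derivK, this, Algebra.smul_def]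

end IsFormalCoordinate
end Coordinate
section VertexAlgebra

variable {𝔤 : Type v} [LieRing 𝔤] [LieAlgebra ℂ 𝔤] (κ : LinearMap.BilinForm ℂ 𝔤)

/-- The commutation relations `[x t^m, y t^n] = [x, y] t^(m + n) + m δ_{m + n, 0} κ (x, y)` of the
affine algebra of `𝔤` over `ℂ[t, t⁻¹]`. -/
inductive AffineRel : TensorAlgebra ℂ (ℤ →₀ 𝔤) → TensorAlgebra ℂ (ℤ →₀ 𝔤) → Prop
  | comm (m n : ℤ) (x y : 𝔤) : AffineRel
      (TensorAlgebra.ι ℂ (.single m x) * TensorAlgebra.ι ℂ (.single n y))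
      (TensorAlgebra.ι ℂ (.single n y) * TensorAlgebra.ι ℂ (.single m x) +
        TensorAlgebra.ι ℂ (.single (m + n) ⁅x, y⁆) +
        algebraMap ℂ _ (if m + n = 0 then m * κ x y else 0))

/-- The enveloping algebra at level `κ` of the affine algebra of `𝔤`. -/
def AffineEnv : Type v := RingQuot (AffineRel κ)

noncomputable instance : Ring (AffineEnv κ) := inferInstanceAs (Ring (RingQuot (AffineRel κ)))
noncomputable instance : Algebra ℂ (AffineEnv κ) :=
  inferInstanceAs (Algebra ℂ (RingQuot (AffineRel κ)))

/-- `x t^n` as an element of the enveloping algebra. -/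
noncomputable def affineGen (x : 𝔤) (n : ℤ) : AffineEnv κ :=
  (RingQuot.mkAlgHom ℂ (AffineRel κ) (TensorAlgebra.ι ℂ (.single n x)) : RingQuot (AffineRel κ))

/-- The left ideal generated by `𝔤[t]`. -/
noncomputable def affineNonneg : Submodule (AffineEnv κ) (AffineEnv κ) :=
  Submodule.span _ {u | ∃ (x : 𝔤) (n : ℕ), u = affineGen κ x n}

/-- The universal affine vertex algebra `V^κ(𝔤)`: the vacuum module. -/
def AffineVertex : Type v := AffineEnv κ ⧸ affineNonneg κ

namespace AffineVertex

noncomputable instance : AddCommGroup (AffineVertex κ) :=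
  inferInstanceAs (AddCommGroup (AffineEnv κ ⧸ affineNonneg κ))
noncomputable instance : Module (AffineEnv κ) (AffineVertex κ) :=
  inferInstanceAs (Module (AffineEnv κ) (AffineEnv κ ⧸ affineNonneg κ))
noncomputable instance : Module ℂ (AffineVertex κ) :=
  inferInstanceAs (Module ℂ (AffineEnv κ ⧸ affineNonneg κ))
instance : IsScalarTower ℂ (AffineEnv κ) (AffineVertex κ) :=
  inferInstanceAs (IsScalarTower ℂ (AffineEnv κ) (AffineEnv κ ⧸ affineNonneg κ))

/-- The vacuum vector. -/
noncomputable def vacuum : AffineVertex κ := Submodule.Quotient.mk (p := affineNonneg κ) 1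

/-- The action of `x t^n`. -/
noncomputable def mode (x : 𝔤) (n : ℤ) : Module.End ℂ (AffineVertex κ) :=
  Algebra.lsmul ℂ ℂ (AffineVertex κ) (affineGen κ x n)

variable {κ}

/-- `IsVertexOp v B` says that `Y (v, z) = ∑ B n z^(-n-1)`, so that `B n w = v_(n) w`, for the
vertex algebra structure of `V^κ(𝔤)`: the field of the vacuum is the identity, and the field of
`x t^n v` is the `n`-th product of the current `∑ (x t^m) z^(-m-1)` with the field of `v`. -/
inductive IsVertexOp : AffineVertex κ → (ℤ → Module.End ℂ (AffineVertex κ)) → Prop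
  | vacuum : IsVertexOp (vacuum κ) fun n => if n = -1 then 1 else 0
  | add {v w B C} : IsVertexOp v B → IsVertexOp w C → IsVertexOp (v + w) (B + C)
  | smul (c : ℂ) {v B} : IsVertexOp v B → IsVertexOp (c • v) (c • B)
  | current (x : 𝔤) (n : ℤ) {v : AffineVertex κ} {B C : ℤ → Module.End ℂ (AffineVertex κ)} :
      IsVertexOp v B →
      (∀ m w, C m w = ∑ᶠ j : ℕ, ((-1 : ℂ) ^ j * (Ring.choose n j : ℤ)) •
        (mode κ x (n - j) (B (m + j) w) - (-1 : ℂ) ^ n • B (n + m - j) (mode κ x j w))) →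
      IsVertexOp (mode κ x n v) C

variable (κ)

/-- The centre of the vertex algebra: vectors `v` with `w_(n) v = 0` for all `w` and `n ≥ 0`. -/
noncomputable def center : Submodule ℂ (AffineVertex κ) where
  carrier := {v | ∀ w B, IsVertexOp w B → ∀ n : ℕ, B n v = 0}
  zero_mem' := fun _ _ _ _ => map_zero _
  add_mem' := fun hv hw u B hB n => by rw [map_add, hv u B hB, hw u B hB, add_zero]
  smul_mem' := fun c _ hv u B hB n => by
    rw [map_smul, hv u B hB, smul_zero]

end AffineVertex
end VertexAlgebra

section Topology

variable {A M : Type*} [CommRing A] [AddCommGroup M] [Module A M]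

/-- The translation invariant topology in which the submodules with property `P` form a basis of
neighbourhoods of `0`. -/
@[reducible] def linearTopology (P : Submodule A M → Prop) (top : P ⊤)
    (inf : ∀ Q Q', P Q → P Q' → P (Q ⊓ Q')) : TopologicalSpace M where
  IsOpen s := ∀ x ∈ s, ∃ Q, P Q ∧ ∀ y ∈ Q, x + y ∈ s
  isOpen_univ _ _ := ⟨⊤, top, fun _ _ => trivial⟩
  isOpen_inter s s' hs hs' x hx := by
    obtain ⟨Q, hQ, h⟩ := hs x hx.1
    obtain ⟨Q', hQ', h'⟩ := hs' x hx.2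
    exact ⟨Q ⊓ Q', inf Q Q' hQ hQ', fun y hy => ⟨h y hy.1, h' y hy.2⟩⟩
  isOpen_sUnion S hS x hx := by
    obtain ⟨s, hs, hxs⟩ := hx
    obtain ⟨Q, hQ, h⟩ := hS s hs x hxs
    exact ⟨Q, hQ, fun y hy => ⟨s, hs, h y hy⟩⟩

end Topology

section Enveloping

variable {A R : Type u} [CommRing A] [CommRing R] [Algebra A R] [Algebra ℂ A] [Algebra ℂ R]
  [IsScalarTower ℂ A R] {𝔤 : Type v} [LieRing 𝔤] [LieAlgebra ℂ 𝔤]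

namespace IsFormalCoordinate
variable {I : ℕ → Ideal R} {t : R} {f : A[X]} (h : IsFormalCoordinate I t f)
  (κ : LinearMap.BilinForm ℂ 𝔤)

/-- The commutation relations of the affine algebra `K ⊗ 𝔤 ⊕ A 𝟏`, with `𝟏` set equal to `1`:
`[k ⊗ x, l ⊗ y] = k l ⊗ [x, y] + κ (x, y) Res (l dk) 𝟏`. -/
inductive EnvRel : TensorAlgebra A (h.Punctured ⊗[ℂ] 𝔤) → TensorAlgebra A (h.Punctured ⊗[ℂ] 𝔤) →
    Prop
  | comm (k l : h.Punctured) (x y : 𝔤) : EnvRel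
      (TensorAlgebra.ι A (k ⊗ₜ x) * TensorAlgebra.ι A (l ⊗ₜ y))
      (TensorAlgebra.ι A (l ⊗ₜ y) * TensorAlgebra.ι A (k ⊗ₜ x) +
        TensorAlgebra.ι A ((k * l) ⊗ₜ ⁅x, y⁆) +
        algebraMap A _ (κ x y • h.res (l * h.derivK k)))

/-- The enveloping algebra of the affine algebra at level `κ`: the quotient by `𝟏 - 1` of the
universal enveloping `A`-algebra of `K ⊗ 𝔤 ⊕ A 𝟏`. -/
def Env : Type (max u v) := RingQuot (EnvRel h κ)

noncomputable instance : Ring (Env h κ) := inferInstanceAs (Ring (RingQuot (EnvRel h κ)))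
noncomputable instance : Algebra A (Env h κ) :=
  inferInstanceAs (Algebra A (RingQuot (EnvRel h κ)))

/-- The quotient map. -/
noncomputable def envMk : TensorAlgebra A (h.Punctured ⊗[ℂ] 𝔤) →ₐ[A] Env h κ :=
  RingQuot.mkAlgHom A (EnvRel h κ)

theorem envMk_surjective : Function.Surjective (envMk h κ) :=
  RingQuot.mkAlgHom_surjective A (EnvRel h κ)

theorem envMk_rel {a b : TensorAlgebra A (h.Punctured ⊗[ℂ] 𝔤)} (hab : EnvRel h κ a b) :
    envMk h κ a = envMk h κ b := RingQuot.mkAlgHom_rel A hab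

/-- The map `K ⊗ 𝔤 → Env`. -/
noncomputable def gen : h.Punctured ⊗[ℂ] 𝔤 →ₗ[A] Env h κ :=
  (envMk h κ).toLinearMap ∘ₗ TensorAlgebra.ι A

theorem gen_mul_gen (k l : h.Punctured) (x y : 𝔤) :
    gen h κ (k ⊗ₜ x) * gen h κ (l ⊗ₜ y) = gen h κ (l ⊗ₜ y) * gen h κ (k ⊗ₜ x) +
      gen h κ ((k * l) ⊗ₜ ⁅x, y⁆) + algebraMap A _ (κ x y • h.res (l * h.derivK k)) := by
  have := envMk_rel h κ (EnvRel.comm k l x y)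
  rw [map_mul, map_add, map_add, map_mul, AlgHom.commutes] at this
  exact this

/-- The left ideal generated by `f (t) ^ n R ⊗ 𝔤`. -/
noncomputable def envLevel (n : ℕ) : Ideal (Env h κ) :=
  Ideal.span {u | ∃ (r : R) (x : 𝔤), u = gen h κ ((h.unif ^ n * algebraMap R _ r) ⊗ₜ x)}

theorem envLevel_antitone : Antitone (envLevel h κ) := by
  intro n m hnm
  refine Ideal.span_le.2 ?_
  rintro _ ⟨r, x, rfl⟩
  refine Ideal.subset_span ⟨aeval t f ^ (m - n) * r, x, ?_⟩
  rw [map_mul, map_pow, ← mul_assoc, ← pow_add, Nat.add_sub_cancel' hnm]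

theorem gen_mul_mem (n : ℕ) (k : h.Punctured) (y : 𝔤) :
    ∃ m, ∀ u ∈ envLevel h κ m, u * gen h κ (k ⊗ₜ y) ∈ envLevel h κ n := by
  obtain ⟨j, s, hs⟩ := h.exists_unif_pow_mul k
  refine ⟨n + j + 1, fun u hu => ?_⟩
  induction hu using Submodule.span_induction with
  | zero => simp
  | add a b _ _ ha hb => rw [add_mul]; exact add_mem ha hb
  | smul a b _ hb => rw [smul_eq_mul, mul_assoc]; exact Ideal.mul_mem_left _ _ hb
  | mem u hu =>
    obtain ⟨r, x, rfl⟩ := hu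
    rw [gen_mul_gen]
    refine add_mem (add_mem (Ideal.mul_mem_left _ _ ?_) ?_) ?_
    · exact envLevel_antitone h κ (by omega : n ≤ n + j + 1) (Ideal.subset_span ⟨r, x, rfl⟩)
    · refine Ideal.subset_span ⟨aeval t f * r * s, ⁅x, y⁆, ?_⟩
      congr 2
      rw [map_mul, map_mul, ← hs]
      ring
    · have : k * h.derivK (h.unif ^ (n + j + 1) * algebraMap R _ r) =
          algebraMap R _ (s * (aeval t f ^ n * ((n + j + 1 : ℕ) * h.deriv (aeval t f) * r +
            aeval t f * h.deriv r))) := by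
        rw [← map_pow (algebraMap R h.Punctured), ← map_mul, derivK_algebraMap, map_mul _ s, ← hs,
          mul_comm _ k, mul_assoc k, ← map_pow (algebraMap R h.Punctured) _ j, ← map_mul]
        congr 2
        rw [Derivation.leibniz, Derivation.leibniz_pow]
        simp only [smul_eq_mul, nsmul_eq_mul, Nat.add_sub_cancel]
        ring
      rw [this, res_algebraMap, smul_zero, map_zero]
      exact zero_mem _

theorem mul_right_mem (v : Env h κ) (n : ℕ) :
    ∃ m, ∀ u ∈ envLevel h κ m, u * v ∈ envLevel h κ n := by
  obtain ⟨w, rfl⟩ := envMk_surjective h κ v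
  induction w using TensorAlgebra.induction generalizing n with
  | algebraMap a =>
    refine ⟨n, fun u hu => ?_⟩
    rw [AlgHom.commutes, ← Algebra.commutes]
    exact Ideal.mul_mem_left _ _ hu
  | ι z =>
    change ∃ m, ∀ u ∈ envLevel h κ m, u * gen h κ z ∈ envLevel h κ n
    induction z with
    | zero => exact ⟨0, fun u _ => by simp⟩
    | tmul k y => exact gen_mul_mem h κ n k y
    | add a b ha hb =>
      obtain ⟨m, hm⟩ := ha
      obtain ⟨m', hm'⟩ := hb
      refine ⟨max m m', fun u hu => ?_⟩
      rw [map_add, mul_add]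
      exact add_mem (hm u (envLevel_antitone h κ (le_max_left _ _) hu))
        (hm' u (envLevel_antitone h κ (le_max_right _ _) hu))
  | mul a b ha hb =>
    obtain ⟨m, hm⟩ := hb n
    obtain ⟨m', hm'⟩ := ha m
    refine ⟨m', fun u hu => ?_⟩
    rw [map_mul, ← mul_assoc]
    exact hm _ (hm' u hu)
  | add a b ha hb =>
    obtain ⟨m, hm⟩ := ha n
    obtain ⟨m', hm'⟩ := hb n
    refine ⟨max m m', fun u hu => ?_⟩
    rw [map_add, mul_add]
    exact add_mem (hm u (envLevel_antitone h κ (le_max_left _ _) hu))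
      (hm' u (envLevel_antitone h κ (le_max_right _ _) hu))

theorem envBasis : RingSubgroupsBasis fun n => (envLevel h κ n).toAddSubgroup where
  inter i j := ⟨max i j, le_inf (envLevel_antitone h κ (le_max_left i j))
    (envLevel_antitone h κ (le_max_right i j))⟩
  mul i := ⟨i, by
    rintro _ ⟨a, _, b, hb, rfl⟩
    exact Ideal.mul_mem_left _ a hb⟩
  leftMul x i := ⟨i, fun _ hb => Ideal.mul_mem_left _ x hb⟩
  rightMul x i := by
    obtain ⟨m, hm⟩ := mul_right_mem h κ x i
    exact ⟨m, fun u hu => hm u hu⟩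

noncomputable instance : TopologicalSpace (Env h κ) := (envBasis h κ).topology
instance : IsTopologicalRing (Env h κ) :=
  (envBasis h κ).toRingFilterBasis.isTopologicalRing
noncomputable instance : UniformSpace (Env h κ) := IsTopologicalAddGroup.rightUniformSpace _
instance : IsUniformAddGroup (Env h κ) := isUniformAddGroup_of_addCommGroup
instance : UniformContinuousConstSMul A (Env h κ) where
  uniformContinuous_const_smul a := by
    simp only [Algebra.smul_def]
    exact uniformContinuous_of_continuousAt_zero (AddMonoidHom.mulLeft (algebraMap A (Env h κ) a))
      (continuous_const_mul _).continuousAt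

/-- The completed enveloping algebra, `lim_n Env / envLevel n`. -/
abbrev CEnv : Type (max u v) := UniformSpace.Completion (Env h κ)

/-! ### Fields -/

/-- `A`-linear maps `K → U`; a field is a continuous one. -/
abbrev PreField : Type (max u v) := h.Punctured →ₗ[A] CEnv h κ

variable {h κ}

/-- Continuity for the topologies in which the `f (t) ^ n R` form a basis of neighbourhoods of
`0` in `K`. -/
def IsField (X : PreField h κ) : Prop :=
  ∀ W ∈ 𝓝 (0 : CEnv h κ), ∃ n : ℕ, ∀ r : R, X (h.unif ^ n * algebraMap R _ r) ∈ W

/-- The action of `R` on fields: `(X r) (k) = X (r k)`. -/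
noncomputable def PreField.mulR (X : PreField h κ) (r : R) : PreField h κ :=
  X ∘ₗ LinearMap.mulLeft A (algebraMap R h.Punctured r)

/-- The right action of `∂_t` on fields: `(X ∂_t) (k) = X (∂_t k)`. -/
noncomputable def PreField.mulDeriv (X : PreField h κ) : PreField h κ :=
  X ∘ₗ (h.derivK : h.Punctured →ₗ[A] h.Punctured)

variable (h κ)

/-- The unit field `k ↦ Res (k dt) 1`. -/
noncomputable def unitField : PreField h κ := Algebra.linearMap A (CEnv h κ) ∘ₗ h.res

/-- The canonical field `k ↦ k ⊗ x` of `x ∈ 𝔤`. -/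
noncomputable def currentField (x : 𝔤) : PreField h κ where
  toFun k := (gen h κ (k ⊗ₜ x) : CEnv h κ)
  map_add' k l := by rw [TensorProduct.add_tmul, map_add, UniformSpace.Completion.coe_add]
  map_smul' a k := by
    rw [← TensorProduct.smul_tmul', map_smul, UniformSpace.Completion.coe_smul]; rfl

variable {h κ}

/-- `k ⊗ l ↦ X (k) Y (l)`. -/
noncomputable def fieldMul (X Y : PreField h κ) : h.Punctured ⊗[A] h.Punctured →ₗ[A] CEnv h κ :=
  TensorProduct.lift ((LinearMap.mul A (CEnv h κ)).compl₁₂ X Y)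

/-- `k ⊗ l ↦ Y (l) X (k)`. -/
noncomputable def fieldMulOp (X Y : PreField h κ) :
    h.Punctured ⊗[A] h.Punctured →ₗ[A] CEnv h κ :=
  TensorProduct.lift ((LinearMap.mul A (CEnv h κ)).flip.compl₁₂ X Y)

variable (h)

/-- The image of the coordinate `t` in `K`. -/
noncomputable abbrev coord : h.Punctured := algebraMap R h.Punctured t

/-- The equation `t ⊗ 1 - 1 ⊗ t` of the diagonal. -/
noncomputable def diag : h.Punctured ⊗[A] h.Punctured := h.coord ⊗ₜ 1 - 1 ⊗ₜ h.coord

/-- The divided difference `(f (t) ⊗ 1 - 1 ⊗ f (t)) / (t ⊗ 1 - 1 ⊗ t)`. -/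
noncomputable def divDiff : h.Punctured ⊗[A] h.Punctured :=
  f.sum fun i c => c • ∑ j ∈ Finset.range i, (h.coord ^ j) ⊗ₜ[A] (h.coord ^ (i - 1 - j))

/-- Partial sums of the expansion of `1 / (t ⊗ 1 - 1 ⊗ t)` in which the second variable is small:
with `φ = f (t)`, they are
`(φ ⊗ 1 - 1 ⊗ φ) / (t ⊗ 1 - 1 ⊗ t) * ∑_{i < N} φ ^ (- i - 1) ⊗ φ ^ i`. -/
noncomputable def diagInv (N : ℕ) : h.Punctured ⊗[A] h.Punctured :=
  h.divDiff * ∑ i ∈ Finset.range N,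
    (IsLocalization.Away.invSelf (S := h.Punctured) (aeval t f) ^ (i + 1)) ⊗ₜ[A] (h.unif ^ i)

/-- `N`-th approximation of `(t ⊗ 1 - 1 ⊗ t) ^ n`, expanded with the second variable small. -/
noncomputable def diagPow (N : ℕ) : ℤ → h.Punctured ⊗[A] h.Punctured
  | .ofNat n => h.diag ^ n
  | .negSucc n => h.diagInv N ^ (n + 1)

/-- `N`-th approximation of `(t ⊗ 1 - 1 ⊗ t) ^ n`, expanded with the first variable small. -/
noncomputable def diagPow' (N : ℕ) : ℤ → h.Punctured ⊗[A] h.Punctured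
  | .ofNat n => h.diag ^ n
  | .negSucc n => (-TensorProduct.comm A h.Punctured h.Punctured (h.diagInv N)) ^ (n + 1)

variable {h}

/-- The field `Z` is the `n`-th product `X_(n) Y`, where
`X_(n) Y (g) = μ ((t ⊗ 1 - 1 ⊗ t) ^ n X ⊠ Y) (1 ⊗ g)`, and the chiral product `μ` is the
commutator: the power of `t ⊗ 1 - 1 ⊗ t` is expanded with the second variable small in
`X (k) Y (l)`, and with the first variable small in `Y (l) X (k)`. -/
def IsNProd (n : ℤ) (X Y Z : PreField h κ) : Prop :=
  IsField Z ∧ ∀ g : h.Punctured, Tendsto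
    (fun N => fieldMul X Y (h.diagPow N n * 1 ⊗ₜ g) - fieldMulOp X Y (h.diagPow' N n * 1 ⊗ₜ g))
    atTop (𝓝 (Z g))

variable (h κ)

/-- The basic filtration of the chiral algebra generated by the canonical fields. -/
noncomputable def chiralFil : ℕ → Submodule A (PreField h κ)
  | 0 => Submodule.span A {W | ∃ r : R, W = (unitField h κ).mulR r ∨
      ∃ x : 𝔤, W = (currentField h κ x).mulR r}
  | n + 1 => chiralFil n ⊔ Submodule.span A
      ({W | ∃ X ∈ chiralFil n, W = X.mulDeriv} ∪
        {W | ∃ X ∈ chiralFil n, ∃ Y ∈ chiralFil n, ∃ Z, IsNProd (-1) X Y Z ∧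
          ∃ r : R, W = Z.mulR r})

/-- (Sections over the base of) the chiral algebra of `𝔤` at level `κ`. -/
noncomputable def chiral : Submodule A (PreField h κ) := ⨆ n, chiralFil h κ n

/-- The centre of the chiral algebra: fields `z` with `μ (z ⊠ y) = 0` for all `y`, that is,
`[z (k), y (l)] = 0` for all `k` and `l`. -/
noncomputable def chiralCenter : Submodule A (PreField h κ) where
  carrier := {z | z ∈ chiral h κ ∧ ∀ y ∈ chiral h κ, ∀ k l, z k * y l = y l * z k}
  zero_mem' := ⟨zero_mem _, fun y _ k l => by simp⟩
  add_mem' := fun {z w} hz hw => ⟨add_mem hz.1 hw.1, fun y hy k l => by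
    rw [LinearMap.add_apply, add_mul, mul_add, hz.2 y hy, hw.2 y hy]⟩
  smul_mem' := fun a z hz => ⟨Submodule.smul_mem _ a hz.1, fun y hy k l => by
    rw [LinearMap.smul_apply, smul_mul_assoc, mul_smul_comm, hz.2 y hy]⟩

/-- The topology of `chiral h κ`: the colimit, among topological modules with a basis of
neighbourhoods of `0` consisting of submodules, of the `chiralFil h κ n` with the topology of
uniform convergence on the `f (t) ^ (-k) R`. -/
@[reducible] noncomputable def chiralTopology : TopologicalSpace (chiral h κ) :=
  linearTopology (A := A)
    (fun Q => ∀ n, ∃ j : ℕ, ∃ W ∈ 𝓝 (0 : CEnv h κ), ∀ X : chiral h κ,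
      (X : PreField h κ) ∈ chiralFil h κ n →
      (∀ (k : h.Punctured) (r : R), h.unif ^ j * k = algebraMap R _ r → X.1 k ∈ W) → X ∈ Q)
    (fun _ => ⟨0, Set.univ, Filter.univ_mem, fun _ _ _ => trivial⟩)
    (fun Q Q' hQ hQ' n => by
      obtain ⟨j, W, hW, H⟩ := hQ n
      obtain ⟨j', W', hW', H'⟩ := hQ' n
      refine ⟨j + j', W ∩ W', Filter.inter_mem hW hW', fun X hX hXW =>
        ⟨H X hX fun k r hr => (hXW k (aeval t f ^ j' * r) ?_).1,
          H' X hX fun k r hr => (hXW k (aeval t f ^ j * r) ?_).2⟩⟩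
      · rw [map_mul, ← hr, map_pow]; ring
      · rw [map_mul, ← hr, map_pow]; ring)

/-- The topology of the centre, induced by `chiralTopology`. -/
@[reducible] noncomputable def chiralCenterTopology : TopologicalSpace (chiralCenter h κ) :=
  (chiralTopology h κ).induced fun z => ⟨z.1, z.2.1⟩

/-- The topology of the completed tensor product of a discrete vector space `V` with `R`: a
submodule is open if for all `v` it contains `f (t) ^ n R ⊗ v` for some `n`. -/
@[reducible] noncomputable def tensorTopology (_ : IsFormalCoordinate I t f) (V : Type*) [AddCommGroup V]
    [Module ℂ V] : TopologicalSpace (R ⊗[ℂ] V) :=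
  linearTopology (A := A) (fun Q => ∀ v : V, ∃ n : ℕ, ∀ r : R, (aeval t f ^ n * r) ⊗ₜ v ∈ Q)
    (fun _ => ⟨0, fun _ => trivial⟩)
    (fun Q Q' hQ hQ' v => by
      obtain ⟨n, H⟩ := hQ v
      obtain ⟨n', H'⟩ := hQ' v
      refine ⟨n + n', fun r => ⟨?_, ?_⟩⟩
      · rw [pow_add, mul_assoc]; exact H _
      · rw [add_comm, pow_add, mul_assoc]; exact H' _)

/-- `Y` is the canonical morphism of vertex algebras over `(R, t)` from `V^κ(𝔤) ⊗ R` to the chiral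
algebra: it is `R`-linear, maps the vacuum to the unit field and `x_(-1) |0⟩` to the canonical
field of `x`, and it is compatible with all `n`-th products. -/
structure IsCanonicalMap (Y : R ⊗[ℂ] AffineVertex κ →ₗ[A] PreField h κ) : Prop where
  mem (z) : Y z ∈ chiral h κ
  map_mul (r s : R) (v) : Y ((r * s) ⊗ₜ v) = (Y (s ⊗ₜ v)).mulR r
  map_vacuum : Y (1 ⊗ₜ AffineVertex.vacuum κ) = unitField h κ
  map_current (x : 𝔤) : Y (1 ⊗ₜ AffineVertex.mode κ x (-1) (AffineVertex.vacuum κ)) =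
    currentField h κ x
  map_nProd (v : AffineVertex κ) (B) (_ : AffineVertex.IsVertexOp v B) (w : AffineVertex κ)
    (n : ℤ) : IsNProd n (Y (1 ⊗ₜ v)) (Y (1 ⊗ₜ w)) (Y (1 ⊗ₜ B n w))

end IsFormalCoordinate
end Enveloping

section Geometry
open AlgebraicGeometry CategoryTheory

variable {A : Type u} [CommRing A] {𝒳 : Scheme.{u}} (p : 𝒳 ⟶ Spec (.of A)) {ι : Type*} [Fintype ι]
  (σ : ι → (Spec (.of A) ⟶ 𝒳))

/-- The product of the ideal sheaves of the sections `σ i`. -/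
noncomputable def sectionsIdeal : 𝒳.IdealSheafData := ∏ i, (σ i).ker

theorem sectionsIdeal_pow_le (n : ℕ) : sectionsIdeal σ ^ (n + 1) ≤ sectionsIdeal σ ^ n :=
  fun U => Ideal.pow_le_pow_right (I := (sectionsIdeal σ).ideal U) (Nat.le_succ n)

/-- Functions on the `n`-th infinitesimal neighbourhood of the union of the sections. -/
def Level (_ : 𝒳 ⟶ Spec (.of A)) (σ : ι → (Spec (.of A) ⟶ 𝒳)) (n : ℕ) : Type u :=
  Γ((sectionsIdeal σ ^ n).subscheme, ⊤)

noncomputable instance (n : ℕ) : CommRing (Level p σ n) :=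
  inferInstanceAs (CommRing Γ((sectionsIdeal σ ^ n).subscheme, ⊤))

/-- The structure map `A → Level p σ n`, the pullback of functions from the base. -/
noncomputable def levelAlgebraMap (n : ℕ) : A →+* Level p σ n :=
  ((Scheme.ΓSpecIso (.of A)).inv ≫ ((sectionsIdeal σ ^ n).subschemeι ≫ p).appTop).hom

noncomputable instance (n : ℕ) : Algebra A (Level p σ n) := (levelAlgebraMap p σ n).toAlgebra

noncomputable instance [Algebra ℂ A] (n : ℕ) : Algebra ℂ (Level p σ n) :=
  ((algebraMap A (Level p σ n)).comp (algebraMap ℂ A)).toAlgebra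

instance [Algebra ℂ A] (n : ℕ) : IsScalarTower ℂ A (Level p σ n) :=
  IsScalarTower.of_algebraMap_eq fun _ => rfl

/-- Restriction of functions from the `n + 1`-st to the `n`-th infinitesimal neighbourhood. -/
noncomputable def levelMap (n : ℕ) : Level p σ (n + 1) →+* Level p σ n :=
  (Scheme.IdealSheafData.inclusion (sectionsIdeal_pow_le σ n)).appTop.hom

theorem levelMap_algebraMap (n : ℕ) (a : A) :
    levelMap p σ n (algebraMap A _ a) = algebraMap A _ a := by
  have : ((Scheme.ΓSpecIso (.of A)).inv ≫ ((sectionsIdeal σ ^ (n + 1)).subschemeι ≫ p).appTop) ≫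
      (Scheme.IdealSheafData.inclusion (sectionsIdeal_pow_le σ n)).appTop =
      (Scheme.ΓSpecIso (.of A)).inv ≫ ((sectionsIdeal σ ^ n).subschemeι ≫ p).appTop := by
    rw [Category.assoc, ← Scheme.Hom.comp_appTop, ← Category.assoc (Scheme.IdealSheafData.inclusion _),
      Scheme.IdealSheafData.inclusion_subschemeι]
  exact congrArg (fun φ => φ.hom a) this

/-- Functions on the formal neighbourhood of the sections: compatible families of functions on
the infinitesimal neighbourhoods. -/
noncomputable def FormalFunctions : Subalgebra A (∀ n, Level p σ n) where
  carrier := {s | ∀ n, levelMap p σ n (s (n + 1)) = s n}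
  mul_mem' hs hs' n := by rw [Pi.mul_apply, map_mul, hs n, hs' n]; rfl
  add_mem' hs hs' n := by rw [Pi.add_apply, map_add, hs n, hs' n]; rfl
  algebraMap_mem' a n := levelMap_algebraMap p σ n a

/-- Restriction of formal functions to the `n`-th infinitesimal neighbourhood. -/
noncomputable def FormalFunctions.eval (n : ℕ) : FormalFunctions p σ →ₐ[A] Level p σ n :=
  (Pi.evalAlgHom A _ n).comp (FormalFunctions p σ).val

/-- Functions vanishing on the `n`-th infinitesimal neighbourhood. -/
noncomputable def FormalFunctions.vanishing (n : ℕ) : Ideal (FormalFunctions p σ) :=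
  RingHom.ker (FormalFunctions.eval p σ n)

/-- The monic polynomial `∏ i, (x - a i)`. -/
noncomputable def rootsPoly (a : ι → A) : A[X] := ∏ i, (X - C (a i))

variable {p σ}

/-- `t` is a coordinate with values `a i` on the sections: it identifies the functions on the
infinitesimal neighbourhoods with `A[x] / (∏ i, (x - a i)) ^ n`, hence the functions on the formal
neighbourhood with the limit of these rings. -/
structure IsCoordinate (t : FormalFunctions p σ) (a : ι → A) : Prop where
  surjective (n : ℕ) (s : Level p σ n) :
    ∃ P : A[X], aeval (FormalFunctions.eval p σ n t) P = s
  eq_zero_iff (n : ℕ) (P : A[X]) :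
    aeval (FormalFunctions.eval p σ n t) P = 0 ↔ rootsPoly a ^ n ∣ P

theorem IsCoordinate.formal {t : FormalFunctions p σ} {a : ι → A} (h : IsCoordinate t a) :
    IsFormalCoordinate (FormalFunctions.vanishing p σ) t (rootsPoly a) where
  monic := monic_prod_of_monic _ _ fun i _ => monic_X_sub_C _
  antitone := antitone_nat_of_succ_le fun n r hr => by
    have h1 : r.1 (n + 1) = 0 := hr
    change r.1 n = 0
    rw [← r.2 n, h1, map_zero]
  aeval_mem_iff n P := by
    rw [← h.eq_zero_iff, aeval_algHom_apply]; rfl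
  exists_sub_mem n r := by
    obtain ⟨P, hP⟩ := h.surjective n (FormalFunctions.eval p σ n r)
    exact ⟨P, by
      change FormalFunctions.eval p σ n _ = 0
      rw [map_sub, ← aeval_algHom_apply, hP, sub_self]⟩
  separated r hr := Subtype.ext (funext fun n => hr n)
  complete s hs := by
    refine ⟨⟨fun n => (s n).1 n, fun n => ?_⟩, fun n => ?_⟩
    · rw [(s (n + 1)).2 n]
      exact sub_eq_zero.1 (hs n)
    · exact sub_self _

end Geometry

end ChiralCenter

/-! The proof has three ingredients: a calculus of local fields, a construction of state fields, and
an evaluation at infinity that makes the construction faithful.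

Calculus. Powers of the diagonal are replaced by finite approximations in `K ⊗ K`. For these the
Borcherds identities are algebraic, up to errors that are small in the second variable, and
neighbourhoods of zero in the enveloping algebra are left ideals, so such errors vanish in the
limit. Locality gives the operator product expansion `IsLocalAt.prodMap_tmul`, by density of
rational functions in `t`. From it follow the commutator formula `IsLocalAt.nProd_comm`, Dong's
lemma `IsLocal.nProd` and the associativity formula `IsLocalAt.nProd_nProd`.

State fields. The canonical fields have the products of affine currents, so their modes make the
module of fields a representation of the affine algebra in which `𝔤[t]` kills the unit field. The
vacuum module maps to it by its universal property, and `stateField_vertexOp` shows that all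
products are respected. Uniqueness holds because the vacuum generates under the modes of currents.
By `exists_finite_stateSpan`, each step of the basic filtration lies in the `R`-span of finitely
many state fields, so every chiral field comes from `R ⊗ V^κ(𝔤)`.

Evaluation at infinity. A rational function with poles along the sections expands in powers of
`t⁻¹`, and its residue along the sections is the coefficient of `t⁻¹`. Hence the enveloping algebra
acts on smooth Laurent series at infinity with values in the vacuum module, and the left ideal
generated by `R ⊗ 𝔤` kills the vacuum. The field of a vector `v` of pure degree `d`, applied to `k`
and then to the vacuum, has lowest term `Res (k dt) ⊗ v`, in degree `d`. By induction on the degree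
and nondegeneracy of the residue pairing, smallness of a field on `φ⁻ʲR` forces all its coefficients
in a suitable basis into the `j`-th ideal (`mem_ideal_of_isGood`). All `j` together give
injectivity; a fixed `j` gives openness.

Centre. A chiral field is central exactly when its nonnegative products with currents vanish.
Through the injective `stateMap` this becomes a family of linear equations on the vacuum module, and
tensoring over `ℂ` commutes with their common kernel, which is `ζ^κ(𝔤)`. -/

namespace ChiralCenter
open Polynomial Filter Topology

set_option linter.unusedSectionVars false


/-! ### Signs, divided powers, and expansions of the powers of the diagonal. -/

section FieldCalculus

/-- The sign `(-1) ^ n` as an integer. -/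
def sgn (n : ℤ) : ℤ := (n.negOnePow : ℤ)

theorem sgn_add (m n : ℤ) : sgn (m + n) = sgn m * sgn n := by
  simp [sgn, Int.negOnePow_add]

theorem sgn_mul_self (n : ℤ) : sgn n * sgn n = 1 := by
  rw [← sgn_add, sgn, Int.negOnePow_even _ ⟨n, rfl⟩, Units.val_one]

theorem sgn_sub (m n : ℤ) : sgn (m - n) = sgn m * sgn n := by
  have h : sgn m = sgn (m - n) * sgn n := by rw [← sgn_add, sub_add_cancel]
  rw [h, mul_assoc, sgn_mul_self, mul_one]

theorem sgn_one : sgn 1 = -1 := by simp [sgn, Int.negOnePow_one]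

theorem sgn_zero : sgn 0 = 1 := by simp [sgn]

theorem sgn_neg_one : sgn (-1) = -1 := by
  rw [show (-1 : ℤ) = 0 - 1 from rfl, sgn_sub, sgn_zero, sgn_one, one_mul]; rfl

theorem sgn_natCast (n : ℕ) : sgn n = (-1) ^ n := by
  induction n with
  | zero => exact sgn_zero
  | succ n ih => rw [Nat.cast_succ, sgn_add, ih, sgn_one, pow_succ]

section Algebra

variable {A K : Type*} [CommRing A] [CommRing K] [Algebra A K]

/-- The span of the `k ⊗ r` with `r` in the `n`-th step of the filtration. -/
def smallSnd (O : ℕ → Submodule A K) (n : ℕ) : Submodule A (K ⊗[A] K) :=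
  Submodule.span A {u | ∃ k, ∃ r ∈ O n, u = k ⊗ₜ r}

/-- Divided powers of a derivation. -/
noncomputable def divPow [Algebra ℂ A] {M : Type*} [AddCommGroup M] [Module A M] (D : M →ₗ[A] M)
    (j : ℕ) : M →ₗ[A] M :=
  algebraMap ℂ A (j.factorial : ℂ)⁻¹ • D ^ j

section divPow
variable [Algebra ℂ A] {M : Type*} [AddCommGroup M] [Module A M] (D : M →ₗ[A] M)

theorem divPow_zero : divPow D 0 = LinearMap.id := by
  simp [divPow]; rfl

theorem divPow_succ (j : ℕ) : (j + 1) • divPow D (j + 1) = D ∘ₗ divPow D j := by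
  ext x
  have h : (j.factorial : ℂ)⁻¹ = (j + 1) * ((j + 1).factorial : ℂ)⁻¹ := by
    have : (j.factorial : ℂ) ≠ 0 := by exact_mod_cast j.factorial_ne_zero
    have : (j : ℂ) + 1 ≠ 0 := by exact_mod_cast j.succ_ne_zero
    rw [Nat.factorial_succ]; push_cast; field_simp
  simp only [divPow, h, LinearMap.smul_apply, LinearMap.comp_apply, map_smul, pow_succ',
    Module.End.mul_apply, map_mul, map_add, map_natCast, map_one, mul_smul]
  rw [← Nat.cast_smul_eq_nsmul A]
  push_cast
  rfl

theorem divPow_succ_apply (j : ℕ) (x : M) : (j + 1) • divPow D (j + 1) x = D (divPow D j x) := by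
  exact LinearMap.congr_fun (divPow_succ D j) x

theorem inv_smul_nsmul_succ (j : ℕ) (z : M) :
    algebraMap ℂ A ((j + 1 : ℕ) : ℂ)⁻¹ • (j + 1) • z = z := by
  rw [← Nat.cast_smul_eq_nsmul A (j + 1) z, smul_smul, ← map_natCast (algebraMap ℂ A), ← map_mul,
    inv_mul_cancel₀ (by exact_mod_cast j.succ_ne_zero), map_one, one_smul]

end divPow

/-- A commutative algebra of functions on a punctured neighbourhood, with a derivation, a
filtration and expansions of the powers of the equation of the diagonal. -/
structure DiagonalKernel (A K : Type*) [CommRing A] [CommRing K] [Algebra A K] where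
  der : Derivation A K K
  t : K
  O : ℕ → Submodule A K
  p : ℕ → ℤ → K ⊗[A] K
  O_anti : Antitone O
  one_mem : 1 ∈ O 0
  t_mem : t ∈ O 0
  mul_mem : ∀ {a b r s}, r ∈ O a → s ∈ O b → r * s ∈ O (a + b)
  absorb : ∀ (k : K) n, ∃ m, ∀ r ∈ O m, k * r ∈ O n
  der_mem : ∀ {n r}, r ∈ O (n + 1) → der r ∈ O n
  der_t : der t = 1
  dense : ∀ (k : K) n, ∃ P F : A[X], ∃ w, IsUnit (aeval t F) ∧ aeval t F * w = aeval t P ∧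
    k - w ∈ O n
  p_mem : ∀ N n, p N n ∈ smallSnd O 0
  p_cauchy : ∀ {N M} n, N ≤ M → p M n - p N n ∈ smallSnd O N
  p_nat : ∀ N (n : ℕ), p N n = (t ⊗ₜ 1 - 1 ⊗ₜ t) ^ n
  diag_mul : ∀ N n, (t ⊗ₜ 1 - 1 ⊗ₜ t) * p N n - p N (n + 1) ∈ smallSnd O N
  p_mul : ∀ N n m, p N n * p N m - p N (n + m) ∈ smallSnd O N
  d1_p : ∀ N n, (der : K →ₗ[A] K).rTensor K (p N n) - n • p N (n - 1) ∈ smallSnd O N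
  -- Differentiating the second variable costs one step of the filtration, whence `N + 1` on the
  -- left and `N` on the right.
  d2_p : ∀ N n, (der : K →ₗ[A] K).lTensor K (p (N + 1) n) + n • p (N + 1) (n - 1) ∈ smallSnd O N

namespace DiagonalKernel
variable (𝔎 : DiagonalKernel A K)

/-- The derivation acting on the first variable. -/
noncomputable abbrev d1 : K ⊗[A] K →ₗ[A] K ⊗[A] K := (𝔎.der : K →ₗ[A] K).rTensor K
/-- The derivation acting on the second variable. -/
noncomputable abbrev d2 : K ⊗[A] K →ₗ[A] K ⊗[A] K := (𝔎.der : K →ₗ[A] K).lTensor K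

/-- The equation of the diagonal. -/
noncomputable abbrev δ : K ⊗[A] K := 𝔎.t ⊗ₜ 1 - 1 ⊗ₜ 𝔎.t

/-- The image of `K ⊗ O n`. -/
abbrev S (n : ℕ) : Submodule A (K ⊗[A] K) := smallSnd 𝔎.O n

theorem tmul_mem {n : ℕ} (k : K) {r : K} (hr : r ∈ 𝔎.O n) : k ⊗ₜ r ∈ 𝔎.S n :=
  Submodule.subset_span ⟨k, r, hr, rfl⟩

theorem map_mem_of_mem_S {M : Type*} [AddCommGroup M] [Module A M] (g : K ⊗[A] K →ₗ[A] M)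
    (Q : Submodule A M) {n : ℕ} (h : ∀ k, ∀ r ∈ 𝔎.O n, g (k ⊗ₜ r) ∈ Q) {u : K ⊗[A] K}
    (hu : u ∈ 𝔎.S n) : g u ∈ Q := by
  refine (Submodule.span_le (p := Q.comap g)).2 ?_ hu
  rintro _ ⟨k, r, hr, rfl⟩
  exact h k r hr

theorem S_anti {n m : ℕ} (h : n ≤ m) : 𝔎.S m ≤ 𝔎.S n :=
  Submodule.span_mono fun _ ⟨k, r, hr, e⟩ => ⟨k, r, 𝔎.O_anti h hr, e⟩

theorem S_mul {a b : ℕ} {u v : K ⊗[A] K} (hu : u ∈ 𝔎.S a) (hv : v ∈ 𝔎.S b) :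
    u * v ∈ 𝔎.S (a + b) := by
  refine 𝔎.map_mem_of_mem_S (LinearMap.mulRight A v) _ (fun k r hr => ?_) hu
  refine 𝔎.map_mem_of_mem_S (LinearMap.mulLeft A (k ⊗ₜ r)) _ (fun k' r' hr' => ?_) hv
  rw [LinearMap.mulLeft_apply, Algebra.TensorProduct.tmul_mul_tmul]
  exact 𝔎.tmul_mem _ (𝔎.mul_mem hr hr')

/-- Multiplication by a fixed tensor is continuous even if its second components have poles. This
allows expansions to be multiplied by an arbitrary `c`. -/
theorem S_absorb (c : K ⊗[A] K) (n : ℕ) : ∃ m, ∀ u ∈ 𝔎.S m, u * c ∈ 𝔎.S n := by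
  induction c with
  | zero => exact ⟨0, fun u _ => by simp⟩
  | tmul k g =>
    obtain ⟨m, hm⟩ := 𝔎.absorb g n
    refine ⟨m, fun u hu => ?_⟩
    refine 𝔎.map_mem_of_mem_S (LinearMap.mulRight A (k ⊗ₜ g)) _ (fun k' r hr => ?_) hu
    rw [LinearMap.mulRight_apply, Algebra.TensorProduct.tmul_mul_tmul, mul_comm r]
    exact 𝔎.tmul_mem _ (hm _ hr)
  | add a b ha hb =>
    obtain ⟨m, hm⟩ := ha
    obtain ⟨m', hm'⟩ := hb
    refine ⟨max m m', fun u hu => ?_⟩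
    rw [mul_add]
    exact add_mem (hm _ (𝔎.S_anti (le_max_left _ _) hu)) (hm' _ (𝔎.S_anti (le_max_right _ _) hu))

theorem d1_mem {n : ℕ} {u : K ⊗[A] K} (hu : u ∈ 𝔎.S n) : 𝔎.d1 u ∈ 𝔎.S n :=
  𝔎.map_mem_of_mem_S 𝔎.d1 _ (fun _ _ hr => 𝔎.tmul_mem _ hr) hu

theorem d2_mem {n : ℕ} {u : K ⊗[A] K} (hu : u ∈ 𝔎.S (n + 1)) : 𝔎.d2 u ∈ 𝔎.S n :=
  𝔎.map_mem_of_mem_S 𝔎.d2 _ (fun _ _ hr => 𝔎.tmul_mem _ (𝔎.der_mem hr)) hu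

theorem d1_mul (u v : K ⊗[A] K) : 𝔎.d1 (u * v) = 𝔎.d1 u * v + u * 𝔎.d1 v := by
  induction u with
  | zero => simp
  | add a b ha hb => simp only [add_mul, map_add, ha, hb]; ring
  | tmul k l =>
    induction v with
    | zero => simp
    | add a b ha hb => simp only [mul_add, map_add, ha, hb]; ring
    | tmul k' l' =>
      simp [TensorProduct.add_tmul, mul_comm, add_comm]

theorem d2_mul (u v : K ⊗[A] K) : 𝔎.d2 (u * v) = 𝔎.d2 u * v + u * 𝔎.d2 v := by
  induction u with
  | zero => simp
  | add a b ha hb => simp only [add_mul, map_add, ha, hb]; ring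
  | tmul k l =>
    induction v with
    | zero => simp
    | add a b ha hb => simp only [mul_add, map_add, ha, hb]; ring
    | tmul k' l' =>
      simp [TensorProduct.tmul_add, mul_comm, add_comm]

/-- Sequences tending to zero in `K ⊗ K` when the second variable is small. -/
def Null (s : ℕ → K ⊗[A] K) : Prop := ∀ n, ∀ᶠ N in atTop, s N ∈ 𝔎.S n

variable {𝔎}

theorem Null.of_mem {s : ℕ → K ⊗[A] K} (h : ∀ N, s N ∈ 𝔎.S N) : 𝔎.Null s := fun n =>
  (eventually_ge_atTop n).mono fun N hN => 𝔎.S_anti hN (h N)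

theorem Null.of_mem_succ {s : ℕ → K ⊗[A] K} (h : ∀ N, s (N + 1) ∈ 𝔎.S N) : 𝔎.Null s := fun n =>
  (eventually_ge_atTop (n + 1)).mono fun N hN => by
    obtain ⟨N, rfl⟩ : ∃ m, N = m + 1 := ⟨N - 1, by omega⟩
    exact 𝔎.S_anti (by omega) (h N)

theorem Null.add {s s' : ℕ → K ⊗[A] K} (h : 𝔎.Null s) (h' : 𝔎.Null s') :
    𝔎.Null fun N => s N + s' N := fun n => by
  filter_upwards [h n, h' n] with N a b using add_mem a b

theorem Null.smul {s : ℕ → K ⊗[A] K} (a : A) (h : 𝔎.Null s) : 𝔎.Null fun N => a • s N := fun n => by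
  filter_upwards [h n] with N b using Submodule.smul_mem _ _ b

theorem Null.zsmul {s : ℕ → K ⊗[A] K} (a : ℤ) (h : 𝔎.Null s) : 𝔎.Null fun N => a • s N := fun n => by
  filter_upwards [h n] with N b using zsmul_mem b a

theorem Null.mul_const {s : ℕ → K ⊗[A] K} (h : 𝔎.Null s) (c : K ⊗[A] K) :
    𝔎.Null fun N => s N * c := fun n => by
  obtain ⟨m, hm⟩ := 𝔎.S_absorb c n
  filter_upwards [h m] with N a using hm _ a

theorem Null.mul {s s' : ℕ → K ⊗[A] K} (h : 𝔎.Null s) (h' : ∀ N, s' N ∈ 𝔎.S 0) :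
    𝔎.Null fun N => s N * s' N := fun n => by
  filter_upwards [h n] with N a
  have := 𝔎.S_mul a (h' N)
  rwa [add_zero] at this

theorem Null.d1 {s : ℕ → K ⊗[A] K} (h : 𝔎.Null s) : 𝔎.Null fun N => 𝔎.d1 (s N) := fun n => by
  filter_upwards [h n] with N a using 𝔎.d1_mem a

theorem Null.d2 {s : ℕ → K ⊗[A] K} (h : 𝔎.Null s) : 𝔎.Null fun N => 𝔎.d2 (s N) := fun n => by
  filter_upwards [h (n + 1)] with N a using 𝔎.d2_mem a

variable (𝔎)

theorem choose_succ_mul (n : ℤ) (j : ℕ) :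
    ((j + 1 : ℕ) : ℤ) * Ring.choose n (j + 1) = Ring.choose n j * (n - j) := by
  have := Ring.choose_smul_choose n (Nat.le_succ j)
  simpa using this

/-- Iterates the rule that `D` takes the `n`-th power of the diagonal to `ε n` times the previous
power. Errors stay null because `D` preserves null sequences, and the division by `j + 1` uses that
`A` is a `ℂ`-algebra. -/
theorem null_divPow [Algebra ℂ A] (D : K ⊗[A] K →ₗ[A] K ⊗[A] K) (ε : ℤ)
    (hD : ∀ s, 𝔎.Null s → 𝔎.Null fun N => D (s N))
    (hp : ∀ n, 𝔎.Null fun N => D (𝔎.p N n) - (ε * n) • 𝔎.p N (n - 1)) (n : ℤ) (j : ℕ) :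
    𝔎.Null fun N => divPow D j (𝔎.p N n) - (ε ^ j * Ring.choose n j : ℤ) • 𝔎.p N (n - j) := by
  induction j with
  | zero => exact Null.of_mem fun N => by simp [divPow_zero]
  | succ j ih =>
    have h := (hD _ ih).add ((hp (n - j)).zsmul (ε ^ j * Ring.choose n j))
    have h2 := h.smul (algebraMap ℂ A ((j + 1 : ℕ) : ℂ)⁻¹)
    refine fun n' => (h2 n').mono fun N hN => ?_
    -- The two errors add up to `j + 1` times the error of the next step, by `(j + 1) * choose n (j
    -- + 1) = choose n j * (n - j)`.
    have e : D (divPow D j (𝔎.p N n) - (ε ^ j * Ring.choose n j : ℤ) • 𝔎.p N (n - j)) +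
        (ε ^ j * Ring.choose n j : ℤ) •
          (D (𝔎.p N (n - j)) - (ε * (n - j)) • 𝔎.p N (n - j - 1)) =
        (j + 1) • (divPow D (j + 1) (𝔎.p N n) -
          (ε ^ (j + 1) * Ring.choose n (j + 1) : ℤ) • 𝔎.p N (n - (j + 1 : ℕ))) := by
      have hc : ((j + 1 : ℕ) : ℤ) * (ε ^ (j + 1) * Ring.choose n (j + 1)) =
          (ε ^ j * Ring.choose n j) * (ε * (n - j)) := by
        rw [mul_left_comm, choose_succ_mul]; ring
      have h1 : n - (j : ℤ) - 1 = n - (j + 1 : ℕ) := by push_cast; ring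
      rw [nsmul_sub, divPow_succ_apply, ← natCast_zsmul _ (j + 1), smul_smul, hc, h1, map_sub,
        map_zsmul, zsmul_sub, smul_smul]
      abel
    simp only at hN
    rwa [e, inv_smul_nsmul_succ] at hN

theorem null_divPow_d1 [Algebra ℂ A] (n : ℤ) (j : ℕ) :
    𝔎.Null fun N => divPow 𝔎.d1 j (𝔎.p N n) - (Ring.choose n j : ℤ) • 𝔎.p N (n - j) := by
  have := 𝔎.null_divPow 𝔎.d1 1 (fun s h => h.d1)
    (fun n => by simpa only [one_mul] using Null.of_mem fun N => 𝔎.d1_p N n) n j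
  simpa only [one_pow, one_mul] using this

theorem null_divPow_d2 [Algebra ℂ A] (n : ℤ) (j : ℕ) :
    𝔎.Null fun N => divPow 𝔎.d2 j (𝔎.p N n) - ((-1) ^ j * Ring.choose n j : ℤ) • 𝔎.p N (n - j) :=
  𝔎.null_divPow 𝔎.d2 (-1) (fun s h => h.d2)
    (fun n => Null.of_mem_succ fun N => by
      simpa only [neg_mul, one_mul, neg_smul, sub_neg_eq_add] using 𝔎.d2_p N n) n j

end DiagonalKernel
end Algebra
end FieldCalculus

/-! ### Continuous fields and convergence of their expanded products. -/

section FieldCalculus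
variable {A K U : Type*} [CommRing A] [CommRing K] [Algebra A K] [Ring U] [Algebra A U]

/-- `k ⊗ l ↦ X (k) Y (l)`. -/
noncomputable def mulMap (X Y : K →ₗ[A] U) : K ⊗[A] K →ₗ[A] U :=
  TensorProduct.lift ((LinearMap.mul A U).compl₁₂ X Y)

@[simp] theorem mulMap_tmul (X Y : K →ₗ[A] U) (k l : K) : mulMap X Y (k ⊗ₜ l) = X k * Y l := rfl

theorem mulMap_add_left (X X' Y : K →ₗ[A] U) : mulMap (X + X') Y = mulMap X Y + mulMap X' Y :=
  TensorProduct.ext' fun k l => by simp [add_mul]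

theorem mulMap_add_right (X Y Y' : K →ₗ[A] U) : mulMap X (Y + Y') = mulMap X Y + mulMap X Y' :=
  TensorProduct.ext' fun k l => by simp [mul_add]

theorem mulMap_sub_left (X X' Y : K →ₗ[A] U) : mulMap (X - X') Y = mulMap X Y - mulMap X' Y :=
  TensorProduct.ext' fun k l => by simp [sub_mul]

theorem mulMap_sub_right (X Y Y' : K →ₗ[A] U) : mulMap X (Y - Y') = mulMap X Y - mulMap X Y' :=
  TensorProduct.ext' fun k l => by simp [mul_sub]

theorem mulMap_smul_left (a : A) (X Y : K →ₗ[A] U) : mulMap (a • X) Y = a • mulMap X Y :=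
  TensorProduct.ext' fun k l => by simp

theorem mulMap_smul_right (a : A) (X Y : K →ₗ[A] U) : mulMap X (a • Y) = a • mulMap X Y :=
  TensorProduct.ext' fun k l => by simp

/-- Exchange of the two variables. -/
noncomputable abbrev swapK : K ⊗[A] K →ₗ[A] K ⊗[A] K := (TensorProduct.comm A K K).toLinearMap

theorem swapK_mul (u v : K ⊗[A] K) : swapK (u * v) = swapK u * swapK v :=
  map_mul (Algebra.TensorProduct.comm A K K) u v

theorem smul_mem_ideal (a : A) {J : Ideal U} {x : U} (h : x ∈ J) : a • x ∈ J := by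
  rw [Algebra.smul_def]; exact J.mul_mem_left _ h

/-- A left ideal as an `A`-submodule. -/
def idealSub (A : Type*) {U : Type*} [CommRing A] [Ring U] [Algebra A U] (J : Ideal U) :
    Submodule A U := { J with smul_mem' := fun a _ h => smul_mem_ideal a h }

namespace DiagonalKernel
variable (𝔎 : DiagonalKernel A K) (W : ℕ → Ideal U)

/-- Continuity of an `A`-linear map. -/
def IsFld (X : K →ₗ[A] U) : Prop := ∀ q, ∃ n, ∀ r ∈ 𝔎.O n, X r ∈ W q

variable {𝔎 W}

theorem IsFld.comp_mul {X : K →ₗ[A] U} (h : 𝔎.IsFld W X) (k : K) :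
    𝔎.IsFld W (X ∘ₗ LinearMap.mulLeft A k) := fun q => by
  obtain ⟨n, hn⟩ := h q
  obtain ⟨m, hm⟩ := 𝔎.absorb k n
  exact ⟨m, fun r hr => hn _ (hm r hr)⟩

theorem IsFld.comp_der {X : K →ₗ[A] U} (h : 𝔎.IsFld W X) :
    𝔎.IsFld W (X ∘ₗ (𝔎.der : K →ₗ[A] K)) := fun q => by
  obtain ⟨n, hn⟩ := h q
  exact ⟨n + 1, fun r hr => hn _ (𝔎.der_mem hr)⟩

theorem IsFld.zero : 𝔎.IsFld W 0 := fun q => ⟨0, fun r _ => by simp⟩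

theorem IsFld.add {X Y : K →ₗ[A] U} (h : 𝔎.IsFld W X) (h' : 𝔎.IsFld W Y) :
    𝔎.IsFld W (X + Y) := fun q => by
  obtain ⟨n, hn⟩ := h q
  obtain ⟨m, hm⟩ := h' q
  exact ⟨max n m, fun r hr => add_mem (hn r (𝔎.O_anti (le_max_left _ _) hr))
    (hm r (𝔎.O_anti (le_max_right _ _) hr))⟩

theorem IsFld.smul {X : K →ₗ[A] U} (a : A) (h : 𝔎.IsFld W X) : 𝔎.IsFld W (a • X) := fun q => by
  obtain ⟨n, hn⟩ := h q
  exact ⟨n, fun r hr => smul_mem_ideal a (hn r hr)⟩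

variable (𝔎 W)

/-- The module of fields. -/
def fields : Submodule A (K →ₗ[A] U) where
  carrier := {X | 𝔎.IsFld W X}
  zero_mem' := IsFld.zero
  add_mem' := IsFld.add
  smul_mem' := fun a _ h => h.smul a

variable {𝔎 W}

theorem IsFld.divPow_comp [Algebra ℂ A] {X : K →ₗ[A] U} (h : 𝔎.IsFld W X) (j : ℕ) :
    𝔎.IsFld W (X ∘ₗ divPow (𝔎.der : K →ₗ[A] K) j) := by
  have h2 : 𝔎.IsFld W (X ∘ₗ (𝔎.der : K →ₗ[A] K) ^ j) := by
    induction j with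
    | zero => exact h
    | succ j ih => rw [pow_succ]; exact ih.comp_der
  rw [divPow, LinearMap.comp_smul]
  exact h2.smul _

/-- The neighbourhoods `W q` are left ideals, so only the right factor has to be small; the bound
does not depend on `X`. -/
theorem IsFld.mulMap_mem {Y : K →ₗ[A] U} (h : 𝔎.IsFld W Y) (q : ℕ) :
    ∃ n, ∀ u ∈ 𝔎.S n, ∀ X : K →ₗ[A] U, mulMap X Y u ∈ W q := by
  obtain ⟨n, hn⟩ := h q
  exact ⟨n, fun u hu X => 𝔎.map_mem_of_mem_S (mulMap X Y) (idealSub A (W q))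
    (fun k r hr => (W q).mul_mem_left _ (hn r hr)) hu⟩

/-- Uniform smallness of `mulMap X Y` on `S n * c`. -/
theorem IsFld.mulMap_mul_mem {Y : K →ₗ[A] U} (h : 𝔎.IsFld W Y) (q : ℕ) (c : K ⊗[A] K) :
    ∃ n, ∀ u ∈ 𝔎.S n, ∀ X : K →ₗ[A] U, mulMap X Y (u * c) ∈ W q := by
  obtain ⟨n, hn⟩ := h.mulMap_mem q
  obtain ⟨m, hm⟩ := 𝔎.S_absorb c n
  exact ⟨m, fun u hu X => hn _ (hm u hu) X⟩

theorem mulMap_mem_of_right {D : K →ₗ[A] U} {q : ℕ} {g : K} (hD : ∀ r ∈ 𝔎.O 0, D (r * g) ∈ W q)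
    (X : K →ₗ[A] U) (k : K) {u : K ⊗[A] K} (hu : u ∈ 𝔎.S 0) :
    mulMap X D (u * k ⊗ₜ g) ∈ W q :=
  𝔎.map_mem_of_mem_S (mulMap X D ∘ₗ LinearMap.mulRight A (k ⊗ₜ g)) (idealSub A (W q))
    (fun k' r hr => by
      rw [LinearMap.comp_apply, LinearMap.mulRight_apply, Algebra.TensorProduct.tmul_mul_tmul]
      exact (W q).mul_mem_left _ (hD r hr)) hu

end DiagonalKernel

variable [UniformSpace U] [IsUniformAddGroup U] [IsTopologicalRing U] [CompleteSpace U] [T2Space U]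

/-- A basis of neighbourhoods of `0` consisting of left ideals. -/
def IsIdealBasis (W : ℕ → Ideal U) : Prop :=
  (𝓝 (0 : U)).HasBasis (fun _ : ℕ => True) fun n => (W n : Set U)

namespace IsIdealBasis
variable {W : ℕ → Ideal U} (hW : IsIdealBasis W)
include hW

theorem tendsto_iff {s : ℕ → U} {L : U} :
    Tendsto s atTop (𝓝 L) ↔ ∀ q, ∀ᶠ N in atTop, s N - L ∈ W q := by
  rw [← tendsto_sub_nhds_zero_iff, hW.tendsto_right_iff]
  simp

theorem exists_tendsto {s : ℕ → U} (h : ∀ q, ∃ N₀, ∀ N ≥ N₀, s N - s N₀ ∈ W q) :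
    ∃ L, Tendsto s atTop (𝓝 L) := by
  refine cauchySeq_tendsto_of_complete ?_
  rw [(hW.uniformity_of_nhds_zero).cauchySeq_iff]
  intro q _
  obtain ⟨N₀, hN⟩ := h q
  refine ⟨N₀, fun m hm n hn => ?_⟩
  have := sub_mem (hN n hn) (hN m hm)
  simpa using this

theorem mem_of_tendsto {s : ℕ → U} {L : U} (h : Tendsto s atTop (𝓝 L)) {q : ℕ}
    (hs : ∀ᶠ N in atTop, s N ∈ W q) : L ∈ W q := by
  obtain ⟨N, h1, h2⟩ := ((hW.tendsto_iff.1 h q).and hs).exists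
  have := sub_mem h2 h1
  simpa using this

theorem eq_zero {x : U} (h : ∀ q, x ∈ W q) : x = 0 := by
  by_contra hx
  obtain ⟨q, -, hq⟩ := hW.mem_iff.1 (isOpen_compl_singleton.mem_nhds (Ne.symm hx))
  exact hq (h q) rfl

theorem mul_right (v : U) (q : ℕ) : ∃ r, ∀ u ∈ W r, u * v ∈ W q := by
  have h : Tendsto (fun u : U => u * v) (𝓝 0) (𝓝 0) := by
    simpa using (continuous_mul_const v).tendsto 0
  obtain ⟨r, -, hr⟩ := (Filter.HasBasis.tendsto_iff hW hW).1 h q trivial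
  exact ⟨r, hr⟩

end IsIdealBasis

namespace DiagonalKernel
variable {𝔎 : DiagonalKernel A K} {W : ℕ → Ideal U} (hW : IsIdealBasis W)
include hW

theorem tendsto_mulMap_null {Y : K →ₗ[A] U} (h : 𝔎.IsFld W Y) (X : K →ₗ[A] U)
    {s : ℕ → K ⊗[A] K} (hs : 𝔎.Null s) : Tendsto (fun N => mulMap X Y (s N)) atTop (𝓝 0) := by
  rw [hW.tendsto_iff]
  intro q
  obtain ⟨n, hn⟩ := h.mulMap_mem q
  filter_upwards [hs n] with N hN
  rw [sub_zero]
  exact hn _ hN X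

theorem tendsto_congr_null {Y : K →ₗ[A] U} (h : 𝔎.IsFld W Y) (X : K →ₗ[A] U)
    {s s' : ℕ → K ⊗[A] K} (hs : 𝔎.Null fun N => s N - s' N) {L : U}
    (hL : Tendsto (fun N => mulMap X Y (s' N)) atTop (𝓝 L)) :
    Tendsto (fun N => mulMap X Y (s N)) atTop (𝓝 L) := by
  have := (tendsto_mulMap_null hW h X hs).add hL
  simpa using this

variable (𝔎) in
-- Successive approximations of the kernel differ by tensors whose second variable is small, and
-- continuity of `Y` makes their images small. Completeness does the rest.
theorem exists_ext {Y : K →ₗ[A] U} (h : 𝔎.IsFld W Y) (X : K →ₗ[A] U) (n : ℤ) (c : K ⊗[A] K) :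
    ∃ L, Tendsto (fun N => mulMap X Y (𝔎.p N n * c)) atTop (𝓝 L) := by
  refine hW.exists_tendsto fun q => ?_
  obtain ⟨m, hm⟩ := h.mulMap_mul_mem q c
  refine ⟨m, fun N hN => ?_⟩
  rw [← map_sub, ← sub_mul]
  exact hm _ (𝔎.p_cauchy n hN) X

omit hW in
variable (𝔎) in
/-- The extension of `k ⊗ l ↦ X (k) Y (l)` to `(t ⊗ 1 - 1 ⊗ t) ^ n c`, expanded with the second
variable small. -/
noncomputable def ext (n : ℤ) (X Y : K →ₗ[A] U) (c : K ⊗[A] K) : U :=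
  limUnder atTop fun N => mulMap X Y (𝔎.p N n * c)

theorem tendsto_ext {Y : K →ₗ[A] U} (h : 𝔎.IsFld W Y) (X : K →ₗ[A] U) (n : ℤ) (c : K ⊗[A] K) :
    Tendsto (fun N => mulMap X Y (𝔎.p N n * c)) atTop (𝓝 (𝔎.ext n X Y c)) :=
  tendsto_nhds_limUnder (exists_ext 𝔎 hW h X n c)

theorem ext_eq {Y : K →ₗ[A] U} (h : 𝔎.IsFld W Y) {X : K →ₗ[A] U} {n : ℤ} {c : K ⊗[A] K} {L : U}
    (hL : Tendsto (fun N => mulMap X Y (𝔎.p N n * c)) atTop (𝓝 L)) : 𝔎.ext n X Y c = L :=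
  tendsto_nhds_unique (tendsto_ext hW h X n c) hL

/-- The approximations of `ext n X Y (v * c)` are uniform in `X` and in `v ∈ S 0`. -/
theorem ext_uniform {Y : K →ₗ[A] U} (h : 𝔎.IsFld W Y) (n : ℤ) (q : ℕ) (c : K ⊗[A] K) :
    ∃ N₀, ∀ N ≥ N₀, ∀ X : K →ₗ[A] U, ∀ v ∈ 𝔎.S 0,
      mulMap X Y (𝔎.p N n * (v * c)) - 𝔎.ext n X Y (v * c) ∈ W q := by
  obtain ⟨m, hm⟩ := h.mulMap_mul_mem q c
  refine ⟨m, fun N hN X v hv => ?_⟩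
  refine hW.mem_of_tendsto (tendsto_const_nhds.sub (tendsto_ext hW h X n (v * c))) ?_
  filter_upwards [eventually_ge_atTop N] with M hM
  rw [← neg_mem_iff, neg_sub, ← map_sub, ← sub_mul, ← mul_assoc]
  refine hm _ ?_ X
  have := 𝔎.S_mul (𝔎.S_anti hN (𝔎.p_cauchy n hM)) hv
  rwa [add_zero] at this

theorem continuous_mulMap_left {Zs : ℕ → K →ₗ[A] U} {Z : K →ₗ[A] U}
    (h : ∀ k, Tendsto (fun N => Zs N k) atTop (𝓝 (Z k))) (Y : K →ₗ[A] U) (c : K ⊗[A] K) :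
    Tendsto (fun N => mulMap (Zs N) Y c) atTop (𝓝 (mulMap Z Y c)) := by
  induction c with
  | zero => simp
  | tmul k l => exact (h k).mul_const _
  | add a b ha hb => simpa only [map_add] using ha.add hb

theorem continuous_mulMap_right {Zs : ℕ → K →ₗ[A] U} {Z : K →ₗ[A] U}
    (h : ∀ k, Tendsto (fun N => Zs N k) atTop (𝓝 (Z k))) (Y : K →ₗ[A] U) (c : K ⊗[A] K) :
    Tendsto (fun N => mulMap Y (Zs N) c) atTop (𝓝 (mulMap Y Z c)) := by
  induction c with
  | zero => simp
  | tmul k l => exact (h l).const_mul _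
  | add a b ha hb => simpa only [map_add] using ha.add hb

/-- When the right factor is approximated along with the kernel, the second components of the kernel
run through `O 0` as `N` grows; uniformity on `O 0 * g` is what controls this. -/
theorem tendsto_ext_of_uniform {a Z : K →ₗ[A] U} {Zs : ℕ → K →ₗ[A] U} (hZ : 𝔎.IsFld W Z) {g : K}
    (h : ∀ q, ∀ᶠ N in atTop, ∀ r ∈ 𝔎.O 0, Zs N (r * g) - Z (r * g) ∈ W q) (n : ℤ) (k : K) :
    Tendsto (fun N => mulMap a (Zs N) (𝔎.p N n * k ⊗ₜ g)) atTop (𝓝 (𝔎.ext n a Z (k ⊗ₜ g))) := by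
  have h0 : Tendsto (fun N => mulMap a (Zs N - Z) (𝔎.p N n * k ⊗ₜ g)) atTop (𝓝 0) := by
    rw [hW.tendsto_iff]
    intro q
    filter_upwards [h q] with N hN
    rw [sub_zero]
    exact mulMap_mem_of_right hN a k (𝔎.p_mem N n)
  have := h0.add (tendsto_ext hW hZ a n (k ⊗ₜ g))
  simpa [mulMap_sub_right] using this

/-- For the left factor pointwise convergence is enough: approximations of `ext` are uniform in it,
so the kernel can be frozen at one index `m`, which leaves a fixed tensor. -/
theorem tendsto_ext_of_pointwise {a Z : K →ₗ[A] U} {Zs : ℕ → K →ₗ[A] U} (ha : 𝔎.IsFld W a)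
    (h : ∀ k, Tendsto (fun N => Zs N k) atTop (𝓝 (Z k))) (n : ℤ) (c : K ⊗[A] K) :
    Tendsto (fun N => mulMap (Zs N) a (𝔎.p N n * c)) atTop (𝓝 (𝔎.ext n Z a c)) := by
  rw [hW.tendsto_iff]
  intro q
  obtain ⟨m, hm⟩ := ext_uniform hW ha n q c
  have h1 : (1 : K ⊗[A] K) ∈ 𝔎.S 0 := 𝔎.tmul_mem 1 𝔎.one_mem
  have hc := hW.tendsto_iff.1 (continuous_mulMap_left hW h a (𝔎.p m n * c)) q
  filter_upwards [hc, eventually_ge_atTop m] with N h2 hN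
  have e1 := hm N hN (Zs N) 1 h1
  have e2 := hm m le_rfl (Zs N) 1 h1
  have e3 := hm m le_rfl Z 1 h1
  rw [one_mul] at e1 e2 e3
  have := add_mem (add_mem (sub_mem e1 e2) h2) e3
  convert this using 1
  abel

end DiagonalKernel
end FieldCalculus

/-! ### The chiral product, the `n`-th products and their linearity over `A`, `R` and `∂`. -/

section FieldCalculus
variable {A K U : Type*} [CommRing A] [CommRing K] [Algebra A K] [Ring U] [Algebra A U]
  [UniformSpace U] [IsUniformAddGroup U] [IsTopologicalRing U] [CompleteSpace U] [T2Space U]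
namespace DiagonalKernel
variable {𝔎 : DiagonalKernel A K} {W : ℕ → Ideal U} (hW : IsIdealBasis W)

theorem continuous_smul_const (a : A) : Continuous fun x : U => a • x := by
  simp only [Algebra.smul_def]; exact continuous_const_mul _

/-- `ext` as a linear map. -/
noncomputable def extLin (n : ℤ) (X : K →ₗ[A] U) (Y : 𝔎.fields W) : K ⊗[A] K →ₗ[A] U where
  toFun := 𝔎.ext n X Y.1
  map_add' c c' := ext_eq hW Y.2 (by
    simpa only [mul_add, map_add] using (tendsto_ext hW Y.2 X n c).add (tendsto_ext hW Y.2 X n c'))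
  map_smul' a c := ext_eq hW Y.2 (by
    exact (((continuous_smul_const (U := U) a).tendsto _).comp (tendsto_ext hW Y.2 X n c)).congr
      fun N => by simp)

theorem extLin_apply (n : ℤ) (X : K →ₗ[A] U) (Y : 𝔎.fields W) (c : K ⊗[A] K) :
    extLin hW n X Y c = 𝔎.ext n X Y.1 c := rfl

theorem extLin_add_left (n : ℤ) (X X' : K →ₗ[A] U) (Y : 𝔎.fields W) :
    extLin hW n (X + X') Y = extLin hW n X Y + extLin hW n X' Y :=
  LinearMap.ext fun c => ext_eq hW Y.2 (by
    exact ((tendsto_ext hW Y.2 X n c).add (tendsto_ext hW Y.2 X' n c)).congr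
      fun N => by simp [mulMap_add_left])

theorem extLin_add_right (n : ℤ) (X : K →ₗ[A] U) (Y Y' : 𝔎.fields W) :
    extLin hW n X (Y + Y') = extLin hW n X Y + extLin hW n X Y' :=
  LinearMap.ext fun c => ext_eq hW (Y + Y').2 (by
    exact ((tendsto_ext hW Y.2 X n c).add (tendsto_ext hW Y'.2 X n c)).congr
      fun N => by simp [mulMap_add_right])

theorem extLin_smul_left (n : ℤ) (a : A) (X : K →ₗ[A] U) (Y : 𝔎.fields W) :
    extLin hW n (a • X) Y = a • extLin hW n X Y :=
  LinearMap.ext fun c => ext_eq hW Y.2 (by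
    exact (((continuous_smul_const (U := U) a).tendsto _).comp (tendsto_ext hW Y.2 X n c)).congr
      fun N => by simp [mulMap_smul_left])

theorem extLin_smul_right (n : ℤ) (a : A) (X : K →ₗ[A] U) (Y : 𝔎.fields W) :
    extLin hW n X (a • Y) = a • extLin hW n X Y :=
  LinearMap.ext fun c => ext_eq hW (a • Y).2 (by
    exact (((continuous_smul_const (U := U) a).tendsto _).comp (tendsto_ext hW Y.2 X n c)).congr
      fun N => by simp [mulMap_smul_right])

theorem extLin_diag (n : ℤ) (X : K →ₗ[A] U) (Y : 𝔎.fields W) (c : K ⊗[A] K) :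
    extLin hW n X Y (𝔎.δ * c) = extLin hW (n + 1) X Y c := by
  refine ext_eq hW Y.2 (tendsto_congr_null hW Y.2 X ?_ (tendsto_ext hW Y.2 X (n + 1) c))
  have := (Null.of_mem fun N => 𝔎.diag_mul N n).mul_const c
  convert this using 2
  ring

theorem extLin_nat (n : ℕ) (X : K →ₗ[A] U) (Y : 𝔎.fields W) (c : K ⊗[A] K) :
    extLin hW n X Y c = mulMap X Y.1 (𝔎.δ ^ n * c) :=
  ext_eq hW Y.2 (by simpa only [𝔎.p_nat] using tendsto_const_nhds)

@[simp] theorem swapK_tmul (k l : K) : swapK (k ⊗ₜ[A] l) = l ⊗ₜ k := rfl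

theorem swapK_diag : swapK 𝔎.δ = -𝔎.δ := by simp

/-- The chiral product `μ ((t ⊗ 1 - 1 ⊗ t) ^ n c · X ⊠ Y)`. -/
noncomputable def prodMap (n : ℤ) (X Y : 𝔎.fields W) : K ⊗[A] K →ₗ[A] U :=
  extLin hW n X.1 Y - sgn n • (extLin hW n Y.1 X ∘ₗ swapK)

theorem prodMap_apply (n : ℤ) (X Y : 𝔎.fields W) (c : K ⊗[A] K) :
    prodMap hW n X Y c = extLin hW n X.1 Y c - sgn n • extLin hW n Y.1 X (swapK c) := rfl

theorem prodMap_diag (n : ℤ) (X Y : 𝔎.fields W) (c : K ⊗[A] K) :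
    prodMap hW n X Y (𝔎.δ * c) = prodMap hW (n + 1) X Y c := by
  rw [prodMap_apply, prodMap_apply, extLin_diag, swapK_mul, swapK_diag, neg_mul, map_neg,
    extLin_diag, sgn_add, sgn_one]
  simp

theorem prodMap_diag_pow (n : ℤ) (m : ℕ) (X Y : 𝔎.fields W) (c : K ⊗[A] K) :
    prodMap hW n X Y (𝔎.δ ^ m * c) = prodMap hW (n + m) X Y c := by
  induction m generalizing n with
  | zero => simp
  | succ m ih => 
    have e : n + 1 + (m : ℤ) = n + (m + 1 : ℕ) := by push_cast; ring
    rw [pow_succ', mul_assoc, prodMap_diag, ih, e]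

/-- Skew-symmetry: the commutator changes sign, and exchanging the variables multiplies the `n`-th
power of the diagonal by `sgn n`. -/
theorem prodMap_swap (n : ℤ) (X Y : 𝔎.fields W) (c : K ⊗[A] K) :
    prodMap hW n Y X (swapK c) = - sgn n • prodMap hW n X Y c := by
  have hs : swapK (swapK c) = c := (TensorProduct.comm A K K).symm_apply_apply c
  rw [prodMap_apply, prodMap_apply, hs, smul_sub, smul_smul, neg_mul, sgn_mul_self]
  simp only [neg_smul, one_smul]
  abel

theorem prodMap_zero_tmul (X Y : 𝔎.fields W) (k l : K) :
    prodMap hW 0 X Y (k ⊗ₜ l) = X.1 k * Y.1 l - Y.1 l * X.1 k := by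
  have h1 := extLin_nat hW 0 X.1 Y (k ⊗ₜ l)
  have h2 := extLin_nat hW 0 Y.1 X (l ⊗ₜ k)
  rw [Nat.cast_zero] at h1 h2
  rw [prodMap_apply, h1, sgn_zero]
  simp [h2]

include hW in
/-- Continuity of the chiral product in the first variable. -/
theorem ext_small_left {X : K →ₗ[A] U} (hX : 𝔎.IsFld W X) {Y : K →ₗ[A] U} (hY : 𝔎.IsFld W Y)
    (n : ℤ) (q : ℕ) (g : K) : ∃ m, ∀ r ∈ 𝔎.O m, 𝔎.ext n X Y (r ⊗ₜ g) ∈ W q := by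
  -- One approximation serves all first components `r` at once, so it remains to treat the fixed
  -- tensor `p N n`.
  obtain ⟨N, hN⟩ := ext_uniform hW hY n q (1 ⊗ₜ g)
  have key : ∀ c : K ⊗[A] K, ∃ m, ∀ r ∈ 𝔎.O m, mulMap X Y (c * r ⊗ₜ g) ∈ W q := fun c => by
    induction c with
    | zero => exact ⟨0, by simp⟩
    | tmul k l =>
      obtain ⟨s, hs⟩ := hW.mul_right (Y (l * g)) q
      obtain ⟨m, hm⟩ := (hX.comp_mul k) s
      exact ⟨m, fun r hr => by simpa using hs _ (hm r hr)⟩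
    | add a b ha hb =>
      obtain ⟨m, hm⟩ := ha
      obtain ⟨m', hm'⟩ := hb
      refine ⟨max m m', fun r hr => ?_⟩
      rw [add_mul, map_add]
      exact add_mem (hm r (𝔎.O_anti (le_max_left _ _) hr)) (hm' r (𝔎.O_anti (le_max_right _ _) hr))
  obtain ⟨m, hm⟩ := key (𝔎.p N n)
  refine ⟨m, fun r hr => ?_⟩
  have h1 := hN N le_rfl X (r ⊗ₜ 1) (𝔎.tmul_mem r 𝔎.one_mem)
  rw [Algebra.TensorProduct.tmul_mul_tmul, mul_one, one_mul] at h1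
  have := sub_mem (hm r hr) h1
  simpa using this

include hW in
theorem ext_small_right {X : K →ₗ[A] U} {Y : K →ₗ[A] U} (hY : 𝔎.IsFld W Y)
    (n : ℤ) (q : ℕ) (g : K) : ∃ m, ∀ r ∈ 𝔎.O m, 𝔎.ext n X Y (g ⊗ₜ r) ∈ W q := by
  obtain ⟨m, hm⟩ := hY.mulMap_mem q
  refine ⟨m, fun r hr => ?_⟩
  refine hW.mem_of_tendsto (tendsto_ext hW hY X n _) (Eventually.of_forall fun N => hm _ ?_ X)
  have := 𝔎.S_mul (𝔎.p_mem N n) (𝔎.tmul_mem g hr)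
  rwa [zero_add] at this

theorem prodMap_small_left (n : ℤ) (X Y : 𝔎.fields W) (q : ℕ) (g : K) :
    ∃ m, ∀ r ∈ 𝔎.O m, prodMap hW n X Y (r ⊗ₜ g) ∈ W q := by
  obtain ⟨m, hm⟩ := ext_small_left hW X.2 Y.2 n q g
  obtain ⟨m', hm'⟩ := ext_small_right hW (X := Y.1) X.2 n q g
  exact ⟨max m m', fun r hr => sub_mem (hm r (𝔎.O_anti (le_max_left _ _) hr))
    (zsmul_mem (hm' r (𝔎.O_anti (le_max_right _ _) hr)) _)⟩

theorem prodMap_small_right (n : ℤ) (X Y : 𝔎.fields W) (q : ℕ) (g : K) :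
    ∃ m, ∀ r ∈ 𝔎.O m, prodMap hW n X Y (g ⊗ₜ r) ∈ W q := by
  obtain ⟨m, hm⟩ := prodMap_small_left hW n Y X q g
  refine ⟨m, fun r hr => ?_⟩
  have h := prodMap_swap hW n Y X (r ⊗ₜ g)
  rw [swapK_tmul] at h
  rw [h]
  exact zsmul_mem (hm r hr) _

/-- The `n`-th product of two fields. -/
noncomputable def nProd (n : ℤ) (X Y : 𝔎.fields W) : 𝔎.fields W :=
  ⟨prodMap hW n X Y ∘ₗ TensorProduct.mk A K K 1, fun q => prodMap_small_right hW n X Y q 1⟩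

theorem nProd_apply (n : ℤ) (X Y : 𝔎.fields W) (g : K) :
    (nProd hW n X Y).1 g = prodMap hW n X Y (1 ⊗ₜ g) := rfl

theorem prodMap_add_left (n : ℤ) (X X' Y : 𝔎.fields W) :
    prodMap hW n (X + X') Y = prodMap hW n X Y + prodMap hW n X' Y := by
  refine LinearMap.ext fun c => ?_
  simp only [prodMap_apply, Submodule.coe_add, extLin_add_left, extLin_add_right,
    LinearMap.add_apply, smul_add]
  abel

theorem prodMap_add_right (n : ℤ) (X Y Y' : 𝔎.fields W) :
    prodMap hW n X (Y + Y') = prodMap hW n X Y + prodMap hW n X Y' := by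
  refine LinearMap.ext fun c => ?_
  simp only [prodMap_apply, Submodule.coe_add, extLin_add_left, extLin_add_right,
    LinearMap.add_apply, smul_add]
  abel

theorem prodMap_smul_left (n : ℤ) (a : A) (X Y : 𝔎.fields W) :
    prodMap hW n (a • X) Y = a • prodMap hW n X Y := by
  simp only [prodMap, Submodule.coe_smul, extLin_smul_left, extLin_smul_right, LinearMap.smul_comp,
    smul_sub, smul_comm a]

theorem prodMap_smul_right (n : ℤ) (a : A) (X Y : 𝔎.fields W) :
    prodMap hW n X (a • Y) = a • prodMap hW n X Y := by
  simp only [prodMap, Submodule.coe_smul, extLin_smul_left, extLin_smul_right, LinearMap.smul_comp,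
    smul_sub, smul_comm a]

/-- The `n`-th product as a bilinear map. -/
noncomputable def nProdL (n : ℤ) : 𝔎.fields W →ₗ[A] 𝔎.fields W →ₗ[A] 𝔎.fields W :=
  LinearMap.mk₂ A (nProd hW n)
    (fun X X' Y => Subtype.ext <| LinearMap.ext fun g => by
      simp [nProd_apply, prodMap_add_left])
    (fun a X Y => Subtype.ext <| LinearMap.ext fun g => by
      simp [nProd_apply, prodMap_smul_left])
    (fun X Y Y' => Subtype.ext <| LinearMap.ext fun g => by
      simp [nProd_apply, prodMap_add_right])
    (fun a X Y => Subtype.ext <| LinearMap.ext fun g => by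
      simp [nProd_apply, prodMap_smul_right])

theorem nProdL_apply (n : ℤ) (X Y : 𝔎.fields W) : nProdL hW n X Y = nProd hW n X Y := rfl

/-- The field `X (k ·)`. -/
def mulFld (X : 𝔎.fields W) (k : K) : 𝔎.fields W := ⟨X.1 ∘ₗ LinearMap.mulLeft A k, X.2.comp_mul k⟩

/-- The field `X ∘ ∂`. -/
def derFld (X : 𝔎.fields W) : 𝔎.fields W := ⟨X.1 ∘ₗ (𝔎.der : K →ₗ[A] K), X.2.comp_der⟩

theorem mulMap_mulFld (X Y : K →ₗ[A] U) (k l : K) (c : K ⊗[A] K) :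
    mulMap (X ∘ₗ LinearMap.mulLeft A k) (Y ∘ₗ LinearMap.mulLeft A l) c =
      mulMap X Y (c * k ⊗ₜ l) := by
  induction c with
  | zero => simp
  | tmul a b => simp [mul_comm]
  | add a b ha hb => rw [map_add, ha, hb, add_mul, map_add]

theorem extLin_mulFld (n : ℤ) (X Y : 𝔎.fields W) (k l : K) (c : K ⊗[A] K) :
    extLin hW n (mulFld X k).1 (mulFld Y l) c = extLin hW n X.1 Y (c * k ⊗ₜ l) :=
  ext_eq hW (mulFld Y l).2 (by
    have := tendsto_ext hW Y.2 X.1 n (c * k ⊗ₜ l)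
    simp only [← mul_assoc] at this
    simp only [mulFld, mulMap_mulFld]
    exact this)

theorem prodMap_mulFld (n : ℤ) (X Y : 𝔎.fields W) (k l : K) (c : K ⊗[A] K) :
    prodMap hW n (mulFld X k) (mulFld Y l) c = prodMap hW n X Y (c * k ⊗ₜ l) := by
  rw [prodMap_apply, prodMap_apply, extLin_mulFld, extLin_mulFld, swapK_mul]
  rfl

theorem mulFld_one (X : 𝔎.fields W) : mulFld X 1 = X :=
  Subtype.ext (LinearMap.ext fun k => by simp [mulFld])

theorem nProd_mulFld_right (n : ℤ) (X Y : 𝔎.fields W) (k : K) :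
    nProd hW n X (mulFld Y k) = mulFld (nProd hW n X Y) k :=
  Subtype.ext (LinearMap.ext fun g => by
    have := prodMap_mulFld hW n X Y 1 k (1 ⊗ₜ g)
    rw [mulFld_one] at this
    rw [nProd_apply, this]
    simp [mulFld, nProd_apply, mul_comm])

theorem nProd_mulFld_left_apply (n : ℤ) (X Y : 𝔎.fields W) (k g : K) :
    (nProd hW n (mulFld X k) Y).1 g = prodMap hW n X Y (k ⊗ₜ g) := by
  have := prodMap_mulFld hW n X Y k 1 (1 ⊗ₜ g)
  rw [mulFld_one] at this
  rw [nProd_apply, this]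
  simp

theorem mulMap_derFld_left (X Y : K →ₗ[A] U) (c : K ⊗[A] K) :
    mulMap (X ∘ₗ (𝔎.der : K →ₗ[A] K)) Y c = mulMap X Y (𝔎.d1 c) := by
  induction c with
  | zero => simp
  | tmul a b => simp
  | add a b ha hb => rw [map_add, ha, hb, map_add, map_add]

theorem mulMap_derFld_right (X Y : K →ₗ[A] U) (c : K ⊗[A] K) :
    mulMap X (Y ∘ₗ (𝔎.der : K →ₗ[A] K)) c = mulMap X Y (𝔎.d2 c) := by
  induction c with
  | zero => simp
  | tmul a b => simp
  | add a b ha hb => rw [map_add, ha, hb, map_add, map_add]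

/-- Leibniz rule for `∂ ⊗ 1` on kernel times `c`; differentiating the kernel lowers the exponent of
the diagonal by one. -/
theorem extLin_derFld_left (n : ℤ) (X : K →ₗ[A] U) (Y : 𝔎.fields W) (c : K ⊗[A] K) :
    extLin hW n (X ∘ₗ (𝔎.der : K →ₗ[A] K)) Y c =
      extLin hW n X Y (𝔎.d1 c) + n • extLin hW (n - 1) X Y c := by
  refine ext_eq hW Y.2 ?_
  have h := (tendsto_ext hW Y.2 X n (𝔎.d1 c)).add
    ((tendsto_ext hW Y.2 X (n - 1) (n • c)))
  rw [extLin_apply, extLin_apply, ← extLin_apply hW _ _ _ c, ← map_zsmul, extLin_apply]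
  simp only [← map_add] at h
  simp only [mulMap_derFld_left]
  refine tendsto_congr_null hW Y.2 X ?_ h
  have := (Null.of_mem fun N => 𝔎.d1_p N n).mul_const c
  convert this using 2
  rw [𝔎.d1_mul, sub_mul, mul_smul_comm, smul_mul_assoc]
  abel

theorem extLin_derFld_right (n : ℤ) (X : K →ₗ[A] U) (Y : 𝔎.fields W) (c : K ⊗[A] K) :
    extLin hW n X (derFld Y) c =
      extLin hW n X Y (𝔎.d2 c) - n • extLin hW (n - 1) X Y c := by
  refine ext_eq hW (derFld Y).2 ?_
  have h := (tendsto_ext hW Y.2 X n (𝔎.d2 c)).sub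
    ((tendsto_ext hW Y.2 X (n - 1) (n • c)))
  rw [extLin_apply, extLin_apply, ← extLin_apply hW _ _ _ c, ← map_zsmul, extLin_apply]
  simp only [← map_sub] at h
  simp only [derFld, mulMap_derFld_right]
  refine tendsto_congr_null hW Y.2 X ?_ h
  have := (Null.of_mem_succ (s := fun N => 𝔎.d2 (𝔎.p N n) + n • 𝔎.p N (n - 1))
    fun N => 𝔎.d2_p N n).mul_const c
  convert this using 2
  rw [𝔎.d2_mul, add_mul, mul_smul_comm, smul_mul_assoc]
  abel

/-- With `1` in the first slot only the power of the diagonal gets differentiated. The right action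
of `∂` is the negative of the usual translation operator, which explains the sign. -/
theorem nProd_derFld_left (n : ℤ) (X Y : 𝔎.fields W) :
    nProd hW n (derFld X) Y = n • nProd hW (n - 1) X Y :=
  Subtype.ext (LinearMap.ext fun g => by
    have h1 := extLin_derFld_left hW n X.1 Y (1 ⊗ₜ g)
    have h2 := extLin_derFld_right hW n Y.1 X (g ⊗ₜ 1)
    rw [nProd_apply, prodMap_apply, swapK_tmul, h2]
    simp only [derFld, h1]
    simp only [LinearMap.rTensor_tmul, LinearMap.lTensor_tmul, Derivation.coeFn_coe,
      Derivation.map_one_eq_zero, TensorProduct.zero_tmul, TensorProduct.tmul_zero, map_zero]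
    change _ = n • (prodMap hW (n - 1) X Y (1 ⊗ₜ g))
    rw [prodMap_apply, swapK_tmul, sgn_sub, sgn_one, mul_neg_one, neg_smul,
      sub_neg_eq_add, smul_add, zero_add, zero_sub, smul_neg, sub_neg_eq_add, smul_comm n])

theorem nProd_derFld_right (n : ℤ) (X Y : 𝔎.fields W) :
    nProd hW n X (derFld Y) = derFld (nProd hW n X Y) - n • nProd hW (n - 1) X Y :=
  Subtype.ext (LinearMap.ext fun g => by
    have h1 := extLin_derFld_left hW n Y.1 X (g ⊗ₜ 1)
    have h2 := extLin_derFld_right hW n X.1 Y (1 ⊗ₜ g)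
    rw [nProd_apply, prodMap_apply, swapK_tmul, h2]
    simp only [derFld, h1]
    simp only [LinearMap.rTensor_tmul, LinearMap.lTensor_tmul, Derivation.coeFn_coe]
    change _ = (prodMap hW n X Y (1 ⊗ₜ 𝔎.der g)) - n • (prodMap hW (n - 1) X Y (1 ⊗ₜ g))
    rw [prodMap_apply, prodMap_apply, swapK_tmul, swapK_tmul, sgn_sub,
      sgn_one, mul_neg_one, neg_smul, sub_neg_eq_add, smul_add, smul_add, smul_comm n]
    abel)

end DiagonalKernel
end FieldCalculus

/-! ### Finite approximations of products and their commutators, without topology. -/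

section FieldCalculus
variable {A K U : Type*} [CommRing A] [CommRing K] [Algebra A K] [Ring U] [Algebra A U]

section DivPow
variable [Algebra ℂ A] (D : Derivation A K K)

theorem divPow_one_eq_zero (j : ℕ) : divPow (D : K →ₗ[A] K) (j + 1) 1 = 0 := by
  have h : ((D : K →ₗ[A] K) ^ (j + 1)) 1 = 0 := by
    rw [pow_succ, Module.End.mul_apply]
    simp
  rw [divPow, LinearMap.smul_apply, h, smul_zero]

/-- Leibniz rule for divided powers: since `D t = 1` and `D 1 = 0`, only two terms survive. -/
theorem divPow_mul_coord {t : K} (ht : D t = 1) (j : ℕ) (k : K) :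
    divPow (D : K →ₗ[A] K) (j + 1) (t * k) =
      t * divPow (D : K →ₗ[A] K) (j + 1) k + divPow (D : K →ₗ[A] K) j k := by
  have hD : ∀ k, (D : K →ₗ[A] K) (t * k) = t * (D : K →ₗ[A] K) k + k := fun k => by
    simp [ht]
  have inj : ∀ (j : ℕ) (x y : K), (j + 1) • x = (j + 1) • y → x = y := fun j x y h => by
    rw [← inv_smul_nsmul_succ (A := A) j x, h, inv_smul_nsmul_succ]
  induction j with
  | zero =>
    refine inj 0 _ _ ?_
    rw [divPow_succ_apply, nsmul_add, ← mul_smul_comm, divPow_succ_apply]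
    simp only [divPow_zero, LinearMap.id_apply, hD]
    simp
  | succ j ih =>
    refine inj (j + 1) _ _ ?_
    rw [divPow_succ_apply, nsmul_add, ← mul_smul_comm, divPow_succ_apply, ih, map_add, hD,
      ← divPow_succ_apply _ j k]
    module

theorem divPow_rTensor (j : ℕ) (k l : K) :
    divPow ((D : K →ₗ[A] K).rTensor K) j (k ⊗ₜ l) = divPow (D : K →ₗ[A] K) j k ⊗ₜ l := by
  have h : (((D : K →ₗ[A] K).rTensor K) ^ j) (k ⊗ₜ[A] l) = ((D : K →ₗ[A] K) ^ j) k ⊗ₜ l := by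
    induction j with
    | zero => rfl
    | succ j ih => rw [pow_succ', Module.End.mul_apply, ih, pow_succ']; rfl
  rw [divPow, LinearMap.smul_apply, h, divPow, LinearMap.smul_apply, TensorProduct.smul_tmul']

theorem divPow_lTensor (j : ℕ) (k l : K) :
    divPow ((D : K →ₗ[A] K).lTensor K) j (k ⊗ₜ l) = k ⊗ₜ divPow (D : K →ₗ[A] K) j l := by
  have h : (((D : K →ₗ[A] K).lTensor K) ^ j) (k ⊗ₜ[A] l) = k ⊗ₜ ((D : K →ₗ[A] K) ^ j) l := by
    induction j with
    | zero => rfl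
    | succ j ih => rw [pow_succ', Module.End.mul_apply, ih, pow_succ']; rfl
  rw [divPow, LinearMap.smul_apply, h, divPow, LinearMap.smul_apply, TensorProduct.tmul_smul]

end DivPow

/-- `g ↦ ∑ X (k) Z (l g)` for `u = ∑ k ⊗ l`. -/
noncomputable def lop (u : K ⊗[A] K) (X Z : K →ₗ[A] U) : K →ₗ[A] U :=
  mulMap X Z ∘ₗ LinearMap.mulLeft A u ∘ₗ TensorProduct.mk A K K 1

/-- `g ↦ ∑ Z (k g) X (l)` for `u = ∑ k ⊗ l`. -/
noncomputable def rop (u : K ⊗[A] K) (X Z : K →ₗ[A] U) : K →ₗ[A] U :=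
  mulMap Z X ∘ₗ LinearMap.mulLeft A u ∘ₗ (TensorProduct.mk A K K).flip 1

theorem lop_apply (u : K ⊗[A] K) (X Z : K →ₗ[A] U) (g : K) :
    lop u X Z g = mulMap X Z (u * 1 ⊗ₜ g) := rfl

theorem rop_apply (u : K ⊗[A] K) (X Z : K →ₗ[A] U) (g : K) :
    rop u X Z g = mulMap Z X (u * g ⊗ₜ 1) := rfl

theorem lop_tmul (k l : K) (X Z : K →ₗ[A] U) (g : K) : lop (k ⊗ₜ l) X Z g = X k * Z (l * g) := by
  simp [lop_apply]

theorem rop_tmul (k l : K) (X Z : K →ₗ[A] U) (g : K) : rop (k ⊗ₜ l) X Z g = Z (k * g) * X l := by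
  simp [rop_apply]

theorem lop_zero (X Z : K →ₗ[A] U) : lop 0 X Z = 0 := LinearMap.ext fun g => by simp [lop_apply]
theorem rop_zero (X Z : K →ₗ[A] U) : rop 0 X Z = 0 := LinearMap.ext fun g => by simp [rop_apply]

theorem lop_add (u v : K ⊗[A] K) (X Z : K →ₗ[A] U) : lop (u + v) X Z = lop u X Z + lop v X Z :=
  LinearMap.ext fun g => by simp [lop_apply, add_mul]

theorem rop_add (u v : K ⊗[A] K) (X Z : K →ₗ[A] U) : rop (u + v) X Z = rop u X Z + rop v X Z :=
  LinearMap.ext fun g => by simp [rop_apply, add_mul]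

theorem lop_add_right (u : K ⊗[A] K) (X Z Z' : K →ₗ[A] U) :
    lop u X (Z + Z') = lop u X Z + lop u X Z' :=
  LinearMap.ext fun g => by simp [lop_apply, mulMap_add_right]

theorem rop_add_right (u : K ⊗[A] K) (X Z Z' : K →ₗ[A] U) :
    rop u X (Z + Z') = rop u X Z + rop u X Z' :=
  LinearMap.ext fun g => by simp [rop_apply, mulMap_add_left]

theorem lop_zero_right (u : K ⊗[A] K) (X : K →ₗ[A] U) : lop u X 0 = 0 := by
  have := lop_add_right u X 0 0
  simpa using this

theorem rop_zero_right (u : K ⊗[A] K) (X : K →ₗ[A] U) : rop u X 0 = 0 := by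
  have := rop_add_right u X 0 0
  simpa using this

/-- Left multiplications by values of `X` commute with right multiplications by values of `Y`, and
the factors inserted in the argument lie in the commutative ring `K`. -/
theorem lop_rop_comm (u v : K ⊗[A] K) (X Y Z : K →ₗ[A] U) :
    lop u X (rop v Y Z) = rop v Y (lop u X Z) := by
  induction u with
  | zero => simp only [lop_zero, rop_zero_right]
  | add a b ha hb => rw [lop_add, lop_add, rop_add_right, ha, hb]
  | tmul k l =>
    induction v with
    | zero => simp only [rop_zero, lop_zero_right]
    | add a b ha hb => rw [rop_add, rop_add, lop_add_right, ha, hb]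
    | tmul k' l' =>
      refine LinearMap.ext fun g => ?_
      rw [lop_tmul, rop_tmul, rop_tmul, lop_tmul, mul_assoc, mul_left_comm l k']

namespace DiagonalKernel
variable {𝔎 : DiagonalKernel A K} [Algebra ℂ A]

/-- If the commutator of `a` and `b` is given by an operator product expansion, associativity of
multiplication leaves a finite identity in which `∂^(j)` falls on the kernel of `a`. -/
theorem lop_lop_comm {a b : K →ₗ[A] U} {c : ℕ → K →ₗ[A] U} {J : ℕ}
    (h : ∀ k l, a k * b l - b l * a k =
      ∑ j ∈ Finset.range J, c j (divPow (𝔎.der : K →ₗ[A] K) j k * l))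
    (u v : K ⊗[A] K) (Z : K →ₗ[A] U) (g : K) :
    lop u a (lop v b Z) g - lop v b (lop u a Z) g =
      ∑ j ∈ Finset.range J, mulMap (c j) Z (divPow 𝔎.d1 j u * v * 1 ⊗ₜ g) := by
  induction u with
  | zero => simp [lop_zero, lop_zero_right]
  | add x y hx hy =>
    simp only [lop_add, lop_add_right, LinearMap.add_apply, map_add, add_mul,
      Finset.sum_add_distrib, ← hx, ← hy]
    abel
  | tmul k l =>
    induction v with
    | zero => simp [lop_zero, lop_zero_right]
    | add x y hx hy =>
      simp only [lop_add, lop_add_right, LinearMap.add_apply, map_add, add_mul, mul_add,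
        Finset.sum_add_distrib, ← hx, ← hy]
      abel
    | tmul k' l' =>
      simp only [lop_tmul, divPow_rTensor, Algebra.TensorProduct.tmul_mul_tmul, mulMap_tmul,
        ← Finset.sum_mul]
      rw [mul_left_comm l' l, ← mul_assoc, ← mul_assoc (b k'), ← mul_assoc l, ← sub_mul, h]
      simp only [mul_one]

theorem rop_rop_comm {a b : K →ₗ[A] U} {c : ℕ → K →ₗ[A] U} {J : ℕ}
    (h : ∀ k l, a k * b l - b l * a k =
      ∑ j ∈ Finset.range J, c j (divPow (𝔎.der : K →ₗ[A] K) j k * l))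
    (u v : K ⊗[A] K) (Z : K →ₗ[A] U) (g : K) :
    rop u a (rop v b Z) g - rop v b (rop u a Z) g =
      - ∑ j ∈ Finset.range J, mulMap Z (c j) (divPow 𝔎.d2 j u * v * g ⊗ₜ 1) := by
  induction u with
  | zero => simp [rop_zero, rop_zero_right]
  | add x y hx hy =>
    simp only [rop_add, rop_add_right, LinearMap.add_apply, map_add, add_mul,
      Finset.sum_add_distrib, neg_add, ← hx, ← hy]
    abel
  | tmul k l =>
    induction v with
    | zero => simp [rop_zero, rop_zero_right]
    | add x y hx hy =>
      simp only [rop_add, rop_add_right, LinearMap.add_apply, map_add, add_mul, mul_add,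
        Finset.sum_add_distrib, neg_add, ← hx, ← hy]
      abel
    | tmul k' l' =>
      simp only [rop_tmul, divPow_lTensor, Algebra.TensorProduct.tmul_mul_tmul, mulMap_tmul,
        ← Finset.mul_sum]
      simp only [mul_one]
      rw [mul_left_comm k' k, mul_assoc, mul_assoc, ← mul_sub, ← h, mul_assoc k, ← mul_neg, neg_sub]

/-- The `N`-th approximation of the `n`-th product. -/
noncomputable def op (𝔎 : DiagonalKernel A K) (N : ℕ) (n : ℤ) (X Z : K →ₗ[A] U) : K →ₗ[A] U :=
  lop (𝔎.p N n) X Z - sgn n • rop (𝔎.p N n) X Z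

theorem op_apply (N : ℕ) (n : ℤ) (X Z : K →ₗ[A] U) (g : K) :
    op 𝔎 N n X Z g = mulMap X Z (𝔎.p N n * 1 ⊗ₜ g) - sgn n • mulMap Z X (𝔎.p N n * g ⊗ₜ 1) := rfl

/-- The mixed terms cancel by `lop_rop_comm`, so only the left-left and the right-right commutators
contribute. -/
theorem op_op_comm {a b : K →ₗ[A] U} {c : ℕ → K →ₗ[A] U} {J : ℕ}
    (h : ∀ k l, a k * b l - b l * a k =
      ∑ j ∈ Finset.range J, c j (divPow (𝔎.der : K →ₗ[A] K) j k * l))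
    (N : ℕ) (m n : ℤ) (Z : K →ₗ[A] U) (g : K) :
    op 𝔎 N m a (op 𝔎 N n b Z) g - op 𝔎 N n b (op 𝔎 N m a Z) g =
      ∑ j ∈ Finset.range J, mulMap (c j) Z (divPow 𝔎.d1 j (𝔎.p N m) * 𝔎.p N n * 1 ⊗ₜ g) -
      (sgn m * sgn n) • ∑ j ∈ Finset.range J,
        mulMap Z (c j) (divPow 𝔎.d2 j (𝔎.p N m) * 𝔎.p N n * g ⊗ₜ 1) := by
  have hl : ∀ (u : K ⊗[A] K) (X Y Y' : K →ₗ[A] U) (s : ℤ),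
      lop u X (Y - s • Y') = lop u X Y - s • lop u X Y' := fun u X Y Y' s =>
    by
      have := (AddMonoidHom.mk' (lop (A := A) u X) (lop_add_right u X)).map_sub Y (s • Y')
      rw [map_zsmul] at this
      exact this
  have hr : ∀ (u : K ⊗[A] K) (X Y Y' : K →ₗ[A] U) (s : ℤ),
      rop u X (Y - s • Y') = rop u X Y - s • rop u X Y' := fun u X Y Y' s =>
    by
      have := (AddMonoidHom.mk' (rop (A := A) u X) (rop_add_right u X)).map_sub Y (s • Y')
      rw [map_zsmul] at this
      exact this
  rw [← lop_lop_comm h, ← neg_neg (∑ j ∈ Finset.range J, _), ← rop_rop_comm h]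
  simp only [op, hl, hr, LinearMap.sub_apply, LinearMap.smul_apply, lop_rop_comm, smul_sub,
    smul_smul, mul_comm (sgn n) (sgn m), neg_sub]
  abel

end DiagonalKernel
end FieldCalculus

/-! ### Locality, the operator product expansion and the commutator formula. -/

section FieldCalculus
variable {A K U : Type*} [CommRing A] [CommRing K] [Algebra A K] [Ring U] [Algebra A U]
  [UniformSpace U] [IsUniformAddGroup U] [IsTopologicalRing U] [CompleteSpace U] [T2Space U]
  [Algebra ℂ A]
namespace DiagonalKernel
variable {𝔎 : DiagonalKernel A K} {W : ℕ → Ideal U} (hW : IsIdealBasis W)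

/-- The approximations of the `n`-th product converge uniformly on `O 0 * g`. -/
theorem op_uniform (n : ℤ) (X Z : 𝔎.fields W) (g : K) (q : ℕ) : ∀ᶠ N in atTop, ∀ r ∈ 𝔎.O 0,
    op 𝔎 N n X.1 Z.1 (r * g) - (nProd hW n X Z).1 (r * g) ∈ W q := by
  obtain ⟨N₁, h1⟩ := ext_uniform hW Z.2 n q (1 ⊗ₜ g)
  obtain ⟨N₂, h2⟩ := ext_uniform hW X.2 n q 1
  filter_upwards [eventually_ge_atTop N₁, eventually_ge_atTop N₂] with N hN₁ hN₂ r hr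
  have e1 := h1 N hN₁ X.1 (1 ⊗ₜ r) (𝔎.tmul_mem 1 hr)
  have e2 := h2 N hN₂ Z.1 ((r * g) ⊗ₜ 1) (𝔎.tmul_mem _ 𝔎.one_mem)
  rw [Algebra.TensorProduct.tmul_mul_tmul, mul_one] at e1
  rw [mul_one] at e2
  rw [op_apply, nProd_apply, prodMap_apply, swapK_tmul, extLin_apply, extLin_apply]
  have := sub_mem e1 (zsmul_mem e2 (sgn n))
  convert this using 1
  rw [smul_sub]
  abel

theorem op_tendsto (n : ℤ) (X Z : 𝔎.fields W) (g : K) :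
    Tendsto (fun N => op 𝔎 N n X.1 Z.1 g) atTop (𝓝 ((nProd hW n X Z).1 g)) := by
  rw [hW.tendsto_iff]
  intro q
  filter_upwards [op_uniform hW n X Z g q] with N hN
  simpa using hN 1 𝔎.one_mem

include hW in
theorem tendsto_of_uniform {Z : K →ₗ[A] U} {Zs : ℕ → K →ₗ[A] U}
    (h : ∀ g q, ∀ᶠ N in atTop, ∀ r ∈ 𝔎.O 0, Zs N (r * g) - Z (r * g) ∈ W q) (g : K) :
    Tendsto (fun N => Zs N g) atTop (𝓝 (Z g)) := by
  rw [hW.tendsto_iff]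
  intro q
  filter_upwards [h g q] with N hN
  simpa using hN 1 𝔎.one_mem

/-- Together with `op_tendsto_left` this replaces an iterated limit by a diagonal one: the inner and
the outer product may be approximated with the same `N`, where exact algebra is available. -/
theorem op_tendsto_right (n : ℤ) (X Z : 𝔎.fields W) {Zs : ℕ → K →ₗ[A] U}
    (h : ∀ g q, ∀ᶠ N in atTop, ∀ r ∈ 𝔎.O 0, Zs N (r * g) - Z.1 (r * g) ∈ W q) (g : K) :
    Tendsto (fun N => op 𝔎 N n X.1 (Zs N) g) atTop (𝓝 ((nProd hW n X Z).1 g)) := by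
  simp only [op_apply]
  exact (tendsto_ext_of_uniform hW Z.2 (h g) n 1).sub ((tendsto_ext_of_pointwise hW X.2
    (tendsto_of_uniform hW h) n (g ⊗ₜ 1)).const_smul (sgn n))

theorem op_tendsto_left (n : ℤ) (X Z : 𝔎.fields W) {Xs : ℕ → K →ₗ[A] U}
    (h : ∀ g q, ∀ᶠ N in atTop, ∀ r ∈ 𝔎.O 0, Xs N (r * g) - X.1 (r * g) ∈ W q) (g : K) :
    Tendsto (fun N => op 𝔎 N n (Xs N) Z.1 g) atTop (𝓝 ((nProd hW n X Z).1 g)) := by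
  simp only [op_apply]
  exact (tendsto_ext_of_pointwise hW Z.2 (tendsto_of_uniform hW h) n (1 ⊗ₜ g)).sub
    ((tendsto_ext_of_uniform hW X.2 (h 1) n g).const_smul (sgn n))

/-- Locality: `(t ⊗ 1 - 1 ⊗ t) ^ m` annihilates the commutator. -/
def IsLocalAt (m : ℕ) (X Y : 𝔎.fields W) : Prop := prodMap hW m X Y = 0

/-- Mutual locality of fields. -/
def IsLocal (X Y : 𝔎.fields W) : Prop := ∃ m, IsLocalAt hW m X Y

variable {hW}

theorem IsLocalAt.eq_zero {m : ℕ} {X Y : 𝔎.fields W} (h : IsLocalAt hW m X Y) {n : ℤ}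
    (hn : (m : ℤ) ≤ n) : prodMap hW n X Y = 0 := by
  obtain ⟨d, rfl⟩ := Int.le.dest hn
  refine LinearMap.ext fun c => ?_
  rw [← prodMap_diag_pow, h]
  rfl

theorem IsLocalAt.mono {m m' : ℕ} (hm : m ≤ m') {X Y : 𝔎.fields W} (h : IsLocalAt hW m X Y) :
    IsLocalAt hW m' X Y := h.eq_zero (by exact_mod_cast hm)

theorem IsLocalAt.symm {m : ℕ} {X Y : 𝔎.fields W} (h : IsLocalAt hW m X Y) :
    IsLocalAt hW m Y X := by
  refine LinearMap.ext fun c => ?_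
  have hs : swapK (swapK c) = c := (TensorProduct.comm A K K).symm_apply_apply c
  rw [← hs, prodMap_swap, h]
  simp

theorem IsLocal.symm {X Y : 𝔎.fields W} (h : IsLocal hW X Y) : IsLocal hW Y X :=
  h.imp fun _ h => h.symm

theorem IsLocal.add {X X' Y : 𝔎.fields W} (h : IsLocal hW X Y) (h' : IsLocal hW X' Y) :
    IsLocal hW (X + X') Y := by
  obtain ⟨m, h⟩ := h
  obtain ⟨m', h'⟩ := h'
  refine ⟨max m m', ?_⟩
  have h1 := h.mono (le_max_left m m')
  have h2 := h'.mono (le_max_right m m')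
  rw [IsLocalAt] at *
  rw [prodMap_add_left, h1, h2, add_zero]

theorem IsLocal.smul {X Y : 𝔎.fields W} (a : A) (h : IsLocal hW X Y) :
    IsLocal hW (a • X) Y := by
  obtain ⟨m, h⟩ := h
  rw [IsLocalAt] at h
  exact ⟨m, by rw [IsLocalAt, prodMap_smul_left, h, smul_zero]⟩

theorem IsLocal.zero {Y : 𝔎.fields W} : IsLocal hW 0 Y := by
  refine ⟨0, ?_⟩
  have := prodMap_smul_left hW (0 : ℕ) (0 : A) 0 Y
  rw [zero_smul, zero_smul] at this
  exact this

theorem nProd_eq_zero {m : ℕ} {X Y : 𝔎.fields W} (h : IsLocalAt hW m X Y) {n : ℤ}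
    (hn : (m : ℤ) ≤ n) : nProd hW n X Y = 0 :=
  Subtype.ext (LinearMap.ext fun g => by rw [nProd_apply, h.eq_zero hn]; rfl)

section OPE

variable (hW) in
/-- The defect in the operator product expansion. -/
noncomputable def opeDefect (n : ℤ) (J : ℕ) (X Y : 𝔎.fields W) (k g : K) : U :=
  prodMap hW n X Y (k ⊗ₜ g) - ∑ j ∈ Finset.range J,
    (nProd hW (n + j) X Y).1 (divPow (𝔎.der : K →ₗ[A] K) j k * g)

theorem opeDefect_add_left (n : ℤ) (J : ℕ) (X Y : 𝔎.fields W) (k k' g : K) :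
    opeDefect hW n J X Y (k + k') g = opeDefect hW n J X Y k g + opeDefect hW n J X Y k' g := by
  simp only [opeDefect, TensorProduct.add_tmul, map_add, add_mul, Finset.sum_add_distrib]
  abel

theorem opeDefect_add_right (n : ℤ) (J : ℕ) (X Y : 𝔎.fields W) (k g g' : K) :
    opeDefect hW n J X Y k (g + g') = opeDefect hW n J X Y k g + opeDefect hW n J X Y k g' := by
  simp only [opeDefect, TensorProduct.tmul_add, map_add, mul_add, Finset.sum_add_distrib]
  abel

theorem opeDefect_smul (n : ℤ) (J : ℕ) (X Y : 𝔎.fields W) (a : A) (k g : K) :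
    opeDefect hW n J X Y (a • k) g = opeDefect hW n J X Y k (a • g) := by
  simp only [opeDefect, TensorProduct.smul_tmul, map_smul, mul_smul_comm, smul_mul_assoc]

/-- Write `t ⊗ 1` as the diagonal plus `1 ⊗ t`. The diagonal raises `n`, and the extra Leibniz terms
of the divided powers form the sum that belongs to `n + 1` and `J`. -/
theorem opeDefect_coord (n : ℤ) (J : ℕ) (X Y : 𝔎.fields W) (k g : K) :
    opeDefect hW n (J + 1) X Y (𝔎.t * k) g =
      opeDefect hW n (J + 1) X Y k (𝔎.t * g) + opeDefect hW (n + 1) J X Y k g := by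
  have e : (𝔎.t * k) ⊗ₜ[A] g = 𝔎.δ * k ⊗ₜ g + k ⊗ₜ (𝔎.t * g) := by
    simp [sub_mul]
  rw [opeDefect, opeDefect, opeDefect, e, map_add, prodMap_diag, Finset.sum_range_succ',
    Finset.sum_range_succ']
  simp only [divPow_mul_coord 𝔎.der 𝔎.der_t, add_mul, map_add, Finset.sum_add_distrib, divPow_zero,
    LinearMap.id_apply]
  simp only [mul_assoc, mul_left_comm 𝔎.t, Nat.cast_add, Nat.cast_one, add_assoc, add_comm (1 : ℤ)]
  abel

theorem opeDefect_small (n : ℤ) (J : ℕ) (X Y : 𝔎.fields W) (q : ℕ) (g : K) :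
    ∃ m, ∀ r ∈ 𝔎.O m, opeDefect hW n J X Y r g ∈ W q := by
  obtain ⟨m, hm⟩ := prodMap_small_left hW n X Y q g
  have h : ∀ j ∈ Finset.range J, ∃ m, ∀ r ∈ 𝔎.O m,
      (nProd hW (n + j) X Y).1 (divPow (𝔎.der : K →ₗ[A] K) j r * g) ∈ W q := fun j _ => by
    obtain ⟨m, hm⟩ := (mulFld (nProd hW (n + j) X Y) g).2.divPow_comp j q
    exact ⟨m, fun r hr => by simpa [mulFld, mul_comm] using hm r hr⟩
  choose! m' hm' using h
  refine ⟨max m (Finset.sup (Finset.range J) m'), fun r hr => sub_mem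
    (hm r (𝔎.O_anti (le_max_left _ _) hr)) (sum_mem fun j hj => hm' j hj r ?_)⟩
  exact 𝔎.O_anti ((Finset.le_sup (f := m') hj).trans (le_max_right _ _)) hr

include hW in
-- Descending induction on `n`, starting where locality makes both terms vanish. Once the defect
-- vanishes at `n + 1`, the one at `n` is balanced in `t`, hence in rational functions of `t`. It
-- vanishes at `k = 1`, where only the term `j = 0` remains, and therefore on a dense set of `k`.
theorem opeDefect_eq_zero {m : ℕ} {X Y : 𝔎.fields W} (h : IsLocalAt hW m X Y) (d : ℕ) :
    ∀ (n : ℤ) (J : ℕ), (m : ℤ) ≤ n + d → (m : ℤ) ≤ n + J → ∀ k g,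
      opeDefect hW n J X Y k g = 0 := by
  induction d with
  | zero =>
    intro n J hn _ k g
    rw [opeDefect, h.eq_zero (by simpa using hn), Finset.sum_eq_zero, LinearMap.zero_apply, sub_zero]
    intro j _
    rw [nProd_eq_zero h (by push_cast at hn; omega)]
    rfl
  | succ d ih =>
    intro n J hn hJ
    rcases J with _ | J
    · exact ih n 0 (by push_cast at hJ; omega) hJ
    have ht : ∀ k g, opeDefect hW n (J + 1) X Y (𝔎.t * k) g =
        opeDefect hW n (J + 1) X Y k (𝔎.t * g) := fun k g => by
      rw [opeDefect_coord, ih (n + 1) J (by push_cast at hn; omega) (by push_cast at hJ; omega),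
        add_zero]
    have hP : ∀ (P : A[X]) k g, opeDefect hW n (J + 1) X Y (aeval 𝔎.t P * k) g =
        opeDefect hW n (J + 1) X Y k (aeval 𝔎.t P * g) := fun P => by
      induction P using Polynomial.induction_on' with
      | add P Q hP hQ =>
        intro k g
        rw [map_add, add_mul, add_mul, opeDefect_add_left, opeDefect_add_right, hP, hQ]
      | monomial i a =>
        induction i with
        | zero =>
          intro k g
          simp only [monomial_zero_left, aeval_C, ← Algebra.smul_def, opeDefect_smul]
        | succ i ih' =>
          intro k g
          rw [← monomial_mul_X, map_mul, aeval_X, mul_assoc, ih', ht, mul_left_comm, ← mul_assoc]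
    have h1 : ∀ g, opeDefect hW n (J + 1) X Y 1 g = 0 := fun g => by
      rw [opeDefect, Finset.sum_range_succ', Finset.sum_eq_zero]
      · simp [divPow_zero, nProd_apply]
      · intro j _
        rw [divPow_one_eq_zero, zero_mul, map_zero]
    intro k g
    refine hW.eq_zero fun q => ?_
    obtain ⟨i, hi⟩ := opeDefect_small (hW := hW) n (J + 1) X Y q g
    obtain ⟨P, F, w, hF, hw, hk⟩ := 𝔎.dense k i
    have hw0 : opeDefect hW n (J + 1) X Y w g = 0 := by
      -- For `w = P (t) / F (t)`, pair with `F (t)⁻¹ g`: moving `F` to the right restores `w` and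
      -- `g`, while moving `P` to the right leaves `k = 1`.
      obtain ⟨u, hu⟩ := hF
      have := hP F w (↑u⁻¹ * g)
      rw [← mul_assoc, ← hu, Units.mul_inv, one_mul, hu, hw, ← mul_one (aeval 𝔎.t P), hP, h1] at this
      exact this.symm
    have := hi _ hk
    rw [← sub_add_cancel k w, opeDefect_add_left, hw0, add_zero]
    exact this

/-- The operator product expansion of local fields. -/
theorem IsLocalAt.prodMap_tmul {m : ℕ} {X Y : 𝔎.fields W} (h : IsLocalAt hW m X Y) {n : ℤ} {J : ℕ}
    (hJ : (m : ℤ) ≤ n + J) (k g : K) :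
    prodMap hW n X Y (k ⊗ₜ g) = ∑ j ∈ Finset.range J,
      (nProd hW (n + j) X Y).1 (divPow (𝔎.der : K →ₗ[A] K) j k * g) :=
  sub_eq_zero.1 (opeDefect_eq_zero h J n J hJ hJ k g)

theorem IsLocalAt.commutator {m J : ℕ} {X Y : 𝔎.fields W} (h : IsLocalAt hW m X Y) (hJ : m ≤ J)
    (k l : K) : X.1 k * Y.1 l - Y.1 l * X.1 k = ∑ j ∈ Finset.range J,
      (nProd hW j X Y).1 (divPow (𝔎.der : K →ₗ[A] K) j k * l) := by
  have := h.prodMap_tmul (n := 0) (J := J) (by simpa using hJ) k l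
  rw [prodMap_zero_tmul] at this
  simpa only [zero_add] using this

end OPE

theorem tendsto_divPow_d1 (X : K →ₗ[A] U) (Y : 𝔎.fields W) (n m : ℤ) (j : ℕ) (c : K ⊗[A] K) :
    Tendsto (fun N => mulMap X Y.1 (divPow 𝔎.d1 j (𝔎.p N n) * 𝔎.p N m * c)) atTop
      (𝓝 ((Ring.choose n j : ℤ) • extLin hW (n + m - j) X Y c)) := by
  have h := tendsto_ext hW Y.2 X (n + m - j) ((Ring.choose n j : ℤ) • c)
  rw [← extLin_apply hW, map_zsmul] at h
  refine tendsto_congr_null hW Y.2 X ?_ h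
  have h1 := ((𝔎.null_divPow_d1 n j).mul fun N => 𝔎.p_mem N m).mul_const c
  have h2 := ((Null.of_mem fun N => 𝔎.p_mul N (n - j) m).zsmul (Ring.choose n j)).mul_const c
  have e : n - (j : ℤ) + m = n + m - j := by ring
  convert h1.add h2 using 2
  simp only [e, sub_mul, smul_sub, smul_mul_assoc, mul_smul_comm]
  abel

theorem tendsto_divPow_d2 (X : K →ₗ[A] U) (Y : 𝔎.fields W) (n m : ℤ) (j : ℕ) (c : K ⊗[A] K) :
    Tendsto (fun N => mulMap X Y.1 (divPow 𝔎.d2 j (𝔎.p N n) * 𝔎.p N m * c)) atTop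
      (𝓝 (((-1) ^ j * Ring.choose n j : ℤ) • extLin hW (n + m - j) X Y c)) := by
  have h := tendsto_ext hW Y.2 X (n + m - j) (((-1) ^ j * Ring.choose n j : ℤ) • c)
  rw [← extLin_apply hW, map_zsmul] at h
  refine tendsto_congr_null hW Y.2 X ?_ h
  have h1 := ((𝔎.null_divPow_d2 n j).mul fun N => 𝔎.p_mem N m).mul_const c
  have h2 := ((Null.of_mem fun N => 𝔎.p_mul N (n - j) m).zsmul
    ((-1) ^ j * Ring.choose n j)).mul_const c
  have e : n - (j : ℤ) + m = n + m - j := by ring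
  convert h1.add h2 using 2
  simp only [e, sub_mul, smul_sub, smul_mul_assoc, mul_smul_comm]
  abel

/-- The commutator formula for the operators of `n`-th product. -/
theorem IsLocalAt.nProd_comm {J : ℕ} {a b : 𝔎.fields W} (h : IsLocalAt hW J a b) (m n : ℤ)
    (Z : 𝔎.fields W) : nProd hW m a (nProd hW n b Z) - nProd hW n b (nProd hW m a Z) =
      ∑ j ∈ Finset.range J, (Ring.choose m j : ℤ) • nProd hW (m + n - j) (nProd hW j a b) Z := by
  refine Subtype.ext (LinearMap.ext fun g => ?_)
  -- Both iterated products are limits of approximations with a common `N`, to which `op_op_comm`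
  -- applies with the commutator given by the operator product expansion.
  have h1 := (op_tendsto_right hW m a (nProd hW n b Z) (op_uniform hW n b Z) g).sub
    (op_tendsto_right hW n b (nProd hW m a Z) (op_uniform hW m a Z) g)
  simp only [op_op_comm (h.commutator le_rfl)] at h1
  refine tendsto_nhds_unique h1 ?_
  have h2 := (tendsto_finsetSum (Finset.range J) fun j _ =>
    tendsto_divPow_d1 (hW := hW) (nProd hW j a b).1 Z m n j (1 ⊗ₜ g)).sub
    ((tendsto_finsetSum (Finset.range J) fun j _ =>
    tendsto_divPow_d2 (hW := hW) Z.1 (nProd hW j a b) m n j (g ⊗ₜ 1)).const_smul (sgn m * sgn n))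
  convert h2 using 2
  rw [AddSubmonoidClass.coe_finsetSum, LinearMap.sum_apply, Finset.smul_sum,
    ← Finset.sum_sub_distrib]
  refine Finset.sum_congr rfl fun j _ => ?_
  -- The signs agree because `sgn m * sgn n * (-1) ^ j = sgn (m + n - j)`.
  change (Ring.choose m j : ℤ) • (nProd hW (m + n - j) (nProd hW j a b) Z).1 g = _
  rw [nProd_apply, prodMap_apply, swapK_tmul, smul_sub, sgn_sub, sgn_add, sgn_natCast, smul_smul,
    smul_smul]
  congr 2
  ring

end DiagonalKernel
end FieldCalculus

/-! ### Dong's lemma and the associativity formula. -/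

section FieldCalculus
variable {A K U : Type*} [CommRing A] [CommRing K] [Algebra A K] [Ring U] [Algebra A U]
  [Algebra ℂ A]
namespace DiagonalKernel
variable {𝔎 : DiagonalKernel A K}

/-- `k ↦ e (m (∂^(j) ((k ⊗ 1) u)))` with `m` the multiplication and `∂^(j)` acting on the first
variable. -/
noncomputable def diagFld (𝔎 : DiagonalKernel A K) (e : K →ₗ[A] U) (j : ℕ) (u : K ⊗[A] K) :
    K →ₗ[A] U :=
  e ∘ₗ LinearMap.mul' A K ∘ₗ divPow 𝔎.d1 j ∘ₗ LinearMap.mulRight A u ∘ₗ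
    (TensorProduct.mk A K K).flip 1

theorem diagFld_apply (e : K →ₗ[A] U) (j : ℕ) (u : K ⊗[A] K) (k : K) :
    diagFld 𝔎 e j u k = e (LinearMap.mul' A K (divPow 𝔎.d1 j (k ⊗ₜ 1 * u))) := rfl

theorem diagFld_tmul (e : K →ₗ[A] U) (j : ℕ) (g l k : K) :
    diagFld 𝔎 e j (g ⊗ₜ l) k = e (divPow (𝔎.der : K →ₗ[A] K) j (k * g) * l) := by
  simp [diagFld_apply, divPow_rTensor]

theorem diagFld_add (e : K →ₗ[A] U) (j : ℕ) (u v : K ⊗[A] K) :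
    diagFld 𝔎 e j (u + v) = diagFld 𝔎 e j u + diagFld 𝔎 e j v :=
  LinearMap.ext fun k => by simp [diagFld_apply, mul_add]

theorem diagFld_zero (e : K →ₗ[A] U) (j : ℕ) : diagFld 𝔎 e j 0 = 0 :=
  LinearMap.ext fun k => by simp [diagFld_apply]

/-- Each derivative in the first variable lowers the order of vanishing along the diagonal by at
most one. -/
theorem exists_pow_d1_diag_mul (j L : ℕ) (w : K ⊗[A] K) :
    ∃ w', (𝔎.d1 ^ j) (𝔎.δ ^ (L + j) * w) = 𝔎.δ ^ L * w' := by
  have hδ : 𝔎.d1 𝔎.δ = 1 := by simp [𝔎.der_t, Algebra.TensorProduct.one_def]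
  have hpow : ∀ n, ∃ c, 𝔎.d1 (𝔎.δ ^ (n + 1)) = 𝔎.δ ^ n * c := fun n => by
    induction n with
    | zero => exact ⟨1, by rw [zero_add, pow_one, hδ]; simp⟩
    | succ n ih =>
      obtain ⟨c, hc⟩ := ih
      refine ⟨c + 1, ?_⟩
      rw [pow_succ _ (n + 1), 𝔎.d1_mul, hc, hδ, pow_succ]
      ring
  induction j generalizing w with
  | zero => exact ⟨w, by simp⟩
  | succ j ih =>
    obtain ⟨c, hc⟩ := hpow (L + j)
    obtain ⟨w', hw'⟩ := ih (c * w + 𝔎.δ * 𝔎.d1 w)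
    refine ⟨w', ?_⟩
    rw [pow_succ, Module.End.mul_apply, ← add_assoc, 𝔎.d1_mul, hc, ← hw']
    congr 1
    rw [pow_succ]
    ring

/-- After `j < L` derivatives a factor of the diagonal is left, which vanishes when both variables
are set equal. In Dong's lemma this disposes of the terms containing the commutator of `b` and `c`.
-/
theorem diagFld_diag_pow (e : K →ₗ[A] U) {j L : ℕ} (hL : j < L) (u : K ⊗[A] K) :
    diagFld 𝔎 e j (𝔎.δ ^ L * u) = 0 := by
  refine LinearMap.ext fun k => ?_
  obtain ⟨d, rfl⟩ : ∃ d, L = (d + 1) + j := ⟨L - j - 1, by omega⟩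
  obtain ⟨w', hw'⟩ := exists_pow_d1_diag_mul (𝔎 := 𝔎) j (d + 1) (k ⊗ₜ 1 * u)
  have h0 : LinearMap.mul' A K (𝔎.δ ^ (d + 1) * w') = 0 := by
    change Algebra.TensorProduct.lmul' A (𝔎.δ ^ (d + 1) * w') = 0
    rw [map_mul, map_pow, map_sub]
    simp
  rw [diagFld_apply, mul_left_comm, divPow, LinearMap.smul_apply, hw', map_smul, h0]
  simp

section
variable {a b c : K →ₗ[A] U} {e f : ℕ → K →ₗ[A] U} {J : ℕ}

/-- The derivation rule `[ab, c] = a [b, c] + [a, c] b`, with both commutators expanded. In the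
first term the test tensor `u` is restricted to the diagonal; in the second the derivatives fall on
the kernel `v`. -/
theorem lop_commutator
    (hac : ∀ k l, a k * c l - c l * a k =
      ∑ j ∈ Finset.range J, e j (divPow (𝔎.der : K →ₗ[A] K) j k * l))
    (hbc : ∀ k l, b k * c l - c l * b k =
      ∑ j ∈ Finset.range J, f j (divPow (𝔎.der : K →ₗ[A] K) j k * l)) (v u : K ⊗[A] K) :
    mulMap (lop v a b) c u - mulMap c (lop v a b) (swapK u) =
      ∑ j ∈ Finset.range J, mulMap a (diagFld 𝔎 (f j) j u) v +
      ∑ j ∈ Finset.range J, mulMap (e j) b (divPow 𝔎.d1 j v * swapK u) := by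
  induction v with
  | zero =>
    have := mulMap_sub_left (0 : K →ₗ[A] U) 0 c
    have h2 := mulMap_sub_right c (0 : K →ₗ[A] U) 0
    simp only [sub_self] at this h2
    simp [lop_zero, this, h2]
  | add x y hx hy =>
    simp only [lop_add, mulMap_add_left, mulMap_add_right, LinearMap.add_apply, map_add, add_mul,
      Finset.sum_add_distrib]
    rw [add_sub_add_comm, hx, hy]
    abel
  | tmul k l =>
    induction u with
    | zero =>
      simp only [map_zero, diagFld_zero, mul_zero]
      simp
    | add x y hx hy =>
      simp only [diagFld_add, mulMap_add_right, LinearMap.add_apply, map_add, mul_add,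
        Finset.sum_add_distrib]
      rw [add_sub_add_comm, hx, hy]
      abel
    | tmul g h =>
      simp only [swapK_tmul, mulMap_tmul, lop_tmul, divPow_rTensor, diagFld_tmul,
        Algebra.TensorProduct.tmul_mul_tmul, ← Finset.mul_sum, ← Finset.sum_mul]
      rw [← hbc, ← hac]
      noncomm_ring

theorem rop_commutator
    (hac : ∀ k l, a k * c l - c l * a k =
      ∑ j ∈ Finset.range J, e j (divPow (𝔎.der : K →ₗ[A] K) j k * l))
    (hbc : ∀ k l, b k * c l - c l * b k =
      ∑ j ∈ Finset.range J, f j (divPow (𝔎.der : K →ₗ[A] K) j k * l)) (v u : K ⊗[A] K) :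
    mulMap (rop v a b) c u - mulMap c (rop v a b) (swapK u) =
      ∑ j ∈ Finset.range J, mulMap (diagFld 𝔎 (f j) j u) a v +
      ∑ j ∈ Finset.range J, mulMap b (e j) (divPow 𝔎.d2 j v * u) := by
  induction v with
  | zero =>
    have := mulMap_sub_left (0 : K →ₗ[A] U) 0 c
    have h2 := mulMap_sub_right c (0 : K →ₗ[A] U) 0
    simp only [sub_self] at this h2
    simp [rop_zero, this, h2]
  | add x y hx hy =>
    simp only [rop_add, mulMap_add_left, mulMap_add_right, LinearMap.add_apply, map_add, add_mul,
      Finset.sum_add_distrib]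
    rw [add_sub_add_comm, hx, hy]
    abel
  | tmul k l =>
    induction u with
    | zero =>
      simp only [map_zero, diagFld_zero, mul_zero]
      simp
    | add x y hx hy =>
      simp only [diagFld_add, mulMap_add_left, LinearMap.add_apply, map_add, mul_add,
        Finset.sum_add_distrib]
      rw [add_sub_add_comm, hx, hy]
      abel
    | tmul g h =>
      simp only [swapK_tmul, mulMap_tmul, rop_tmul, divPow_lTensor, diagFld_tmul,
        Algebra.TensorProduct.tmul_mul_tmul, ← Finset.mul_sum, ← Finset.sum_mul]
      rw [← hbc, ← hac]
      noncomm_ring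

/-- The approximation of `l ↦ μ ((t ⊗ 1 - 1 ⊗ t) ^ m (l ⊗ g) b ⊠ c)` with kernel `w`. -/
noncomputable def prodApprox (w : K ⊗[A] K) (s : ℤ) (b c : K →ₗ[A] U) (g : K) : K →ₗ[A] U :=
  mulMap b c ∘ₗ LinearMap.mulLeft A w ∘ₗ (TensorProduct.mk A K K).flip g -
    s • (mulMap c b ∘ₗ LinearMap.mulLeft A w ∘ₗ TensorProduct.mk A K K g)

theorem prodApprox_apply (w : K ⊗[A] K) (s : ℤ) (b c : K →ₗ[A] U) (g l : K) :
    prodApprox w s b c g l = mulMap b c (w * l ⊗ₜ g) - s • mulMap c b (w * g ⊗ₜ l) := rfl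

theorem prodApprox_add (w w' : K ⊗[A] K) (s : ℤ) (b c : K →ₗ[A] U) (g : K) :
    prodApprox (w + w') s b c g = prodApprox w s b c g + prodApprox w' s b c g :=
  LinearMap.ext fun l => by
    simp only [prodApprox_apply, add_mul, map_add, smul_add, LinearMap.add_apply]
    abel

theorem prodApprox_zero (s : ℤ) (b c : K →ₗ[A] U) (g : K) : prodApprox 0 s b c g = 0 :=
  LinearMap.ext fun l => by simp [prodApprox_apply]

/-- In the product of `ab` with `c`, keeping `a` on the left and moving `c` past it leaves `a` times
the inner approximation for `b` and `c`, plus a correction by the commutator of `a` and `c`. -/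
theorem lop_iterate
    (hac : ∀ k l, a k * c l - c l * a k =
      ∑ j ∈ Finset.range J, e j (divPow (𝔎.der : K →ₗ[A] K) j k * l))
    (v w : K ⊗[A] K) (s : ℤ) (g : K) :
    lop w (lop v a b) c g - s • rop w (lop v a b) c g =
      mulMap a (prodApprox w s b c g) v +
      s • ∑ j ∈ Finset.range J, mulMap (e j) b (divPow 𝔎.d1 j v * w * g ⊗ₜ 1) := by
  simp only [lop_apply w, rop_apply w]
  induction v with
  | zero =>
    have := mulMap_sub_left (0 : K →ₗ[A] U) 0 c
    have h2 := mulMap_sub_right c (0 : K →ₗ[A] U) 0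
    simp only [sub_self] at this h2
    simp [lop_zero, this, h2]
  | add x y hx hy =>
    simp only [lop_add, mulMap_add_left, mulMap_add_right, LinearMap.add_apply, map_add, add_mul,
      Finset.sum_add_distrib, smul_add]
    rw [add_sub_add_comm, hx, hy]
    abel
  | tmul k l =>
    induction w with
    | zero => simp [prodApprox_zero]
    | add x y hx hy =>
      simp only [prodApprox_add, mulMap_add_right, LinearMap.add_apply, map_add, mul_add, add_mul,
        Finset.sum_add_distrib, smul_add]
      rw [add_sub_add_comm, hx, hy]
      abel
    | tmul k' l' =>
      simp only [mulMap_tmul, lop_tmul, divPow_rTensor, prodApprox_apply,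
        Algebra.TensorProduct.tmul_mul_tmul, ← Finset.sum_mul, mul_one, mul_assoc _ k' g]
      rw [← hac, mul_comm k' l, mul_comm l' l]
      simp only [mul_sub, sub_mul, smul_sub, mul_smul_comm, mul_assoc]
      abel

/-- The mirror image of `lop_iterate`: here `a` stands on the right of `b`, so `c` is moved past it
from the other side. -/
theorem rop_iterate
    (hac : ∀ k l, a k * c l - c l * a k =
      ∑ j ∈ Finset.range J, e j (divPow (𝔎.der : K →ₗ[A] K) j k * l))
    (v w : K ⊗[A] K) (s : ℤ) (g : K) :
    lop w (rop v a b) c g - s • rop w (rop v a b) c g =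
      mulMap (prodApprox w s b c g) a v +
      ∑ j ∈ Finset.range J, mulMap b (e j) (divPow 𝔎.d2 j v * w * 1 ⊗ₜ g) := by
  simp only [lop_apply w, rop_apply w]
  induction v with
  | zero =>
    have := mulMap_sub_left (0 : K →ₗ[A] U) 0 c
    have h2 := mulMap_sub_right c (0 : K →ₗ[A] U) 0
    simp only [sub_self] at this h2
    simp [rop_zero, this, h2]
  | add x y hx hy =>
    simp only [rop_add, mulMap_add_left, mulMap_add_right, LinearMap.add_apply, map_add, add_mul,
      Finset.sum_add_distrib, smul_add]
    rw [add_sub_add_comm, hx, hy]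
    abel
  | tmul k l =>
    induction w with
    | zero =>
      have := mulMap_sub_left (0 : K →ₗ[A] U) 0 a
      simp only [sub_self] at this
      simp [prodApprox_zero, this]
    | add x y hx hy =>
      simp only [prodApprox_add, mulMap_add_left, LinearMap.add_apply, map_add, mul_add, add_mul,
        Finset.sum_add_distrib, smul_add]
      rw [add_sub_add_comm, hx, hy]
      abel
    | tmul k' l' =>
      simp only [mulMap_tmul, rop_tmul, divPow_lTensor, prodApprox_apply,
        Algebra.TensorProduct.tmul_mul_tmul, ← Finset.mul_sum, mul_one, mul_assoc _ l' g]
      rw [← hac, mul_comm k' k, mul_comm l' k]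
      simp only [mul_sub, sub_mul, smul_mul_assoc, mul_assoc]
      abel

end

variable [UniformSpace U] [IsUniformAddGroup U] [IsTopologicalRing U] [CompleteSpace U] [T2Space U]
  {W : ℕ → Ideal U} {hW : IsIdealBasis W}

theorem p_zero (N : ℕ) : 𝔎.p N 0 = 1 := by
  have := 𝔎.p_nat N 0
  rwa [Nat.cast_zero, pow_zero] at this

theorem swapK_diag_pow_mul (L : ℕ) (c : K ⊗[A] K) :
    swapK (𝔎.δ ^ L * c) = 𝔎.δ ^ L * ((-1) ^ L * swapK c) := by
  have h : swapK (𝔎.δ ^ L) = (swapK 𝔎.δ) ^ L :=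
    map_pow (Algebra.TensorProduct.comm A K K) 𝔎.δ L
  rw [swapK_mul, h, swapK_diag, neg_pow]
  ring

theorem prodMap_zero (X Y : 𝔎.fields W) (c : K ⊗[A] K) :
    prodMap hW 0 X Y c = mulMap X.1 Y.1 c - mulMap Y.1 X.1 (swapK c) := by
  have h1 := extLin_nat hW 0 X.1 Y c
  have h2 := extLin_nat hW 0 Y.1 X (swapK c)
  rw [Nat.cast_zero, pow_zero, one_mul] at h1 h2
  rw [prodMap_apply, h1, h2, sgn_zero, one_smul]

theorem tendsto_divPow_d1' (X : K →ₗ[A] U) (Y : 𝔎.fields W) (n : ℤ) (j : ℕ) (c : K ⊗[A] K) :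
    Tendsto (fun N => mulMap X Y.1 (divPow 𝔎.d1 j (𝔎.p N n) * c)) atTop
      (𝓝 ((Ring.choose n j : ℤ) • extLin hW (n - j) X Y c)) := by
  have := tendsto_divPow_d1 (hW := hW) X Y n 0 j c
  simpa only [p_zero, mul_one, add_zero] using this

theorem tendsto_divPow_d2' (X : K →ₗ[A] U) (Y : 𝔎.fields W) (n : ℤ) (j : ℕ) (c : K ⊗[A] K) :
    Tendsto (fun N => mulMap X Y.1 (divPow 𝔎.d2 j (𝔎.p N n) * c)) atTop
      (𝓝 (((-1) ^ j * Ring.choose n j : ℤ) • extLin hW (n - j) X Y c)) := by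
  have := tendsto_divPow_d2 (hW := hW) X Y n 0 j c
  simpa only [p_zero, mul_one, add_zero] using this

/-- Products of local fields are local. -/
theorem IsLocal.nProd {a b c : 𝔎.fields W} (hac : IsLocal hW a c) (hbc : IsLocal hW b c)
    (h : ∀ j : ℕ, IsLocal hW (nProd hW j a c) b) (n : ℤ) : IsLocal hW (nProd hW n a b) c := by
  obtain ⟨m₁, h1⟩ := hac
  obtain ⟨m₂, h2⟩ := hbc
  choose m₃ h3 using h
  set J := max m₁ m₂ with hJ
  have hac := h1.commutator (le_max_left m₁ m₂)
  have hbc := h2.commutator (le_max_right m₁ m₂)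
  -- `L` exceeds every `j < J`, which kills the terms with the commutator of `b` and `c`. It also
  -- satisfies `m₃ j ≤ n - j + L`, which kills those with `a_(j) c` and `b` after the diagonal power
  -- has been absorbed.
  refine ⟨(Finset.range J).sup m₃ + J + n.natAbs, LinearMap.ext fun u => ?_⟩
  set L := (Finset.range J).sup m₃ + J + n.natAbs with hL
  have e0 := prodMap_diag_pow hW 0 L (DiagonalKernel.nProd hW n a b) c u
  rw [zero_add] at e0
  rw [← e0, prodMap_zero]
  have t1 := (continuous_mulMap_left hW (op_tendsto hW n a b) c.1 (𝔎.δ ^ L * u)).sub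
    (continuous_mulMap_right hW (op_tendsto hW n a b) c.1 (swapK (𝔎.δ ^ L * u)))
  have hd : ∀ N, ∑ j ∈ Finset.range J,
      mulMap a.1 (diagFld 𝔎 (DiagonalKernel.nProd hW j b c).1 j (𝔎.δ ^ L * u)) (𝔎.p N n) = 0 :=
    fun N => Finset.sum_eq_zero fun j hj => by
      rw [diagFld_diag_pow _ (by have := Finset.mem_range.1 hj; omega)]
      have := mulMap_sub_right a.1 (0 : K →ₗ[A] U) 0
      simp only [sub_self] at this
      rw [this]; rfl
  have hd' : ∀ N, ∑ j ∈ Finset.range J,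
      mulMap (diagFld 𝔎 (DiagonalKernel.nProd hW j b c).1 j (𝔎.δ ^ L * u)) a.1 (𝔎.p N n) = 0 :=
    fun N => Finset.sum_eq_zero fun j hj => by
      rw [diagFld_diag_pow _ (by have := Finset.mem_range.1 hj; omega)]
      have := mulMap_sub_left (0 : K →ₗ[A] U) 0 a.1
      simp only [sub_self] at this
      rw [this]; rfl
  have e1 : ∀ N, mulMap (op 𝔎 N n a.1 b.1) c.1 (𝔎.δ ^ L * u) -
      mulMap c.1 (op 𝔎 N n a.1 b.1) (swapK (𝔎.δ ^ L * u)) =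
      ∑ j ∈ Finset.range J, mulMap (DiagonalKernel.nProd hW j a c).1 b.1
        (divPow 𝔎.d1 j (𝔎.p N n) * swapK (𝔎.δ ^ L * u)) -
      sgn n • ∑ j ∈ Finset.range J, mulMap b.1 (DiagonalKernel.nProd hW j a c).1
        (divPow 𝔎.d2 j (𝔎.p N n) * (𝔎.δ ^ L * u)) := fun N => by
    have q1 := lop_commutator hac hbc (𝔎.p N n) (𝔎.δ ^ L * u)
    have q2 := rop_commutator hac hbc (𝔎.p N n) (𝔎.δ ^ L * u)
    rw [hd, zero_add] at q1
    rw [hd', zero_add] at q2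
    rw [← q1, ← q2, op, mulMap_sub_left, mulMap_sub_right, ← Int.cast_smul_eq_zsmul A,
      mulMap_smul_left, mulMap_smul_right, ← Int.cast_smul_eq_zsmul A, smul_sub]
    simp only [LinearMap.sub_apply, LinearMap.smul_apply]
    abel
  simp only [e1] at t1
  refine tendsto_nhds_unique t1 ?_
  have t2 := (tendsto_finsetSum (Finset.range J) fun j _ => tendsto_divPow_d1' (hW := hW)
      (DiagonalKernel.nProd hW j a c).1 b n j (swapK (𝔎.δ ^ L * u))).sub
    ((tendsto_finsetSum (Finset.range J) fun j _ => tendsto_divPow_d2' (hW := hW)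
      b.1 (DiagonalKernel.nProd hW j a c) n j (𝔎.δ ^ L * u)).const_smul (sgn n))
  convert t2 using 2
  rw [Finset.smul_sum, ← Finset.sum_sub_distrib]
  symm
  refine Finset.sum_eq_zero fun j hj => ?_
  have hz : prodMap hW (n - j) (DiagonalKernel.nProd hW j a c) b (swapK (𝔎.δ ^ L * u)) = 0 := by
    rw [swapK_diag_pow_mul, prodMap_diag_pow, (h3 j).eq_zero]
    · rfl
    · have h4 := Finset.le_sup (f := m₃) hj
      have h5 := Finset.mem_range.1 hj
      have h6 := neg_abs_le n
      rw [hL]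
      push_cast
      have h7 : (m₃ j : ℤ) ≤ ((Finset.range J).sup m₃ : ℕ) := by exact_mod_cast h4
      have h8 : (j : ℤ) ≤ J := by exact_mod_cast h5.le
      linarith
  have hs : swapK (swapK (𝔎.δ ^ L * u)) = 𝔎.δ ^ L * u :=
    (TensorProduct.comm A K K).symm_apply_apply _
  rw [prodMap_apply, hs] at hz
  rw [smul_smul, ← mul_assoc, mul_comm _ (Ring.choose n j : ℤ), mul_smul, ← smul_sub,
    ← sgn_natCast, ← mul_comm (sgn (j : ℤ)), mul_comm (sgn (j : ℤ)), ← sgn_sub, hz, smul_zero]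

/-- Evaluation at `1` moves `∂^(j)` from the argument of `Z` onto the power of the diagonal, where
it acts in the second variable and gives `(-1) ^ j * choose n j`. -/
theorem nProd_divPow (n : ℤ) (a Z : 𝔎.fields W) (g : K) (j : ℕ) :
    (DiagonalKernel.nProd hW n a ⟨(mulFld Z g).1 ∘ₗ divPow (𝔎.der : K →ₗ[A] K) j,
      (mulFld Z g).2.divPow_comp j⟩).1 1 =
      ((-1) ^ j * Ring.choose n j : ℤ) • (DiagonalKernel.nProd hW (n - j) a Z).1 g := by
  have h1 : ∀ c, mulMap a.1 ((mulFld Z g).1 ∘ₗ divPow (𝔎.der : K →ₗ[A] K) j) c =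
      mulMap a.1 Z.1 (divPow 𝔎.d2 j c * 1 ⊗ₜ g) := fun c => by
    induction c with
    | zero => simp
    | add x y hx hy => simp only [map_add, add_mul, hx, hy]
    | tmul k l => simp [divPow_lTensor, mulFld, mul_comm]
  have h2 : ∀ c, mulMap ((mulFld Z g).1 ∘ₗ divPow (𝔎.der : K →ₗ[A] K) j) a.1 c =
      mulMap Z.1 a.1 (divPow 𝔎.d1 j c * g ⊗ₜ 1) := fun c => by
    induction c with
    | zero => simp
    | add x y hx hy => simp only [map_add, add_mul, hx, hy]
    | tmul k l => simp [divPow_rTensor, mulFld, mul_comm]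
  have t := op_tendsto hW n a ⟨(mulFld Z g).1 ∘ₗ divPow (𝔎.der : K →ₗ[A] K) j,
      (mulFld Z g).2.divPow_comp j⟩ 1
  simp only [op_apply, ← Algebra.TensorProduct.one_def, mul_one, h1, h2] at t
  refine tendsto_nhds_unique t ?_
  convert (tendsto_divPow_d2' (hW := hW) a.1 Z n j (1 ⊗ₜ g)).sub
    ((tendsto_divPow_d1' (hW := hW) Z.1 a n j (g ⊗ₜ 1)).const_smul (sgn n)) using 2
  rw [nProd_apply, prodMap_apply, swapK_tmul, smul_sub, smul_smul, smul_smul, sgn_sub, sgn_natCast]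
  congr 2
  have : ((-1 : ℤ) ^ j) * (-1) ^ j = 1 := by rw [← mul_pow]; simp
  linear_combination (Ring.choose n j * sgn n) * this

/-- The associativity formula for the products of local fields. -/
theorem IsLocalAt.nProd_nProd {a b c : 𝔎.fields W} {J J' : ℕ} {m : ℤ} (hac : IsLocalAt hW J a c)
    {m₂ : ℕ} (hbc : IsLocalAt hW m₂ b c) (hJ' : (m₂ : ℤ) ≤ m + J') (n : ℤ) :
    DiagonalKernel.nProd hW m (DiagonalKernel.nProd hW n a b) c =
      ∑ j ∈ Finset.range J', ((-1) ^ j * Ring.choose n j : ℤ) •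
        DiagonalKernel.nProd hW (n - j) a (DiagonalKernel.nProd hW (m + j) b c) -
      sgn n • ∑ j ∈ Finset.range J, ((-1) ^ j * Ring.choose n j : ℤ) •
        DiagonalKernel.nProd hW (n + m - j) b (DiagonalKernel.nProd hW j a c) := by
  refine Subtype.ext (LinearMap.ext fun g => ?_)
  -- With `g` fixed, the inner chiral product of `b` and `c` is a field `H` in its first variable.
  -- The main term of the limit is the `n`-th product of `a` with `H` at `1`.
  set H : 𝔎.fields W := ⟨prodMap hW m b c ∘ₗ (TensorProduct.mk A K K).flip g,
    fun q => prodMap_small_left hW m b c q g⟩ with hH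
  have hu : ∀ g' q, ∀ᶠ N in atTop, ∀ r ∈ 𝔎.O 0,
      prodApprox (𝔎.p N m) (sgn m) b.1 c.1 g (r * g') - H.1 (r * g') ∈ W q := fun g' q => by
    obtain ⟨N₁, h1⟩ := ext_uniform hW c.2 m q (1 ⊗ₜ g)
    obtain ⟨N₂, h2⟩ := ext_uniform hW b.2 m q (g ⊗ₜ g')
    filter_upwards [eventually_ge_atTop N₁, eventually_ge_atTop N₂] with N hN₁ hN₂ r hr
    have e1 := h1 N hN₁ b.1 ((r * g') ⊗ₜ 1) (𝔎.tmul_mem _ 𝔎.one_mem)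
    have e2 := h2 N hN₂ c.1 (1 ⊗ₜ r) (𝔎.tmul_mem _ hr)
    rw [Algebra.TensorProduct.tmul_mul_tmul, mul_one, one_mul] at e1
    rw [Algebra.TensorProduct.tmul_mul_tmul, one_mul] at e2
    change _ - prodMap hW m b c ((r * g') ⊗ₜ g) ∈ W q
    rw [prodApprox_apply, prodMap_apply, swapK_tmul, extLin_apply, extLin_apply]
    have := sub_mem e1 (zsmul_mem e2 (sgn m))
    convert this using 1
    rw [smul_sub]
    abel
  have t1 := op_tendsto_left hW m (DiagonalKernel.nProd hW n a b) c (op_uniform hW n a b) g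
  have e1 : ∀ N, op 𝔎 N m (op 𝔎 N n a.1 b.1) c.1 g =
      op 𝔎 N n a.1 (prodApprox (𝔎.p N m) (sgn m) b.1 c.1 g) 1 +
      (sgn m • ∑ j ∈ Finset.range J, mulMap (DiagonalKernel.nProd hW j a c).1 b.1
        (divPow 𝔎.d1 j (𝔎.p N n) * 𝔎.p N m * g ⊗ₜ 1) -
      sgn n • ∑ j ∈ Finset.range J, mulMap b.1 (DiagonalKernel.nProd hW j a c).1
        (divPow 𝔎.d2 j (𝔎.p N n) * 𝔎.p N m * 1 ⊗ₜ g)) := fun N => by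
    have q1 := lop_iterate (b := b.1) (hac.commutator le_rfl) (𝔎.p N n) (𝔎.p N m) (sgn m) g
    have q2 := rop_iterate (b := b.1) (hac.commutator le_rfl) (𝔎.p N n) (𝔎.p N m) (sgn m) g
    rw [op_apply N n, ← Algebra.TensorProduct.one_def, mul_one]
    have r1 := eq_sub_of_add_eq' q1.symm
    have r2 := eq_sub_of_add_eq' q2.symm
    rw [r1, r2, op_apply N m, op, mulMap_sub_left, mulMap_sub_right,
      ← Int.cast_smul_eq_zsmul A (sgn n) (rop _ _ _), mulMap_smul_left, mulMap_smul_right]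
    simp only [Int.cast_smul_eq_zsmul, LinearMap.sub_apply, LinearMap.smul_apply, lop_apply (𝔎.p N m),
      rop_apply (𝔎.p N m), smul_sub, smul_comm (sgn m) (sgn n)]
    abel
  simp only [e1] at t1
  have t2 := (op_tendsto_right hW n a H hu 1).add
    (((tendsto_finsetSum (Finset.range J) fun j _ => tendsto_divPow_d1 (hW := hW)
      (DiagonalKernel.nProd hW j a c).1 b n m j (g ⊗ₜ 1)).const_smul (sgn m)).sub
    ((tendsto_finsetSum (Finset.range J) fun j _ => tendsto_divPow_d2 (hW := hW)
      b.1 (DiagonalKernel.nProd hW j a c) n m j (1 ⊗ₜ g)).const_smul (sgn n)))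
  rw [tendsto_nhds_unique t1 t2]
  -- The operator product expansion of `b` and `c` turns `H` into fields of the shape treated by
  -- `nProd_divPow`.
  have hHs : H = ∑ j ∈ Finset.range J', ⟨(mulFld (DiagonalKernel.nProd hW (m + j) b c) g).1 ∘ₗ
      divPow (𝔎.der : K →ₗ[A] K) j, (mulFld _ g).2.divPow_comp j⟩ := by
    refine Subtype.ext (LinearMap.ext fun l => ?_)
    rw [AddSubmonoidClass.coe_finsetSum, LinearMap.sum_apply]
    refine (hbc.prodMap_tmul hJ' l g).trans (Finset.sum_congr rfl fun j _ => ?_)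
    simp [mulFld, mul_comm]
  have hH1 : (DiagonalKernel.nProd hW n a H).1 1 = ∑ j ∈ Finset.range J',
      ((-1) ^ j * Ring.choose n j : ℤ) •
        (DiagonalKernel.nProd hW (n - j) a (DiagonalKernel.nProd hW (m + j) b c)).1 g := by
    rw [hHs, ← nProdL_apply, map_sum, AddSubmonoidClass.coe_finsetSum, LinearMap.sum_apply]
    exact Finset.sum_congr rfl fun j _ => nProd_divPow n a _ g j
  rw [hH1, Submodule.coe_sub, LinearMap.sub_apply, AddSubmonoidClass.coe_finsetSum,
    LinearMap.sum_apply, sub_eq_add_neg (∑ d ∈ Finset.range J', _)]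
  refine congrArg₂ (· + ·) rfl ?_
  change _ = -(sgn n • (∑ j ∈ Finset.range J, ((-1) ^ j * Ring.choose n j : ℤ) •
        DiagonalKernel.nProd hW (n + m - j) b (DiagonalKernel.nProd hW j a c) : 𝔎.fields W).1 g)
  rw [AddSubmonoidClass.coe_finsetSum, LinearMap.sum_apply, Finset.smul_sum, Finset.smul_sum,
    Finset.smul_sum, ← Finset.sum_sub_distrib, ← Finset.sum_neg_distrib]
  refine Finset.sum_congr rfl fun j _ => ?_
  change _ = -(sgn n • ((-1) ^ j * Ring.choose n j : ℤ) •
    (DiagonalKernel.nProd hW (n + m - j) b (DiagonalKernel.nProd hW j a c)).1 g)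
  rw [nProd_apply, prodMap_apply, swapK_tmul]
  simp only [smul_sub, smul_smul, sgn_sub, sgn_add, sgn_natCast]
  have h1 : ((-1 : ℤ) ^ j) * (-1) ^ j = 1 := by rw [← mul_pow]; simp
  have h2 := sgn_mul_self n
  have h3 : sgn n * ((-1) ^ j * Ring.choose n j * (sgn n * sgn m * (-1) ^ j)) =
      sgn m * Ring.choose n j := by
    linear_combination (Ring.choose n j * sgn m * (sgn n * sgn n)) * h1 +
      (Ring.choose n j * sgn m) * h2
  simp only [mul_assoc] at h3 ⊢
  rw [h3]
  abel

end DiagonalKernel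
end FieldCalculus

/-! ### Residue functionals and the unit field. -/

section FieldCalculus
variable {A K U : Type*} [CommRing A] [CommRing K] [Algebra A K] [Ring U] [Algebra A U]

/-- Contraction of the first variable with a functional. -/
noncomputable def contractFst (res : K →ₗ[A] A) : K ⊗[A] K →ₗ[A] K :=
  (TensorProduct.lid A K).toLinearMap ∘ₗ res.rTensor K

@[simp] theorem contractFst_tmul (res : K →ₗ[A] A) (k l : K) :
    contractFst res (k ⊗ₜ l) = res k • l := by simp [contractFst]

theorem contractFst_mul_tmul (res : K →ₗ[A] A) (c : K ⊗[A] K) (g : K) :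
    contractFst res (c * 1 ⊗ₜ g) = contractFst res c * g := by
  induction c with
  | zero => simp
  | tmul a b => simp
  | add a b ha hb => rw [add_mul, map_add, ha, hb, map_add, add_mul]

namespace DiagonalKernel
variable [Algebra ℂ A] {𝔎 : DiagonalKernel A K}

/-- A residue functional for the derivation and the expansions of a diagonal kernel. -/
structure IsResidueFor (𝔎 : DiagonalKernel A K) (res : K →ₗ[A] A) : Prop where
  res_mem : ∀ r ∈ 𝔎.O 0, res r = 0
  res_der : ∀ k, res (𝔎.der k) = 0
  contract : ∀ N, contractFst res (𝔎.p N (-1)) - 1 ∈ 𝔎.O N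

variable {res : K →ₗ[A] A} (hr : 𝔎.IsResidueFor res)
include hr

/-- Elements of `S 0` are regular in the second variable, so taking the residue there gives zero. -/
theorem IsResidueFor.contract_swap (c : K ⊗[A] K) (hc : c ∈ 𝔎.S 0) :
    contractFst res (swapK c) = 0 := by
  have := 𝔎.map_mem_of_mem_S (contractFst res ∘ₗ swapK) ⊥ (n := 0) (fun k r h => by
    simp [hr.res_mem r h]) hc
  exact this

omit hr in
theorem contractFst_mem {N : ℕ} {c : K ⊗[A] K} (hc : c ∈ 𝔎.S N) : contractFst res c ∈ 𝔎.O N :=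
  𝔎.map_mem_of_mem_S _ _ (fun k r h => by
    rw [contractFst_tmul]; exact Submodule.smul_mem _ _ h) hc

/-- For `n ≠ -1` the `n`-th power of the diagonal is approximately the derivative of `(n + 1)⁻¹`
times the next power, and residues of derivatives vanish. -/
theorem IsResidueFor.contract_p (N : ℕ) {n : ℤ} (hn : n ≠ -1) :
    contractFst res (𝔎.p N n) ∈ 𝔎.O N := by
  have h1 : contractFst res (𝔎.d1 (𝔎.p N (n + 1))) = 0 := by
    have : ∀ c : K ⊗[A] K, contractFst res (𝔎.d1 c) = 0 := fun c => by
      induction c with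
      | zero => simp
      | tmul a b => simp [hr.res_der]
      | add a b ha hb => rw [map_add, map_add, ha, hb, add_zero]
    exact this _
  have h2 := contractFst_mem (res := res) (𝔎.d1_p N (n + 1))
  rw [map_sub, h1, zero_sub, neg_mem_iff, map_zsmul, add_sub_cancel_right] at h2
  have h3 : ((n + 1 : ℤ) : ℂ) ≠ 0 := by exact_mod_cast (by omega : n + 1 ≠ 0)
  have h4 := (𝔎.O N).smul_mem (algebraMap ℂ A ((n + 1 : ℤ) : ℂ)⁻¹) h2
  rwa [← Int.cast_smul_eq_zsmul A, smul_smul, ← map_intCast (algebraMap ℂ A), ← map_mul,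
    inv_mul_cancel₀ h3, map_one, one_smul] at h4

variable {W : ℕ → Ideal U}

/-- The unit field. -/
noncomputable def IsResidueFor.unitFld (hr : 𝔎.IsResidueFor res) (W : ℕ → Ideal U) : 𝔎.fields W :=
  ⟨Algebra.linearMap A U ∘ₗ res, fun q => ⟨0, fun r h => by simp [hr.res_mem r h]⟩⟩

theorem IsResidueFor.mulMap_unit_left (Z : K →ₗ[A] U) (c : K ⊗[A] K) :
    mulMap (hr.unitFld W).1 Z c = Z (contractFst res c) := by
  induction c with
  | zero => simp
  | tmul a b => simp [unitFld, ← Algebra.smul_def]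
  | add a b ha hb => rw [map_add, ha, hb, map_add, map_add]

theorem IsResidueFor.mulMap_unit_right (Z : K →ₗ[A] U) (c : K ⊗[A] K) :
    mulMap Z (hr.unitFld W).1 c = Z (contractFst res (swapK c)) := by
  induction c with
  | zero => simp
  | tmul a b =>
    simp only [mulMap_tmul, unitFld, LinearMap.comp_apply, Algebra.linearMap_apply, swapK_tmul,
      contractFst_tmul, map_smul]
    rw [← Algebra.commutes, ← Algebra.smul_def]
  | add a b ha hb => simp only [map_add, ha, hb]

variable [UniformSpace U] [IsUniformAddGroup U] [IsTopologicalRing U] [CompleteSpace U] [T2Space U]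
  (hW : IsIdealBasis W)

theorem IsResidueFor.unit_isLocal (Z : 𝔎.fields W) : IsLocalAt hW 0 (hr.unitFld W) Z := by
  refine TensorProduct.ext' fun k l => ?_
  rw [Nat.cast_zero, prodMap_zero_tmul]
  simp [unitFld, Algebra.commutes]

/-- The unit field contracts one variable of the kernel by the residue. In the first half of the
commutator this gives the residue of the power of the diagonal, namely `1` or `0`; in the other half
it gives zero by regularity. -/
theorem IsResidueFor.nProd_unit_left (n : ℤ) (Z : 𝔎.fields W) :
    DiagonalKernel.nProd hW n (hr.unitFld W) Z = if n = -1 then Z else 0 := by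
  have key : ∀ a : K, (∀ N, contractFst res (𝔎.p N n) - a ∈ 𝔎.O N) →
      DiagonalKernel.nProd hW n (hr.unitFld W) Z = mulFld Z a := fun a ha => by
    refine Subtype.ext (LinearMap.ext fun g => ?_)
    have h1 : extLin hW n (hr.unitFld W).1 Z (1 ⊗ₜ g) = Z.1 (a * g) := by
      refine ext_eq hW Z.2 ((hW.tendsto_iff).2 fun q => ?_)
      obtain ⟨m, hm⟩ := 𝔎.absorb g 0
      obtain ⟨m, hm⟩ := Z.2.comp_mul g q
      filter_upwards [eventually_ge_atTop m] with N hN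
      rw [hr.mulMap_unit_left, contractFst_mul_tmul, ← map_sub, ← sub_mul, mul_comm]
      exact hm _ (𝔎.O_anti hN (ha N))
    have h2 : extLin hW n Z.1 (hr.unitFld W) (g ⊗ₜ 1) = 0 := by
      refine ext_eq hW (hr.unitFld W).2 ?_
      have : ∀ N, mulMap Z.1 (hr.unitFld W).1 (𝔎.p N n * g ⊗ₜ 1) = 0 := fun N => by
        rw [hr.mulMap_unit_right, swapK_mul, swapK_tmul, contractFst_mul_tmul,
          hr.contract_swap _ (𝔎.p_mem N n), zero_mul, map_zero]
      simp only [this]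
      exact tendsto_const_nhds
    rw [nProd_apply, prodMap_apply, swapK_tmul, h1, h2]
    simp [mulFld]
  split_ifs with hn
  · subst hn
    rw [key 1 hr.contract, mulFld_one]
  · rw [key 0 fun N => by rw [sub_zero]; exact hr.contract_p N hn]
    exact Subtype.ext (LinearMap.ext fun g => by simp [mulFld])

theorem IsResidueFor.nProd_unit_right (n : ℕ) (Z : 𝔎.fields W) :
    DiagonalKernel.nProd hW n Z (hr.unitFld W) = 0 :=
  nProd_eq_zero (hr.unit_isLocal hW Z).symm (by simp)

/-- Skew-symmetry reduces to products with the unit on the left. There the operator product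
expansion has only the term `j = 0`. -/
theorem IsResidueFor.nProd_neg_one_unit (Z : 𝔎.fields W) :
    DiagonalKernel.nProd hW (-1) Z (hr.unitFld W) = Z := by
  refine Subtype.ext (LinearMap.ext fun g => ?_)
  have h1 := (hr.unit_isLocal hW Z).prodMap_tmul (n := -1) (J := 1) (by simp) g 1
  have h2 := prodMap_swap hW (-1) (hr.unitFld W) Z (g ⊗ₜ 1)
  rw [swapK_tmul, h1, sgn_neg_one] at h2
  rw [nProd_apply, h2]
  simp [hr.nProd_unit_left hW, divPow_zero]

end DiagonalKernel
end FieldCalculus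

/-! ### Constructing a diagonal kernel from an inverse of `f (t)`. -/

section FieldCalculus
variable {A K : Type*} [CommRing A] [CommRing K] [Algebra A K]

theorem rTensor_derivation_mul (D : Derivation A K K)
    (u v : K ⊗[A] K) : (D : K →ₗ[A] K).rTensor K (u * v) =
      (D : K →ₗ[A] K).rTensor K u * v + u * (D : K →ₗ[A] K).rTensor K v := by
  induction u with
  | zero => simp
  | add a b ha hb => simp only [add_mul, map_add, ha, hb]; abel
  | tmul a b =>
    induction v with
    | zero => simp
    | add c d hc hd => simp only [mul_add, map_add, hc, hd]; abel
    | tmul c d =>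
      simp [TensorProduct.add_tmul, Derivation.leibniz, mul_comm, add_comm]

theorem lTensor_derivation_mul (D : Derivation A K K)
    (u v : K ⊗[A] K) : (D : K →ₗ[A] K).lTensor K (u * v) =
      (D : K →ₗ[A] K).lTensor K u * v + u * (D : K →ₗ[A] K).lTensor K v := by
  induction u with
  | zero => simp
  | add a b ha hb => simp only [add_mul, map_add, ha, hb]; abel
  | tmul a b =>
    induction v with
    | zero => simp
    | add c d hc hd => simp only [mul_add, map_add, hc, hd]; abel
    | tmul c d =>
      simp [TensorProduct.tmul_add, Derivation.leibniz, mul_comm, add_comm]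

/-- A ring of functions on a punctured neighbourhood of the zeros of `f (t)`. -/
structure PuncturedData (A K : Type*) [CommRing A] [CommRing K] [Algebra A K] where
  der : Derivation A K K
  t : K
  O : ℕ → Submodule A K
  f : A[X]
  φ : K
  u : K
  O_anti : Antitone O
  one_mem : 1 ∈ O 0
  t_mem : t ∈ O 0
  mul_mem : ∀ {a b r s}, r ∈ O a → s ∈ O b → r * s ∈ O (a + b)
  absorb : ∀ (k : K) n, ∃ m, ∀ r ∈ O m, k * r ∈ O n
  der_mem : ∀ {n r}, r ∈ O (n + 1) → der r ∈ O n
  der_mem_zero : ∀ {r}, r ∈ O 0 → der r ∈ O 0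
  der_t : der t = 1
  dense : ∀ (k : K) n, ∃ P F : A[X], ∃ w, IsUnit (aeval t F) ∧ aeval t F * w = aeval t P ∧
    k - w ∈ O n
  aeval_t : aeval t f = φ
  φ_mem : ∀ n, φ ^ n ∈ O n
  φ_mul_u : φ * u = 1

namespace PuncturedData
variable (𝔡 : PuncturedData A K)

/-- The equation of the diagonal. -/
noncomputable def diag : K ⊗[A] K := 𝔡.t ⊗ₜ 1 - 1 ⊗ₜ 𝔡.t

/-- The divided difference of `f`. -/
noncomputable def divDiff : K ⊗[A] K :=
  𝔡.f.sum fun i c => c • ∑ j ∈ Finset.range i, (𝔡.t ^ j) ⊗ₜ[A] (𝔡.t ^ (i - 1 - j))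

/-- Partial sums of the expansion of the inverse of the diagonal. -/
noncomputable def diagInv (N : ℕ) : K ⊗[A] K :=
  𝔡.divDiff * ∑ i ∈ Finset.range N, (𝔡.u ^ (i + 1)) ⊗ₜ[A] (𝔡.φ ^ i)

/-- Approximations of the powers of the diagonal. -/
noncomputable def diagPow (N : ℕ) : ℤ → K ⊗[A] K
  | .ofNat n => 𝔡.diag ^ n
  | .negSucc n => 𝔡.diagInv N ^ (n + 1)

/-- The image of `K ⊗ f (t) ^ n R` in `K ⊗ K`. -/
noncomputable abbrev S (n : ℕ) : Submodule A (K ⊗[A] K) :=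
  smallSnd 𝔡.O n

theorem tmul_mem {n : ℕ} (k : K) {r : K} (hr : r ∈ 𝔡.O n) :
    k ⊗ₜ r ∈ 𝔡.S n := Submodule.subset_span ⟨k, r, hr, rfl⟩

theorem map_mem_of_mem {M : Type*} [AddCommGroup M] [Module A M]
    (g : K ⊗[A] K →ₗ[A] M) (Q : Submodule A M) {n : ℕ}
    (hg : ∀ k, ∀ r ∈ 𝔡.O n, g (k ⊗ₜ r) ∈ Q) {u : K ⊗[A] K}
    (hu : u ∈ 𝔡.S n) : g u ∈ Q := by
  refine (Submodule.span_le (p := Q.comap g)).2 ?_ hu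
  rintro _ ⟨k, r, hr, rfl⟩
  exact hg k r hr

theorem S_mul {a b : ℕ} {u v : K ⊗[A] K} (hu : u ∈ 𝔡.S a)
    (hv : v ∈ 𝔡.S b) : u * v ∈ 𝔡.S (a + b) := by
  refine 𝔡.map_mem_of_mem (LinearMap.mulRight A v) _ (fun k r hr => ?_) hu
  refine 𝔡.map_mem_of_mem (LinearMap.mulLeft A (k ⊗ₜ r)) _ (fun k' r' hr' => ?_) hv
  rw [LinearMap.mulLeft_apply, Algebra.TensorProduct.tmul_mul_tmul]
  exact 𝔡.tmul_mem _ (𝔡.mul_mem hr hr')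

theorem S_mul_zero {a : ℕ} {u v : K ⊗[A] K} (hu : u ∈ 𝔡.S a)
    (hv : v ∈ 𝔡.S 0) : u * v ∈ 𝔡.S a := by
  have := 𝔡.S_mul hu hv
  rwa [add_zero] at this

theorem zero_mul_S {a : ℕ} {u v : K ⊗[A] K} (hu : u ∈ 𝔡.S 0)
    (hv : v ∈ 𝔡.S a) : u * v ∈ 𝔡.S a := by
  rw [mul_comm]; exact 𝔡.S_mul_zero hv hu

theorem one_mem_S : (1 : K ⊗[A] K) ∈ 𝔡.S 0 :=
  𝔡.tmul_mem 1 𝔡.one_mem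

theorem pow_mem_S {u : K ⊗[A] K} (hu : u ∈ 𝔡.S 0) (n : ℕ) :
    u ^ n ∈ 𝔡.S 0 := by
  induction n with
  | zero => rw [pow_zero]; exact 𝔡.one_mem_S
  | succ n ih => rw [pow_succ]; exact 𝔡.S_mul_zero ih hu

theorem diag_mem : 𝔡.diag ∈ 𝔡.S 0 :=
  sub_mem (𝔡.tmul_mem _ 𝔡.one_mem)
    (𝔡.tmul_mem _ 𝔡.t_mem)

theorem t_pow_mem (n : ℕ) : 𝔡.t ^ n ∈ 𝔡.O 0 := by
  induction n with
  | zero => simpa using 𝔡.one_mem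
  | succ n ih => rw [pow_succ]; exact 𝔡.mul_mem ih 𝔡.t_mem

theorem divDiff_mem : 𝔡.divDiff ∈ 𝔡.S 0 :=
  sum_mem fun _ _ => Submodule.smul_mem _ _ (sum_mem fun _ _ => 𝔡.tmul_mem _ (𝔡.t_pow_mem _))

theorem diag_mul_divDiff : 𝔡.diag * 𝔡.divDiff = 𝔡.φ ⊗ₜ 1 - 1 ⊗ₜ 𝔡.φ := by
  have h1 : ∀ i, 𝔡.diag * ∑ j ∈ Finset.range i, (𝔡.t ^ j) ⊗ₜ[A] (𝔡.t ^ (i - 1 - j)) =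
      (𝔡.t ^ i) ⊗ₜ 1 - 1 ⊗ₜ (𝔡.t ^ i) := fun i => by
    have := (Commute.all (𝔡.t ⊗ₜ[A] (1 : K)) ((1 : K) ⊗ₜ[A] 𝔡.t)).mul_geom_sum₂ i
    simpa [Algebra.TensorProduct.tmul_pow, diag] using this
  have h3 : 𝔡.φ = 𝔡.f.sum fun i c => c • 𝔡.t ^ i := by
    rw [← 𝔡.aeval_t, aeval_eq_sum_range, Polynomial.sum_over_range _ (by simp)]
  conv_rhs => rw [h3]
  rw [divDiff, Polynomial.sum, Polynomial.sum, Finset.mul_sum, TensorProduct.sum_tmul,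
    TensorProduct.tmul_sum, ← Finset.sum_sub_distrib]
  refine Finset.sum_congr rfl fun i _ => ?_
  rw [mul_smul_comm, h1, smul_sub, TensorProduct.smul_tmul', TensorProduct.tmul_smul]

/-- The divided difference turns the diagonal into `φ ⊗ 1 - 1 ⊗ φ`, against which the geometric sum
telescopes. The error `u ^ N ⊗ φ ^ N` is small in the second variable. -/
theorem diag_mul_diagInv (N : ℕ) :
    𝔡.diag * 𝔡.diagInv N = 1 - (𝔡.u ^ N) ⊗ₜ (𝔡.φ ^ N) := by
  rw [diagInv, ← mul_assoc, diag_mul_divDiff, Finset.mul_sum]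
  have : ∀ i ∈ Finset.range N, (𝔡.φ ⊗ₜ 1 - 1 ⊗ₜ 𝔡.φ) * (𝔡.u ^ (i + 1)) ⊗ₜ[A] (𝔡.φ ^ i)
      = (𝔡.u ^ i) ⊗ₜ[A] (𝔡.φ ^ i) - (𝔡.u ^ (i + 1)) ⊗ₜ[A] (𝔡.φ ^ (i + 1)) := by
    intro i _
    rw [sub_mul, Algebra.TensorProduct.tmul_mul_tmul, Algebra.TensorProduct.tmul_mul_tmul, one_mul,
      one_mul, pow_succ', ← mul_assoc, φ_mul_u, one_mul, pow_succ' 𝔡.φ]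
  rw [Finset.sum_congr rfl this, Finset.sum_range_sub']
  simp [Algebra.TensorProduct.one_def]

theorem diagInv_mem (N : ℕ) : 𝔡.diagInv N ∈ 𝔡.S 0 := by
  refine 𝔡.S_mul_zero 𝔡.divDiff_mem (sum_mem fun i _ => 𝔡.tmul_mem _ ?_)
  exact 𝔡.O_anti (Nat.zero_le i) (𝔡.φ_mem i)

theorem diagInv_cauchy {N M : ℕ} (hNM : N ≤ M) : 𝔡.diagInv M - 𝔡.diagInv N ∈ 𝔡.S N := by
  rw [diagInv, diagInv, ← mul_sub, ← Finset.sum_sdiff (Finset.range_subset_range.2 hNM),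
    add_sub_cancel_right]
  refine 𝔡.zero_mul_S 𝔡.divDiff_mem (sum_mem fun i hi => 𝔡.tmul_mem _ ?_)
  refine 𝔡.O_anti ?_ (𝔡.φ_mem i)
  simp at hi
  exact hi.2

theorem pow_sub_pow_mem {u v : K ⊗[A] K} (hu : u ∈ 𝔡.S 0)
    (hv : v ∈ 𝔡.S 0) {N : ℕ} (huv : u - v ∈ 𝔡.S N) (k : ℕ) :
    u ^ k - v ^ k ∈ 𝔡.S N := by
  induction k with
  | zero => simp
  | succ k ih =>
    have := add_mem (𝔡.zero_mul_S (𝔡.pow_mem_S hu k) huv) (𝔡.S_mul_zero ih hv)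
    convert this using 1
    ring

theorem diagPow_natCast (N n : ℕ) : 𝔡.diagPow N n = 𝔡.diag ^ n := rfl

theorem diagPow_neg (N n : ℕ) : 𝔡.diagPow N (-n) = 𝔡.diagInv N ^ n := by
  cases n with
  | zero => rfl
  | succ n => rfl

theorem diagPow_mem (N : ℕ) (n : ℤ) : 𝔡.diagPow N n ∈ 𝔡.S 0 := by
  obtain ⟨n, rfl | rfl⟩ := n.eq_nat_or_neg
  · exact 𝔡.pow_mem_S 𝔡.diag_mem n
  · rw [diagPow_neg]
    exact 𝔡.pow_mem_S (𝔡.diagInv_mem N) n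

theorem diagPow_cauchy {N M : ℕ} (n : ℤ) (hNM : N ≤ M) :
    𝔡.diagPow M n - 𝔡.diagPow N n ∈ 𝔡.S N := by
  obtain ⟨n, rfl | rfl⟩ := n.eq_nat_or_neg
  · rw [diagPow_natCast, diagPow_natCast, sub_self]
    exact zero_mem _
  · rw [diagPow_neg, diagPow_neg]
    exact 𝔡.pow_sub_pow_mem (𝔡.diagInv_mem M) (𝔡.diagInv_mem N) (𝔡.diagInv_cauchy hNM) n

theorem diag_mul_diagPow (N : ℕ) (n : ℤ) :
    𝔡.diag * 𝔡.diagPow N n - 𝔡.diagPow N (n + 1) ∈ 𝔡.S N := by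
  obtain ⟨n, rfl | rfl⟩ := n.eq_nat_or_neg
  · have : 𝔡.diagPow N (n + 1) = 𝔡.diag ^ (n + 1) := rfl
    rw [this, diagPow_natCast, pow_succ', sub_self]
    exact zero_mem _
  · cases n with
    | zero =>
      have : 𝔡.diagPow N (-(0 : ℕ) + 1) = 𝔡.diag ^ 1 := rfl
      rw [this, diagPow_neg]
      simp
    | succ n =>
      have e : -((n + 1 : ℕ) : ℤ) + 1 = -n := by push_cast; ring
      rw [e, diagPow_neg, diagPow_neg, pow_succ', ← mul_assoc, diag_mul_diagInv, sub_mul, one_mul,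
        sub_sub_cancel_left, neg_mem_iff]
      exact 𝔡.S_mul_zero (𝔡.tmul_mem _ (𝔡.φ_mem N))
        (𝔡.pow_mem_S (𝔡.diagInv_mem N) n)

theorem diagPow_mul (N : ℕ) (n m : ℤ) :
    𝔡.diagPow N n * 𝔡.diagPow N m - 𝔡.diagPow N (n + m) ∈ 𝔡.S N := by
  have key : ∀ (n : ℕ) (m : ℤ), 𝔡.diagPow N n * 𝔡.diagPow N m - 𝔡.diagPow N (n + m) ∈
      𝔡.S N := fun n m => by
    rw [diagPow_natCast]
    induction n with
    | zero => simp
    | succ n ih =>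
      have := add_mem (𝔡.zero_mul_S 𝔡.diag_mem ih) (𝔡.diag_mul_diagPow N (n + m))
      have e : ((n + 1 : ℕ) : ℤ) + m = n + m + 1 := by push_cast; ring
      rw [e]
      convert this using 1
      ring
  obtain ⟨n, rfl | rfl⟩ := n.eq_nat_or_neg
  · exact key n m
  · obtain ⟨m, rfl | rfl⟩ := m.eq_nat_or_neg
    · rw [mul_comm, add_comm]
      exact key m _
    · have e : -(n : ℤ) + -m = -((n + m : ℕ) : ℤ) := by push_cast; ring
      rw [e, diagPow_neg, diagPow_neg, diagPow_neg, pow_add, sub_self]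
      exact zero_mem _

/-- The derivative of the powers of an element that is approximately inverse to the diagonal. -/
theorem derivation_diagPow {D : K ⊗[A] K →ₗ[A] K ⊗[A] K}
    (hD : ∀ u v, D (u * v) = D u * v + u * D v) (hD0 : ∀ u ∈ 𝔡.S 0, D u ∈ 𝔡.S 0)
    {c : A} (hc : D 𝔡.diag = c • 1) {N M : ℕ} (hNM : N ≤ M)
    (hε : D ((𝔡.u ^ M) ⊗ₜ (𝔡.φ ^ M)) ∈ 𝔡.S N) (n : ℤ) :
    D (𝔡.diagPow M n) - (c * n) • 𝔡.diagPow M (n - 1) ∈ 𝔡.S N := by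
  have h1 : D 1 = 0 := by simpa using hD 1 1
  have hpow : ∀ u (n : ℕ), D (u ^ (n + 1)) = (n + 1) • (u ^ n * D u) := fun u n => by
    induction n with
    | zero => simp
    | succ n ih =>
      rw [pow_succ, hD, ih]
      simp only [nsmul_eq_mul]
      push_cast
      ring
  obtain ⟨n, rfl | rfl⟩ := n.eq_nat_or_neg
  · cases n with
    | zero => simp [h1, show 𝔡.diagPow M 0 = 1 from rfl]
    | succ n =>
      have e : ((n + 1 : ℕ) : ℤ) - 1 = n := by push_cast; ring
      rw [e, diagPow_natCast, diagPow_natCast, hpow, hc, mul_smul_comm, mul_one, mul_smul,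
        smul_comm c]
      simp [← Nat.cast_smul_eq_nsmul A]
  · have h2 : D (𝔡.diagInv M) + c • 𝔡.diagInv M ^ 2 ∈ 𝔡.S N := by
      -- Differentiate `diag * diagInv M = 1 - ε` with `ε = u ^ M ⊗ φ ^ M`, and multiply by `diagInv
      -- M`. The remaining errors contain the factor `ε` or `D ε`.
      have h3 := congrArg D (𝔡.diag_mul_diagInv M)
      rw [hD, hc, map_sub, h1, zero_sub, smul_mul_assoc, one_mul] at h3
      have h4 := 𝔡.S_mul_zero hε (𝔡.diagInv_mem M)
      have h5 := 𝔡.S_mul_zero (𝔡.tmul_mem (𝔡.u ^ M)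
        (𝔡.O_anti hNM (𝔡.φ_mem M))) (hD0 _ (𝔡.diagInv_mem M))
      have h6 : D (𝔡.diagInv M) + c • 𝔡.diagInv M ^ 2 =
          (𝔡.u ^ M) ⊗ₜ (𝔡.φ ^ M) * D (𝔡.diagInv M) -
          D ((𝔡.u ^ M) ⊗ₜ (𝔡.φ ^ M)) * 𝔡.diagInv M := by
        have h7 := 𝔡.diag_mul_diagInv M
        have h8 : c • 𝔡.diagInv M ^ 2 = (c • 𝔡.diagInv M) * 𝔡.diagInv M := by
          rw [smul_mul_assoc, sq]
        rw [h8]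
        linear_combination (𝔡.diagInv M) * h3 - D (𝔡.diagInv M) * h7
      rw [h6]
      exact sub_mem h5 h4
    cases n with
    | zero => simp [h1, show 𝔡.diagPow M 0 = 1 from rfl]
    | succ n =>
      have e : -((n + 1 : ℕ) : ℤ) - 1 = -((n + 2 : ℕ) : ℤ) := by push_cast; ring
      rw [e, diagPow_neg, diagPow_neg, hpow]
      have := Submodule.smul_of_tower_mem (𝔡.S N) (n + 1)
        (𝔡.zero_mul_S (𝔡.pow_mem_S (𝔡.diagInv_mem M) n) h2)
      convert this using 1
      rw [mul_add, mul_smul_comm, ← pow_add, ← Nat.cast_smul_eq_nsmul A, ← Nat.cast_smul_eq_nsmul A,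
        smul_add, smul_smul, sub_eq_add_neg, ← neg_smul]
      congr 2
      push_cast
      ring


theorem d1_diagPow (N : ℕ) (n : ℤ) :
    (𝔡.der : K →ₗ[A] K).rTensor K (𝔡.diagPow N n) - n • 𝔡.diagPow N (n - 1) ∈ 𝔡.S N := by
  have h0 : ∀ a, ∀ u ∈ 𝔡.S a, (𝔡.der : K →ₗ[A] K).rTensor K u ∈ 𝔡.S a := fun a u hu =>
    𝔡.map_mem_of_mem ((𝔡.der : K →ₗ[A] K).rTensor K) (𝔡.S a)
      (fun k r hr => by rw [LinearMap.rTensor_tmul]; exact 𝔡.tmul_mem _ hr) hu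
  have h1 : (𝔡.der : K →ₗ[A] K).rTensor K 𝔡.diag = (1 : A) • 1 := by
    simp [diag, 𝔡.der_t, Algebra.TensorProduct.one_def]
  have := 𝔡.derivation_diagPow (rTensor_derivation_mul 𝔡.der) (h0 0) h1 le_rfl
    (h0 N _ (𝔡.tmul_mem _ (𝔡.φ_mem N))) n
  rwa [one_mul, Int.cast_smul_eq_zsmul] at this

theorem d2_diagPow (N : ℕ) (n : ℤ) : (𝔡.der : K →ₗ[A] K).lTensor K (𝔡.diagPow (N + 1) n) +
    n • 𝔡.diagPow (N + 1) (n - 1) ∈ 𝔡.S N := by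
  have h0 : ∀ u ∈ 𝔡.S 0, (𝔡.der : K →ₗ[A] K).lTensor K u ∈ 𝔡.S 0 := fun u hu =>
    𝔡.map_mem_of_mem ((𝔡.der : K →ₗ[A] K).lTensor K) (𝔡.S 0)
      (fun k r hr => by rw [LinearMap.lTensor_tmul]; exact 𝔡.tmul_mem _ (𝔡.der_mem_zero hr)) hu
  have h1 : (𝔡.der : K →ₗ[A] K).lTensor K 𝔡.diag = (-1 : A) • 1 := by
    simp [diag, 𝔡.der_t, Algebra.TensorProduct.one_def]
  have h2 : (𝔡.der : K →ₗ[A] K).lTensor K ((𝔡.u ^ (N + 1)) ⊗ₜ (𝔡.φ ^ (N + 1))) ∈ 𝔡.S N := by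
    rw [LinearMap.lTensor_tmul]
    exact 𝔡.tmul_mem _ (𝔡.der_mem (𝔡.φ_mem (N + 1)))
  have := 𝔡.derivation_diagPow (lTensor_derivation_mul 𝔡.der) h0 h1 N.le_succ h2 n
  rwa [neg_one_mul, neg_smul, sub_neg_eq_add, Int.cast_smul_eq_zsmul] at this

/-- The diagonal kernel of a punctured neighbourhood. -/
noncomputable def kernel : DiagonalKernel A K where
  der := 𝔡.der
  t := 𝔡.t
  O := 𝔡.O
  p := 𝔡.diagPow
  O_anti := 𝔡.O_anti
  one_mem := 𝔡.one_mem
  t_mem := 𝔡.t_mem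
  mul_mem := 𝔡.mul_mem
  absorb := 𝔡.absorb
  der_mem := 𝔡.der_mem
  der_t := 𝔡.der_t
  dense := 𝔡.dense
  p_mem := 𝔡.diagPow_mem
  p_cauchy := 𝔡.diagPow_cauchy
  p_nat _ _ := rfl
  diag_mul := 𝔡.diag_mul_diagPow
  p_mul := 𝔡.diagPow_mul
  d1_p := 𝔡.d1_diagPow
  d2_p := 𝔡.d2_diagPow

end PuncturedData
end FieldCalculus

/-! ### The punctured formal neighbourhood as a diagonal kernel. -/

namespace IsFormalCoordinate
section Kernel
variable {A R : Type u} [CommRing A] [CommRing R] [Algebra A R]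
variable {I : ℕ → Ideal R} {t : R} {f : A[X]} (h : IsFormalCoordinate I t f)

theorem ideal_zero_eq_top (h : IsFormalCoordinate I t f) : I 0 = ⊤ :=
  (Ideal.eq_top_iff_one _).2 (by simpa using (h.aeval_mem_iff 0 1).2 (by simp))

/-- For polynomials in `t` divisibility is part of the definition of a coordinate. In general the
quotients of polynomial approximations form a Cauchy sequence, and completeness supplies `s`. -/
theorem mem_ideal_iff (h : IsFormalCoordinate I t f) {n : ℕ} {r : R} :
    r ∈ I n ↔ ∃ s, r = aeval t f ^ n * s := by
  constructor
  · intro hr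
    have h1 : ∀ m, ∃ Q : A[X], r - aeval t (f ^ n * Q) ∈ I (m + n) := fun m => by
      obtain ⟨P, hP⟩ := h.exists_sub_mem (m + n) r
      have h2 : aeval t P ∈ I n := by
        have := (I n).sub_mem hr (h.antitone (Nat.le_add_left n m) hP)
        simpa using this
      obtain ⟨Q, rfl⟩ := (h.aeval_mem_iff _ _).1 h2
      exact ⟨Q, hP⟩
    choose Q hQ using h1
    obtain ⟨s, hs⟩ := h.complete (fun m => aeval t (Q m)) fun m => by
      refine h.mem_of_mul_pow_mem (d := n) ?_
      have := (I (m + n)).sub_mem (hQ m) (h.antitone (by omega : m + n ≤ m + 1 + n) (hQ (m + 1)))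
      convert this using 1
      simp
      ring
    refine ⟨s, sub_eq_zero.1 (h.separated _ fun m => h.antitone (Nat.le_add_right m n) ?_)⟩
    have := (I (m + n)).sub_mem (hQ m) (h.mul_pow_mem n (hs m))
    convert this using 1
    simp
    ring
  · rintro ⟨s, rfl⟩
    have := h.mul_pow_mem n (m := 0) (r := s) (by rw [h.ideal_zero_eq_top]; trivial)
    rwa [zero_add] at this

theorem deriv_coord : h.deriv t = 1 :=
  h.derivFun_eq _ _ fun n => ⟨X, by simp, by simp⟩

/-- The submodule `f (t) ^ n R` of `K`. -/
noncomputable def levelK (n : ℕ) : Submodule A h.Punctured :=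
  LinearMap.range (LinearMap.mulLeft A (h.unif ^ n) ∘ₗ
    (IsScalarTower.toAlgHom A R h.Punctured).toLinearMap)

theorem mem_levelK {n : ℕ} {k : h.Punctured} :
    k ∈ h.levelK n ↔ ∃ r : R, k = h.unif ^ n * algebraMap R _ r := by
  simp [levelK, LinearMap.mem_range, eq_comm]

theorem algebraMap_mem (r : R) : algebraMap R h.Punctured r ∈ h.levelK 0 :=
  h.mem_levelK.2 ⟨r, by simp⟩

theorem unif_mul_mem (n : ℕ) (r : R) : h.unif ^ n * algebraMap R _ r ∈ h.levelK n :=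
  h.mem_levelK.2 ⟨r, rfl⟩

theorem levelK_antitone : Antitone h.levelK := by
  intro m n hmn k hk
  obtain ⟨r, rfl⟩ := h.mem_levelK.1 hk
  refine h.mem_levelK.2 ⟨aeval t f ^ (n - m) * r, ?_⟩
  rw [map_mul, map_pow, ← mul_assoc, ← pow_add, Nat.add_sub_cancel' hmn]

theorem levelK_mul {a b : ℕ} {r s : h.Punctured} (hr : r ∈ h.levelK a) (hs : s ∈ h.levelK b) :
    r * s ∈ h.levelK (a + b) := by
  obtain ⟨r, rfl⟩ := h.mem_levelK.1 hr
  obtain ⟨s, rfl⟩ := h.mem_levelK.1 hs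
  exact h.mem_levelK.2 ⟨r * s, by rw [map_mul]; ring⟩

theorem levelK_absorb (k : h.Punctured) (n : ℕ) :
    ∃ m, ∀ r ∈ h.levelK m, k * r ∈ h.levelK n := by
  obtain ⟨j, s, hs⟩ := h.exists_unif_pow_mul k
  refine ⟨n + j, fun r hr => ?_⟩
  obtain ⟨r, rfl⟩ := h.mem_levelK.1 hr
  exact h.mem_levelK.2 ⟨s * r, by rw [map_mul, ← hs]; ring⟩

theorem derivK_mem {n : ℕ} {k : h.Punctured} (hk : k ∈ h.levelK (n + 1)) :
    h.derivK k ∈ h.levelK n := by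
  obtain ⟨r, rfl⟩ := h.mem_levelK.1 hk
  rw [← map_pow (algebraMap R h.Punctured), ← map_mul, derivK_algebraMap]
  refine h.mem_levelK.2 ⟨(n + 1 : ℕ) * h.deriv (aeval t f) * r + aeval t f * h.deriv r, ?_⟩
  rw [← map_pow (algebraMap R h.Punctured), ← map_mul]
  congr 1
  rw [Derivation.leibniz, Derivation.leibniz_pow]
  simp only [smul_eq_mul, nsmul_eq_mul, Nat.add_sub_cancel]
  ring

theorem derivK_mem_zero {k : h.Punctured} (hk : k ∈ h.levelK 0) : h.derivK k ∈ h.levelK 0 := by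
  obtain ⟨r, rfl⟩ := h.mem_levelK.1 hk
  rw [pow_zero, one_mul, derivK_algebraMap]
  exact h.algebraMap_mem _

/-- The inverse of the uniformizer. -/
noncomputable abbrev invUnif : h.Punctured :=
  IsLocalization.Away.invSelf (S := h.Punctured) (aeval t f)

theorem unif_mul_inv : h.unif * h.invUnif = 1 := IsLocalization.Away.mul_invSelf _

theorem inv_pow_mul (n : ℕ) (k : h.Punctured) : h.invUnif ^ n * (h.unif ^ n * k) = k := by
  rw [← mul_assoc, ← mul_pow, mul_comm h.invUnif, unif_mul_inv, one_pow, one_mul]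

/-- A numerator agrees with a polynomial in `t` modulo any ideal of the family, and the denominator
is already a power of `f (t)`. -/
theorem dense_rational (k : h.Punctured) (n : ℕ) : ∃ P F : A[X], ∃ w : h.Punctured,
    IsUnit (aeval h.coord F) ∧ aeval h.coord F * w = aeval h.coord P ∧ k - w ∈ h.levelK n := by
  obtain ⟨m, r, hr⟩ := h.exists_unif_pow_mul k
  obtain ⟨P, hP⟩ := h.exists_sub_mem (m + n) r
  obtain ⟨s, hs⟩ := h.mem_ideal_iff.1 hP
  have e : aeval h.coord (f ^ m) = h.unif ^ m := by rw [map_pow, aeval_algebraMap_apply]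
  refine ⟨P, f ^ m, h.invUnif ^ m * aeval h.coord P, ?_, ?_, ?_⟩
  · rw [e]
    exact (IsUnit.of_mul_eq_one _ h.unif_mul_inv).pow m
  · rw [e, ← mul_assoc, ← mul_pow, unif_mul_inv, one_pow, one_mul]
  · refine h.mem_levelK.2 ⟨s, ?_⟩
    rw [← h.inv_pow_mul m k, ← mul_sub, hr, aeval_algebraMap_apply, ← map_sub, hs, map_mul,
      map_pow, pow_add, mul_assoc, inv_pow_mul]

theorem unif_pow_mem (N : ℕ) : h.unif ^ N ∈ h.levelK N := by
  have := h.unif_mul_mem N 1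
  rwa [map_one, mul_one] at this

/-- The punctured formal neighbourhood of a formal coordinate. -/
noncomputable def puncturedData : PuncturedData A h.Punctured where
  der := h.derivK
  t := h.coord
  O := h.levelK
  f := f
  φ := h.unif
  u := h.invUnif
  O_anti := h.levelK_antitone
  one_mem := by simpa using h.algebraMap_mem 1
  t_mem := h.algebraMap_mem t
  mul_mem := h.levelK_mul
  absorb := h.levelK_absorb
  der_mem := h.derivK_mem
  der_mem_zero := h.derivK_mem_zero
  der_t := by rw [coord, derivK_algebraMap, deriv_coord, map_one]
  dense := h.dense_rational
  aeval_t := aeval_algebraMap_apply _ _ _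
  φ_mem := h.unif_pow_mem
  φ_mul_u := h.unif_mul_inv

/-- The diagonal kernel of a formal coordinate. -/
noncomputable def kernel : DiagonalKernel A h.Punctured := h.puncturedData.kernel

theorem kernel_p (N : ℕ) (n : ℤ) : h.kernel.p N n = h.diagPow N n := by
  cases n <;> rfl

end Kernel
end IsFormalCoordinate

/-! ### The residue along the sections: exact forms and the Cauchy kernel. -/

namespace IsFormalCoordinate
section Residue
variable {A R : Type u} [CommRing A] [CommRing R] [Algebra A R]
variable {I : ℕ → Ideal R} {t : R} {f : A[X]} (h : IsFormalCoordinate I t f)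

theorem res_eq {k : h.Punctured} {c : A} (hc : h.IsResidue k c) : h.res k = c :=
  h.isResidue_unique (h.exists_isResidue k).choose_spec hc

theorem res_eq_of_unif_pow {k : h.Punctured} {m : ℕ} {P : A[X]}
    (hk : h.unif ^ m * k = algebraMap R _ (aeval t P)) :
    h.res k = (P %ₘ f ^ m).coeff (m * f.natDegree - 1) :=
  h.res_eq ⟨m, aeval t P, P, hk.symm, by simp, rfl⟩

theorem res_mem_zero {r : h.Punctured} (hr : r ∈ h.levelK 0) : h.res r = 0 := by
  obtain ⟨r, rfl⟩ := h.mem_levelK.1 hr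
  rw [pow_zero, one_mul, res_algebraMap]

theorem unif_pow_mul_derivK {m : ℕ} {k : h.Punctured} {r : R}
    (hk : h.unif ^ m * k = algebraMap R _ r) : h.unif ^ (m + 1) * h.derivK k =
      algebraMap R _ (aeval t f * h.deriv r - m * h.deriv (aeval t f) * r) := by
  have h1 := congrArg h.derivK hk
  rw [Derivation.leibniz, Derivation.leibniz_pow, derivK_algebraMap, derivK_algebraMap] at h1
  simp only [smul_eq_mul, nsmul_eq_mul] at h1
  rw [map_sub, map_mul, map_mul, map_mul, ← h1, ← hk, map_natCast]
  cases m with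
  | zero => simp
  | succ m =>
    simp only [Nat.add_sub_cancel]
    ring

/-- This is the numerator of the derivative of `P / f ^ m`. Polynomial parts of `P / f ^ m`
contribute multiples of `f ^ (m + 1)`, and for a proper fraction the derivative vanishes to order
two at infinity, so its numerator has too small a degree to have a residue. -/
theorem coeff_deriv_modByMonic (hf : f.Monic) (m : ℕ) (P : A[X]) :
    ((f * derivative P - (m : A[X]) * derivative f * P) %ₘ f ^ (m + 1)).coeff
      ((m + 1) * f.natDegree - 1) = 0 := by
  nontriviality A
  have h1 : f ^ (m + 1) ∣ (f * derivative P - m * derivative f * P) -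
      (f * derivative (P %ₘ f ^ m) - m * derivative f * (P %ₘ f ^ m)) := by
    refine ⟨derivative (P /ₘ f ^ m), ?_⟩
    conv_lhs => rw [← modByMonic_add_div P (f ^ m)]
    have : derivative (f ^ m) * f = m * f ^ m * derivative f := by
      rw [derivative_pow]
      cases m with
      | zero => simp
      | succ m => simp; ring
    rw [derivative_add, derivative_mul, modByMonic_add_div]
    conv_lhs =>
      enter [1, 2, 2]
      rw [← modByMonic_add_div P (f ^ m)]
    linear_combination (P /ₘ f ^ m) * this
  rw [← modByMonic_eq_zero_iff_dvd (hf.pow _), sub_modByMonic, sub_eq_zero] at h1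
  rw [h1]
  rcases Nat.eq_zero_or_pos f.natDegree with h0 | hd
  · rw [eq_one_of_monic_natDegree_zero hf h0]
    simp
  rcases m with _ | m
  · simp
  have hB := natDegree_modByMonic_lt P (hf.pow (m + 1)) (fun e => by
    have := hf.natDegree_pow (m + 1)
    rw [e, natDegree_one] at this
    have h2 : 0 < (m + 1) * f.natDegree := by positivity
    omega)
  rw [hf.natDegree_pow] at hB
  set B := P %ₘ f ^ (m + 1) with hBdef
  have hmul : (m + 1 + 1) * f.natDegree = (m + 1) * f.natDegree + f.natDegree := by ring
  have h3 : (f * derivative B).natDegree < (m + 1 + 1) * f.natDegree - 1 ∨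
      f * derivative B = 0 := by
    by_cases hB0 : B.natDegree = 0
    · right
      rw [eq_C_of_natDegree_eq_zero hB0]
      simp
    · left
      have := natDegree_mul_le (p := f) (q := derivative B)
      have := natDegree_derivative_le B
      omega
  have h4 : (((m + 1 : ℕ) : A[X]) * derivative f * B).natDegree <
      (m + 1 + 1) * f.natDegree - 1 := by
    have a1 := natDegree_mul_le (p := ((m + 1 : ℕ) : A[X]) * derivative f) (q := B)
    have a2 := natDegree_mul_le (p := ((m + 1 : ℕ) : A[X])) (q := derivative f)
    have a3 := natDegree_derivative_le f
    rw [natDegree_natCast] at a2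
    omega
  have h5 : (f * derivative B - ((m + 1 : ℕ) : A[X]) * derivative f * B).natDegree <
      (m + 1 + 1) * f.natDegree - 1 := by
    rcases h3 with h3 | h3
    · exact (natDegree_sub_le _ _).trans_lt (max_lt h3 h4)
    · rw [h3, zero_sub, natDegree_neg]
      exact h4
  rw [(modByMonic_eq_self_iff (hf.pow _)).2, coeff_eq_zero_of_natDegree_lt h5]
  refine degree_lt_degree ?_
  rw [hf.natDegree_pow]
  omega

/-- Modulo a regular function, whose derivative is regular, `k` is a fraction `P / f ^ m`; for this
the quotient rule and `coeff_deriv_modByMonic` apply. -/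
theorem res_derivK (k : h.Punctured) : h.res (h.derivK k) = 0 := by
  obtain ⟨m, r, hr⟩ := h.exists_unif_pow_mul k
  obtain ⟨P, hP⟩ := h.exists_sub_mem (m + 1) r
  obtain ⟨s, hs⟩ := h.mem_ideal_iff.1 hP
  have h1 : k = h.invUnif ^ m * algebraMap R _ (aeval t P) + h.unif * algebraMap R _ s := by
    rw [← h.inv_pow_mul m k, hr, ← sub_add_cancel r (aeval t P), hs, map_add, mul_add, add_comm]
    congr 1
    rw [map_mul, map_pow, pow_succ, mul_assoc, inv_pow_mul]
  have h2 : h.derivK (h.unif * algebraMap R _ s) ∈ h.levelK 0 :=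
    h.derivK_mem_zero (by rw [← map_mul]; exact h.algebraMap_mem _)
  rw [h1, map_add, map_add, h.res_mem_zero h2, add_zero]
  have h3 : h.unif ^ m * (h.invUnif ^ m * algebraMap R h.Punctured (aeval t P)) =
      algebraMap R _ (aeval t P) := by
    rw [← mul_assoc, ← mul_pow, unif_mul_inv, one_pow, one_mul]
  have h4 := h.unif_pow_mul_derivK h3
  have h5 : aeval t f * h.deriv (aeval t P) - m * h.deriv (aeval t f) * aeval t P =
      aeval t (f * derivative P - (m : A[X]) * derivative f * P) := by
    simp [deriv_coord]
  rw [h5] at h4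
  rw [h.res_eq_of_unif_pow h4, coeff_deriv_modByMonic h.monic]

theorem res_coord_pow_mul (i j : ℕ) (hj : j < f.natDegree) :
    h.res (h.coord ^ j * h.invUnif ^ (i + 1)) =
      if j = (i + 1) * f.natDegree - 1 then 1 else 0 := by
  nontriviality A
  rw [h.res_eq_of_unif_pow (m := i + 1) (P := X ^ j), (modByMonic_eq_self_iff (h.monic.pow _)).2,
    coeff_X_pow]
  · simp [eq_comm]
  · rw [degree_X_pow, degree_eq_natDegree (h.monic.pow _).ne_zero, h.monic.natDegree_pow]
    have : f.natDegree ≤ (i + 1) * f.natDegree := Nat.le_mul_of_pos_left _ i.succ_pos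
    exact_mod_cast hj.trans_le this
  · rw [mul_left_comm, ← mul_pow, unif_mul_inv, one_pow, mul_one, map_pow, aeval_X, map_pow]

/-- The first components of the expansion are the fractions `t ^ j / φ ^ (i + 1)` with `j < deg f`.
Only `t ^ (deg f - 1) / φ` has a nonzero residue, and it occurs once, with second component `1`. -/
theorem contract_diagInv (N : ℕ) : contractFst h.res (h.diagInv N) - 1 ∈ h.levelK N := by
  -- In degree zero `f = 1`, nothing is inverted and every step of the filtration is all of `K`.
  rcases Nat.eq_zero_or_pos f.natDegree with h0 | hd
  · have h1 : ∀ k : h.Punctured, k ∈ h.levelK N := fun k => by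
      obtain ⟨m, r, hr⟩ := h.exists_unif_pow_mul k
      have h2 : h.unif = 1 := by
        have h3 : aeval t f = 1 := by
          rw [eq_one_of_monic_natDegree_zero h.monic h0, map_one]
        exact (congrArg (algebraMap R h.Punctured) h3).trans (map_one _)
      refine h.mem_levelK.2 ⟨r, ?_⟩
      rw [← hr, h2]
      simp
    exact h1 _
  cases N with
  | zero =>
    simp only [diagInv, Finset.range_zero, Finset.sum_empty, mul_zero, map_zero, zero_sub,
      neg_mem_iff]
    simpa using h.algebraMap_mem 1
  | succ N =>
  have h1 : contractFst h.res (h.diagInv (N + 1)) = 1 := by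
    have h2 : ∀ i, contractFst h.res (h.divDiff * (h.invUnif ^ (i + 1)) ⊗ₜ[A] (h.unif ^ i)) =
        if i = 0 then 1 else 0 := fun i => by
      rw [divDiff, Polynomial.sum, Finset.sum_mul, map_sum]
      have h3 : ∀ l ∈ f.support, contractFst h.res ((f.coeff l • ∑ j ∈ Finset.range l,
          (h.coord ^ j) ⊗ₜ[A] (h.coord ^ (l - 1 - j))) * (h.invUnif ^ (i + 1)) ⊗ₜ[A] (h.unif ^ i)) =
          if l = f.natDegree ∧ i = 0 then 1 else 0 := fun l hl => by
        have hl := le_natDegree_of_mem_supp l hl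
        rw [smul_mul_assoc, map_smul, Finset.sum_mul, map_sum]
        have h4 : ∀ j ∈ Finset.range l, contractFst h.res
            ((h.coord ^ j) ⊗ₜ[A] (h.coord ^ (l - 1 - j)) * (h.invUnif ^ (i + 1)) ⊗ₜ[A] (h.unif ^ i))
            = if j = (i + 1) * f.natDegree - 1 then h.coord ^ (l - 1 - j) * h.unif ^ i else 0 := by
          intro j hj
          rw [Algebra.TensorProduct.tmul_mul_tmul, contractFst_tmul,
            h.res_coord_pow_mul i j (by have := Finset.mem_range.1 hj; omega), ite_smul, one_smul,
            zero_smul]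
        rw [Finset.sum_congr rfl h4, Finset.sum_ite_eq']
        by_cases hc : l = f.natDegree ∧ i = 0
        · obtain ⟨rfl, rfl⟩ := hc
          rw [if_pos, if_pos ⟨rfl, rfl⟩, h.monic.coeff_natDegree]
          · simp
          · simp [hd]
        · rw [if_neg hc, if_neg, smul_zero]
          rw [Finset.mem_range]
          intro hlt
          apply hc
          have : i = 0 := by
            by_contra hi
            have : 2 * f.natDegree ≤ (i + 1) * f.natDegree := Nat.mul_le_mul_right _ (by omega)
            omega
          subst this
          exact ⟨by omega, rfl⟩
      rw [Finset.sum_congr rfl h3]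
      split_ifs with hi
      · simp only [hi, and_true]
        rw [Finset.sum_ite_eq' f.support, if_pos]
        exact natDegree_mem_support_of_nonzero (ne_zero_of_natDegree_gt hd)
      · simp [hi]
    rw [diagInv, Finset.mul_sum, map_sum, Finset.sum_congr rfl fun i _ => h2 i,
      Finset.sum_ite_eq', if_pos (by simp)]
  rw [h1, sub_self]
  exact zero_mem _

theorem isResidueFor [Algebra ℂ A] : h.kernel.IsResidueFor h.res where
  res_mem _ hr := h.res_mem_zero hr
  res_der := h.res_derivK
  contract N := by
    rw [kernel_p, show h.diagPow N (-1) = h.diagInv N ^ 1 from rfl, pow_one]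
    exact h.contract_diagInv N

end Residue
end IsFormalCoordinate

/-! ### The completed enveloping algebra and the products of canonical fields. -/

namespace IsFormalCoordinate
section Enveloping
variable {A R : Type u} [CommRing A] [CommRing R] [Algebra A R] [Algebra ℂ A] [Algebra ℂ R]
  [IsScalarTower ℂ A R] {𝔤 : Type v} [LieRing 𝔤] [LieAlgebra ℂ 𝔤]
variable {I : ℕ → Ideal R} {t : R} {f : A[X]} (h : IsFormalCoordinate I t f)
  (κ : LinearMap.BilinForm ℂ 𝔤)

theorem nhds_zero_env : (𝓝 (0 : Env h κ)).HasBasis (fun _ : ℕ => True)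
    fun n => (envLevel h κ n : Set (Env h κ)) :=
  (envBasis h κ).hasBasis_nhds_zero

theorem isClosed_envLevel (n : ℕ) : IsClosed (envLevel h κ n : Set (Env h κ)) :=
  AddSubgroup.isClosed_of_isOpen (envLevel h κ n).toAddSubgroup
    ((envLevel h κ n).toAddSubgroup.isOpen_of_mem_nhds ((nhds_zero_env h κ).mem_of_mem trivial))

/-- The closure of `envLevel n` in the completed enveloping algebra. -/
noncomputable def cLevel (n : ℕ) : Ideal (CEnv h κ) where
  carrier := closure ((↑) '' (envLevel h κ n : Set (Env h κ)))
  zero_mem' := subset_closure ⟨0, zero_mem _, UniformSpace.Completion.coe_zero⟩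
  add_mem' := fun {a b} ha hb => by
    refine map_mem_closure₂ continuous_add ha hb ?_
    rintro _ ⟨a, ha, rfl⟩ _ ⟨b, hb, rfl⟩
    exact ⟨a + b, add_mem ha hb, UniformSpace.Completion.coe_add a b⟩
  smul_mem' := fun a b hb => by
    refine map_mem_closure₂ continuous_mul (UniformSpace.Completion.denseRange_coe a) hb ?_
    rintro _ ⟨a, rfl⟩ _ ⟨b, hb, rfl⟩
    exact ⟨a * b, Ideal.mul_mem_left _ _ hb, UniformSpace.Completion.coe_mul a b⟩

theorem coe_mem_cLevel {n : ℕ} {e : Env h κ} :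
    (e : CEnv h κ) ∈ cLevel h κ n ↔ e ∈ envLevel h κ n := by
  have h1 := (UniformSpace.Completion.isUniformInducing_coe (Env h κ)).isInducing.closure_eq_preimage_closure_image
    (envLevel h κ n : Set (Env h κ))
  rw [(isClosed_envLevel h κ n).closure_eq] at h1
  exact (Set.ext_iff.1 h1 e).symm

theorem isIdealBasis : IsIdealBasis (cLevel h κ) := by
  have := (nhds_zero_env h κ).hasBasis_of_isDenseInducing
    (UniformSpace.Completion.isDenseInducing_coe (α := Env h κ))
  rw [UniformSpace.Completion.coe_zero] at this
  exact this

variable {h κ}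

theorem isField_iff {X : PreField h κ} : IsField X ↔ h.kernel.IsFld (cLevel h κ) X := by
  constructor
  · intro hX q
    obtain ⟨n, hn⟩ := hX _ ((isIdealBasis h κ).mem_of_mem (i := q) trivial)
    refine ⟨n, fun r hr => ?_⟩
    obtain ⟨r, rfl⟩ := h.mem_levelK.1 hr
    exact hn r
  · intro hX W hW
    obtain ⟨q, -, hq⟩ := (isIdealBasis h κ).mem_iff.1 hW
    obtain ⟨n, hn⟩ := hX q
    exact ⟨n, fun r => hq (hn _ (h.unif_mul_mem n r))⟩

theorem fieldMulOp_apply (X Y : PreField h κ) (c : h.Punctured ⊗[A] h.Punctured) :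
    fieldMulOp X Y c = mulMap Y X (swapK c) := by
  induction c with
  | zero => simp
  | tmul k l => rfl
  | add a b ha hb => simp only [map_add, ha, hb]

theorem neg_pow_eq_sgn_smul {X : Type*} [CommRing X] (a : X) (n : ℕ) :
    (-a) ^ n = sgn n • a ^ n := by
  rw [neg_pow, sgn_natCast, zsmul_eq_mul]
  push_cast
  rfl

theorem swapK_pow (u : h.Punctured ⊗[A] h.Punctured) (n : ℕ) : swapK (u ^ n) = swapK u ^ n :=
  map_pow (Algebra.TensorProduct.comm A h.Punctured h.Punctured) u n

/-- Translates the expansion with the first variable small, used in the definition of the products,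
into the single kernel `p`; the exchange of variables produces the sign. -/
theorem swapK_diagPow' (N : ℕ) (n : ℤ) : swapK (h.diagPow' N n) = sgn n • h.kernel.p N n := by
  rw [kernel_p]
  have key : ∀ (a : h.Punctured ⊗[A] h.Punctured) (n : ℕ), (-a) ^ n = sgn n • a ^ n :=
    neg_pow_eq_sgn_smul
  rcases n with n | n
  · change swapK (h.diag ^ n) = sgn (n : ℤ) • h.diag ^ n
    rw [swapK_pow, ← key, diag, map_sub]
    simp
  · change swapK ((-TensorProduct.comm A h.Punctured h.Punctured (h.diagInv N)) ^ (n + 1)) =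
      sgn (-((n + 1 : ℕ) : ℤ)) • h.diagInv N ^ (n + 1)
    have e : sgn (-((n + 1 : ℕ) : ℤ)) = sgn ((n + 1 : ℕ) : ℤ) := by
      rw [← zero_sub, sgn_sub, sgn_zero, one_mul]
    rw [swapK_pow, e, ← key, map_neg]
    congr 2
    exact (TensorProduct.comm A h.Punctured h.Punctured).symm_apply_apply _

theorem isNProd_nProd (n : ℤ) (X Y : h.kernel.fields (cLevel h κ)) :
    IsNProd n X.1 Y.1 (DiagonalKernel.nProd (isIdealBasis h κ) n X Y).1 := by
  refine ⟨isField_iff.2 (DiagonalKernel.nProd (isIdealBasis h κ) n X Y).2, fun g => ?_⟩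
  have := DiagonalKernel.op_tendsto (isIdealBasis h κ) n X Y g
  refine this.congr fun N => ?_
  rw [DiagonalKernel.op_apply, fieldMulOp_apply, swapK_mul, swapK_diagPow', kernel_p, smul_mul_assoc,
    map_zsmul]
  rfl

theorem IsNProd.eq {n : ℤ} {X Y Z : PreField h κ} (hZ : IsNProd n X Y Z)
    (hX : h.kernel.IsFld (cLevel h κ) X) (hY : h.kernel.IsFld (cLevel h κ) Y) :
    Z = (DiagonalKernel.nProd (isIdealBasis h κ) n ⟨X, hX⟩ ⟨Y, hY⟩).1 :=
  LinearMap.ext fun g => tendsto_nhds_unique (hZ.2 g) ((isNProd_nProd n ⟨X, hX⟩ ⟨Y, hY⟩).2 g)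

variable (h κ)

/-- The unit field. -/
noncomputable abbrev unitF : h.kernel.fields (cLevel h κ) := h.isResidueFor.unitFld (cLevel h κ)

/-- The canonical field of an element of `𝔤`. -/
noncomputable def curF : 𝔤 →+ h.kernel.fields (cLevel h κ) where
  toFun x := ⟨currentField h κ x, fun q => ⟨q, fun r hr => by
    obtain ⟨r, rfl⟩ := h.mem_levelK.1 hr
    exact (coe_mem_cLevel h κ).2 (Ideal.subset_span ⟨r, x, rfl⟩)⟩⟩
  map_zero' := Subtype.ext (LinearMap.ext fun k => by
    change ((gen h κ (k ⊗ₜ 0) : Env h κ) : CEnv h κ) = 0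
    rw [TensorProduct.tmul_zero, map_zero, UniformSpace.Completion.coe_zero])
  map_add' x y := Subtype.ext (LinearMap.ext fun k => by
    change ((gen h κ (k ⊗ₜ (x + y)) : Env h κ) : CEnv h κ) =
      (gen h κ (k ⊗ₜ x) : CEnv h κ) + (gen h κ (k ⊗ₜ y) : CEnv h κ)
    rw [TensorProduct.tmul_add, map_add, UniformSpace.Completion.coe_add])

theorem curF_apply (x : 𝔤) (k : h.Punctured) :
    (curF h κ x).1 k = (gen h κ (k ⊗ₜ x) : CEnv h κ) := rfl

theorem curF_smul (c : ℂ) (x : 𝔤) : curF h κ (c • x) = algebraMap ℂ A c • curF h κ x :=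
  Subtype.ext (LinearMap.ext fun k => by
    change ((gen h κ (k ⊗ₜ (c • x)) : Env h κ) : CEnv h κ) =
      algebraMap ℂ A c • (gen h κ (k ⊗ₜ x) : CEnv h κ)
    rw [← UniformSpace.Completion.coe_smul, ← map_smul, TensorProduct.smul_tmul',
      TensorProduct.tmul_smul, TensorProduct.smul_tmul', algebraMap_smul])

theorem coe_algebraMap (a : A) : ((algebraMap A (Env h κ) a : Env h κ) : CEnv h κ) =
    algebraMap A (CEnv h κ) a := by
  rw [Algebra.algebraMap_eq_smul_one, Algebra.algebraMap_eq_smul_one,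
    UniformSpace.Completion.coe_smul, UniformSpace.Completion.coe_one]

/-- The commutator of two currents as a function of a tensor. -/
theorem prodMap_curF (x y : 𝔤) (c : h.Punctured ⊗[A] h.Punctured) :
    DiagonalKernel.prodMap (isIdealBasis h κ) 0 (curF h κ x) (curF h κ y) c =
      (curF h κ ⁅x, y⁆).1 (LinearMap.mul' A _ c) +
      algebraMap ℂ A (κ x y) • (unitF h κ).1 (LinearMap.mul' A _ (h.kernel.d1 c)) := by
  induction c with
  | zero => simp
  | add a b ha hb => simp only [map_add, ha, hb, smul_add]; abel
  | tmul k l =>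
    rw [DiagonalKernel.prodMap_zero_tmul, curF_apply, curF_apply, ← UniformSpace.Completion.coe_mul,
      ← UniformSpace.Completion.coe_mul, ← UniformSpace.Completion.coe_sub, gen_mul_gen, add_assoc,
      add_sub_cancel_left, UniformSpace.Completion.coe_add, coe_algebraMap, LinearMap.mul'_apply,
      LinearMap.rTensor_tmul, LinearMap.mul'_apply, curF_apply]
    congr 1
    change _ = algebraMap ℂ A (κ x y) • algebraMap A (CEnv h κ) (h.res (h.derivK k * l))
    rw [← algebraMap_smul A (κ x y), smul_eq_mul, map_mul, Algebra.smul_def, mul_comm l]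

theorem mul'_mul {K : Type*} [CommRing K] [Algebra A K] (u v : K ⊗[A] K) :
    LinearMap.mul' A K (u * v) = LinearMap.mul' A K u * LinearMap.mul' A K v :=
  map_mul (Algebra.TensorProduct.lmul' A (S := K)) u v

theorem mul'_diag : LinearMap.mul' A _ h.kernel.δ = 0 := by
  simp [DiagonalKernel.δ]

theorem d1_diag : h.kernel.d1 h.kernel.δ = 1 := by
  simp [h.kernel.der_t, Algebra.TensorProduct.one_def]

/-- The diagonal equation restricts to `0` on the diagonal, and its derivative in the first variable
is `1`. -/
theorem mul'_d1_diag_mul (c : h.Punctured ⊗[A] h.Punctured) :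
    LinearMap.mul' A _ (h.kernel.d1 (h.kernel.δ * c)) = LinearMap.mul' A _ c := by
  rw [DiagonalKernel.d1_mul, map_add, mul'_mul, mul'_mul, d1_diag, mul'_diag, zero_mul, add_zero,
    ← mul'_mul, one_mul]

theorem prodMap_one_curF (x y : 𝔤) (c : h.Punctured ⊗[A] h.Punctured) :
    DiagonalKernel.prodMap (isIdealBasis h κ) 1 (curF h κ x) (curF h κ y) c =
      algebraMap ℂ A (κ x y) • (unitF h κ).1 (LinearMap.mul' A _ c) := by
  have := DiagonalKernel.prodMap_diag (isIdealBasis h κ) 0 (curF h κ x) (curF h κ y) c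
  rw [zero_add] at this
  rw [← this, prodMap_curF, mul'_mul, mul'_diag, zero_mul, map_zero, zero_add, mul'_d1_diag_mul]

/-- The bracket term depends only on the restriction to the diagonal and dies after one factor of
the diagonal equation. The central term involves one derivative and dies after two. -/
theorem curF_isLocalAt (x y : 𝔤) :
    DiagonalKernel.IsLocalAt (isIdealBasis h κ) 2 (curF h κ x) (curF h κ y) := by
  refine LinearMap.ext fun c => ?_
  have := DiagonalKernel.prodMap_diag (isIdealBasis h κ) 1 (curF h κ x) (curF h κ y) c
  rw [show ((2 : ℕ) : ℤ) = 1 + 1 from rfl, ← this, prodMap_one_curF, mul'_mul, mul'_diag, zero_mul,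
    map_zero, smul_zero]
  rfl

theorem nProd_zero_curF (x y : 𝔤) :
    DiagonalKernel.nProd (isIdealBasis h κ) 0 (curF h κ x) (curF h κ y) = curF h κ ⁅x, y⁆ :=
  Subtype.ext (LinearMap.ext fun g => by
    rw [DiagonalKernel.nProd_apply, prodMap_curF]
    simp)

theorem nProd_one_curF (x y : 𝔤) :
    DiagonalKernel.nProd (isIdealBasis h κ) 1 (curF h κ x) (curF h κ y) =
      algebraMap ℂ A (κ x y) • unitF h κ :=
  Subtype.ext (LinearMap.ext fun g => by
    rw [DiagonalKernel.nProd_apply, prodMap_one_curF]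
    simp)

end Enveloping
end IsFormalCoordinate

/-! ### The vacuum module: induction principles, smoothness and the centre. -/

section VertexAlgebra
variable {𝔤 : Type v} [LieRing 𝔤] [LieAlgebra ℂ 𝔤] (κ : LinearMap.BilinForm ℂ 𝔤)

theorem affineGen_add (x y : 𝔤) (n : ℤ) :
    affineGen κ (x + y) n = affineGen κ x n + affineGen κ y n := by
  simp only [affineGen, Finsupp.single_add, map_add]
  rfl

theorem affineGen_smul (c : ℂ) (x : 𝔤) (n : ℤ) :
    affineGen κ (c • x) n = c • affineGen κ x n := by
  simp only [affineGen, ← Finsupp.smul_single, map_smul]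
  rfl

theorem affineGen_mul (x y : 𝔤) (m n : ℤ) : affineGen κ x m * affineGen κ y n =
    affineGen κ y n * affineGen κ x m + affineGen κ ⁅x, y⁆ (m + n) +
      algebraMap ℂ _ (if m + n = 0 then m * κ x y else 0) := by
  have := RingQuot.mkAlgHom_rel ℂ (AffineRel.comm (κ := κ) m n x y)
  rw [map_mul, map_add, map_add, map_mul, AlgHom.commutes] at this
  exact this

theorem AffineEnv.induction {P : AffineEnv κ → Prop} (alg : ∀ c : ℂ, P (algebraMap ℂ _ c))
    (gen : ∀ x n, P (affineGen κ x n)) (add : ∀ u v, P u → P v → P (u + v))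
    (mul : ∀ u v, P u → P v → P (u * v)) (u : AffineEnv κ) : P u := by
  obtain ⟨w, rfl⟩ := RingQuot.mkAlgHom_surjective ℂ (AffineRel κ) u
  induction w using TensorAlgebra.induction with
  | algebraMap c => rw [AlgHom.commutes]; exact alg c
  | ι z =>
    induction z using Finsupp.induction_linear with
    | zero => rw [map_zero, map_zero]; have := alg 0; rwa [map_zero] at this
    | add a b ha hb => rw [map_add, map_add]; exact add _ _ ha hb
    | single n x => exact gen x n
  | mul a b ha hb => rw [map_mul]; exact mul _ _ ha hb
  | add a b ha hb => rw [map_add]; exact add _ _ ha hb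

namespace AffineVertex
variable {κ}

theorem mode_apply (x : 𝔤) (n : ℤ) (v : AffineVertex κ) : mode κ x n v = affineGen κ x n • v := rfl

theorem smul_vacuum (u : AffineEnv κ) : u • vacuum κ = Submodule.Quotient.mk (p := affineNonneg κ) u := by
  have : u • vacuum κ = Submodule.Quotient.mk (p := affineNonneg κ) (u • 1) := rfl
  rw [this, smul_eq_mul, mul_one]

theorem algebraMap_smul' (c : ℂ) (v : AffineVertex κ) :
    (algebraMap ℂ (AffineEnv κ) c) • v = c • v := algebraMap_smul (AffineEnv κ) c v

theorem mode_vacuum (x : 𝔤) (n : ℕ) : mode κ x n (vacuum κ) = 0 := by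
  rw [mode_apply, smul_vacuum]
  exact (Submodule.Quotient.mk_eq_zero _).2 (Submodule.subset_span ⟨x, n, rfl⟩)

theorem mode_add (x y : 𝔤) (n : ℤ) : mode κ (x + y) n = mode κ x n + mode κ y n :=
  LinearMap.ext fun v => by
    simp only [mode_apply, affineGen_add, add_smul, LinearMap.add_apply]

theorem mode_smul (c : ℂ) (x : 𝔤) (n : ℤ) : mode κ (c • x) n = c • mode κ x n :=
  LinearMap.ext fun v => by
    simp only [mode_apply, affineGen_smul, smul_assoc, LinearMap.smul_apply]

theorem mode_comm (x y : 𝔤) (m n : ℤ) (v : AffineVertex κ) :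
    mode κ x m (mode κ y n v) = mode κ y n (mode κ x m v) + mode κ ⁅x, y⁆ (m + n) v +
      (if m + n = 0 then m * κ x y else 0 : ℂ) • v := by
  simp only [mode_apply]
  rw [← mul_smul, affineGen_mul, add_smul, add_smul, mul_smul, algebraMap_smul']

@[elab_as_elim]
theorem induction {P : AffineVertex κ → Prop} (vac : P (vacuum κ))
    (add : ∀ u v, P u → P v → P (u + v)) (smul : ∀ (c : ℂ) v, P v → P (c • v))
    (mode : ∀ x n v, P v → P (mode κ x n v)) (v : AffineVertex κ) : P v := by
  obtain ⟨u, rfl⟩ := Submodule.Quotient.mk_surjective (affineNonneg κ) v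
  rw [← smul_vacuum]
  suffices ∀ v, P v → P (u • v) from this _ vac
  induction u using AffineEnv.induction with
  | alg c => intro v hv; rw [algebraMap_smul']; exact smul c v hv
  | gen x n => exact mode x n
  | add a b ha hb => intro v hv; rw [add_smul]; exact add _ _ (ha v hv) (hb v hv)
  | mul a b ha hb => intro v hv; rw [mul_smul]; exact ha _ (hb v hv)

/-- Commute `x t^n` past the operators that create `v`: for large `n` the brackets also have large
modes and no central term occurs. This makes the sums defining vertex operators finite. -/
theorem exists_mode_eq_zero (v : AffineVertex κ) :
    ∀ x, ∃ N : ℕ, ∀ n : ℤ, N ≤ n → mode κ x n v = 0 := by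
  induction v using AffineVertex.induction with
  | vac =>
    refine fun x => ⟨0, fun n hn => ?_⟩
    lift n to ℕ using by simpa using hn
    exact mode_vacuum x n
  | add u v hu hv =>
    intro x
    obtain ⟨N, hN⟩ := hu x
    obtain ⟨N', hN'⟩ := hv x
    refine ⟨max N N', fun n hn => ?_⟩
    push_cast at hn
    rw [map_add, hN n (le_trans (le_max_left _ _) hn), hN' n (le_trans (le_max_right _ _) hn),
      add_zero]
  | smul c v hv =>
    intro x
    obtain ⟨N, hN⟩ := hv x
    exact ⟨N, fun n hn => by rw [map_smul, hN n hn, smul_zero]⟩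
  | mode y m v hv =>
    intro x
    obtain ⟨N, hN⟩ := hv x
    obtain ⟨N', hN'⟩ := hv ⁅x, y⁆
    refine ⟨N + N' + m.natAbs + 1, fun n hn => ?_⟩
    push_cast at hn
    have := neg_abs_le m
    have := abs_nonneg m
    rw [mode_comm, hN n (by omega), hN' (n + m) (by omega), if_neg (by omega), map_zero, add_zero,
      zero_smul, add_zero]

/-- A finite sum for the operators in the definition of vertex operators. -/
theorem finsum_eq_sum {M : Type*} [AddCommMonoid M] {F : ℕ → M} {N : ℕ} (hF : ∀ j, N ≤ j → F j = 0) :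
    ∑ᶠ j, F j = ∑ j ∈ Finset.range N, F j :=
  finsum_eq_sum_of_support_subset _ fun j hj => by
    simp only [Finset.coe_range, Set.mem_Iio]
    by_contra h
    exact hj (hF j (by omega))

theorem IsVertexOp.exists_eq_zero {v : AffineVertex κ} {B : ℤ → Module.End ℂ (AffineVertex κ)}
    (hB : IsVertexOp v B) (w : AffineVertex κ) : ∃ N : ℕ, ∀ n : ℤ, N ≤ n → B n w = 0 := by
  induction hB generalizing w with
  | vacuum =>
    refine ⟨0, fun n hn => ?_⟩
    beta_reduce
    rw [if_neg (by omega)]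
    rfl
  | add _ _ hB hC =>
    obtain ⟨N, hN⟩ := hB w
    obtain ⟨N', hN'⟩ := hC w
    refine ⟨max N N', fun n hn => ?_⟩
    push_cast at hn
    rw [Pi.add_apply, LinearMap.add_apply, hN n (le_trans (le_max_left _ _) hn),
      hN' n (le_trans (le_max_right _ _) hn), add_zero]
  | smul c _ hB =>
    obtain ⟨N, hN⟩ := hB w
    exact ⟨N, fun n hn => by rw [Pi.smul_apply, LinearMap.smul_apply, hN n hn, smul_zero]⟩
  | @current x n v B C _ hC hB =>
    obtain ⟨N, hN⟩ := hB w
    obtain ⟨J, hJ⟩ := exists_mode_eq_zero w x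
    choose N' hN' using fun j : ℕ => hB (mode κ x j w)
    refine ⟨N + (Finset.range J).sup N' + J + n.natAbs, fun m hm => ?_⟩
    push_cast at hm
    have hn := neg_abs_le n
    have := abs_nonneg n
    rw [hC, finsum_eq_sum (N := J)]
    · refine Finset.sum_eq_zero fun j hj => ?_
      have hj' := Finset.mem_range.1 hj
      have h1 := Finset.le_sup (f := N') hj
      rw [hN _ (by omega), hN' j _ (by omega), map_zero, smul_zero, sub_zero, smul_zero]
    · intro j hj
      rw [hN _ (by omega), hJ j (by exact_mod_cast hj), map_zero, map_zero, smul_zero, sub_zero,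
        smul_zero]

theorem isVertexOp_current (x : 𝔤) :
    IsVertexOp (mode κ x (-1) (vacuum κ)) fun n => mode κ x n := by
  refine IsVertexOp.current x (-1) IsVertexOp.vacuum fun m w => ?_
  have h1 : ∀ j : ℕ, ((-1 : ℂ) ^ j * (Ring.choose (-1 : ℤ) j : ℤ)) = 1 := fun j => by
    have : (Ring.choose (-1 : ℤ) j : ℤ) = (-1) ^ j := by
      rw [Ring.choose_neg, show (1 : ℤ) + j - 1 = (j : ℕ) by ring, Ring.choose_natCast]
      simp [Int.negOnePow, Units.smul_def]
    rw [this]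
    push_cast
    rw [← mul_pow]
    simp
  simp only [h1, one_smul]
  -- The field of the vacuum leaves a single term: for `m ≥ 0` it comes from the second product with
  -- `j = m`, for `m < 0` from the first with `j = -1 - m`.
  rcases le_or_gt 0 m with hm | hm
  · rw [finsum_eq_single _ m.toNat]
    · rw [if_neg (by omega), if_pos (by omega), Int.toNat_of_nonneg hm]
      simp
    · intro j hj
      rw [if_neg (by omega), if_neg (by omega)]
      simp
  · rw [finsum_eq_single _ (-1 - m).toNat]
    · rw [if_pos (by omega), if_neg (by omega), Int.toNat_of_nonneg (by omega)]
      simp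
    · intro j hj
      rw [if_neg (by omega), if_neg (by omega)]
      simp

/-- One direction uses the vertex operator of a current. Conversely, in a nonnegative mode of `x t^n
w` every term applies to `v` a nonnegative mode either of `x` or of `w`, so vanishing propagates. -/
theorem mem_center_iff {v : AffineVertex κ} :
    v ∈ center κ ↔ ∀ (x : 𝔤) (n : ℕ), mode κ x n v = 0 := by
  refine ⟨fun hv x n => hv _ _ (isVertexOp_current x) n, fun hv w B hB => ?_⟩
  induction hB with
  | vacuum =>
    intro n
    beta_reduce
    rw [if_neg (by omega)]
    rfl
  | add _ _ hB hC => intro n; rw [Pi.add_apply, LinearMap.add_apply, hB, hC, add_zero]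
  | smul c _ hB => intro n; rw [Pi.smul_apply, LinearMap.smul_apply, hB, smul_zero]
  | current x n _ hC hB =>
    intro m
    rw [hC]
    refine (finsum_congr fun j => ?_).trans finsum_zero
    rw [hv, ← Nat.cast_add, hB, map_zero, map_zero, smul_zero, sub_zero, smul_zero]

section orbitMap
variable {E F : Type*} [Semiring E] [AddCommGroup F] [Module E F] (ρ : AffineEnv κ →+* E) (e : F)
  (he : ∀ x (n : ℕ), ρ (affineGen κ x n) • e = 0)
include he

/-- The map of the vacuum module to a module with a vector that is killed by `𝔤[t]`. -/
noncomputable def orbitMap : AffineVertex κ →+ F :=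
  QuotientAddGroup.lift (affineNonneg κ).toAddSubgroup
    { toFun := fun u => ρ u • e
      map_zero' := by rw [map_zero, zero_smul]
      map_add' := fun u v => by rw [map_add, add_smul] } (by
    intro u hu
    induction hu using Submodule.span_induction with
    | mem u hu =>
      obtain ⟨x, n, rfl⟩ := hu
      exact he x n
    | zero => exact zero_mem _
    | add a b _ _ ha hb => exact add_mem ha hb
    | smul a b _ hb =>
      change ρ b • e = 0 at hb
      change ρ (a * b) • e = 0
      rw [map_mul, mul_smul, hb, smul_zero])

theorem orbitMap_mk (u : AffineEnv κ) :
    orbitMap ρ e he (Submodule.Quotient.mk (p := affineNonneg κ) u) = ρ u • e := rfl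

theorem orbitMap_vacuum : orbitMap ρ e he (vacuum κ) = e := by
  rw [vacuum, orbitMap_mk, map_one, one_smul]

theorem orbitMap_smul (u : AffineEnv κ) (v : AffineVertex κ) :
    orbitMap ρ e he (u • v) = ρ u • orbitMap ρ e he v := by
  obtain ⟨w, rfl⟩ := Submodule.Quotient.mk_surjective (affineNonneg κ) v
  rw [orbitMap_mk, ← mul_smul, ← map_mul, ← orbitMap_mk ρ e he]
  rfl

end orbitMap

end AffineVertex
end VertexAlgebra

/-! ### The representation on fields and the state-field correspondence. -/

section FieldCalculus
variable {A K U : Type*} [CommRing A] [CommRing K] [Algebra A K] [Ring U] [Algebra A U]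
  [UniformSpace U] [IsUniformAddGroup U] [IsTopologicalRing U] [CompleteSpace U] [T2Space U]
  [Algebra ℂ A] {𝔤 : Type v} [LieRing 𝔤] [LieAlgebra ℂ 𝔤]

/-- Endomorphisms of a module over an algebra over `ℂ`. -/
@[reducible] noncomputable def endAlgebra (A F : Type*) [CommRing A] [Algebra ℂ A] [AddCommMonoid F]
    [Module A F] : Algebra ℂ (Module.End A F) :=
  Algebra.compHom (Module.End A F) (algebraMap ℂ A)

attribute [local instance] endAlgebra

theorem endAlgebra_smul {F : Type*} [AddCommMonoid F] [Module A F] (c : ℂ) (e : Module.End A F)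
    (z : F) : (c • e) z = algebraMap ℂ A c • e z := rfl

theorem zsmul_smul_eq {F : Type*} [AddCommGroup F] [Module A F] (m : ℤ) (a : A) (z : F) :
    m • a • z = ((m : A) * a) • z := by
  rw [mul_smul, Int.cast_smul_eq_zsmul]

namespace DiagonalKernel
variable {𝔎 : DiagonalKernel A K} {res : K →ₗ[A] A} (hr : 𝔎.IsResidueFor res) {W : ℕ → Ideal U}
  (hW : IsIdealBasis W) (κ : LinearMap.BilinForm ℂ 𝔤)

/-- Fields with the products of the generating currents of the affine vertex algebra. -/
structure IsCurrents (cur : 𝔤 →+ 𝔎.fields W) : Prop where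
  map_smul : ∀ (c : ℂ) x, cur (c • x) = algebraMap ℂ A c • cur x
  isLocalAt : ∀ x y, IsLocalAt hW 2 (cur x) (cur y)
  nProd_zero : ∀ x y, nProd hW 0 (cur x) (cur y) = cur ⁅x, y⁆
  nProd_one : ∀ x y, nProd hW 1 (cur x) (cur y) = algebraMap ℂ A (κ x y) • hr.unitFld W

namespace IsCurrents
variable {hr hW κ} {cur : 𝔤 →+ 𝔎.fields W} (hc : IsCurrents hr hW κ cur)
include hc

/-- The operators of `n`-th product with a current. -/
noncomputable def modeOp (n : ℤ) : 𝔤 →ₗ[ℂ] Module.End A (𝔎.fields W) where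
  toFun x := nProdL hW n (cur x)
  map_add' x y := by rw [map_add, map_add]
  map_smul' c x := by
    rw [hc.map_smul, LinearMap.map_smul]
    rfl

theorem modeOp_apply (n : ℤ) (x : 𝔤) (Z : 𝔎.fields W) :
    hc.modeOp n x Z = DiagonalKernel.nProd hW n (cur x) Z := rfl

/-- Currents are local of order two, so the commutator formula has two terms: the bracket, and `m
κ(x, y)` times a product with the unit field, which is the identity exactly when `m + n = 0`. -/
theorem modeOp_comm (m n : ℤ) (x y : 𝔤) : hc.modeOp m x * hc.modeOp n y =
    hc.modeOp n y * hc.modeOp m x + hc.modeOp (m + n) ⁅x, y⁆ +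
      algebraMap ℂ _ (if m + n = 0 then m * κ x y else 0) := by
  refine LinearMap.ext fun Z => ?_
  have h1 := (sub_eq_iff_eq_add' (G := 𝔎.fields W)).1 ((hc.isLocalAt x y).nProd_comm m n Z)
  change DiagonalKernel.nProd hW m (cur x) (DiagonalKernel.nProd hW n (cur y) Z) =
    DiagonalKernel.nProd hW n (cur y) (DiagonalKernel.nProd hW m (cur x) Z) +
    DiagonalKernel.nProd hW (m + n) (cur ⁅x, y⁆) Z + algebraMap ℂ A _ • Z
  rw [h1, add_assoc, Finset.sum_range_succ, Finset.sum_range_one]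
  congr 1
  simp only [Nat.cast_zero, sub_zero, Nat.cast_one, Ring.choose_zero_right, Ring.choose_one_right,
    one_smul]
  rw [hc.nProd_zero, hc.nProd_one, ← nProdL_apply hW (m + n - 1), LinearMap.map_smul, LinearMap.smul_apply,
    nProdL_apply, hr.nProd_unit_left hW]
  congr 1
  by_cases h0 : m + n = 0
  · rw [if_pos (by omega), if_pos h0, map_mul, map_intCast]
    exact zsmul_smul_eq (A := A) m (algebraMap ℂ A (κ x y)) Z
  · rw [if_neg (by omega), if_neg h0]
    simp

/-- The action of the enveloping algebra of the affine algebra on fields. -/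
noncomputable def rep : AffineEnv κ →ₐ[ℂ] Module.End A (𝔎.fields W) :=
  RingQuot.liftAlgHom ℂ ⟨TensorAlgebra.lift ℂ (Finsupp.lsum ℂ hc.modeOp), by
    rintro _ _ ⟨m, n, x, y⟩
    simp only [map_mul, map_add, TensorAlgebra.lift_ι_apply, Finsupp.lsum_single, AlgHom.commutes]
    exact hc.modeOp_comm m n x y⟩

theorem rep_affineGen (x : 𝔤) (n : ℤ) : hc.rep (affineGen κ x n) = hc.modeOp n x := by
  rw [rep, affineGen]
  refine (RingQuot.liftAlgHom_mkAlgHom_apply ℂ _ _ _).trans ?_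
  simp

theorem rep_nonneg (x : 𝔤) (n : ℕ) : hc.rep (affineGen κ x n) (hr.unitFld W) = 0 := by
  rw [rep_affineGen, modeOp_apply, hr.nProd_unit_right hW]

/-- The state-field correspondence. -/
noncomputable def stateField : AffineVertex κ →+ 𝔎.fields W :=
  AffineVertex.orbitMap (hc.rep : AffineEnv κ →+* Module.End A (𝔎.fields W)) (hr.unitFld W)
    hc.rep_nonneg

theorem stateField_vacuum : hc.stateField (AffineVertex.vacuum κ) = hr.unitFld W :=
  AffineVertex.orbitMap_vacuum _ _ _

theorem stateField_mode (x : 𝔤) (n : ℤ) (v : AffineVertex κ) :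
    hc.stateField (AffineVertex.mode κ x n v) =
      DiagonalKernel.nProd hW n (cur x) (hc.stateField v) := by
  refine (AffineVertex.orbitMap_smul _ _ _ _ _).trans ?_
  change hc.rep (affineGen κ x n) _ = _
  rw [rep_affineGen, modeOp_apply]
  rfl

theorem stateField_smul (c : ℂ) (v : AffineVertex κ) :
    hc.stateField (c • v) = algebraMap ℂ A c • hc.stateField v := by
  rw [← AffineVertex.algebraMap_smul']
  refine (AffineVertex.orbitMap_smul _ _ _ _ _).trans ?_
  change hc.rep (algebraMap ℂ _ c) _ = _
  rw [AlgHom.commutes]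
  rfl

theorem stateField_current (x : 𝔤) :
    hc.stateField (AffineVertex.mode κ x (-1) (AffineVertex.vacuum κ)) = cur x := by
  rw [stateField_mode, stateField_vacuum, hr.nProd_neg_one_unit hW]

/-- Dong's lemma, by induction on `v` for all currents at once: the products `y_(j) x` are a
current, a multiple of the unit field, or zero, and each is local to the field of `v`. -/
theorem isLocal_cur (x : 𝔤) (v : AffineVertex κ) : IsLocal hW (cur x) (hc.stateField v) := by
  induction v using AffineVertex.induction generalizing x with
  | vac =>
    rw [stateField_vacuum]
    exact ⟨0, (hr.unit_isLocal hW _).symm⟩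
  | add u v hu hv => rw [map_add]; exact ((hu x).symm.add (hv x).symm).symm
  | smul c v hv => rw [stateField_smul]; exact ((hv x).symm.smul _).symm
  | mode y n v hv =>
    rw [stateField_mode]
    refine (IsLocal.nProd ⟨2, hc.isLocalAt y x⟩ (hv x).symm (fun j => ?_) n).symm
    rcases j with _ | _ | j
    · rw [Nat.cast_zero, hc.nProd_zero]
      exact hv _
    · rw [zero_add, Nat.cast_one, hc.nProd_one]
      exact IsLocal.smul _ ⟨0, hr.unit_isLocal hW _⟩
    · rw [nProd_eq_zero (hc.isLocalAt y x) (by push_cast; omega)]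
      exact IsLocal.zero

/-- Induction on `v` for all `w`: the products of a current with the field of `w` are again state
fields, so the induction hypothesis meets the condition in Dong's lemma. -/
theorem isLocal_stateField (v w : AffineVertex κ) :
    IsLocal hW (hc.stateField v) (hc.stateField w) := by
  induction v using AffineVertex.induction generalizing w with
  | vac => rw [stateField_vacuum]; exact ⟨0, hr.unit_isLocal hW _⟩
  | add u v hu hv => rw [map_add]; exact (hu w).add (hv w)
  | smul c v hv => rw [stateField_smul]; exact (hv w).smul _
  | mode y n v hv =>
    rw [stateField_mode]
    refine IsLocal.nProd (hc.isLocal_cur y w) (hv w) (fun j => ?_) n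
    rw [← hc.stateField_mode]
    exact (hv _).symm

/-- The clause for `x t^n v` in the definition of vertex operators has the same form as the
associativity formula for fields. It remains to compare truncations. -/
theorem stateField_vertexOp {v : AffineVertex κ} {B : ℤ → Module.End ℂ (AffineVertex κ)}
    (hB : AffineVertex.IsVertexOp v B) (n : ℤ) (w : AffineVertex κ) :
    hc.stateField (B n w) = DiagonalKernel.nProd hW n (hc.stateField v) (hc.stateField w) := by
  induction hB generalizing n w with
  | vacuum =>
    beta_reduce
    rw [stateField_vacuum, hr.nProd_unit_left hW]
    split_ifs
    · rfl
    · exact map_zero _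
  | add _ _ hB hC =>
    rw [Pi.add_apply, LinearMap.add_apply, map_add, map_add, hB, hC, ← nProdL_apply, ← nProdL_apply,
      ← nProdL_apply, map_add, LinearMap.add_apply]
  | smul c _ hB =>
    rw [Pi.smul_apply, LinearMap.smul_apply, stateField_smul, stateField_smul, hB, ← nProdL_apply,
      ← nProdL_apply, LinearMap.map_smul, LinearMap.smul_apply]
  | @current x m v B C hB hC ih =>
    obtain ⟨N, hN⟩ := hB.exists_eq_zero w
    obtain ⟨J, hJ⟩ := AffineVertex.exists_mode_eq_zero w x
    obtain ⟨J₁, hJ₁⟩ := hc.isLocal_cur x w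
    obtain ⟨m₂, hm₂⟩ := hc.isLocal_stateField v w
    -- A single bound beyond which both the sum in the vertex algebra and the two sums of the
    -- associativity formula may be cut off.
    set L := N + J + J₁ + m₂ + n.natAbs with hL
    have hn := neg_abs_le n
    have hn' := abs_nonneg n
    rw [hC, AffineVertex.finsum_eq_sum (N := L), stateField_mode,
      (hJ₁.mono (by omega : J₁ ≤ L)).nProd_nProd hm₂ (J' := L) (by push_cast [hL]; omega),
      map_sum, Finset.smul_sum]
    · refine Eq.trans ?_ (Finset.sum_sub_distrib (s := Finset.range L) (G := 𝔎.fields W) _ _)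
      refine Finset.sum_congr rfl fun j _ => ?_
      have e1 : ((-1 : ℂ) ^ j * (Ring.choose m j : ℤ)) = (((-1) ^ j * Ring.choose m j : ℤ) : ℂ) := by
        push_cast; rfl
      have e2 : ((-1 : ℂ) ^ m) = ((sgn m : ℤ) : ℂ) := by
        rw [sgn, Int.cast_negOnePow]
      rw [e1, e2, Int.cast_smul_eq_zsmul ℂ, Int.cast_smul_eq_zsmul ℂ, map_zsmul, map_sub, map_zsmul,
        stateField_mode, ih, ih, stateField_mode, smul_sub, smul_comm (sgn m)]
    · intro j hj
      rw [hN _ (by push_cast [hL] at hj; omega), hJ j (by push_cast [hL] at hj; omega), map_zero,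
        map_zero, smul_zero, sub_zero, smul_zero]

end IsCurrents
end DiagonalKernel
end FieldCalculus

/-! ### Creation operators span the vacuum module. -/

namespace AffineVertex
variable {𝔤 : Type v} [LieRing 𝔤] [LieAlgebra ℂ 𝔤] {κ : LinearMap.BilinForm ℂ 𝔤}

/-- The vectors generated from the vacuum by creation operators. -/
inductive IsCreated : AffineVertex κ → Prop
  | vac : IsCreated (vacuum κ)
  | add {u v} : IsCreated u → IsCreated v → IsCreated (u + v)
  | smul (c : ℂ) {v} : IsCreated v → IsCreated (c • v)
  | mode (x : 𝔤) (s : ℕ) {v} : IsCreated v → IsCreated (mode κ x (-1 - s) v)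

theorem IsCreated.zero : IsCreated (0 : AffineVertex κ) := by
  simpa using IsCreated.smul 0 (IsCreated.vac (κ := κ))

/-- Move the nonnegative mode past the creation operator. The bracket has mode `n - 1 - s`, either
nonnegative and covered by the induction, or again a creation mode. -/
theorem IsCreated.mode_nonneg {v : AffineVertex κ} (hv : IsCreated v) (x : 𝔤) (n : ℕ) :
    IsCreated (AffineVertex.mode κ x n v) := by
  induction hv generalizing x n with
  | vac => rw [mode_vacuum]; exact .zero
  | add _ _ hu hv => rw [map_add]; exact (hu x n).add (hv x n)
  | smul c _ hv => rw [map_smul]; exact (hv x n).smul c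
  | @mode y s v h hv =>
    rw [mode_comm]
    refine (IsCreated.add (.mode y s (hv x n)) ?_).add (h.smul _)
    by_cases hs : s < n
    · have := hv ⁅x, y⁆ (n - 1 - s)
      rwa [show ((n - 1 - s : ℕ) : ℤ) = n + (-1 - s) by omega] at this
    · have := h.mode ⁅x, y⁆ (s - n)
      rwa [show (-1 - (s - n : ℕ) : ℤ) = n + (-1 - s) by omega] at this

theorem isCreated (v : AffineVertex κ) : IsCreated v := by
  induction v using AffineVertex.induction with
  | vac => exact .vac
  | add u v hu hv => exact hu.add hv
  | smul c v hv => exact hv.smul c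
  | mode x n v hv =>
    rcases Int.le_total 0 n with hn | hn
    · lift n to ℕ using hn
      exact hv.mode_nonneg x n
    · rcases hn.eq_or_lt with rfl | hn
      · exact hv.mode_nonneg x 0
      · have := hv.mode x (-1 - n).toNat
        rwa [show (-1 - ((-1 - n).toNat : ℤ)) = n by omega] at this

end AffineVertex

/-! ### Closure of the state fields under `∂` and products. -/

section FieldCalculus
variable {A K U : Type*} [CommRing A] [CommRing K] [Algebra A K] [Ring U] [Algebra A U]
  [UniformSpace U] [IsUniformAddGroup U] [IsTopologicalRing U] [CompleteSpace U] [T2Space U]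
  [Algebra ℂ A] {𝔤 : Type v} [LieRing 𝔤] [LieAlgebra ℂ 𝔤]

namespace DiagonalKernel
variable {𝔎 : DiagonalKernel A K} {res : K →ₗ[A] A} {hr : 𝔎.IsResidueFor res} {W : ℕ → Ideal U}
  {hW : IsIdealBasis W} {κ : LinearMap.BilinForm ℂ 𝔤}

theorem derFld_add (X Y : 𝔎.fields W) : derFld (X + Y) = derFld X + derFld Y := rfl

theorem derFld_smul (a : A) (X : 𝔎.fields W) : derFld (a • X) = a • derFld X := rfl

namespace IsCurrents
variable {cur : 𝔤 →+ 𝔎.fields W} (hc : IsCurrents hr hW κ cur)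
include hc

/-- `∂` acts on products with currents by a Leibniz rule, and it kills the unit field because
residues of derivatives vanish. -/
theorem exists_derFld (v : AffineVertex κ) :
    ∃ v', derFld (hc.stateField v) = hc.stateField v' := by
  induction v using AffineVertex.induction with
  | vac =>
    refine ⟨0, ?_⟩
    rw [stateField_vacuum, map_zero]
    refine Subtype.ext (LinearMap.ext fun k => ?_)
    simp [derFld, IsResidueFor.unitFld, hr.res_der]
  | add u v hu hv =>
    obtain ⟨u', hu⟩ := hu
    obtain ⟨v', hv⟩ := hv
    exact ⟨u' + v', by rw [map_add, map_add, derFld_add, hu, hv]⟩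
  | smul c v hv =>
    obtain ⟨v', hv⟩ := hv
    exact ⟨c • v', by rw [stateField_smul, stateField_smul, derFld_smul, hv]⟩
  | mode x n v hv =>
    obtain ⟨v', hv⟩ := hv
    refine ⟨AffineVertex.mode κ x n v' + n • AffineVertex.mode κ x (n - 1) v, ?_⟩
    have := nProd_derFld_right hW n (cur x) (hc.stateField v)
    rw [hv] at this
    rw [map_add, map_zsmul, stateField_mode, stateField_mode, stateField_mode, this]
    exact (sub_add_cancel (G := 𝔎.fields W) _ _).symm

/-- Associativity rewrites a product with the field of `x t^m v` in terms of products with a current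
and products with the field of `v`, finitely many by locality. -/
theorem exists_nProd (n : ℤ) (v w : AffineVertex κ) :
    ∃ v', DiagonalKernel.nProd hW n (hc.stateField v) (hc.stateField w) = hc.stateField v' := by
  induction v using AffineVertex.induction generalizing n w with
  | vac =>
    rw [stateField_vacuum, hr.nProd_unit_left hW]
    split_ifs
    · exact ⟨w, rfl⟩
    · exact ⟨0, (map_zero _).symm⟩
  | add u v hu hv =>
    obtain ⟨u', hu⟩ := hu n w
    obtain ⟨v', hv⟩ := hv n w
    refine ⟨u' + v', ?_⟩
    rw [map_add, map_add, ← hu, ← hv, ← nProdL_apply, ← nProdL_apply, ← nProdL_apply, map_add,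
      LinearMap.add_apply]
  | smul c v hv =>
    obtain ⟨v', hv⟩ := hv n w
    refine ⟨c • v', ?_⟩
    rw [stateField_smul, stateField_smul, ← hv, ← nProdL_apply, ← nProdL_apply, LinearMap.map_smul,
      LinearMap.smul_apply]
  | mode x m v hv =>
    obtain ⟨J, hJ⟩ := hc.isLocal_cur x w
    obtain ⟨m₂, hm₂⟩ := hc.isLocal_stateField v w
    choose g hg using hv
    rw [stateField_mode, hJ.nProd_nProd hm₂ (J' := (m₂ + n.natAbs)) (by omega)]
    simp only [hg, ← stateField_mode]
    refine ⟨∑ j ∈ Finset.range (m₂ + n.natAbs), ((-1) ^ j * Ring.choose m j : ℤ) •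
      AffineVertex.mode κ x (m - j) (g (n + j) w) - sgn m • ∑ j ∈ Finset.range J,
        ((-1) ^ j * Ring.choose m j : ℤ) • g (m + n - j) (AffineVertex.mode κ x j w), ?_⟩
    simp only [map_sub, map_sum, map_zsmul]

end IsCurrents
end DiagonalKernel
end FieldCalculus

/-! ### The chiral algebra as the `R`-span of the state fields. -/

namespace IsFormalCoordinate
section Enveloping
variable {A R : Type u} [CommRing A] [CommRing R] [Algebra A R] [Algebra ℂ A] [Algebra ℂ R]
  [IsScalarTower ℂ A R] {𝔤 : Type v} [LieRing 𝔤] [LieAlgebra ℂ 𝔤]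
variable {I : ℕ → Ideal R} {t : R} {f : A[X]} (h : IsFormalCoordinate I t f)
  (κ : LinearMap.BilinForm ℂ 𝔤)

theorem isCurrents :
    DiagonalKernel.IsCurrents h.isResidueFor (isIdealBasis h κ) κ (curF h κ) where
  map_smul := curF_smul h κ
  isLocalAt := curF_isLocalAt h κ
  nProd_zero := nProd_zero_curF h κ
  nProd_one := nProd_one_curF h κ

/-- The state-field correspondence. -/
noncomputable abbrev sf : AffineVertex κ →+ h.kernel.fields (cLevel h κ) := (isCurrents h κ).stateField

/-- The action of `R` on fields as a linear map. -/
noncomputable def mulRL (r : R) : PreField h κ →ₗ[A] PreField h κ :=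
  LinearMap.lcomp A _ (LinearMap.mulLeft A (algebraMap R h.Punctured r))

variable {h κ}

theorem mulRL_apply (r : R) (X : PreField h κ) : mulRL h κ r X = X.mulR r := rfl

theorem mulR_mulR (X : PreField h κ) (r s : R) : (X.mulR r).mulR s = X.mulR (r * s) :=
  LinearMap.ext fun k => by simp [PreField.mulR]

theorem mulDeriv_mulR (X : PreField h κ) (r : R) :
    X.mulDeriv.mulR r = X.mulR (h.deriv r) + (X.mulR r).mulDeriv :=
  LinearMap.ext fun k => by
    simp only [PreField.mulDeriv, PreField.mulR, LinearMap.comp_apply, LinearMap.mulLeft_apply,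
      LinearMap.add_apply, Derivation.coeFn_coe, Derivation.leibniz, smul_eq_mul, derivK_algebraMap,
      map_add]
    rw [add_comm, mul_comm k]

variable (h κ)

theorem chiralFil_monotone : Monotone (chiralFil h κ) :=
  monotone_nat_of_le_succ fun _ => le_sup_left

theorem mem_chiral_iff {X : PreField h κ} : X ∈ chiral h κ ↔ ∃ n, X ∈ chiralFil h κ n :=
  Submodule.mem_iSup_of_directed _ (chiralFil_monotone h κ).directed_le

theorem chiralFil_mulR (n : ℕ) (r : R) {X : PreField h κ} (hX : X ∈ chiralFil h κ n) :
    X.mulR r ∈ chiralFil h κ n := by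
  induction n generalizing r X with
  | zero =>
    suffices chiralFil h κ 0 ≤ (chiralFil h κ 0).comap (mulRL h κ r) from this hX
    refine Submodule.span_le.2 ?_
    rintro _ ⟨s, rfl | ⟨x, rfl⟩⟩
    · exact Submodule.subset_span ⟨s * r, Or.inl ((mulRL_apply _ _).trans (mulR_mulR _ _ _))⟩
    · exact Submodule.subset_span ⟨s * r, Or.inr ⟨x, (mulRL_apply _ _).trans (mulR_mulR _ _ _)⟩⟩
  | succ n ih =>
    suffices chiralFil h κ (n + 1) ≤ (chiralFil h κ (n + 1)).comap (mulRL h κ r) from this hX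
    refine sup_le (fun X hX => Submodule.mem_sup_left (ih r hX)) (Submodule.span_le.2 ?_)
    rintro _ (⟨X, hX, rfl⟩ | ⟨X, hX, Y, hY, Z, hZ, s, rfl⟩)
    · rw [SetLike.mem_coe, Submodule.mem_comap, mulRL_apply, mulDeriv_mulR]
      exact add_mem (Submodule.mem_sup_left (ih _ hX))
        (Submodule.mem_sup_right (Submodule.subset_span (Or.inl ⟨_, ih r hX, rfl⟩)))
    · exact Submodule.mem_sup_right (Submodule.subset_span
        (Or.inr ⟨X, hX, Y, hY, Z, hZ, s * r, (mulRL_apply _ _).trans (mulR_mulR _ _ _)⟩))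

theorem chiral_mulR (r : R) {X : PreField h κ} (hX : X ∈ chiral h κ) : X.mulR r ∈ chiral h κ := by
  obtain ⟨n, hn⟩ := (mem_chiral_iff h κ).1 hX
  exact (mem_chiral_iff h κ).2 ⟨n, chiralFil_mulR h κ n r hn⟩

/-- Only `(-1)`-products are built into the filtration. Replacing `X` by `X ∂` lowers the order of a
product by one at the price of the factor `-1 - s`, which is invertible over `ℂ`. -/
theorem nProd_mem_chiral (s : ℕ) {X Y : h.kernel.fields (cLevel h κ)} (hX : X.1 ∈ chiral h κ)
    (hY : Y.1 ∈ chiral h κ) :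
    (DiagonalKernel.nProd (isIdealBasis h κ) (-1 - s) X Y).1 ∈ chiral h κ := by
  induction s generalizing X with
  | zero =>
    obtain ⟨n, hn⟩ := (mem_chiral_iff h κ).1 hX
    obtain ⟨m, hm⟩ := (mem_chiral_iff h κ).1 hY
    refine (mem_chiral_iff h κ).2 ⟨max n m + 1, Submodule.mem_sup_right (Submodule.subset_span
      (Or.inr ⟨X.1, chiralFil_monotone h κ (le_max_left _ _) hn, Y.1,
        chiralFil_monotone h κ (le_max_right _ _) hm, _, isNProd_nProd (-1) X Y, 1, ?_⟩))⟩
    · refine LinearMap.ext fun k => ?_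
      simp [PreField.mulR]
  | succ s ih =>
    obtain ⟨n, hn⟩ := (mem_chiral_iff h κ).1 hX
    have h1 : (DiagonalKernel.derFld X).1 ∈ chiral h κ :=
      (mem_chiral_iff h κ).2 ⟨n + 1, Submodule.mem_sup_right (Submodule.subset_span
        (Or.inl ⟨X.1, hn, rfl⟩))⟩
    have h2 := ih h1
    rw [DiagonalKernel.nProd_derFld_left] at h2
    have h3 := (chiral h κ).smul_mem (algebraMap ℂ A ((-1 - s : ℤ) : ℂ)⁻¹) h2
    have h4 : ((-1 - s : ℤ) : ℂ) ≠ 0 := by exact_mod_cast (by omega : (-1 - s : ℤ) ≠ 0)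
    have h5 := AddSubgroupClass.coe_zsmul
      (DiagonalKernel.nProd (isIdealBasis h κ) (-1 - s - 1) X Y) (-1 - s)
    rw [h5, ← Int.cast_smul_eq_zsmul A, smul_smul, ← map_intCast (algebraMap ℂ A), ← map_mul,
      inv_mul_cancel₀ h4, map_one, one_smul] at h3
    rwa [show (-1 - ((s + 1 : ℕ) : ℤ)) = -1 - s - 1 by push_cast; ring]

theorem sf_mem_chiral (v : AffineVertex κ) : (sf h κ v).1 ∈ chiral h κ := by
  have hv := AffineVertex.isCreated v
  have one : ∀ X : PreField h κ, X = X.mulR 1 := fun X => LinearMap.ext fun k => by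
    simp [PreField.mulR]
  induction hv with
  | vac =>
    rw [DiagonalKernel.IsCurrents.stateField_vacuum]
    exact (mem_chiral_iff h κ).2 ⟨0, Submodule.subset_span ⟨1, Or.inl (one _)⟩⟩
  | add _ _ hu hv => rw [map_add]; exact add_mem hu hv
  | smul c _ hv =>
    rw [DiagonalKernel.IsCurrents.stateField_smul]
    exact Submodule.smul_mem _ _ hv
  | mode x s _ hv =>
    rw [DiagonalKernel.IsCurrents.stateField_mode]
    exact nProd_mem_chiral h κ s
      ((mem_chiral_iff h κ).2 ⟨0, Submodule.subset_span ⟨1, Or.inr ⟨x, one _⟩⟩⟩) hv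

/-- The `R`-span of the fields of the vectors in a set. -/
noncomputable def stateSpan (S : Set (AffineVertex κ)) : Submodule A (h.kernel.fields (cLevel h κ)) :=
  Submodule.span A {X | ∃ v ∈ S, ∃ r : R, X =
    DiagonalKernel.mulFld (sf h κ v) (algebraMap R h.Punctured r)}

variable {h κ} in
theorem stateSpan_mono {S S' : Set (AffineVertex κ)} (hS : S ⊆ S') :
    stateSpan h κ S ≤ stateSpan h κ S' :=
  Submodule.span_mono fun _ ⟨v, hv, r, e⟩ => ⟨v, hS hv, r, e⟩

variable {h κ} in
theorem mulFld_mem_stateSpan {S : Set (AffineVertex κ)} {X : h.kernel.fields (cLevel h κ)} (r : R)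
    (hX : X ∈ stateSpan h κ S) :
    DiagonalKernel.mulFld X (algebraMap R h.Punctured r) ∈ stateSpan h κ S := by
  induction hX using Submodule.span_induction with
  | mem X hX =>
    obtain ⟨v, hv, s, rfl⟩ := hX
    refine Submodule.subset_span ⟨v, hv, s * r, Subtype.ext (LinearMap.ext fun k => ?_)⟩
    simp [DiagonalKernel.mulFld]
  | zero => exact zero_mem _
  | add _ _ _ _ ha hb => exact add_mem ha hb
  | smul a _ _ hb => exact Submodule.smul_mem _ a hb

theorem divPow_algebraMap (j : ℕ) (r : R) : ∃ s : R,
    divPow (h.kernel.der : h.Punctured →ₗ[A] h.Punctured) j (algebraMap R h.Punctured r) =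
      algebraMap R h.Punctured s := by
  have h1 : ∀ j, ∃ s : R, ((h.kernel.der : h.Punctured →ₗ[A] h.Punctured) ^ j)
      (algebraMap R h.Punctured r) = algebraMap R h.Punctured s := fun j => by
    induction j with
    | zero => exact ⟨r, rfl⟩
    | succ j ih =>
      obtain ⟨s, hs⟩ := ih
      refine ⟨h.deriv s, ?_⟩
      rw [pow_succ', Module.End.mul_apply, hs, ← derivK_algebraMap]
      rfl
  obtain ⟨s, hs⟩ := h1 j
  refine ⟨algebraMap ℂ A (j.factorial : ℂ)⁻¹ • s, ?_⟩
  rw [divPow, LinearMap.smul_apply, hs, Algebra.smul_def, Algebra.smul_def, map_mul,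
    ← IsScalarTower.algebraMap_apply A R h.Punctured]

/-- A coefficient on the right factor passes through. One on the left is absorbed by the operator
product expansion, which trades it for its divided derivatives on the products of orders `-1`, `0`,
..., `J - 1`. -/
theorem nProd_mem_stateSpan {v w : AffineVertex κ} {J : ℕ}
    (hJ : DiagonalKernel.IsLocalAt (isIdealBasis h κ) J (sf h κ v) (sf h κ w))
    {S : Set (AffineVertex κ)}
    (hS : ∀ j < J + 1, ∃ u ∈ S, DiagonalKernel.nProd (isIdealBasis h κ) (-1 + j) (sf h κ v)
      (sf h κ w) = sf h κ u) (r s : R) :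
    DiagonalKernel.nProd (isIdealBasis h κ) (-1)
      (DiagonalKernel.mulFld (sf h κ v) (algebraMap R h.Punctured r))
      (DiagonalKernel.mulFld (sf h κ w) (algebraMap R h.Punctured s)) ∈ stateSpan h κ S := by
  rw [DiagonalKernel.nProd_mulFld_right]
  refine mulFld_mem_stateSpan s ?_
  choose d hd using fun j => h.divPow_algebraMap j r
  have e : DiagonalKernel.nProd (isIdealBasis h κ) (-1)
      (DiagonalKernel.mulFld (sf h κ v) (algebraMap R h.Punctured r)) (sf h κ w) =
      ∑ j ∈ Finset.range (J + 1), DiagonalKernel.mulFld (DiagonalKernel.nProd (isIdealBasis h κ)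
        (-1 + j) (sf h κ v) (sf h κ w)) (algebraMap R h.Punctured (d j)) := by
    refine Subtype.ext (LinearMap.ext fun g => ?_)
    rw [DiagonalKernel.nProd_mulFld_left_apply, hJ.prodMap_tmul (J := J + 1) (by omega),
      AddSubmonoidClass.coe_finsetSum, LinearMap.sum_apply]
    exact Finset.sum_congr rfl fun j _ => by rw [hd]; rfl
  rw [e]
  refine Submodule.sum_mem _ fun j hj => ?_
  obtain ⟨u, hu, e⟩ := hS j (Finset.mem_range.1 hj)
  rw [e]
  exact Submodule.subset_span ⟨u, hu, d j, rfl⟩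

theorem curF_mem_stateSpan {B : Set 𝔤} {x : 𝔤} (hx : x ∈ Submodule.span ℂ B) :
    curF h κ x ∈ stateSpan h κ
      ((fun x => AffineVertex.mode κ x (-1) (AffineVertex.vacuum κ)) '' B) := by
  induction hx using Submodule.span_induction with
  | mem x hx =>
    refine Submodule.subset_span ⟨_, ⟨x, hx, rfl⟩, 1, Subtype.ext (LinearMap.ext fun k => ?_)⟩
    rw [DiagonalKernel.IsCurrents.stateField_current]
    simp [DiagonalKernel.mulFld]
  | zero => rw [map_zero]; exact zero_mem _
  | add x y _ _ hx hy => rw [map_add]; exact add_mem hx hy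
  | smul c x _ hx => rw [curF_smul]; exact Submodule.smul_mem _ _ hx

/-- Each step of the filtration needs finitely many new vectors, starting from a finite spanning set
of `𝔤`. Finiteness matters for the topology: one bound on poles then works for a whole step of the
filtration. -/
theorem exists_finite_stateSpan [FiniteDimensional ℂ 𝔤] (n : ℕ) :
    ∃ S : Set (AffineVertex κ), S.Finite ∧
      chiralFil h κ n ≤ (stateSpan h κ S).map (h.kernel.fields (cLevel h κ)).subtype := by
  induction n with
  | zero =>
    obtain ⟨B, hB⟩ := (Module.Finite.fg_top : (⊤ : Submodule ℂ 𝔤).FG)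
    refine ⟨{AffineVertex.vacuum κ} ∪
      (fun x => AffineVertex.mode κ x (-1) (AffineVertex.vacuum κ)) '' B,
      (Set.finite_singleton _).union (B.finite_toSet.image _), Submodule.span_le.2 ?_⟩
    rintro _ ⟨r, rfl | ⟨x, rfl⟩⟩
    · refine ⟨_, Submodule.subset_span ⟨AffineVertex.vacuum κ, Or.inl rfl, r, rfl⟩, ?_⟩
      rw [DiagonalKernel.IsCurrents.stateField_vacuum]
      rfl
    · refine ⟨_, mulFld_mem_stateSpan r (stateSpan_mono Set.subset_union_right
        (curF_mem_stateSpan h κ (B := B) (x := x) (by rw [hB]; trivial))), rfl⟩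
  | succ n ih =>
    obtain ⟨S, hS, hle⟩ := ih
    choose D hD using (isCurrents h κ).exists_derFld
    choose P hP using (isCurrents h κ).exists_nProd
    choose J hJ using (isCurrents h κ).isLocal_stateField
    -- Besides `S` this contains the derivatives and, for each pair, the finitely many products that
    -- occur in `nProd_mem_stateSpan`.
    set T : Set (AffineVertex κ) := S ∪ D '' S ∪
      ⋃ v ∈ S, ⋃ w ∈ S, (fun j : ℕ => P (-1 + j) v w) '' Set.Iio (J v w + 1) with hT
    have hST : S ⊆ T := Set.subset_union_left.trans Set.subset_union_left
    refine ⟨T, (hS.union (hS.image _)).union (hS.biUnion fun v _ => hS.biUnion fun w _ =>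
      (Set.finite_Iio _).image _), sup_le (hle.trans (Submodule.map_mono (stateSpan_mono hST)))
      (Submodule.span_le.2 ?_)⟩
    rintro _ (⟨X, hX, rfl⟩ | ⟨X, hX, Y, hY, Z, hZ, s, rfl⟩)
    · obtain ⟨X, hX', rfl⟩ := hle hX
      refine ⟨DiagonalKernel.derFld X, ?_, rfl⟩
      clear hX
      induction hX' using Submodule.span_induction with
      | zero => exact zero_mem _
      | add _ _ _ _ ha hb => exact add_mem ha hb
      | smul a _ _ hb => exact Submodule.smul_mem _ a hb
      | mem X hX =>
        obtain ⟨v, hv, r, rfl⟩ := hX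
        have e : DiagonalKernel.derFld
            (DiagonalKernel.mulFld (sf h κ v) (algebraMap R h.Punctured r)) =
            DiagonalKernel.mulFld (sf h κ (D v)) (algebraMap R h.Punctured r) +
            (-1 : A) • DiagonalKernel.mulFld (sf h κ v)
              (algebraMap R h.Punctured (h.deriv r)) := by
          rw [← hD]
          refine Subtype.ext (LinearMap.ext fun k => ?_)
          have h1 := LinearMap.congr_fun (mulDeriv_mulR (sf h κ v).1 r) k
          refine (eq_sub_of_add_eq' h1.symm).trans ((sub_eq_add_neg _ _).trans ?_)
          exact congrArg (_ + ·) (neg_one_smul A _).symm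
        rw [e]
        refine Submodule.add_mem _ ?_ (Submodule.smul_mem _ _ ?_)
        · exact Submodule.subset_span ⟨_, Or.inl (Or.inr ⟨v, hv, rfl⟩), r, rfl⟩
        · exact Submodule.subset_span ⟨v, hST hv, _, rfl⟩
    · obtain ⟨X, hX', rfl⟩ := hle hX
      obtain ⟨Y, hY', rfl⟩ := hle hY
      refine ⟨_, mulFld_mem_stateSpan s ?_, congrArg (fun Z => PreField.mulR Z s)
        (hZ.eq X.2 Y.2).symm⟩
      refine LinearMap.BilinMap.apply_apply_mem_of_mem_span (stateSpan h κ T) _ _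
        (DiagonalKernel.nProdL (isIdealBasis h κ) (-1)) ?_ X Y hX' hY'
      rintro _ ⟨v, hv, r, rfl⟩ _ ⟨w, hw, s, rfl⟩
      refine nProd_mem_stateSpan h κ (hJ v w) (fun j hj => ⟨_, Or.inr ?_, hP (-1 + j) v w⟩) r s
      exact Set.mem_biUnion hv (Set.mem_biUnion hw ⟨j, hj, rfl⟩)

end Enveloping
end IsFormalCoordinate

/-! ### Coefficients of products of Laurent series as sums over intervals. -/

section LaurentSums
variable {E V : Type*}

/-- The coefficients vanish below `n`. -/
def SupportedFrom [Zero V] (n : ℤ) (c : HahnSeries ℤ V) : Prop := ∀ a < n, c.coeff a = 0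

theorem SupportedFrom.mono [Zero V] {n m : ℤ} {c : HahnSeries ℤ V} (hc : SupportedFrom n c)
    (h : m ≤ n) : SupportedFrom m c := fun a ha => hc a (by omega)

theorem exists_supportedFrom [Zero V] (c : HahnSeries ℤ V) : ∃ n, SupportedFrom n c :=
  ⟨c.order, fun _ ha => HahnSeries.coeff_eq_zero_of_lt_order ha⟩

/-- A Hahn series over `ℤ` from a function with support bounded below. -/
def laurentMk [Zero V] (F : ℤ → V) (n : ℤ) (h : ∀ a < n, F a = 0) : HahnSeries ℤ V where
  coeff := F
  isPWO_support' := by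
    refine Set.IsWF.isPWO (BddBelow.wellFoundedOn_lt ⟨n, fun a ha => ?_⟩)
    by_contra hlt
    exact ha (h a (by omega))

theorem coeff_hahn_smul [Semiring E] [AddCommMonoid V] [Module E V] {x : HahnSeries ℤ E}
    {m : HahnModule ℤ E V} {a₀ b₀ : ℤ} (hx : SupportedFrom a₀ x)
    (hm : SupportedFrom b₀ ((HahnModule.of E).symm m)) (e : ℤ) :
    ((HahnModule.of E).symm (x • m)).coeff e =
      ∑ a ∈ Finset.Icc a₀ (e - b₀), x.coeff a • ((HahnModule.of E).symm m).coeff (e - a) := by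
  rw [HahnModule.coeff_smul]
  refine Finset.sum_bij_ne_zero (fun p _ _ => p.1) (fun p hp h0 => ?_) (fun p hp h0 q hq h1 e => ?_)
    (fun a ha h0 => ?_) (fun p hp h0 => ?_)
  · rw [Finset.mem_vaddAntidiagonal] at hp
    have h1 : a₀ ≤ p.1 := by
      by_contra hlt
      exact hp.1 (hx _ (by omega))
    have h2 : b₀ ≤ p.2 := by
      by_contra hlt
      exact hp.2.1 (hm _ (by omega))
    have h3 : p.1 + p.2 = _ := hp.2.2
    exact Finset.mem_Icc.2 ⟨h1, by omega⟩
  · rw [Finset.mem_vaddAntidiagonal] at hp hq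
    have h3 : p.1 + p.2 = _ := hp.2.2
    have h4 : q.1 + q.2 = _ := hq.2.2
    exact Prod.ext e (by omega)
  · refine ⟨(a, e - a), ?_, h0, rfl⟩
    rw [Finset.mem_vaddAntidiagonal]
    refine ⟨fun h1 => h0 ?_, fun h1 => h0 ?_, ?_⟩
    · rw [h1, zero_smul]
    · exact (congrArg (x.coeff a • ·) h1).trans (smul_zero _)
    · change a + (e - a) = e
      omega
  · rw [Finset.mem_vaddAntidiagonal] at hp
    have h3 : p.1 + p.2 = _ := hp.2.2
    rw [← h3, add_sub_cancel_left]

theorem coeff_laurent_mul [Semiring E] {x y : HahnSeries ℤ E} {a₀ b₀ : ℤ}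
    (hx : SupportedFrom a₀ x) (hy : SupportedFrom b₀ y) (e : ℤ) :
    (x * y).coeff e = ∑ a ∈ Finset.Icc a₀ (e - b₀), x.coeff a * y.coeff (e - a) :=
  coeff_hahn_smul (m := HahnModule.of E y) hx hy e

theorem coeff_laurent_mul' [Semiring E] {x y : HahnSeries ℤ E} {a₀ b₀ : ℤ}
    (hx : SupportedFrom a₀ x) (hy : SupportedFrom b₀ y) (e : ℤ) :
    (x * y).coeff e = ∑ a ∈ Finset.Icc b₀ (e - a₀), x.coeff (e - a) * y.coeff a := by
  rw [coeff_laurent_mul hx hy]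
  refine Finset.sum_nbij' (fun a => e - a) (fun a => e - a) ?_ ?_ ?_ ?_ ?_ <;>
    simp only [Finset.mem_Icc] <;> intro a ha
  · omega
  · omega
  · omega
  · omega
  · rw [sub_sub_cancel]

/-- The lowest coefficient of `x` is `1`, so the lowest term of `y` survives in the product and
fixes its order. -/
theorem supportedFrom_mul_iff [Semiring E] {x y : HahnSeries ℤ E} {a₀ b₀ : ℤ}
    (hx : SupportedFrom a₀ x) (hx1 : x.coeff a₀ = 1) (hxy : SupportedFrom (a₀ + b₀) (x * y)) :
    SupportedFrom b₀ y := by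
  rcases eq_or_ne y 0 with rfl | hy
  · exact fun _ _ => rfl
  have h1 : SupportedFrom y.order y := fun _ ha => HahnSeries.coeff_eq_zero_of_lt_order ha
  refine h1.mono ?_
  by_contra hlt
  have h2 := hxy (a₀ + y.order) (by omega)
  rw [coeff_laurent_mul hx h1, add_sub_cancel_right, Finset.Icc_self, Finset.sum_singleton, hx1,
    one_mul, add_sub_cancel_left] at h2
  exact hy (HahnSeries.coeff_order_eq_zero.1 h2)

end LaurentSums

/-- The algebra of Laurent series with constants acting coefficientwise. -/
@[reducible] noncomputable def laurentAlgebra (A E : Type*) [CommSemiring A] [Semiring E]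
    [Algebra A E] : Algebra A (HahnSeries ℤ E) := HahnSeries.instAlgebra

/-! ### Expansion at infinity of polynomials and fractions. -/

section Infinity
variable {A : Type*} [CommRing A]

attribute [local instance] laurentAlgebra

/-- The derivation `t d / dt` in the coordinate `t⁻¹` at infinity. -/
noncomputable def eulerInf (A : Type*) [CommRing A] : Derivation A (HahnSeries ℤ A) (HahnSeries ℤ A) :=
  Derivation.mk'
    { toFun := fun c => laurentMk (fun a => -(a : A) * c.coeff a) c.order (fun a ha => by
        rw [HahnSeries.coeff_eq_zero_of_lt_order ha, mul_zero])
      map_add' := fun c c' => HahnSeries.ext (funext fun a => mul_add _ _ _)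
      map_smul' := fun r c => HahnSeries.ext (funext fun a => mul_left_comm _ _ _) } (by
    intro c c'
    refine HahnSeries.ext (funext fun e => ?_)
    obtain ⟨n, hn⟩ := exists_supportedFrom c
    obtain ⟨m, hm⟩ := exists_supportedFrom c'
    rw [HahnSeries.coeff_add, smul_eq_mul, smul_eq_mul, mul_comm c',
      coeff_laurent_mul hn (b₀ := m), coeff_laurent_mul (a₀ := n) (b₀ := m) _ hm]
    · change -(e : A) * (c * c').coeff e = _
      rw [coeff_laurent_mul hn hm, Finset.mul_sum, ← Finset.sum_add_distrib]
      refine Finset.sum_congr rfl fun a _ => ?_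
      change _ = c.coeff a * (-((e - a : ℤ) : A) * c'.coeff (e - a)) +
        -(a : A) * c.coeff a * c'.coeff (e - a)
      push_cast
      ring
    · exact fun a ha => (congrArg (_ * ·) (hn a ha)).trans (mul_zero _)
    · exact fun a ha => (congrArg (_ * ·) (hm a ha)).trans (mul_zero _))

theorem eulerInf_coeff (c : HahnSeries ℤ A) (a : ℤ) :
    (eulerInf A c).coeff a = -(a : A) * c.coeff a := rfl

/-- The derivation `d / dt` in the coordinate `t⁻¹` at infinity. -/
noncomputable def derInf (A : Type*) [CommRing A] : Derivation A (HahnSeries ℤ A) (HahnSeries ℤ A) :=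
  HahnSeries.single (1 : ℤ) (1 : A) • eulerInf A

/-- Degree `a` stands for `t ^ (-a)`, so differentiation raises the degree by one. -/
theorem derInf_coeff_add_one (c : HahnSeries ℤ A) (a : ℤ) :
    (derInf A c).coeff (a + 1) = -(a : A) * c.coeff a := by
  change (HahnSeries.single (1 : ℤ) (1 : A) * eulerInf A c).coeff (a + 1) = _
  rw [HahnSeries.coeff_single_mul_add, one_mul, eulerInf_coeff]

/-- Expansion of polynomials at infinity. -/
noncomputable def expInf : A[X] →ₐ[A] HahnSeries ℤ A := aeval (HahnSeries.single (-1) 1)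

theorem expInf_X : expInf (X : A[X]) = HahnSeries.single (-1) 1 := aeval_X _

theorem derInf_expInf (P : A[X]) : derInf A (expInf P) = expInf (derivative P) := by
  have h1 : derInf A (HahnSeries.single (-1) 1) = 1 := by
    refine HahnSeries.ext (funext fun a => ?_)
    obtain ⟨b, rfl⟩ : ∃ b, a = b + 1 := ⟨a - 1, by ring⟩
    rw [derInf_coeff_add_one, HahnSeries.coeff_one, HahnSeries.coeff_single]
    by_cases hb : b = -1
    · subst hb; simp
    · rw [if_neg hb, if_neg (by omega), mul_zero]
  rw [expInf, Derivation.map_aeval, h1, smul_eq_mul, mul_one]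

theorem expInf_coeff (P : A[X]) (a : ℤ) :
    (expInf P).coeff a = if a ≤ 0 then P.coeff (-a).toNat else 0 := by
  induction P using Polynomial.induction_on' with
  | add p q hp hq =>
    rw [map_add, HahnSeries.coeff_add, hp, hq, coeff_add]
    split_ifs <;> simp
  | monomial n r =>
    rw [expInf, aeval_monomial, HahnSeries.single_pow, one_pow, HahnSeries.algebraMap_apply,
      HahnSeries.C_mul_eq_smul, HahnSeries.coeff_smul, HahnSeries.coeff_single, coeff_monomial]
    by_cases h : a = n • -1
    · subst h; simp
    · rw [if_neg h, smul_zero]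
      rw [nsmul_eq_mul] at h
      split_ifs <;> first | rfl | omega

theorem expInf_supportedFrom {P : A[X]} {n : ℕ} (hP : P.natDegree ≤ n) :
    SupportedFrom (-n) (expInf P) := fun a ha => by
  rw [expInf_coeff]
  split_ifs
  · exact coeff_eq_zero_of_natDegree_lt (by omega)
  · rfl

theorem expInf_coeff_neg (P : A[X]) (n : ℕ) : (expInf P).coeff (-n) = P.coeff n := by
  rw [expInf_coeff, if_pos (by omega)]; simp

theorem isUnit_expInf {g : A[X]} (hg : g.Monic) : IsUnit (expInf g) := by
  nontriviality A
  have h1 : (expInf g).coeff (-g.natDegree) = 1 := by rw [expInf_coeff_neg]; exact hg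
  have h2 : (expInf g).order = -g.natDegree := by
    refine le_antisymm (HahnSeries.order_le_of_coeff_ne_zero (by rw [h1]; exact one_ne_zero)) ?_
    by_contra hlt
    have h3 := expInf_supportedFrom (le_refl g.natDegree) _ (not_le.1 hlt)
    rw [HahnSeries.coeff_order_eq_zero] at h3
    rw [h3] at h1
    exact zero_ne_one h1
  refine HahnSeries.isUnit_of_isUnit_leadingCoeff_AddUnitOrder ?_ (AddGroup.isAddUnit _)
  rw [HahnSeries.leadingCoeff_eq, h2, h1]
  exact isUnit_one

/-- Expansions of proper fractions vanish at infinity. -/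
theorem supportedFrom_one_of_mul_eq {g r : A[X]} (hg : g.Monic) (hr : r.degree < g.degree)
    {c : HahnSeries ℤ A} (hc : expInf g * c = expInf r) :
    SupportedFrom 1 c ∧ c.coeff 1 = r.coeff (g.natDegree - 1) := by
  have hg1 : (expInf g).coeff (-g.natDegree) = 1 := by rw [expInf_coeff_neg]; exact hg
  have hgs := expInf_supportedFrom (le_refl g.natDegree)
  rcases eq_or_ne r 0 with rfl | hr0
  · rw [map_zero, (isUnit_expInf hg).mul_right_eq_zero] at hc
    subst hc
    exact ⟨fun _ _ => rfl, by simp⟩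
  have hlt : r.natDegree < g.natDegree := natDegree_lt_natDegree hr0 hr
  have h1 : SupportedFrom 1 c := supportedFrom_mul_iff hgs hg1 (by
    rw [hc]
    exact (expInf_supportedFrom (n := g.natDegree - 1) (by omega)).mono (by omega))
  refine ⟨h1, ?_⟩
  have h2 := coeff_laurent_mul hgs h1 (-(g.natDegree - 1 : ℕ))
  rw [hc, expInf_coeff_neg, show (-((g.natDegree - 1 : ℕ) : ℤ) - 1) = -g.natDegree by omega,
    Finset.Icc_self, Finset.sum_singleton, hg1, one_mul] at h2
  rw [h2]
  congr 1
  omega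

variable {K : Type*} [CommRing K] [Algebra A K] (τ : K) (f : A[X])

/-- `c` is the expansion at infinity of the fraction `k` with poles along `f = 0`. -/
def IsExp (k : K) (c : HahnSeries ℤ A) : Prop :=
  ∃ (n : ℕ) (P : A[X]), aeval τ f ^ n * k = aeval τ P ∧ expInf f ^ n * c = expInf P

variable {τ f}

theorem IsExp.add {k k' : K} {c c' : HahnSeries ℤ A} (h : IsExp τ f k c) (h' : IsExp τ f k' c') :
    IsExp τ f (k + k') (c + c') := by
  obtain ⟨n, P, h1, h2⟩ := h
  obtain ⟨m, Q, h3, h4⟩ := h'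
  refine ⟨n + m, f ^ m * P + f ^ n * Q, ?_, ?_⟩
  · simp only [map_add, map_mul, map_pow, ← h1, ← h3]; ring
  · simp only [map_add, map_mul, map_pow, ← h2, ← h4]; ring

theorem IsExp.mul {k k' : K} {c c' : HahnSeries ℤ A} (h : IsExp τ f k c) (h' : IsExp τ f k' c') :
    IsExp τ f (k * k') (c * c') := by
  obtain ⟨n, P, h1, h2⟩ := h
  obtain ⟨m, Q, h3, h4⟩ := h'
  refine ⟨n + m, P * Q, ?_, ?_⟩
  · simp only [map_mul, ← h1, ← h3]; ring
  · simp only [map_mul, ← h2, ← h4]; ring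

theorem IsExp.aeval (P : A[X]) : IsExp τ f (aeval τ P) (expInf P) := ⟨0, P, by simp, by simp⟩

theorem IsExp.smul (a : A) {k : K} {c : HahnSeries ℤ A} (h : IsExp τ f k c) :
    IsExp τ f (a • k) (a • c) := by
  obtain ⟨n, P, h1, h2⟩ := h
  refine ⟨n, a • P, ?_, ?_⟩
  · rw [mul_smul_comm, h1, map_smul]
  · rw [mul_smul_comm, h2, map_smul]

/-- The quotient rule cleared of denominators, in an abstract ring so that it applies both to `K`
and to Laurent series. -/
theorem pow_mul_quotient_deriv {L : Type*} [CommRing L] {n : ℕ} {φ x φ' P P' dx : L}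
    (h1 : φ ^ n * x = P) (h2 : φ ^ n * dx + x * (n • (φ ^ (n - 1) * φ')) = P') :
    φ ^ (n + 1) * dx = φ * P' - n * φ' * P := by
  subst h1 h2
  cases n with
  | zero => simp
  | succ n => simp only [nsmul_eq_mul, Nat.add_sub_cancel]; push_cast; ring

theorem IsExp.der {d : Derivation A K K} (hd : d τ = 1) {k : K} {c : HahnSeries ℤ A}
    (h : IsExp τ f k c) : IsExp τ f (d k) (derInf A c) := by
  obtain ⟨n, P, h1, h2⟩ := h
  refine ⟨n + 1, f * derivative P - n * derivative f * P, ?_, ?_⟩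
  · simp only [map_sub, map_mul, map_natCast]
    refine pow_mul_quotient_deriv h1 ?_
    have h3 := congrArg d h1
    rwa [Derivation.leibniz, Derivation.leibniz_pow, Derivation.map_aeval, Derivation.map_aeval, hd,
      smul_eq_mul, smul_eq_mul, smul_eq_mul, smul_eq_mul, smul_eq_mul, mul_one, mul_one] at h3
  · simp only [map_sub, map_mul, map_natCast]
    refine pow_mul_quotient_deriv h2 ?_
    have h3 := congrArg (derInf A) h2
    rwa [Derivation.leibniz, Derivation.leibniz_pow, derInf_expInf, derInf_expInf,
      smul_eq_mul, smul_eq_mul, smul_eq_mul] at h3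

theorem exists_isExp (hf : f.Monic) {n : ℕ} {k : K} {P : A[X]}
    (h : Polynomial.aeval τ f ^ n * k = Polynomial.aeval τ P) :
    ∃ c, IsExp τ f k c ∧ expInf f ^ n * c = expInf P := by
  obtain ⟨c, hc⟩ := ((isUnit_expInf hf).pow n).dvd (a := expInf P)
  exact ⟨c, ⟨n, P, h, hc.symm⟩, hc.symm⟩

end Infinity

/-! ### Residues of `t ^ j` against powers of the diagonal. -/

section Contraction
variable {A K : Type*} [CommRing A] [CommRing K] [Algebra A K] [Algebra ℂ A]

namespace DiagonalKernel
variable {𝔎 : DiagonalKernel A K} {res : K →ₗ[A] A} (hr : 𝔎.IsResidueFor res)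
include hr

/-- Cauchy's formula: for `n < 0` the limit is the divided derivative of order `-1 - n` of `t ^ j`.
Writing `t ⊗ 1` as the diagonal plus `1 ⊗ t` turns induction on `j` into Pascal's rule. -/
theorem IsResidueFor.contract_pow_mul (N j : ℕ) (n : ℤ) :
    contractFst res ((𝔎.t ^ j) ⊗ₜ 1 * 𝔎.p N n) -
      (if n < 0 then (j.choose (-1 - n).toNat : A) • 𝔎.t ^ (j - (-1 - n).toNat) else 0) ∈ 𝔎.O N := by
  induction j generalizing n with
  | zero =>
    rw [pow_zero, ← Algebra.TensorProduct.one_def, one_mul]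
    by_cases hn : n = -1
    · subst hn
      simpa using hr.contract N
    · have h1 := hr.contract_p N hn
      split_ifs with h0
      · rw [Nat.choose_eq_zero_of_lt (by omega), Nat.cast_zero, zero_smul, sub_zero]
        exact h1
      · rwa [sub_zero]
  | succ j ih =>
    have e : (𝔎.t ^ (j + 1)) ⊗ₜ[A] (1 : K) * 𝔎.p N n =
        (𝔎.t ^ j) ⊗ₜ 1 * 𝔎.p N n * 1 ⊗ₜ 𝔎.t + (𝔎.t ^ j) ⊗ₜ 1 * 𝔎.p N (n + 1) +
        (𝔎.t ^ j) ⊗ₜ 1 * (𝔎.δ * 𝔎.p N n - 𝔎.p N (n + 1)) := by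
      have : (𝔎.t ^ (j + 1)) ⊗ₜ[A] (1 : K) = (𝔎.t ^ j) ⊗ₜ 1 * 𝔎.t ⊗ₜ 1 := by
        rw [Algebra.TensorProduct.tmul_mul_tmul, pow_succ, one_mul]
      rw [this, δ]
      ring
    have h1 : contractFst res ((𝔎.t ^ j) ⊗ₜ 1 * (𝔎.δ * 𝔎.p N n - 𝔎.p N (n + 1))) ∈ 𝔎.O N := by
      refine contractFst_mem ?_
      have := 𝔎.S_mul (𝔎.tmul_mem (𝔎.t ^ j) 𝔎.one_mem) (𝔎.diag_mul N n)
      rwa [zero_add] at this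
    have h2 := 𝔎.mul_mem (ih n) 𝔎.t_mem
    rw [add_zero] at h2
    have h3 := add_mem (add_mem h2 (ih (n + 1))) h1
    rw [e, map_add, map_add, contractFst_mul_tmul]
    generalize contractFst res ((𝔎.t ^ j) ⊗ₜ 1 * (𝔎.δ * 𝔎.p N n - 𝔎.p N (n + 1))) = c₁ at h3 ⊢
    generalize contractFst res ((𝔎.t ^ j) ⊗ₜ 1 * 𝔎.p N n) = c₂ at h3 ⊢
    generalize contractFst res ((𝔎.t ^ j) ⊗ₜ 1 * 𝔎.p N (n + 1)) = c₃ at h3 ⊢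
    convert h3 using 1
    rw [sub_mul]
    rcases lt_trichotomy n (-1) with hn | rfl | hn
    · obtain ⟨s, rfl⟩ : ∃ s : ℕ, n = -1 - (s + 1) := ⟨(-2 - n).toNat, by omega⟩
      rw [if_pos (by omega), if_pos (by omega), if_pos (by omega),
        show (-1 - (-1 - ((s : ℤ) + 1))).toNat = s + 1 by omega,
        show (-1 - (-1 - ((s : ℤ) + 1) + 1)).toNat = s by omega, Nat.choose_succ_succ,
        Nat.add_sub_add_right, smul_mul_assoc, ← pow_succ]
      -- Truncated subtraction gives different exponents when `j < s + 1`, but then the binomial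
      -- coefficient is zero.
      have : (j.choose (s + 1) : A) • 𝔎.t ^ (j - (s + 1) + 1) =
          (j.choose (s + 1) : A) • 𝔎.t ^ (j - s) := by
        rcases Nat.lt_or_ge j (s + 1) with h | h
        · rw [Nat.choose_eq_zero_of_lt h, Nat.cast_zero, zero_smul, zero_smul]
        · rw [show j - (s + 1) + 1 = j - s by omega]
      rw [this]
      push_cast
      rw [add_smul]
      ring
    · rw [if_pos (by omega), if_pos (by omega), if_neg (by omega)]
      simp [pow_succ]
      ring
    · rw [if_neg (by omega), if_neg (by omega), if_neg (by omega)]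
      ring

end DiagonalKernel
end Contraction

/-! ### Rational functions on the punctured neighbourhood, and the residue pairing. -/

namespace IsFormalCoordinate
section Expansion
variable {A R : Type u} [CommRing A] [CommRing R] [Algebra A R]
  {I : ℕ → Ideal R} {t : R} {f : A[X]} (h : IsFormalCoordinate I t f)

theorem aeval_coord (P : A[X]) : aeval h.coord P = algebraMap R h.Punctured (aeval t P) :=
  aeval_algebraMap_apply _ _ _

/-- Expansion at infinity of rational functions. -/
def Exp (k : h.Punctured) (c : HahnSeries ℤ A) : Prop := IsExp h.coord f k c

variable {h}

theorem exp_iff {k : h.Punctured} {c : HahnSeries ℤ A} : h.Exp k c ↔ ∃ (n : ℕ) (P : A[X]),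
    h.unif ^ n * k = algebraMap R _ (aeval t P) ∧ expInf f ^ n * c = expInf P := by
  simp only [Exp, IsExp, aeval_coord]

/-- If a fraction `P / f ^ m` lies in `φ ^ n R`, then `f ^ (m + n)` divides `P` and the fraction is
a polynomial multiple of `f ^ n`. -/
theorem Exp.eq_mul {n : ℕ} {k : h.Punctured} {c : HahnSeries ℤ A} (hc : h.Exp k c)
    (hk : k ∈ h.levelK n) : ∃ Q : A[X], c = expInf f ^ n * expInf Q := by
  obtain ⟨m, P, h1, h2⟩ := exp_iff.1 hc
  obtain ⟨r, rfl⟩ := h.mem_levelK.1 hk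
  have h3 : aeval t P = aeval t f ^ (m + n) * r := h.algebraMap_injective (by
    rw [← h1, map_mul, map_pow, pow_add, mul_assoc])
  obtain ⟨Q, rfl⟩ := (h.aeval_mem_iff (m + n) P).1 (h.mem_ideal_iff.2 ⟨r, h3⟩)
  refine ⟨Q, ((isUnit_expInf h.monic).pow m).mul_left_cancel ?_⟩
  rw [h2, map_mul, map_pow, pow_add, mul_assoc]

/-- The polynomial part of a fraction has no `t⁻¹` term, and for the proper part this coefficient is
the leading quotient that defines the residue along the sections. -/
theorem Exp.res_eq {k : h.Punctured} {c : HahnSeries ℤ A} (hc : h.Exp k c) :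
    h.res k = c.coeff 1 := by
  obtain ⟨m, P, h1, h2⟩ := exp_iff.1 hc
  nontriviality A
  have hm := h.monic.pow m
  have h3 : expInf (f ^ m) * (c - expInf (P /ₘ f ^ m)) = expInf (P %ₘ f ^ m) := by
    rw [mul_sub, map_pow, h2, ← map_pow, ← map_mul, ← map_sub]
    exact congrArg expInf (eq_sub_of_add_eq (modByMonic_add_div P (f ^ m))).symm
  have h4 := (supportedFrom_one_of_mul_eq hm (degree_modByMonic_lt _ hm) h3).2
  rw [h.res_eq_of_unif_pow h1, ← h.monic.natDegree_pow, ← h4, HahnSeries.coeff_sub, expInf_coeff,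
    if_neg (by omega), sub_zero]

variable (h)

theorem exists_exp (k : h.Punctured) (n : ℕ) : ∃ k' c, h.Exp k' c ∧ k - k' ∈ h.levelK n := by
  obtain ⟨m, r, hr⟩ := h.exists_unif_pow_mul k
  obtain ⟨P, hP⟩ := h.exists_sub_mem (m + n) r
  obtain ⟨s, hs⟩ := h.mem_ideal_iff.1 hP
  have h1 : h.unif ^ m * (h.invUnif ^ m * algebraMap R _ (aeval t P)) =
      algebraMap R _ (aeval t P) := by
    rw [← mul_assoc, ← mul_pow, unif_mul_inv, one_pow, one_mul]
  obtain ⟨c, hc, -⟩ := exists_isExp (τ := h.coord) h.monic (n := m) (P := P)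
    (k := h.invUnif ^ m * algebraMap R _ (aeval t P)) (by rw [aeval_coord, aeval_coord]; exact h1)
  refine ⟨_, c, hc, h.mem_levelK.2 ⟨s, ?_⟩⟩
  rw [← h.inv_pow_mul m k, hr, ← mul_sub, ← map_sub, hs, map_mul, map_pow, pow_add, mul_assoc,
    inv_pow_mul]

theorem exp_aeval (P : A[X]) : h.Exp (algebraMap R _ (aeval t P)) (expInf P) := by
  rw [← aeval_coord]
  exact IsExp.aeval P

theorem derivK_coord : h.derivK h.coord = 1 := by
  rw [derivK_algebraMap, deriv_coord, map_one]

variable {h}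

theorem Exp.der {k : h.Punctured} {c : HahnSeries ℤ A} (hc : h.Exp k c) :
    h.Exp (h.derivK k) (derInf A c) :=
  IsExp.der h.derivK_coord hc

theorem Exp.mul {k k' : h.Punctured} {c c' : HahnSeries ℤ A} (hc : h.Exp k c) (hc' : h.Exp k' c') :
    h.Exp (k * k') (c * c') := IsExp.mul hc hc'

variable (h)

/-- Proper rational functions. -/
def IsProper (k : h.Punctured) : Prop := ∃ (n : ℕ) (P : A[X]),
  h.unif ^ n * k = algebraMap R _ (aeval t P) ∧ P.degree < (f ^ n).degree

variable {h}

theorem IsProper.exists_exp {k : h.Punctured} (hk : h.IsProper k) :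
    ∃ c, h.Exp k c ∧ SupportedFrom 1 c := by
  obtain ⟨n, P, h1, h2⟩ := hk
  obtain ⟨c, hc, hc'⟩ := exists_isExp (τ := h.coord) h.monic (n := n) (P := P)
    (k := k) (by rw [aeval_coord, aeval_coord]; exact h1)
  rw [← map_pow] at hc'
  exact ⟨c, hc, (supportedFrom_one_of_mul_eq (h.monic.pow n) h2 hc').1⟩

theorem IsProper.mul {k l : h.Punctured} (hk : h.IsProper k) (hl : h.IsProper l) :
    h.IsProper (k * l) := by
  obtain ⟨n, P, h1, h2⟩ := hk
  obtain ⟨m, Q, h3, h4⟩ := hl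
  refine ⟨n + m, P * Q, ?_, ?_⟩
  · rw [map_mul, map_mul, ← h1, ← h3, pow_add, mul_mul_mul_comm]
  · rcases subsingleton_or_nontrivial A with hA | hA
    · rw [Subsingleton.elim P 0, Subsingleton.elim (f ^ n) 0] at h2
      exact absurd h2 (lt_irrefl _)
    rw [pow_add, (h.monic.pow m).degree_mul]
    rcases eq_or_ne P 0 with rfl | hP
    · rw [zero_mul, degree_zero, bot_lt_iff_ne_bot, ← (h.monic.pow m).degree_mul, ← pow_add]
      exact degree_ne_bot.2 (h.monic.pow _).ne_zero
    rcases eq_or_ne Q 0 with rfl | hQ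
    · rw [mul_zero, degree_zero, bot_lt_iff_ne_bot, ← (h.monic.pow m).degree_mul, ← pow_add]
      exact degree_ne_bot.2 (h.monic.pow _).ne_zero
    refine (degree_mul_le _ _).trans_lt ?_
    rw [degree_eq_natDegree hP, degree_eq_natDegree (h.monic.pow n).ne_zero] at *
    rw [degree_eq_natDegree hQ, degree_eq_natDegree (h.monic.pow m).ne_zero] at *
    exact_mod_cast add_lt_add (Nat.cast_lt.1 h2) (Nat.cast_lt.1 h4)

/-- The expansion of a fraction in terms of residues. -/
theorem Exp.coeff_succ {k : h.Punctured} {c : HahnSeries ℤ A} (hc : h.Exp k c) (l : ℕ) :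
    c.coeff (l + 1) = h.res (h.coord ^ l * k) := by
  have h1 := (h.exp_aeval (X ^ l)).mul hc
  rw [map_pow, aeval_X, map_pow] at h1
  have h2 := HahnSeries.coeff_single_mul_add (r := (1 : A)) (x := c) (a := (l + 1 : ℤ))
    (b := l • (-1 : ℤ))
  rw [one_mul, show ((l : ℤ) + 1 + l • (-1 : ℤ)) = 1 by simp] at h2
  rw [h1.res_eq, map_pow, expInf_X, HahnSeries.single_pow, one_pow, h2]

/-- The residue pairing is nondegenerate. -/
theorem mem_ideal_of_res_eq_zero (h : IsFormalCoordinate I t f) {j : ℕ} {r : R}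
    (hr : ∀ k : h.Punctured, (∃ s, h.unif ^ j * k = algebraMap R _ s) →
      h.res (algebraMap R _ r * k) = 0) : r ∈ I j := by
  rcases subsingleton_or_nontrivial A with hA | hA
  · have := Module.subsingleton A R
    rw [Subsingleton.elim r 0]
    exact zero_mem _
  obtain ⟨P, hP⟩ := h.exists_sub_mem j r
  have hm := h.monic.pow j
  suffices P %ₘ f ^ j = 0 by
    have h1 := (h.aeval_mem_iff j P).2 ((modByMonic_eq_zero_iff_dvd hm).1 this)
    have := (I j).add_mem hP h1
    rwa [sub_add_cancel] at this
  by_contra h0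
  set Q := P %ₘ f ^ j with hQ
  have hdeg : Q.natDegree < j * f.natDegree := by
    rw [← h.monic.natDegree_pow]
    exact natDegree_lt_natDegree h0 (degree_modByMonic_lt _ hm)
  -- The exponent for which `Q * X ^ m` has degree `j * deg f - 1`: the residue against `t ^ m / f
  -- (t) ^ j` is then the leading coefficient of `Q`.
  set m := j * f.natDegree - 1 - Q.natDegree with hm'
  obtain ⟨s, hs⟩ := h.mem_ideal_iff.1 (show r - aeval t Q ∈ I j by
    have h1 : aeval t (P - Q) ∈ I j := (h.aeval_mem_iff _ _).2
      ⟨P /ₘ f ^ j, by rw [hQ]; nth_rewrite 1 [← modByMonic_add_div P (f ^ j)]; ring⟩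
    rw [map_sub] at h1
    have := (I j).add_mem hP h1
    rwa [sub_add_sub_cancel] at this)
  have h1 := hr (h.invUnif ^ j * algebraMap R _ (t ^ m)) ⟨t ^ m, by
    rw [← mul_assoc, ← mul_pow, unif_mul_inv, one_pow, one_mul]⟩
  have h2 : h.unif ^ j * (algebraMap R _ (aeval t Q) * (h.invUnif ^ j * algebraMap R _ (t ^ m))) =
      algebraMap R _ (aeval t (Q * X ^ m)) := by
    rw [mul_left_comm, ← mul_assoc (h.unif ^ j), ← mul_pow, unif_mul_inv, one_pow, one_mul,
      ← map_mul, map_mul (aeval t), map_pow (aeval t), aeval_X]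
  have h3 := h.res_eq_of_unif_pow h2
  have h4 : h.res (algebraMap R _ (r - aeval t Q) * (h.invUnif ^ j * algebraMap R _ (t ^ m))) = 0 := by
    refine h.res_mem_zero (h.mem_levelK.2 ⟨s * t ^ m, ?_⟩)
    rw [hs, map_mul, map_pow, pow_zero, one_mul, mul_assoc, mul_left_comm (algebraMap R _ s),
      ← mul_assoc, ← mul_pow, unif_mul_inv, one_pow, one_mul, map_mul]
  rw [map_sub, sub_mul, map_sub, h1, zero_sub, neg_eq_zero, h3] at h4
  rw [(modByMonic_eq_self_iff hm).2] at h4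
  · have : (Q * X ^ m).coeff (j * f.natDegree - 1) = Q.leadingCoeff := by
      rw [show j * f.natDegree - 1 = Q.natDegree + m by omega, coeff_mul_X_pow]
      rfl
    rw [this] at h4
    exact h0 (leadingCoeff_eq_zero.1 h4)
  · rw [degree_eq_natDegree hm.ne_zero, h.monic.natDegree_pow]
    refine lt_of_le_of_lt degree_le_natDegree (Nat.cast_lt.2 ?_)
    refine lt_of_le_of_lt natDegree_mul_le ?_
    rw [natDegree_X_pow]
    omega

theorem isProper_coord_pow_mul (h : IsFormalCoordinate I t f) (i : ℕ) {j : ℕ}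
    (hj : j < f.natDegree) : h.IsProper (h.coord ^ j * h.invUnif ^ (i + 1)) := by
  refine ⟨i + 1, X ^ j, ?_, ?_⟩
  · rw [mul_left_comm, ← mul_pow, unif_mul_inv, one_pow, mul_one, map_pow, map_pow, aeval_X]
  · have hA : Nontrivial A := by
      by_contra hA
      rw [not_nontrivial_iff_subsingleton] at hA
      rw [Subsingleton.elim f 0, natDegree_zero] at hj
      omega
    rw [degree_X_pow, degree_eq_natDegree (h.monic.pow _).ne_zero, h.monic.natDegree_pow]
    exact_mod_cast (by nlinarith : j < (i + 1) * f.natDegree)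

/-- Tensors whose first components are proper rational functions. -/
noncomputable def properFst (h : IsFormalCoordinate I t f) :
    Submodule A (h.Punctured ⊗[A] h.Punctured) :=
  Submodule.span A {u | ∃ k l, h.IsProper k ∧ u = k ⊗ₜ l}

theorem properFst_mul {u v : h.Punctured ⊗[A] h.Punctured} (hu : u ∈ h.properFst)
    (hv : v ∈ h.properFst) : u * v ∈ h.properFst := by
  refine LinearMap.BilinMap.apply_apply_mem_of_mem_span h.properFst _ _
    (LinearMap.mul A (h.Punctured ⊗[A] h.Punctured)) ?_ u v hu hv
  rintro _ ⟨k, l, hk, rfl⟩ _ ⟨k', l', hk', rfl⟩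
  exact Submodule.subset_span ⟨k * k', l * l', hk.mul hk', Algebra.TensorProduct.tmul_mul_tmul _ _ _ _⟩

theorem diagInv_mem_properFst (h : IsFormalCoordinate I t f) (N : ℕ) :
    h.diagInv N ∈ h.properFst := by
  rw [diagInv, divDiff, Polynomial.sum, Finset.sum_mul]
  refine Submodule.sum_mem _ fun i hi => ?_
  rw [smul_mul_assoc, Finset.sum_mul_sum]
  refine Submodule.smul_mem _ _ (Submodule.sum_mem _ fun j hj => Submodule.sum_mem _ fun m _ => ?_)
  rw [Algebra.TensorProduct.tmul_mul_tmul]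
  refine Submodule.subset_span ⟨_, _, h.isProper_coord_pow_mul m ?_, rfl⟩
  exact (Finset.mem_range.1 hj).trans_le (le_natDegree_of_mem_supp i hi)

/-- Proper first components expand at infinity from degree one on, so a product of negative order
lets the current act on the vacuum module by creation operators alone. -/
theorem kernel_p_mem_properFst (h : IsFormalCoordinate I t f) [Algebra ℂ A] (N s : ℕ) :
    h.kernel.p N (-1 - s) ∈ h.properFst := by
  rw [kernel_p, show (-1 - s : ℤ) = Int.negSucc s by omega]
  change h.diagInv N ^ (s + 1) ∈ _
  induction s with
  | zero => rw [zero_add, pow_one]; exact h.diagInv_mem_properFst N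
  | succ s ih => rw [pow_succ]; exact properFst_mul ih (h.diagInv_mem_properFst N)

end Expansion
end IsFormalCoordinate

attribute [local instance] laurentAlgebra

/-! ### Laurent series at infinity with values in the vacuum module. -/

section InfinityModule
variable (A : Type u) [CommRing A] [Algebra ℂ A] {𝔤 : Type v} [LieRing 𝔤] [LieAlgebra ℂ 𝔤]
  (κ : LinearMap.BilinForm ℂ 𝔤)

/-- Endomorphisms of the vacuum module over `A`. -/
abbrev VacuumEnd : Type (max u v) := Module.End A (A ⊗[ℂ] AffineVertex κ)

variable {κ} in
/-- The operator `x t^n` over `A`. -/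
noncomputable def modeA (x : 𝔤) (n : ℤ) : VacuumEnd A κ := (AffineVertex.mode κ x n).baseChange A

variable {A} in
theorem modeA_tmul (x : 𝔤) (n : ℤ) (a : A) (v : AffineVertex κ) :
    modeA A x n (a ⊗ₜ v) = a ⊗ₜ AffineVertex.mode κ x n v := rfl

theorem modeA_add (x y : 𝔤) (n : ℤ) : modeA (κ := κ) A (x + y) n = modeA A x n + modeA A y n := by
  rw [modeA, AffineVertex.mode_add, LinearMap.baseChange_add]; rfl

theorem modeA_smul (c : ℂ) (x : 𝔤) (n : ℤ) :
    modeA (κ := κ) A (c • x) n = algebraMap ℂ A c • modeA A x n := by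
  rw [modeA, AffineVertex.mode_smul, LinearMap.baseChange_smul, algebraMap_smul]; rfl

theorem modeA_comm (x y : 𝔤) (m n : ℤ) : modeA (κ := κ) A x m * modeA A y n =
    modeA A y n * modeA A x m + modeA A ⁅x, y⁆ (m + n) +
      algebraMap A _ (if m + n = 0 then m * algebraMap ℂ A (κ x y) else 0) := by
  refine TensorProduct.AlgebraTensorModule.ext fun a v => ?_
  simp only [Module.End.mul_apply, LinearMap.add_apply, modeA_tmul, Module.algebraMap_end_apply]
  rw [AffineVertex.mode_comm, TensorProduct.tmul_add, TensorProduct.tmul_add, TensorProduct.tmul_smul,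
    ← algebraMap_smul A]
  congr 2
  split_ifs <;> simp

variable {A} in
/-- The action of a Laurent series at infinity. -/
noncomputable def series (x : 𝔤) : HahnSeries ℤ A →ₗ[A] HahnSeries ℤ (VacuumEnd A κ) where
  toFun c := laurentMk (fun a => c.coeff a • modeA A x (-a)) c.order (fun a ha => by
    rw [HahnSeries.coeff_eq_zero_of_lt_order ha, zero_smul])
  map_add' c c' := HahnSeries.ext (funext fun a => add_smul _ _ _)
  map_smul' r c := HahnSeries.ext (funext fun a => mul_smul r (c.coeff a) (modeA A x (-a)))

variable {A κ}

theorem series_coeff (x : 𝔤) (c : HahnSeries ℤ A) (a : ℤ) :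
    (series κ x c).coeff a = c.coeff a • modeA A x (-a) := rfl

theorem series_supportedFrom (x : 𝔤) {c : HahnSeries ℤ A} {n : ℤ} (hc : SupportedFrom n c) :
    SupportedFrom n (series κ x c) := fun a ha => by
  rw [series_coeff, hc a ha, zero_smul]

theorem series_add (x y : 𝔤) (c : HahnSeries ℤ A) :
    series κ (x + y) c = series κ x c + series κ y c :=
  HahnSeries.ext (funext fun a => by
    simp only [HahnSeries.coeff_add, series_coeff, modeA_add, smul_add])

theorem series_smul (z : ℂ) (x : 𝔤) (c : HahnSeries ℤ A) :
    series κ (z • x) c = algebraMap ℂ A z • series κ x c :=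
  HahnSeries.ext (funext fun a => by
    simp only [HahnSeries.coeff_smul, series_coeff, modeA_smul]
    rw [smul_comm])

/-- Degree by degree these are the affine commutation relations. The central terms occur only in
degree zero, where the sum of `-a c_a c'_{-a}` is the `t⁻¹` coefficient of `c' dc / dt`. -/
theorem series_comm (x y : 𝔤) (c c' : HahnSeries ℤ A) : series κ x c * series κ y c' =
    series κ y c' * series κ x c + series κ ⁅x, y⁆ (c * c') +
      algebraMap A _ (algebraMap ℂ A (κ x y) * (c' * derInf A c).coeff 1) := by
  refine HahnSeries.ext (funext fun e => ?_)
  obtain ⟨n, hn⟩ := exists_supportedFrom c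
  obtain ⟨m, hm⟩ := exists_supportedFrom c'
  have hd : SupportedFrom (n + 1) (derInf A c) := fun a ha => by
    obtain ⟨b, rfl⟩ : ∃ b, a = b + 1 := ⟨a - 1, by ring⟩
    rw [derInf_coeff_add_one, hn b (by omega), mul_zero]
  rw [HahnSeries.coeff_add, HahnSeries.coeff_add,
    coeff_laurent_mul (series_supportedFrom x hn) (series_supportedFrom y hm),
    coeff_laurent_mul' (series_supportedFrom y hm) (series_supportedFrom x hn), series_coeff,
    coeff_laurent_mul hn hm, coeff_laurent_mul' hm hd, HahnSeries.algebraMap_apply,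
    HahnSeries.C_apply, HahnSeries.coeff_single]
  have h1 : ∀ a, (series κ x c).coeff a * (series κ y c').coeff (e - a) =
      (series κ y c').coeff (e - a) * (series κ x c).coeff a +
      ((c.coeff a * c'.coeff (e - a)) • modeA A ⁅x, y⁆ (-e) +
      algebraMap A _ (if e = 0 then algebraMap ℂ A (κ x y) * (c'.coeff (-a) * (-a * c.coeff a))
        else 0)) := fun a => by
    rw [series_coeff, series_coeff, smul_mul_smul_comm, smul_mul_smul_comm, modeA_comm, smul_add,
      smul_add, show -a + -(e - a) = -e by ring, mul_comm (c'.coeff (e - a)), add_assoc]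
    congr 2
    rw [Algebra.algebraMap_eq_smul_one (R := A) (A := VacuumEnd A κ),
      Algebra.algebraMap_eq_smul_one (R := A) (A := VacuumEnd A κ), smul_smul]
    congr 1
    by_cases he : e = 0
    · subst he
      simp only [neg_zero, if_pos, zero_sub, Int.cast_neg]
      ring
    · rw [if_neg he, if_neg (by omega), mul_zero]
  rw [Finset.sum_congr rfl fun a _ => h1 a, Finset.sum_add_distrib, Finset.sum_add_distrib,
    ← Finset.sum_smul, ← map_sum, ← add_assoc]
  congr 1
  by_cases he : e = 0
  · subst he
    simp only [if_pos]
    rw [← Finset.mul_sum]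
    congr 2
    refine Finset.sum_nbij' (fun a => a + 1) (fun a => a - 1) ?_ ?_ ?_ ?_ ?_ <;>
      simp only [Finset.mem_Icc] <;> intro a ha
    · omega
    · omega
    · omega
    · omega
    · rw [derInf_coeff_add_one, show (1 : ℤ) - (a + 1) = -a by ring]
  · simp [he]

variable (A κ)

/-- Laurent series at infinity with values in the vacuum module. -/
def InfModule : Type (max u v) := HahnModule ℤ (VacuumEnd A κ) (A ⊗[ℂ] AffineVertex κ)

noncomputable instance : AddCommGroup (InfModule A κ) :=
  inferInstanceAs (AddCommGroup (HahnModule ℤ (VacuumEnd A κ) (A ⊗[ℂ] AffineVertex κ)))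
noncomputable instance : Module (HahnSeries ℤ (VacuumEnd A κ)) (InfModule A κ) :=
  inferInstanceAs (Module (HahnSeries ℤ (VacuumEnd A κ))
    (HahnModule ℤ (VacuumEnd A κ) (A ⊗[ℂ] AffineVertex κ)))
noncomputable instance : Module A (InfModule A κ) :=
  Module.compHom _ (algebraMap A (HahnSeries ℤ (VacuumEnd A κ)))
instance : IsScalarTower A (HahnSeries ℤ (VacuumEnd A κ)) (InfModule A κ) where
  smul_assoc a x m := (congrArg (· • m) (Algebra.smul_def a x)).trans (mul_smul _ _ _)

variable {A κ}

/-- The coefficients of an element. -/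
noncomputable def InfModule.coeff (e : ℤ) : InfModule A κ →ₗ[A] A ⊗[ℂ] AffineVertex κ where
  toFun m := ((HahnModule.of (VacuumEnd A κ)).symm m).coeff e
  map_add' _ _ := rfl
  map_smul' a m := HahnModule.coeff_single_zero_smul (Γ := ℤ) (R := VacuumEnd A κ)
    (r := algebraMap A (VacuumEnd A κ) a) (x := m)

theorem InfModule.ext {m m' : InfModule A κ} (h : ∀ e, coeff e m = coeff e m') : m = m' :=
  HahnModule.ext _ _ (funext h)

theorem InfModule.coeff_smul {X : HahnSeries ℤ (VacuumEnd A κ)} {m : InfModule A κ} {a₀ b₀ : ℤ}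
    (hX : SupportedFrom a₀ X) (hm : ∀ b < b₀, coeff b m = 0) (e : ℤ) :
    coeff e (X • m) = ∑ a ∈ Finset.Icc a₀ (e - b₀), X.coeff a (coeff (e - a) m) :=
  coeff_hahn_smul (V := A ⊗[ℂ] AffineVertex κ) hX hm e

variable (A κ) in
/-- The vacuum vector. -/
noncomputable def InfModule.vac : InfModule A κ :=
  HahnModule.of (VacuumEnd A κ) (HahnSeries.single (0 : ℤ) (1 ⊗ₜ AffineVertex.vacuum κ))

theorem InfModule.coeff_vac (e : ℤ) :
    coeff e (vac A κ) = if e = 0 then 1 ⊗ₜ AffineVertex.vacuum κ else 0 := by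
  change (HahnSeries.single (0 : ℤ) ((1 : A) ⊗ₜ[ℂ] AffineVertex.vacuum κ)).coeff e = _
  rw [HahnSeries.coeff_single]
  split_ifs <;> rfl

/-- Expansions of polynomials contain only nonnegative powers of `t`, and these modes kill the
vacuum. -/
theorem InfModule.series_smul_vac (x : 𝔤) (P : A[X]) : series κ x (expInf P) • vac A κ = 0 := by
  refine InfModule.ext fun e => ?_
  rw [InfModule.coeff_smul (b₀ := 0) (series_supportedFrom x (expInf_supportedFrom le_rfl))
    (fun b hb => by rw [coeff_vac, if_neg (by omega)]), map_zero]
  refine Finset.sum_eq_zero fun a _ => ?_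
  rw [series_coeff, coeff_vac, expInf_coeff]
  by_cases h1 : a ≤ 0
  · split_ifs
    · rw [LinearMap.smul_apply, show -a = ((-a).toNat : ℤ) by omega, modeA_tmul,
        AffineVertex.mode_vacuum, TensorProduct.tmul_zero, smul_zero]
    · rw [map_zero]
  · rw [if_neg h1, zero_smul, LinearMap.zero_apply]

variable (f : A[X])

/-- The vector `m` is killed by the `n`-th step of the filtration. -/
def InfModule.IsKilled (n : ℕ) (m : InfModule A κ) : Prop :=
  ∀ (x : 𝔤) (Q : A[X]), series κ x (expInf f ^ n * expInf Q) • m = 0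

variable {f} in
theorem InfModule.IsKilled.mono {n n' : ℕ} {m : InfModule A κ} (h : IsKilled f n m) (hn : n ≤ n') :
    IsKilled f n' m := fun x Q => by
  have := h x (f ^ (n' - n) * Q)
  rwa [map_mul expInf, map_pow expInf, ← mul_assoc, ← pow_add, Nat.add_sub_cancel' hn] at this

variable (κ) in
/-- The vectors killed by some step of the filtration. -/
noncomputable def smoothPart : Submodule A (InfModule A κ) where
  carrier := {m | ∃ n, InfModule.IsKilled f n m}
  zero_mem' := ⟨0, fun x Q => smul_zero _⟩
  add_mem' := fun ⟨n, hn⟩ ⟨n', hn'⟩ => ⟨max n n', fun x Q => by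
    rw [smul_add, hn.mono (le_max_left _ _), hn'.mono (le_max_right _ _), add_zero]⟩
  smul_mem' := fun a m ⟨n, hn⟩ => ⟨n, fun x Q => by rw [smul_comm, hn, smul_zero]⟩

variable (κ) in
theorem vac_isKilled : InfModule.IsKilled f 0 (InfModule.vac A κ) := fun x Q => by
  rw [pow_zero, one_mul, InfModule.series_smul_vac]

end InfinityModule

attribute [local instance] laurentAlgebra endAlgebra

/-! ### The enveloping algebra acts on the smooth vectors at infinity. -/

namespace IsFormalCoordinate
section InfinityAction
variable {A R : Type u} [CommRing A] [CommRing R] [Algebra A R] [Algebra ℂ A]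
  {𝔤 : Type v} [LieRing 𝔤] [LieAlgebra ℂ 𝔤]
variable {I : ℕ → Ideal R} {t : R} {f : A[X]} {h : IsFormalCoordinate I t f}
  {κ : LinearMap.BilinForm ℂ 𝔤}

open InfModule

theorem series_mul_smul (x y : 𝔤) (c c' : HahnSeries ℤ A) (m : InfModule A κ) :
    series κ x c • series κ y c' • m = series κ y c' • series κ x c • m +
      series κ ⁅x, y⁆ (c * c') • m + (algebraMap ℂ A (κ x y) * (c' * derInf A c).coeff 1) • m := by
  rw [← mul_smul, series_comm, add_smul, add_smul, mul_smul]
  rfl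

theorem Exp.sub {k k' : h.Punctured} {c c' : HahnSeries ℤ A} (hc : h.Exp k c) (hc' : h.Exp k' c') :
    h.Exp (k - k') (c - c') := by
  have := IsExp.add hc (IsExp.smul (-1) hc')
  rwa [neg_one_smul, neg_one_smul, ← sub_eq_add_neg, ← sub_eq_add_neg] at this

theorem series_smul_mem (x : 𝔤) {k : h.Punctured} {c : HahnSeries ℤ A} (hc : h.Exp k c)
    {m : InfModule A κ} (hm : m ∈ smoothPart κ f) : series κ x c • m ∈ smoothPart κ f := by
  obtain ⟨n, hn⟩ := hm
  -- The factor `f ^ j` cancels the denominator of `c`, so the bracket stays in the `n`-th step. The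
  -- additional `1` compensates the power lost to differentiation, which makes the central term the
  -- residue of a polynomial.
  obtain ⟨j, P, -, hP⟩ := exp_iff.1 hc
  refine ⟨n + j + 1, fun y Q => ?_⟩
  have e1 : expInf f ^ (n + j + 1) * expInf Q * c = expInf f ^ n * expInf (f * Q * P) := by
    rw [map_mul, map_mul, ← hP]; ring
  have e2 : (c * derInf A (expInf f ^ (n + j + 1) * expInf Q)).coeff 1 = 0 := by
    obtain ⟨S, hS⟩ := pow_dvd_derivative (f := f) (n := j) (P := f ^ (n + j + 1) * Q)
      ⟨f ^ n * Q, by ring⟩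
    rw [← map_pow, ← map_mul, derInf_expInf, hS, map_mul, map_pow, mul_left_comm, ← mul_assoc, hP,
      ← map_mul, expInf_coeff, if_neg (by omega)]
  rw [series_mul_smul, e1, e2, hn.mono (by omega : n ≤ n + j + 1) y Q, hn, smul_zero, mul_zero,
    zero_smul, add_zero, add_zero]

/-- Two rational functions congruent modulo `φ ^ n R` differ by a polynomial multiple of `f ^ n`,
which kills `m`. Hence the action of any `k` can be defined through rational approximations. -/
theorem series_smul_eq (x : 𝔤) {k k' : h.Punctured} {c c' : HahnSeries ℤ A} (hc : h.Exp k c)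
    (hc' : h.Exp k' c') {n : ℕ} {m : InfModule A κ} (hm : IsKilled f n m)
    (hk : k - k' ∈ h.levelK n) : series κ x c • m = series κ x c' • m := by
  obtain ⟨Q, hQ⟩ := (hc.sub hc').eq_mul hk
  rw [sub_eq_iff_eq_add.1 hQ, map_add, add_smul, hm, zero_add]

variable (h) in
/-- The action of `k ⊗ x`: replace `k` by a rational function and expand at infinity. -/
noncomputable def smoothActFun (x : 𝔤) (k : h.Punctured) (m : smoothPart κ f) : smoothPart κ f :=
  ⟨series κ x (h.exists_exp k m.2.choose).choose_spec.choose • m.1,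
    series_smul_mem x (h.exists_exp k m.2.choose).choose_spec.choose_spec.1 m.2⟩

theorem smoothActFun_eq (x : 𝔤) {k k' : h.Punctured} {c : HahnSeries ℤ A} {m : smoothPart κ f}
    {n : ℕ} (hm : IsKilled f n m.1) (hc : h.Exp k' c) (hk : k - k' ∈ h.levelK n) :
    (h.smoothActFun x k m).1 = series κ x c • m.1 := by
  have h1 := (h.exists_exp k m.2.choose).choose_spec.choose_spec
  set n' := m.2.choose with hn'
  -- Both approximations are valid only at the smaller level, and `m` is killed there because that
  -- level is one of the two.
  have h2 : IsKilled f (min n n') m.1 := by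
    rcases min_choice n n' with e | e
    · rw [e]; exact hm
    · rw [e]; exact m.2.choose_spec
  refine series_smul_eq x h1.1 hc h2 ?_
  have := sub_mem (h.levelK_antitone (min_le_left n n') hk)
    (h.levelK_antitone (min_le_right n n') h1.2)
  rwa [sub_sub_sub_cancel_left] at this

theorem smoothActFun_add (x : 𝔤) (k : h.Punctured) (m m' : smoothPart κ f) :
    h.smoothActFun x k (m + m') = h.smoothActFun x k m + h.smoothActFun x k m' := by
  obtain ⟨n, hn⟩ := m.2
  obtain ⟨n', hn'⟩ := m'.2
  have h1 := hn.mono (le_max_left n n')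
  have h2 := hn'.mono (le_max_right n n')
  obtain ⟨k', c, hc, hk⟩ := h.exists_exp k (max n n')
  have h3 : IsKilled f (max n n') (m + m').1 := fun y Q => by
    rw [Submodule.coe_add, smul_add, h1, h2, add_zero]
  refine Subtype.ext ?_
  rw [smoothActFun_eq x h3 hc hk, Submodule.coe_add, Submodule.coe_add, smoothActFun_eq x h1 hc hk,
    smoothActFun_eq x h2 hc hk, smul_add]

theorem smoothActFun_smul (x : 𝔤) (k : h.Punctured) (a : A) (m : smoothPart κ f) :
    h.smoothActFun x k (a • m) = a • h.smoothActFun x k m := by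
  obtain ⟨n, hn⟩ := m.2
  obtain ⟨k', c, hc, hk⟩ := h.exists_exp k n
  have h3 : IsKilled f n (a • m).1 := fun y Q => by
    rw [Submodule.coe_smul, smul_comm, hn, smul_zero]
  refine Subtype.ext ?_
  rw [smoothActFun_eq x h3 hc hk, Submodule.coe_smul, Submodule.coe_smul,
    smoothActFun_eq x hn hc hk, smul_comm]

theorem smoothActFun_add_left (x y : 𝔤) (k : h.Punctured) (m : smoothPart κ f) :
    h.smoothActFun (x + y) k m = h.smoothActFun x k m + h.smoothActFun y k m := by
  obtain ⟨n, hn⟩ := m.2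
  obtain ⟨k', c, hc, hk⟩ := h.exists_exp k n
  refine Subtype.ext ?_
  rw [smoothActFun_eq (x + y) hn hc hk, Submodule.coe_add, smoothActFun_eq x hn hc hk,
    smoothActFun_eq y hn hc hk, series_add, add_smul]

theorem smoothActFun_smul_left (z : ℂ) (x : 𝔤) (k : h.Punctured) (m : smoothPart κ f) :
    h.smoothActFun (z • x) k m = algebraMap ℂ A z • h.smoothActFun x k m := by
  obtain ⟨n, hn⟩ := m.2
  obtain ⟨k', c, hc, hk⟩ := h.exists_exp k n
  refine Subtype.ext ?_
  rw [smoothActFun_eq (z • x) hn hc hk, Submodule.coe_smul, smoothActFun_eq x hn hc hk, series_smul,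
    smul_assoc]

theorem smoothActFun_add_mid (x : 𝔤) (k l : h.Punctured) (m : smoothPart κ f) :
    h.smoothActFun x (k + l) m = h.smoothActFun x k m + h.smoothActFun x l m := by
  obtain ⟨n, hn⟩ := m.2
  obtain ⟨k', c, hc, hk⟩ := h.exists_exp k n
  obtain ⟨l', d, hd, hl⟩ := h.exists_exp l n
  have h1 := add_mem hk hl
  rw [sub_add_sub_comm] at h1
  refine Subtype.ext ?_
  rw [smoothActFun_eq x hn (IsExp.add hc hd) h1, Submodule.coe_add, smoothActFun_eq x hn hc hk,
    smoothActFun_eq x hn hd hl, map_add, add_smul]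

theorem smoothActFun_smul_mid (x : 𝔤) (a : A) (k : h.Punctured) (m : smoothPart κ f) :
    h.smoothActFun x (a • k) m = a • h.smoothActFun x k m := by
  obtain ⟨n, hn⟩ := m.2
  obtain ⟨k', c, hc, hk⟩ := h.exists_exp k n
  have h1 := (h.levelK n).smul_mem a hk
  rw [smul_sub] at h1
  refine Subtype.ext ?_
  rw [smoothActFun_eq x hn (IsExp.smul a hc) h1, Submodule.coe_smul, smoothActFun_eq x hn hc hk,
    map_smul, smul_assoc]

variable (h κ) in
/-- The action of `k ⊗ x` on the smooth part. -/
noncomputable def smoothAct (k : h.Punctured) (x : 𝔤) : Module.End A (smoothPart κ f) where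
  toFun := h.smoothActFun x k
  map_add' := smoothActFun_add x k
  map_smul' := smoothActFun_smul x k

theorem smoothAct_eq (x : 𝔤) {k k' : h.Punctured} {c : HahnSeries ℤ A} {m : smoothPart κ f}
    {n : ℕ} (hm : IsKilled f n m.1) (hc : h.Exp k' c) (hk : k - k' ∈ h.levelK n) :
    (h.smoothAct κ k x m).1 = series κ x c • m.1 := smoothActFun_eq x hm hc hk

theorem smoothAct_exp (x : 𝔤) {k : h.Punctured} {c : HahnSeries ℤ A} (hc : h.Exp k c)
    (m : smoothPart κ f) : (h.smoothAct κ k x m).1 = series κ x c • m.1 := by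
  obtain ⟨n, hn⟩ := m.2
  exact smoothAct_eq x hn hc (by rw [sub_self]; exact zero_mem _)

theorem smoothAct_comm (x y : 𝔤) (k l : h.Punctured) :
    h.smoothAct κ k x * h.smoothAct κ l y = h.smoothAct κ l y * h.smoothAct κ k x +
      h.smoothAct κ (k * l) ⁅x, y⁆ +
      algebraMap A _ (algebraMap ℂ A (κ x y) * h.res (l * h.derivK k)) := by
  refine LinearMap.ext fun m => Subtype.ext ?_
  obtain ⟨n₀, h₀⟩ := m.2
  obtain ⟨n₁, h₁⟩ := (h.smoothAct κ l y m).2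
  obtain ⟨n₂, h₂⟩ := (h.smoothAct κ k x m).2
  obtain ⟨a₁, ha₁⟩ := h.levelK_absorb k n₀
  obtain ⟨a₂, ha₂⟩ := h.levelK_absorb l n₀
  obtain ⟨a₃, ha₃⟩ := h.levelK_absorb (h.derivK k) 0
  obtain ⟨a₄, ha₄⟩ := h.levelK_absorb l 0
  -- Precise enough for `m`, for its two images, for the product `k * l` and for the residue of `l
  -- dk`; one more order is spent on the derivative.
  set N := n₀ + n₁ + n₂ + a₁ + a₂ + a₃ + a₄ with hN
  obtain ⟨k', c, hc, hk⟩ := h.exists_exp k (N + 1)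
  obtain ⟨l', d, hd, hl⟩ := h.exists_exp l (N + 1)
  have anti : ∀ {n : ℕ} {r : h.Punctured}, n ≤ N + 1 → r ∈ h.levelK (N + 1) → r ∈ h.levelK n :=
    fun hn hr => h.levelK_antitone hn hr
  have e1 : k * l - k' * l' ∈ h.levelK n₀ := by
    have h3 := sub_mem (add_mem (ha₁ _ (anti (by omega) hl)) (ha₂ _ (anti (by omega) hk)))
      (h.levelK_antitone (by omega : n₀ ≤ N + 1 + (N + 1)) (h.levelK_mul hk hl))
    convert h3 using 1
    ring
  have e2 : h.res (l * h.derivK k) = (d * derInf A c).coeff 1 := by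
    rw [← (hd.mul hc.der).res_eq, ← sub_eq_zero, ← map_sub]
    refine h.res_mem_zero ?_
    have h3 := h.derivK_mem hk
    have h4 := sub_mem (add_mem (ha₃ _ (anti (by omega) hl))
      (ha₄ _ (h.levelK_antitone (by omega : a₄ ≤ N) h3)))
      (h.levelK_antitone (by omega : 0 ≤ N + 1 + N) (h.levelK_mul hl h3))
    convert h4 using 1
    rw [map_sub]
    ring
  change (h.smoothAct κ k x (h.smoothAct κ l y m)).1 = (h.smoothAct κ l y (h.smoothAct κ k x m)).1 +
    (h.smoothAct κ (k * l) ⁅x, y⁆ m).1 + (algebraMap ℂ A (κ x y) * h.res (l * h.derivK k)) • m.1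
  rw [smoothAct_eq x h₁ hc (anti (by omega) hk), smoothAct_eq y h₂ hd (anti (by omega) hl),
    smoothAct_eq _ h₀ (hc.mul hd) e1, smoothAct_eq y h₀ hd (anti (by omega) hl),
    smoothAct_eq x h₀ hc (anti (by omega) hk), series_mul_smul, e2]

variable [Algebra ℂ R] [IsScalarTower ℂ A R]

variable (h κ) in
/-- The action of `K ⊗ 𝔤` on the smooth part. -/
noncomputable def smoothActL : h.Punctured ⊗[ℂ] 𝔤 →ₗ[A] Module.End A (smoothPart κ f) :=
  haveI : IsScalarTower ℂ A (Module.End A (smoothPart κ f)) :=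
    ⟨fun c a e => LinearMap.ext fun m => by
      rw [endAlgebra_smul, Algebra.smul_def c a, LinearMap.smul_apply, LinearMap.smul_apply,
        mul_smul]⟩
  TensorProduct.AlgebraTensorModule.lift
    { toFun := fun k =>
        { toFun := h.smoothAct κ k
          map_add' := fun x y => LinearMap.ext (smoothActFun_add_left x y k)
          map_smul' := fun z x => LinearMap.ext (smoothActFun_smul_left z x k) }
      map_add' := fun k l => LinearMap.ext fun x => LinearMap.ext (smoothActFun_add_mid x k l)
      map_smul' := fun a k => LinearMap.ext fun x => LinearMap.ext (smoothActFun_smul_mid x a k) }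

theorem smoothActL_tmul (k : h.Punctured) (x : 𝔤) :
    smoothActL h κ (k ⊗ₜ x) = h.smoothAct κ k x := rfl

variable (h κ) in
/-- The action of the enveloping algebra on the smooth part. -/
noncomputable def envRep : Env h κ →ₐ[A] Module.End A (smoothPart κ f) :=
  RingQuot.liftAlgHom A ⟨TensorAlgebra.lift A (smoothActL h κ), by
    rintro _ _ ⟨k, l, x, y⟩
    simp only [map_mul, map_add, TensorAlgebra.lift_ι_apply, AlgHom.commutes, smoothActL_tmul]
    rw [smoothAct_comm, ← algebraMap_smul A (κ x y) (h.res _), smul_eq_mul, map_mul]⟩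

theorem envRep_gen (k : h.Punctured) (x : 𝔤) :
    envRep h κ (gen h κ (k ⊗ₜ x)) = h.smoothAct κ k x := by
  rw [envRep, gen, LinearMap.comp_apply]
  refine (RingQuot.liftAlgHom_mkAlgHom_apply A _ _ _).trans ?_
  rw [TensorAlgebra.lift_ι_apply, smoothActL_tmul]

end InfinityAction
end IsFormalCoordinate

/-! ### Evaluating fields on the vacuum at infinity. -/

namespace IsFormalCoordinate
section Evaluation
variable {A R : Type u} [CommRing A] [CommRing R] [Algebra A R] [Algebra ℂ A] [Algebra ℂ R]
  [IsScalarTower ℂ A R] {𝔤 : Type v} [LieRing 𝔤] [LieAlgebra ℂ 𝔤]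
variable {I : ℕ → Ideal R} {t : R} {f : A[X]} (h : IsFormalCoordinate I t f)
  (κ : LinearMap.BilinForm ℂ 𝔤)

open InfModule

variable (f) in
/-- The vacuum as a smooth vector. -/
noncomputable def smoothVac : smoothPart (A := A) κ f :=
  ⟨vac A κ, 0, vac_isKilled (A := A) κ f⟩

/-- The action of the enveloping algebra on the vacuum. -/
noncomputable def envEv : Env h κ →ₗ[A] smoothPart κ f :=
  LinearMap.comp (LinearMap.applyₗ (R := A) (M₂ := smoothPart κ f) (smoothVac f κ))
    (envRep h κ).toLinearMap

theorem envEv_apply (e : Env h κ) : envEv h κ e = envRep h κ e (smoothVac f κ) := rfl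

theorem envEv_eq_zero {e : Env h κ} (he : e ∈ envLevel h κ 0) : envEv h κ e = 0 := by
  induction he using Submodule.span_induction with
  | zero => exact map_zero _
  | add a b _ _ ha hb => rw [map_add, ha, hb, add_zero]
  | smul a b _ hb =>
    rw [envEv_apply] at hb ⊢
    rw [smul_eq_mul, map_mul, Module.End.mul_apply, hb, map_zero]
  | mem e he =>
    obtain ⟨r, x, rfl⟩ := he
    rw [envEv_apply, envRep_gen]
    refine Subtype.ext ?_
    -- At level zero a regular function may be approximated by `0`.
    refine (smoothAct_eq (m := smoothVac f κ) (n := 0) x (vac_isKilled (A := A) κ f)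
      (h.exp_aeval 0) (sub_mem (h.unif_mul_mem 0 r) (h.algebraMap_mem _))).trans ?_
    exact series_smul_vac x 0

theorem exists_coe_sub_mem (u : CEnv h κ) : ∃ e : Env h κ, u - e ∈ cLevel h κ 0 := by
  have h1 : (fun w => u - w) ⁻¹' (cLevel h κ 0 : Set (CEnv h κ)) ∈ 𝓝 u := by
    refine (continuous_const.sub continuous_id).continuousAt.preimage_mem_nhds ?_
    change _ ∈ 𝓝 (u - u)
    rw [sub_self]
    exact (isIdealBasis h κ).mem_of_mem trivial
  obtain ⟨_, hw, e, rfl⟩ := mem_closure_iff_nhds.1 (UniformSpace.Completion.denseRange_coe u) _ h1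
  exact ⟨e, hw⟩

theorem envEv_eq_of_sub_mem {u : CEnv h κ} {e e' : Env h κ} (he : u - e ∈ cLevel h κ 0)
    (he' : u - e' ∈ cLevel h κ 0) : envEv h κ e = envEv h κ e' := by
  have h1 := sub_mem he' he
  rw [sub_sub_sub_cancel_left, ← UniformSpace.Completion.coe_sub, coe_mem_cLevel] at h1
  have h2 := envEv_eq_zero h κ h1
  rwa [map_sub, sub_eq_zero] at h2

/-- The action of the completed enveloping algebra on the vacuum. -/
noncomputable def cEv : CEnv h κ →ₗ[A] smoothPart κ f where
  toFun u := envEv h κ (exists_coe_sub_mem h κ u).choose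
  map_add' u u' := by
    rw [← map_add]
    refine envEv_eq_of_sub_mem h κ (exists_coe_sub_mem h κ (u + u')).choose_spec ?_
    rw [UniformSpace.Completion.coe_add, add_sub_add_comm]
    exact add_mem (exists_coe_sub_mem h κ u).choose_spec (exists_coe_sub_mem h κ u').choose_spec
  map_smul' a u := by
    rw [RingHom.id_apply, ← map_smul]
    refine envEv_eq_of_sub_mem h κ (exists_coe_sub_mem h κ (a • u)).choose_spec ?_
    rw [UniformSpace.Completion.coe_smul, ← smul_sub]
    exact smul_mem_ideal a (exists_coe_sub_mem h κ u).choose_spec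

variable {h κ}

theorem cEv_eq {u : CEnv h κ} {e : Env h κ} (he : u - e ∈ cLevel h κ 0) :
    cEv h κ u = envEv h κ e :=
  envEv_eq_of_sub_mem h κ (exists_coe_sub_mem h κ u).choose_spec he

theorem cEv_eq_zero {u : CEnv h κ} (hu : u ∈ cLevel h κ 0) : cEv h κ u = 0 := by
  rw [cEv_eq (e := 0), map_zero]
  rwa [UniformSpace.Completion.coe_zero, sub_zero]

theorem cEv_coe_mul (e : Env h κ) (u : CEnv h κ) : cEv h κ (e * u) = envRep h κ e (cEv h κ u) := by
  obtain ⟨e', he'⟩ := exists_coe_sub_mem h κ u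
  rw [cEv_eq (e := e * e'), cEv_eq he', envEv_apply, envEv_apply, map_mul, Module.End.mul_apply]
  rw [UniformSpace.Completion.coe_mul, ← mul_sub]
  exact Ideal.mul_mem_left _ _ he'

theorem cEv_algebraMap (a : A) : cEv h κ (algebraMap A _ a) = a • smoothVac f κ := by
  rw [cEv_eq (e := algebraMap A _ a), envEv_apply, AlgHom.commutes, Module.algebraMap_end_apply]
  rw [coe_algebraMap, sub_self]
  exact zero_mem _

/-- The components of the action of a field on the vacuum. -/
noncomputable def cEvCoeff (e : ℤ) : CEnv h κ →ₗ[A] A ⊗[ℂ] AffineVertex κ :=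
  InfModule.coeff e ∘ₗ (smoothPart κ f).subtype ∘ₗ cEv h κ

theorem cEvCoeff_apply (e : ℤ) (u : CEnv h κ) : cEvCoeff e u = coeff e (cEv h κ u).1 := rfl

variable (h) in
/-- The field of `v` maps the vacuum to translates of `v`, with `v` in degree `d`. -/
def IsGood (d : ℕ) (v : AffineVertex κ) : Prop :=
  ∃ w : ℕ → AffineVertex κ, w 0 = v ∧ ∀ k : h.Punctured,
    (∀ e < (d : ℤ), cEvCoeff e ((sf h κ v).1 k) = 0) ∧
    ∀ l : ℕ, cEvCoeff (d + l : ℤ) ((sf h κ v).1 k) = h.res (h.coord ^ l * k) ⊗ₜ w l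

variable (h κ) in
theorem isGood_vacuum : IsGood h 0 (AffineVertex.vacuum κ) := by
  refine ⟨fun l => if l = 0 then AffineVertex.vacuum κ else 0, rfl, fun k => ?_⟩
  have h1 : ∀ e : ℤ, cEvCoeff e ((sf h κ (AffineVertex.vacuum κ)).1 k) =
      if e = 0 then h.res k ⊗ₜ AffineVertex.vacuum κ else 0 := fun e => by
    rw [DiagonalKernel.IsCurrents.stateField_vacuum, cEvCoeff_apply]
    change coeff e (cEv h κ (algebraMap A _ (h.res k))).1 = _
    rw [cEv_algebraMap, Submodule.coe_smul, map_smul, smoothVac, coeff_vac]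
    split_ifs
    · rw [TensorProduct.smul_tmul', smul_eq_mul, mul_one]
    · rw [smul_zero]
  refine ⟨fun e he => by rw [h1, if_neg (by simpa using he.ne)], fun l => ?_⟩
  rw [h1]
  rcases Nat.eq_zero_or_pos l with rfl | hl
  · simp
  · beta_reduce
    rw [if_neg (by push_cast; omega), if_neg hl.ne', TensorProduct.tmul_zero]

/-- A proper `k` has expansion coefficients `Res (t ^ i k dt)` in degrees `i + 1`, so the current
acts by `x t^(-1-i)`. Summing over the kernel turns these residues into contractions of its first
variable. -/
theorem cEvCoeff_proper (x : 𝔤) {d : ℕ} {Z : h.Punctured →ₗ[A] CEnv h κ} {w : ℕ → AffineVertex κ}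
    (hZ : ∀ k : h.Punctured, (∀ e < (d : ℤ), cEvCoeff e (Z k) = 0) ∧
      ∀ l : ℕ, cEvCoeff (d + l : ℤ) (Z k) = h.res (h.coord ^ l * k) ⊗ₜ w l)
    (g : h.Punctured) {c : h.Punctured ⊗[A] h.Punctured} (hc : c ∈ h.properFst) :
    (∀ e < (d : ℤ) + 1, cEvCoeff e (mulMap (curF h κ x).1 Z (c * 1 ⊗ₜ g)) = 0) ∧
    ∀ L : ℕ, cEvCoeff (d + 1 + L : ℤ) (mulMap (curF h κ x).1 Z (c * 1 ⊗ₜ g)) =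
      ∑ i ∈ Finset.range (L + 1), h.res (h.coord ^ (L - i) *
        (contractFst h.res ((h.coord ^ i) ⊗ₜ 1 * c) * g)) ⊗ₜ
          AffineVertex.mode κ x (-1 - i) (w (L - i)) := by
  induction hc using Submodule.span_induction with
  | zero => simp
  | add a b _ _ ha hb =>
    simp only [add_mul, map_add, mul_add, TensorProduct.add_tmul, Finset.sum_add_distrib]
    exact ⟨fun e he => by rw [ha.1 e he, hb.1 e he, add_zero], fun L => by rw [ha.2, hb.2]⟩
  | smul a b _ hb =>
    simp only [smul_mul_assoc, map_smul, mul_smul_comm, smul_eq_mul]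
    refine ⟨fun e he => by rw [hb.1 e he, smul_zero], fun L => ?_⟩
    rw [hb.2, Finset.smul_sum]
    exact Finset.sum_congr rfl fun i _ => TensorProduct.smul_tmul' _ _ _
  | mem c hc =>
    obtain ⟨k, l, hk, rfl⟩ := hc
    obtain ⟨s, hs, hs1⟩ := hk.exists_exp
    have h1 : ∀ e, cEvCoeff e (mulMap (curF h κ x).1 Z (k ⊗ₜ l * 1 ⊗ₜ g)) =
        ∑ a ∈ Finset.Icc 1 (e - d), s.coeff a • modeA A x (-a) (cEvCoeff (e - a) (Z (l * g))) :=
      fun e => by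
        rw [Algebra.TensorProduct.tmul_mul_tmul, mul_one, mulMap_tmul, curF_apply, cEvCoeff_apply,
          cEv_coe_mul, envRep_gen, smoothAct_exp x hs,
          InfModule.coeff_smul (m := (cEv h κ (Z (l * g))).1) (series_supportedFrom x hs1) (fun b hb => (hZ (l * g)).1 b hb)]
        rfl
    refine ⟨fun e he => by rw [h1, Finset.Icc_eq_empty (by omega), Finset.sum_empty], fun L => ?_⟩
    rw [h1]
    symm
    refine Finset.sum_nbij' (fun i => (i + 1 : ℤ)) (fun a => (a - 1).toNat) ?_ ?_ ?_ ?_ ?_ <;>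
      simp only [Finset.mem_Icc, Finset.mem_range] <;> intro i hi
    · omega
    · omega
    · omega
    · omega
    · rw [show (d + 1 + L - (i + 1 : ℤ)) = d + (L - i : ℕ) by omega, (hZ (l * g)).2, modeA_tmul,
        hs.coeff_succ, TensorProduct.smul_tmul', show (-(i + 1 : ℤ)) = -1 - i by ring,
        Algebra.TensorProduct.tmul_mul_tmul, contractFst_tmul, one_mul, smul_mul_assoc,
        mul_smul_comm, map_smul]

/-- Contraction of `t ^ i` with the kernel is the divided derivative `choose i s * t ^ (i - s)`,
which vanishes for `i < s`. So the lowest degree is `d + 1 + s`, where only `i = s` and the lowest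
term `v` contribute. -/
theorem IsGood.mode {d : ℕ} {v : AffineVertex κ} (hv : IsGood h d v) (x : 𝔤) (s : ℕ) :
    IsGood h (d + 1 + s) (AffineVertex.mode κ x (-1 - s) v) := by
  obtain ⟨w, hw, hZ⟩ := hv
  refine ⟨fun l => ∑ i ∈ Finset.range (s + l + 1), i.choose s •
    AffineVertex.mode κ x (-1 - i) (w (s + l - i)), ?_, fun g => ?_⟩
  · beta_reduce
    rw [Finset.sum_eq_single_of_mem s (by simp), Nat.choose_self, one_smul]
    · simp [hw]
    · intro i hi his
      rw [Nat.choose_eq_zero_of_lt (by simp at hi; omega), zero_smul]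
  obtain ⟨N₁, hN₁⟩ := h.levelK_absorb g 0
  obtain ⟨N, hN, hNop⟩ := ((eventually_ge_atTop N₁).and ((isIdealBasis h κ).tendsto_iff.1
    (DiagonalKernel.op_tendsto (isIdealBasis h κ) (-1 - s) (curF h κ x) (sf h κ v) g) 0)).exists
  have h1 : ∀ e, cEvCoeff e ((sf h κ (AffineVertex.mode κ x (-1 - s) v)).1 g) =
      cEvCoeff e (mulMap (curF h κ x).1 (sf h κ v).1 (h.kernel.p N (-1 - s) * 1 ⊗ₜ g)) := fun e => by
    -- In this half of the commutator the current stands on the right with a regular argument, hence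
    -- kills the vacuum.
    have h2 : mulMap (sf h κ v).1 (curF h κ x).1 (h.kernel.p N (-1 - s) * g ⊗ₜ 1) ∈
        cLevel h κ 0 := by
      refine DiagonalKernel.mulMap_mem_of_right (𝔎 := h.kernel) (fun r hr => ?_) _ _
        (h.kernel.p_mem N _)
      obtain ⟨r, rfl⟩ := h.mem_levelK.1 hr
      rw [mul_one]
      exact (coe_mem_cLevel h κ).2 (Ideal.subset_span ⟨r, x, rfl⟩)
    rw [DiagonalKernel.op_apply, sub_right_comm] at hNop
    have h3 := add_mem hNop (zsmul_mem h2 (sgn (-1 - s)))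
    rw [sub_add_cancel] at h3
    rw [DiagonalKernel.IsCurrents.stateField_mode]
    have h4 := cEv_eq_zero h3
    rw [map_sub, sub_eq_zero] at h4
    rw [cEvCoeff_apply, cEvCoeff_apply, h4]
  have h2 := cEvCoeff_proper x hZ g (h.kernel_p_mem_properFst N s)
  have h3 : ∀ i j : ℕ, h.res (h.coord ^ j * (contractFst h.res ((h.coord ^ i) ⊗ₜ 1 *
      h.kernel.p N (-1 - s)) * g)) = i.choose s • h.res (h.coord ^ (j + (i - s)) * g) := by
    intro i j
    have h4 := h.isResidueFor.contract_pow_mul N i (-1 - s)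
    rw [if_pos (by omega), show (-1 - (-1 - (s : ℤ))).toNat = s by omega] at h4
    have h5 : h.res (h.coord ^ j * ((contractFst h.res ((h.coord ^ i) ⊗ₜ 1 *
        h.kernel.p N (-1 - s)) - (i.choose s : A) • h.coord ^ (i - s)) * g)) = 0 := by
      refine h.res_mem_zero ?_
      have h6 := hN₁ _ (h.levelK_antitone hN h4)
      have h7 := h.levelK_mul (h.algebraMap_mem (t ^ j)) h6
      rw [map_pow] at h7
      rwa [mul_comm _ g]
    rw [sub_mul, mul_sub, map_sub, sub_eq_zero] at h5
    rw [h5, smul_mul_assoc, mul_smul_comm, map_smul, Nat.cast_smul_eq_nsmul, ← mul_assoc, ← pow_add]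
  refine ⟨fun e he => ?_, fun l => ?_⟩
  · rw [h1]
    rcases lt_or_ge e (d + 1 : ℤ) with he' | he'
    · exact h2.1 e he'
    · obtain ⟨L, rfl⟩ : ∃ L : ℕ, e = d + 1 + L := ⟨(e - (d + 1)).toNat, by omega⟩
      rw [h2.2]
      refine Finset.sum_eq_zero fun i hi => ?_
      rw [h3, Nat.choose_eq_zero_of_lt (by push_cast at he; simp at hi; omega), zero_smul,
        TensorProduct.zero_tmul]
  · rw [h1, show (((d + 1 + s : ℕ) : ℤ) + l) = d + 1 + (s + l : ℕ) by push_cast; ring, h2.2,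
      TensorProduct.tmul_sum]
    refine Finset.sum_congr rfl fun i hi => ?_
    rw [h3]
    rcases Nat.lt_or_ge i s with his | his
    · rw [Nat.choose_eq_zero_of_lt his, zero_smul, zero_smul, TensorProduct.tmul_zero,
        TensorProduct.zero_tmul]
    · rw [show s + l - i + (i - s) = l by simp at hi; omega, TensorProduct.tmul_smul,
        TensorProduct.smul_tmul']

end Evaluation
end IsFormalCoordinate

/-! ### Recovering the coefficients of a field from its values. -/

namespace IsFormalCoordinate
section Detection
variable {A R : Type u} [CommRing A] [CommRing R] [Algebra A R] [Algebra ℂ A] [Algebra ℂ R]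
  [IsScalarTower ℂ A R] {𝔤 : Type v} [LieRing 𝔤] [LieAlgebra ℂ 𝔤]
variable {I : ℕ → Ideal R} {t : R} {f : A[X]} (h : IsFormalCoordinate I t f)
  (κ : LinearMap.BilinForm ℂ 𝔤)

theorem span_isGood : ⊤ ≤ Submodule.span ℂ {v : AffineVertex κ | ∃ d, IsGood h d v} := by
  intro v _
  have hv := AffineVertex.isCreated v
  induction hv with
  | vac => exact Submodule.subset_span ⟨0, isGood_vacuum h κ⟩
  | add _ _ hu hv => exact add_mem (hu trivial) (hv trivial)
  | smul c _ hv => exact Submodule.smul_mem _ c (hv trivial)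
  | mode x s _ hv =>
    refine (Submodule.map_span_le (AffineVertex.mode κ x (-1 - s)) _ _).2 ?_
      (Submodule.mem_map_of_mem (hv trivial))
    rintro w ⟨d, hw⟩
    exact Submodule.subset_span ⟨_, hw.mode x s⟩

/-- There is a basis of the vacuum module consisting of vectors of pure degree. -/
theorem exists_basis_isGood : ∃ (ι : Type v) (b : Module.Basis ι ℂ (AffineVertex κ)) (d : ι → ℕ),
    ∀ i, IsGood h (d i) (b i) := by
  have h1 := fun i => Module.Basis.ofSpan_subset (span_isGood h κ) (Set.mem_range_self i)
  choose d hd using h1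
  exact ⟨_, _, d, hd⟩

variable {h κ}

/-- Strong induction on the degree of `b i`. In that degree higher vectors do not contribute and
lower ones contribute residues of regular functions. Vectors of equal degree are separated by the
basis, and nondegeneracy of the residue pairing concludes. -/
theorem mem_ideal_of_isGood {ι : Type*} {b : Module.Basis ι ℂ (AffineVertex κ)} {d : ι → ℕ}
    (hb : ∀ i, IsGood h (d i) (b i)) {j : ℕ} {r : ι →₀ R}
    (hr : ∀ k : h.Punctured, (∃ s, h.unif ^ j * k = algebraMap R _ s) →
      r.sum (fun i ri => (sf h κ (b i)).1 (algebraMap R _ ri * k)) ∈ cLevel h κ 0) (i : ι) :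
    r i ∈ I j := by
  induction hn : d i using Nat.strong_induction_on generalizing i with
  | _ n ih =>
  subst hn
  refine h.mem_ideal_of_res_eq_zero fun k hk => ?_
  have h1 : ∀ i', cEvCoeff (d i : ℤ) ((sf h κ (b i')).1 (algebraMap R _ (r i') * k)) =
      if d i' = d i then h.res (algebraMap R _ (r i') * k) ⊗ₜ b i' else 0 := by
    intro i'
    obtain ⟨w, hw, H⟩ := hb i'
    obtain ⟨H1, H2⟩ := H (algebraMap R _ (r i') * k)
    rcases lt_trichotomy (d i') (d i) with hd | hd | hd
    -- By induction `r i'` lies in `I j`, which cancels the poles of `k`.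
    · obtain ⟨l, hl⟩ := Nat.exists_eq_add_of_le hd.le
      rw [if_neg hd.ne, hl, Nat.cast_add, H2, h.res_mem_zero, TensorProduct.zero_tmul]
      obtain ⟨s, hs⟩ := h.mem_ideal_iff.1 (ih _ hd i' rfl)
      obtain ⟨s', hs'⟩ := hk
      rw [hs, map_mul, mul_right_comm, map_pow, hs', ← map_pow, ← map_mul, ← map_mul]
      exact h.algebraMap_mem _
    · rw [if_pos hd, ← hd]
      have := H2 0
      rwa [Nat.cast_zero, add_zero, pow_zero, one_mul, hw] at this
    · rw [if_neg hd.ne', H1 _ (by exact_mod_cast hd)]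
  by_cases hi : r i = 0
  · rw [hi, map_zero, zero_mul, map_zero]
  have h2 : cEvCoeff (d i : ℤ) (r.sum fun i ri => (sf h κ (b i)).1 (algebraMap R _ ri * k)) = 0 := by
    rw [cEvCoeff_apply, cEv_eq_zero (hr k hk)]
    exact map_zero _
  rw [Finsupp.sum, map_sum, Finset.sum_congr rfl fun i' _ => h1 i'] at h2
  have h3 := congrArg (fun z => (b.baseChange A).repr z i) h2
  simp only [map_sum, Finsupp.finsetSum_apply, map_zero, Finsupp.zero_apply] at h3
  rw [Finset.sum_eq_single i, if_pos rfl, Module.Basis.baseChange_repr_tmul,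
    Module.Basis.repr_self, Finsupp.single_eq_same, one_smul] at h3
  · exact h3
  · intro i' _ hi'
    split_ifs
    · rw [Module.Basis.baseChange_repr_tmul, Module.Basis.repr_self,
        Finsupp.single_eq_of_ne hi'.symm, zero_smul]
    · rw [map_zero, Finsupp.zero_apply]
  · intro h4
    exact absurd (Finsupp.notMem_support_iff.1 h4) hi

end Detection
end IsFormalCoordinate

/-! ### Induced linear topologies. -/

theorem induced_linearTopology {A M N : Type*} [CommRing A] [AddCommGroup M] [Module A M]
    [AddCommGroup N] [Module A N] {P : Submodule A M → Prop} {top inf}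
    {P' : Submodule A N → Prop} {top' inf'} (g : M →ₗ[A] N)
    (h : ∀ Q, P' Q → P (Q.comap g)) (h' : ∀ Q, P Q → ∃ Q', P' Q' ∧ Q'.comap g ≤ Q) :
    linearTopology P top inf = (linearTopology P' top' inf').induced g := by
  refine TopologicalSpace.ext (funext fun s => propext ⟨fun hs => ?_, ?_⟩)
  · refine ⟨{y | ∃ x ∈ s, ∃ Q, P' Q ∧ y - g x ∈ Q ∧ ∀ z ∈ Q.comap g, x + z ∈ s}, ?_, ?_⟩
    · rintro y ⟨x, hx, Q, hQ, hy, H⟩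
      refine ⟨Q, hQ, fun z hz => ⟨x, hx, Q, hQ, ?_, H⟩⟩
      rw [add_sub_right_comm]
      exact add_mem hy hz
    · ext x
      constructor
      · rintro ⟨x', hx', Q, hQ, hx, H⟩
        have := H (x - x') (by rwa [Submodule.mem_comap, map_sub])
        rwa [add_sub_cancel] at this
      · intro hx
        obtain ⟨Q, hQ, H⟩ := hs x hx
        obtain ⟨Q', hQ', hle⟩ := h' Q hQ
        exact ⟨x, hx, Q', hQ', by rw [sub_self]; exact zero_mem _, fun z hz => H z (hle hz)⟩
  · rintro ⟨U, hU, rfl⟩ x hx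
    obtain ⟨Q, hQ, H⟩ := hU _ hx
    refine ⟨_, h Q hQ, fun z hz => ?_⟩
    rw [Set.mem_preimage, map_add]
    exact H _ hz

/-! ### The canonical map: existence, uniqueness, injectivity and image. -/

namespace IsFormalCoordinate
section CanonicalMap
variable {A R : Type u} [CommRing A] [CommRing R] [Algebra A R] [Algebra ℂ A] [Algebra ℂ R]
  [IsScalarTower ℂ A R] {𝔤 : Type v} [LieRing 𝔤] [LieAlgebra ℂ 𝔤]
variable {I : ℕ → Ideal R} {t : R} {f : A[X]} (h : IsFormalCoordinate I t f)
  (κ : LinearMap.BilinForm ℂ 𝔤)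

/-- The additive map `r ⊗ v ↦ Y (v) r` to fields. -/
noncomputable def stateAddHom : R ⊗[ℂ] AffineVertex κ →+ PreField h κ :=
  TensorProduct.liftAddHom
    (AddMonoidHom.mk' (fun r => AddMonoidHom.mk' (fun v => PreField.mulR (sf h κ v).1 r)
      fun v w => by rw [map_add]; rfl) fun r s => by
        refine AddMonoidHom.ext fun v => LinearMap.ext fun k => ?_
        simp [PreField.mulR, add_mul])
    (fun c r v => LinearMap.ext fun k => by
      change (sf h κ v).1 (algebraMap R _ (c • r) * k) =
        (sf h κ (c • v)).1 (algebraMap R _ r * k)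
      rw [DiagonalKernel.IsCurrents.stateField_smul, algebra_compatible_smul A c r,
        Algebra.smul_def, map_mul (algebraMap R h.Punctured),
        ← IsScalarTower.algebraMap_apply A R h.Punctured, mul_assoc, ← Algebra.smul_def, map_smul]
      rfl)

/-- The map `r ⊗ v ↦ Y (v) r` to fields. -/
noncomputable def stateMap : R ⊗[ℂ] AffineVertex κ →ₗ[A] PreField h κ where
  toFun := stateAddHom h κ
  map_add' := map_add _
  map_smul' a z := by
    induction z with
    | zero => simp
    | add y z hy hz => rw [smul_add, map_add, hy, hz, map_add, smul_add]
    | tmul r v =>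
      refine LinearMap.ext fun k => ?_
      change (sf h κ v).1 (algebraMap R _ (a • r) * k) = a • (sf h κ v).1 (algebraMap R _ r * k)
      rw [Algebra.smul_def, map_mul (algebraMap R h.Punctured),
        ← IsScalarTower.algebraMap_apply A R h.Punctured, mul_assoc, ← Algebra.smul_def, map_smul]

theorem stateMap_tmul (r : R) (v : AffineVertex κ) :
    stateMap h κ (r ⊗ₜ v) = PreField.mulR (sf h κ v).1 r := rfl

theorem stateMap_one_tmul (v : AffineVertex κ) : stateMap h κ (1 ⊗ₜ v) = (sf h κ v).1 :=
  LinearMap.ext fun k => by simp [stateMap_tmul, PreField.mulR]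

theorem isCanonicalMap_stateMap : IsCanonicalMap h κ (stateMap h κ) where
  mem z := by
    induction z with
    | zero => rw [map_zero]; exact zero_mem _
    | add y z hy hz => rw [map_add]; exact add_mem hy hz
    | tmul r v => exact chiral_mulR h κ r (sf_mem_chiral h κ v)
  map_mul r s v := by rw [stateMap_tmul, stateMap_tmul, mulR_mulR, mul_comm]
  map_vacuum := by
    rw [stateMap_one_tmul, DiagonalKernel.IsCurrents.stateField_vacuum]
    rfl
  map_current x := by
    rw [stateMap_one_tmul, DiagonalKernel.IsCurrents.stateField_current]
    rfl
  map_nProd v B hB w n := by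
    rw [stateMap_one_tmul, stateMap_one_tmul, stateMap_one_tmul,
      DiagonalKernel.IsCurrents.stateField_vertexOp _ hB]
    exact isNProd_nProd n _ _

variable {h κ}

/-- The vacuum module is generated from the vacuum by modes of currents, and products of fields are
limits, hence unique. -/
theorem IsCanonicalMap.eq_stateMap {Y : R ⊗[ℂ] AffineVertex κ →ₗ[A] PreField h κ}
    (hY : IsCanonicalMap h κ Y) : Y = stateMap h κ := by
  have h1 : ∀ v, Y (1 ⊗ₜ v) = (sf h κ v).1 := fun v => by
    induction v using AffineVertex.induction with
    | vac =>
      rw [hY.map_vacuum, ← (isCanonicalMap_stateMap h κ).map_vacuum, stateMap_one_tmul]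
    | add u v hu hv => rw [TensorProduct.tmul_add, map_add, map_add, hu, hv]; rfl
    | smul c v hv =>
      rw [TensorProduct.tmul_smul, algebra_compatible_smul A c, map_smul, hv,
        DiagonalKernel.IsCurrents.stateField_smul]
      rfl
    | mode x n v hv =>
      have h2 := hY.map_nProd _ _ (AffineVertex.isVertexOp_current x) v n
      rw [hY.map_current, hv] at h2
      rw [h2.eq (curF h κ x).2 (sf h κ v).2, DiagonalKernel.IsCurrents.stateField_mode]
      rfl
  refine LinearMap.ext fun z => ?_
  induction z with
  | zero => simp
  | add y z hy hz => rw [map_add, map_add, hy, hz]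
  | tmul r v =>
    have := hY.map_mul r 1 v
    rw [mul_one] at this
    rw [this, h1, stateMap_tmul]

variable (h κ)

/-- A quantitative injectivity: smallness on functions with poles of order at most `j` bounds every
coefficient. Letting `j` vary yields injectivity; with `j` fixed it compares the topologies. -/
theorem exists_basis_detect : ∃ (ι : Type v) (b : Module.Basis ι ℂ (AffineVertex κ)),
    ∀ (j : ℕ) (z : R ⊗[ℂ] AffineVertex κ), (∀ k : h.Punctured,
      (∃ s, h.unif ^ j * k = algebraMap R _ s) → stateMap h κ z k ∈ cLevel h κ 0) →
      ∀ i, (b.baseChange R).repr z i ∈ I j := by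
  obtain ⟨ι, b, d, hb⟩ := exists_basis_isGood h κ
  refine ⟨ι, b, fun j z hz => mem_ideal_of_isGood hb fun k hk => ?_⟩
  convert hz k hk using 1
  conv_rhs => rw [← (b.baseChange R).linearCombination_repr z]
  rw [Finsupp.linearCombination_apply, Finsupp.sum, Finsupp.sum, map_sum, LinearMap.sum_apply]
  refine Finset.sum_congr rfl fun i _ => ?_
  rw [Module.Basis.baseChange_apply, TensorProduct.smul_tmul', smul_eq_mul, mul_one]
  rfl

theorem stateMap_injective : Function.Injective (stateMap h κ) := by
  obtain ⟨ι, b, hb⟩ := exists_basis_detect h κ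
  refine (injective_iff_map_eq_zero _).2 fun z hz => (b.baseChange R).ext_elem fun i => ?_
  rw [map_zero, Finsupp.zero_apply]
  refine h.separated _ fun j => hb j z (fun k _ => ?_) i
  rw [hz]
  exact zero_mem _

theorem stateSpan_le (S : Set (AffineVertex κ)) (T : Submodule A (R ⊗[ℂ] AffineVertex κ))
    (hT : ∀ v ∈ S, ∀ r : R, r ⊗ₜ v ∈ T) :
    (stateSpan h κ S).map (h.kernel.fields (cLevel h κ)).subtype ≤ T.map (stateMap h κ) := by
  rw [stateSpan, Submodule.map_span, Submodule.span_le]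
  rintro _ ⟨_, ⟨v, hv, r, rfl⟩, rfl⟩
  exact ⟨_, hT v hv r, rfl⟩

theorem exists_stateMap_eq [FiniteDimensional ℂ 𝔤] {X : PreField h κ} (hX : X ∈ chiral h κ) :
    ∃ z, stateMap h κ z = X := by
  obtain ⟨n, hn⟩ := (mem_chiral_iff h κ).1 hX
  obtain ⟨S, _, hS⟩ := exists_finite_stateSpan h κ n
  obtain ⟨z, _, hz⟩ := stateSpan_le h κ S ⊤ (fun _ _ _ => trivial) (hS hn)
  exact ⟨z, hz⟩

end CanonicalMap
end IsFormalCoordinate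

/-! ### The centre and its topology. -/

theorem mem_range_lTensor_of_forall {k M V J : Type*} [Field k] [AddCommGroup M] [Module k M]
    [AddCommGroup V] [Module k V] (C : Submodule k V) (g : J → V →ₗ[k] V)
    (hC : ∀ v, (∀ j, g j v = 0) → v ∈ C) {z : M ⊗[k] V} (hz : ∀ j, (g j).lTensor M z = 0) :
    z ∈ LinearMap.range (C.subtype.lTensor M) := by
  classical
  let b := Module.Basis.ofVectorSpace k M
  let e := TensorProduct.equivFinsuppOfBasisLeft (N := V) b
  have h1 : ∀ j (y : M ⊗[k] V) i, e ((g j).lTensor M y) i = g j (e y i) := fun j y i => by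
    induction y with
    | zero => simp
    | add y y' hy hy' => simp only [map_add, Finsupp.add_apply, hy, hy']
    | tmul m v =>
      rw [LinearMap.lTensor_tmul, TensorProduct.equivFinsuppOfBasisLeft_apply_tmul_apply,
        TensorProduct.equivFinsuppOfBasisLeft_apply_tmul_apply, map_smul]
  -- In a basis of `M` the equations hold coefficient by coefficient.
  have h2 : ∀ i, e z i ∈ C := fun i => hC _ fun j => by rw [← h1, hz, map_zero, Finsupp.zero_apply]
  rw [← e.symm_apply_apply z, TensorProduct.equivFinsuppOfBasisLeft_symm_apply]
  exact Submodule.sum_mem _ fun i _ => ⟨b i ⊗ₜ ⟨e z i, h2 i⟩, rfl⟩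

namespace IsFormalCoordinate
section Center
variable {A R : Type u} [CommRing A] [CommRing R] [Algebra A R] [Algebra ℂ A] [Algebra ℂ R]
  [IsScalarTower ℂ A R] {𝔤 : Type v} [LieRing 𝔤] [LieAlgebra ℂ 𝔤]
variable {I : ℕ → Ideal R} {t : R} {f : A[X]} (h : IsFormalCoordinate I t f)
  (κ : LinearMap.BilinForm ℂ 𝔤)

section Commutant
variable {h κ}

theorem IsNProd.commute {n : ℤ} {X Y Z : PreField h κ} (hZ : IsNProd n X Y Z) {u : CEnv h κ}
    (hX : ∀ k, Commute u (X k)) (hY : ∀ k, Commute u (Y k)) (k : h.Punctured) :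
    Commute u (Z k) := by
  have h1 : ∀ c, Commute u (fieldMul X Y c) := fun c => by
    induction c with
    | zero => rw [map_zero]; exact Commute.zero_right _
    | add a b ha hb => rw [map_add]; exact ha.add_right hb
    | tmul k l => exact (hX k).mul_right (hY l)
  have h2 : ∀ c, Commute u (fieldMulOp X Y c) := fun c => by
    induction c with
    | zero => rw [map_zero]; exact Commute.zero_right _
    | add a b ha hb => rw [map_add]; exact ha.add_right hb
    | tmul k l => exact (hY l).mul_right (hX k)
  have h3 := hZ.2 k
  refine tendsto_nhds_unique (h3.const_mul u) ?_
  refine (h3.mul_const u).congr fun N => ?_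
  exact ((h1 _).sub_right (h2 _)).eq.symm

theorem sf_commute_of_curF {u : CEnv h κ} (hu : ∀ x k, Commute u ((curF h κ x).1 k))
    (v : AffineVertex κ) (k : h.Punctured) : Commute u ((sf h κ v).1 k) := by
  have hv := AffineVertex.isCreated v
  induction hv generalizing k with
  | vac =>
    rw [DiagonalKernel.IsCurrents.stateField_vacuum]
    exact (Algebra.commutes (h.res k) u).symm
  | add _ _ ha hb => rw [map_add]; exact (ha k).add_right (hb k)
  | smul c _ ha =>
    rw [DiagonalKernel.IsCurrents.stateField_smul]
    exact (ha k).smul_right (algebraMap ℂ A c)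
  | mode x s _ ha =>
    rw [DiagonalKernel.IsCurrents.stateField_mode]
    exact (isNProd_nProd (-1 - s) _ _).commute (hu x) ha k

/-- For `n ≥ 0` the two expansions are the same polynomial in the variables, so commuting fields
give exactly zero. -/
theorem isNProd_zero {X Y : PreField h κ} (hXY : ∀ k l, X k * Y l = Y l * X k) (n : ℕ) :
    IsNProd n X Y 0 := by
  have h1 : fieldMul X Y = fieldMulOp X Y := TensorProduct.ext' fun k l => hXY k l
  refine ⟨fun W hW => ⟨0, fun _ => mem_of_mem_nhds hW⟩, fun g => ?_⟩
  refine tendsto_const_nhds.congr fun N => ?_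
  rw [h1]
  exact (sub_self _).symm

end Commutant

/-- The commutator with a current is a sum over the fields of `x_(j) z` with `j ≥ 0`, which vanish.
Everything else is generated from currents by limits of products, and so lies in the same commutant.
-/
theorem sf_commute_of_mem_center {z : AffineVertex κ} (hz : z ∈ AffineVertex.center κ)
    (v : AffineVertex κ) (k l : h.Punctured) : Commute ((sf h κ z).1 k) ((sf h κ v).1 l) := by
  refine sf_commute_of_curF (fun x l => ?_) v l
  obtain ⟨m, hm⟩ := (isCurrents h κ).isLocal_cur x z
  have h1 := hm.commutator le_rfl l k
  refine (sub_eq_zero.1 (h1.trans (Finset.sum_eq_zero fun j _ => ?_))).symm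
  have h2 := (isCurrents h κ).stateField_mode x j z
  rw [AffineVertex.mem_center_iff.1 hz x j, map_zero] at h2
  rw [← h2]
  rfl

theorem stateMap_mem_chiralCenter [FiniteDimensional ℂ 𝔤]
    (z : R ⊗[ℂ] AffineVertex.center κ) :
    stateMap h κ ((AffineVertex.center κ).subtype.lTensor R z) ∈ chiralCenter h κ := by
  induction z with
  | zero => rw [map_zero, map_zero]; exact zero_mem _
  | add y z hy hz => rw [map_add, map_add]; exact add_mem hy hz
  | tmul r z =>
    rw [LinearMap.lTensor_tmul]
    refine ⟨(isCanonicalMap_stateMap h κ).mem _, fun y hy k l => ?_⟩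
    obtain ⟨w, rfl⟩ := exists_stateMap_eq h κ hy
    induction w with
    | zero => simp
    | add a b ha hb =>
      rw [map_add, LinearMap.add_apply, mul_add, add_mul,
        ha ((isCanonicalMap_stateMap h κ).mem _), hb ((isCanonicalMap_stateMap h κ).mem _)]
    | tmul s v => exact sf_commute_of_mem_center h κ z.2 v _ _

theorem exists_field_stateMap (z : R ⊗[ℂ] AffineVertex κ) (x : 𝔤) (n : ℤ) :
    ∃ Z : h.kernel.fields (cLevel h κ), Z.1 = stateMap h κ z ∧
      (DiagonalKernel.nProd (isIdealBasis h κ) n (curF h κ x) Z).1 =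
        stateMap h κ ((AffineVertex.mode κ x n).lTensor R z) := by
  induction z with
  | zero =>
    refine ⟨0, by rw [map_zero]; rfl, ?_⟩
    rw [map_zero, map_zero, ← DiagonalKernel.nProdL_apply, map_zero]
    rfl
  | add y z hy hz =>
    obtain ⟨Y, hY, hY'⟩ := hy
    obtain ⟨Z, hZ, hZ'⟩ := hz
    refine ⟨Y + Z, by rw [map_add, ← hY, ← hZ]; rfl, ?_⟩
    rw [map_add, map_add, ← hY', ← hZ', ← DiagonalKernel.nProdL_apply, map_add]
    rfl
  | tmul r v =>
    refine ⟨DiagonalKernel.mulFld (sf h κ v) (algebraMap R h.Punctured r), rfl, ?_⟩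
    rw [DiagonalKernel.nProd_mulFld_right, LinearMap.lTensor_tmul,
      ← DiagonalKernel.IsCurrents.stateField_mode (isCurrents h κ)]
    rfl

/-- Commuting with the currents annihilates all nonnegative products with them. By injectivity of
`stateMap` the preimage is killed by all `x t^n` with `n ≥ 0`, and the common kernel of these is `R
⊗ ζ^κ(𝔤)`. -/
theorem exists_center_of_mem_chiralCenter [FiniteDimensional ℂ 𝔤] {X : PreField h κ}
    (hX : X ∈ chiralCenter h κ) : ∃ z : R ⊗[ℂ] AffineVertex.center κ,
      stateMap h κ ((AffineVertex.center κ).subtype.lTensor R z) = X := by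
  obtain ⟨z, rfl⟩ := exists_stateMap_eq h κ hX.1
  obtain ⟨z', rfl⟩ := mem_range_lTensor_of_forall (AffineVertex.center κ)
    (fun p : 𝔤 × ℕ => AffineVertex.mode κ p.1 p.2)
    (fun v hv => AffineVertex.mem_center_iff.2 fun x n => hv (x, n)) (z := z) fun p => by
      refine stateMap_injective h κ ?_
      obtain ⟨Z, hZ, hZ'⟩ := exists_field_stateMap h κ z p.1 p.2
      have h1 : IsNProd p.2 (curF h κ p.1).1 Z.1 0 := isNProd_zero (fun k l => by
        have h2 := hX.2 _ (sf_mem_chiral h κ (AffineVertex.mode κ p.1 (-1)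
          (AffineVertex.vacuum κ))) l k
        rw [DiagonalKernel.IsCurrents.stateField_current] at h2
        rw [hZ]
        exact h2.symm) p.2
      rw [← hZ', map_zero]
      exact (h1.eq (curF h κ p.1).2 Z.2).symm
  exact ⟨z', rfl⟩

/-- The restriction of `stateMap` to the centre. -/
noncomputable def centerMap : R ⊗[ℂ] AffineVertex.center κ →ₗ[A] chiral h κ :=
  (stateMap h κ ∘ₗ TensorProduct.AlgebraTensorModule.lTensor A R
    (AffineVertex.center κ).subtype).codRestrict (chiral h κ)
      fun _ => (isCanonicalMap_stateMap h κ).mem _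

theorem centerMap_injective : Function.Injective (centerMap h κ) := fun _ _ hyz =>
  Module.Flat.lTensor_preserves_injective_linearMap (M := R) (AffineVertex.center κ).subtype
    (AffineVertex.center κ).injective_subtype (stateMap_injective h κ (congrArg Subtype.val hyz))

/-- Continuity: multiplying a field by a high power of `φ` makes it small on functions with bounded
poles. Openness: on a step of the filtration only finitely many basis vectors occur, and
`exists_basis_detect` bounds their coefficients. -/
theorem induced_centerMap [FiniteDimensional ℂ 𝔤] :
    h.tensorTopology (AffineVertex.center κ) = (chiralTopology h κ).induced (centerMap h κ) := by
  refine induced_linearTopology (centerMap h κ) (fun Q hQ z => ?_) fun Q hQ => ?_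
  · obtain ⟨n, hn⟩ := (mem_chiral_iff h κ).1 (sf_mem_chiral h κ z.1)
    obtain ⟨j, W, hW, H⟩ := hQ n
    obtain ⟨N, hN⟩ := isField_iff.2 (sf h κ z.1).2 W hW
    refine ⟨N + j, fun r => H _ (chiralFil_mulR h κ n _ hn) fun k s hs => ?_⟩
    change (sf h κ z.1).1 (algebraMap R _ (aeval t f ^ (N + j) * r) * k) ∈ W
    have e : algebraMap R h.Punctured (aeval t f ^ (N + j) * r) * k =
        h.unif ^ N * algebraMap R _ (r * s) := by
      rw [map_mul, map_mul, ← hs, pow_add, map_mul, map_pow, map_pow]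
      ring
    rw [e]
    exact hN _
  -- A linear retraction onto the centre extends `Q` to a submodule of `R ⊗ V^κ(𝔤)`, so that
  -- neighbourhoods can be tested on arbitrary chiral fields.
  · obtain ⟨π, hπ⟩ := (AffineVertex.center κ).subtype.exists_leftInverse_of_injective
      (AffineVertex.center κ).ker_subtype
    obtain ⟨ι, b, hb⟩ := exists_basis_detect h κ
    set π' := TensorProduct.AlgebraTensorModule.lTensor A R π with hπ'
    refine ⟨((Q.comap π').map (stateMap h κ)).comap (chiral h κ).subtype, fun n => ?_, ?_⟩
    · obtain ⟨S, hS, hle⟩ := exists_finite_stateSpan h κ n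
      set F : Set ι := ⋃ v ∈ S, (b.repr v).support with hF
      have hfin : F.Finite := hS.biUnion fun v _ => Finset.finite_toSet _
      choose N hN using fun i => hQ (π (b i))
      -- `M` dominates the powers of `φ` required by the finitely many basis vectors that occur, so
      -- coefficients in `I M` put the preimage of the field into the extended `Q`.
      obtain ⟨M, hM⟩ := (hfin.image N).bddAbove
      let T : Submodule A (R ⊗[ℂ] AffineVertex κ) :=
        { carrier := {z | ∀ i ∉ F, (b.baseChange R).repr z i = 0}
          zero_mem' := fun i _ => by rw [map_zero, Finsupp.zero_apply]
          add_mem' := fun hy hz i hi => by rw [map_add, Finsupp.add_apply, hy i hi, hz i hi, add_zero]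
          smul_mem' := fun a z hz i hi => by
            rw [algebra_compatible_smul R a z, map_smul, Finsupp.smul_apply, hz i hi, smul_zero] }
      refine ⟨M, cLevel h κ 0, (isIdealBasis h κ).mem_of_mem trivial, fun X hX hXW => ?_⟩
      obtain ⟨z, hz, hzX⟩ := stateSpan_le h κ S T (fun v hv r i hi => by
        rw [Module.Basis.baseChange_repr_tmul, Finsupp.notMem_support_iff.1, zero_smul]
        exact fun h1 => hi (Set.mem_biUnion hv h1)) (hle hX)
      refine ⟨z, ?_, hzX⟩
      have h1 := hb M z fun k ⟨s, hs⟩ => by rw [hzX]; exact hXW k s hs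
      rw [SetLike.mem_coe, ← (b.baseChange R).linearCombination_repr z,
        Finsupp.linearCombination_apply]
      refine Submodule.sum_mem _ fun i _ => ?_
      beta_reduce
      rw [Module.Basis.baseChange_apply, TensorProduct.smul_tmul', smul_eq_mul, mul_one]
      by_cases hi : i ∈ F
      · obtain ⟨s, hs⟩ := h.mem_ideal_iff.1 (h1 i)
        have h2 : N i ≤ M := hM (Set.mem_image_of_mem N hi)
        rw [hs, ← Nat.add_sub_cancel' h2, pow_add, mul_assoc]
        exact hN i _
      · rw [hz i hi, TensorProduct.zero_tmul]
        exact zero_mem _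
    · rintro z ⟨y, hy, hyz⟩
      have h1 := stateMap_injective h κ hyz
      rw [h1] at hy
      have h2 : π' ((AffineVertex.center κ).subtype.lTensor R z) = z := by
        have := LinearMap.lTensor_comp_apply R π (AffineVertex.center κ).subtype z
        rw [hπ, LinearMap.lTensor_id] at this
        exact this.symm
      change π' _ ∈ Q at hy
      rwa [← h2]

theorem exists_canonicalMap [FiniteDimensional ℂ 𝔤] :
    ∃ Y : R ⊗[ℂ] AffineVertex κ →ₗ[A] PreField h κ, IsCanonicalMap h κ Y ∧
      (∀ Y', IsCanonicalMap h κ Y' → Y' = Y) ∧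
      ∃ hY : ∀ z : R ⊗[ℂ] AffineVertex.center κ,
          Y ((AffineVertex.center κ).subtype.lTensor R z) ∈ chiralCenter h κ,
        @IsHomeomorph (R ⊗[ℂ] AffineVertex.center κ) (chiralCenter h κ)
          (h.tensorTopology (AffineVertex.center κ)) (chiralCenterTopology h κ)
          fun z => ⟨_, hY z⟩ := by
  refine ⟨stateMap h κ, isCanonicalMap_stateMap h κ, fun Y hY => hY.eq_stateMap,
    stateMap_mem_chiralCenter h κ, ?_⟩
  let := h.tensorTopology (AffineVertex.center κ)
  let := chiralCenterTopology h κ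
  refine isHomeomorph_iff_isEmbedding_surjective.2 ⟨⟨⟨?_⟩, fun y z hyz => ?_⟩, fun X => ?_⟩
  · exact (induced_centerMap h κ).trans (@induced_compose _ _ _ (chiralTopology h κ)
      (fun z => (⟨_, stateMap_mem_chiralCenter h κ z⟩ : chiralCenter h κ))
      fun z => ⟨z.1, z.2.1⟩).symm
  · exact centerMap_injective h κ
      (Subtype.ext (congrArg (fun X : chiralCenter h κ => (X : PreField h κ)) hyz))
  · obtain ⟨z, hz⟩ := exists_center_of_mem_chiralCenter h κ X.2
    exact ⟨z, Subtype.ext hz⟩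

end Center
end IsFormalCoordinate

end ChiralCenter

theorem mainTheorem7 {A : Type u} [CommRing A] [IsDomain A] [Algebra ℂ A]
    {𝒳 : AlgebraicGeometry.Scheme.{u}} (p : 𝒳 ⟶ AlgebraicGeometry.Spec (.of A))
    [AlgebraicGeometry.SmoothOfRelativeDimension 1 p] [AlgebraicGeometry.IsSeparated p]
    {ι : Type w} [Fintype ι] [Nonempty ι] (σ : ι → (AlgebraicGeometry.Spec (.of A) ⟶ 𝒳))
    (hσ : ∀ i, CategoryTheory.CategoryStruct.comp (σ i) p = CategoryTheory.CategoryStruct.id _)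
    {𝔤 : Type v} [LieRing 𝔤] [LieAlgebra ℂ 𝔤] [FiniteDimensional ℂ 𝔤]
    (κ : LinearMap.BilinForm ℂ 𝔤) (hκ : κ.IsSymm) (hκ' : κ.lieInvariant 𝔤)
    (t : ChiralCenter.FormalFunctions p σ) (a : ι → A) (ht : ChiralCenter.IsCoordinate t a) :
    ∃ Y : ChiralCenter.FormalFunctions p σ ⊗[ℂ] ChiralCenter.AffineVertex κ →ₗ[A]
        ht.formal.PreField κ,
      ht.formal.IsCanonicalMap κ Y ∧
      (∀ Y', ht.formal.IsCanonicalMap κ Y' → Y' = Y) ∧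
      ∃ hY : ∀ z : ChiralCenter.FormalFunctions p σ ⊗[ℂ] ChiralCenter.AffineVertex.center κ,
          Y ((ChiralCenter.AffineVertex.center κ).subtype.lTensor
            (ChiralCenter.FormalFunctions p σ) z) ∈
              ht.formal.chiralCenter κ,
        @IsHomeomorph
          (ChiralCenter.FormalFunctions p σ ⊗[ℂ] ChiralCenter.AffineVertex.center κ)
          (ht.formal.chiralCenter κ)
          (ht.formal.tensorTopology
            (ChiralCenter.AffineVertex.center κ))
          (ht.formal.chiralCenterTopology κ)
          fun z => ⟨_, hY z⟩ := ht.formal.exists_canonicalMap κ
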